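/- Let $\mathcal V=(\mathcal V_0,I,\otimes,[-,-])$ be a complete (hence cocomplete) $*$-autonomous symmetric monoidal closed category: there is an object $D$ such that every canonical map $X\to[[X,D],D]$ is invertible, and we write $X^*=[X,D]$ (for instance $D=I$). All categories, functors and natural transformations below are $\mathcal V$-enriched. Let $(\mathcal A,p,j)$ be a small promonoidal $\mathcal V$-category: a small $\mathcal V$-category $\mathcal A$ with $\mathcal V$-functors $p:\mathcal A^{op}\otimes\mathcal A^{op}\otimes\mathcal A\to\mathcal V$ and $j:\mathcal A\to\mathcal V$ and $\mathcal V$-natural isomorphisms $$\int^{x}p(a,b,x)\otimes p(x,c,d)\cong\int^{y}p(b,c,y)\otimes p(a,y,d),\qquad \int^{x}j(x)\otimes p(x,b,c)\cong\mathcal A(b,c),\qquad \int^{x}j(x)\otimes p(a,x,c)\cong\mathcal A(a,c)$$ satisfying the pentagon and triangle axioms. Let $S:\mathcal A^{op}\to\mathcal A$ be an antipode, i.e. a $\mathcal V$-functor with $S^{op}\dashv S$ and $S^2\cong 1$, and suppose that $(\mathcal A,p,j,S)$ is $S$-autonomous, i.e. there are isomorphisms $p(a,b,Sc)\cong p(b,c,Sa)$,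 $\mathcal V$-natural in $a,b,c\in\mathcal A$. Then the upper (Day) convolution $$f\,\overline{*}\,g=\int^{a,b}f(a)\otimes g(b)\otimes p(a,b,-),\qquad \overline I=j,$$ with the associativity and unit constraints induced by those of $(\mathcal A,p,j)$, exists as a monoidal structure on the $\mathcal V$-category $[\mathcal A,\mathcal V]$, and for every such choice of the coends, $[\mathcal A,\mathcal V]$ is $*$-autonomous under the antipode $(-)^*:[\mathcal A,\mathcal V]^{op}\to[\mathcal A,\mathcal V]$ given by $f^*(a)=f(Sa)^*$. That is, there are an adjunction $((-)^*)^{op}\dashv(-)^*$ of $\mathcal V$-functors, a $\mathcal V$-natural isomorphism $f^{**}\cong f$, and isomorphisms $$[\mathcal A,\mathcal V](f\,\overline{*}\,g,\,h^*)\cong[\mathcal A,\mathcal V](g\,\overline{*}\,h,\,f^*)$$ that are $\mathcal V$-natural in $f,g,h$. -/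

import Mathlib

open CategoryTheory MonoidalCategory Limits Opposite

universe v u

namespace StarAut

section Main

variable {V : Type u} [Category.{v} V] [MonoidalCategory V] [SymmetricCategory V]

theorem mu_right (X Y : V) : ((ρ_ X).inv ⊗ₘ (ρ_ Y).inv) ≫ tensorμ X (𝟙_ V) Y (𝟙_ V) =
    (ρ_ (X ⊗ Y)).inv ≫ (X ⊗ Y) ◁ (λ_ (𝟙_ V)).inv := by
  have h := rightUnitor_monoidal X Y
  have h2 : ((ρ_ X).inv ⊗ₘ (ρ_ Y).inv) ≫ ((ρ_ X).hom ⊗ₘ (ρ_ Y).hom) = 𝟙 _ := by simp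
  rw [h] at h2
  rw [← cancel_mono ((X ⊗ Y) ◁ (λ_ (𝟙_ V)).hom), ← cancel_mono (ρ_ _).hom]
  simpa using h2

theorem mu_left (X Y : V) : ((λ_ X).inv ⊗ₘ (λ_ Y).inv) ≫ tensorμ (𝟙_ V) X (𝟙_ V) Y =
    (λ_ (X ⊗ Y)).inv ≫ (λ_ (𝟙_ V)).inv ▷ (X ⊗ Y) := by
  have h := leftUnitor_monoidal X Y
  have h2 : ((λ_ X).inv ⊗ₘ (λ_ Y).inv) ≫ ((λ_ X).hom ⊗ₘ (λ_ Y).hom) = 𝟙 _ := by simp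
  rw [h] at h2
  rw [← cancel_mono ((λ_ (𝟙_ V)).hom ▷ (X ⊗ Y)), ← cancel_mono (λ_ _).hom]
  simpa using h2

theorem mu_mid (X Y : V) : ((ρ_ X).inv ⊗ₘ (λ_ Y).inv) ≫ tensorμ X (𝟙_ V) (𝟙_ V) Y =
    ((ρ_ X).inv ⊗ₘ (λ_ Y).inv) := by
  simp only [tensorμ, braiding_tensorUnit_left]
  monoidal

theorem mu_swap (X Y : V) : ((λ_ Y).inv ⊗ₘ (ρ_ X).inv) ≫ tensorμ (𝟙_ V) Y X (𝟙_ V) =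
    (β_ Y X).hom ≫ ((λ_ X).inv ⊗ₘ (ρ_ Y).inv) := by
  have : ((λ_ Y).inv ⊗ₘ (ρ_ X).inv) ≫ tensorμ (𝟙_ V) Y X (𝟙_ V) =
     𝟙 _ ⊗≫ (𝟙_ V ◁ (β_ Y X).hom ▷ 𝟙_ V) ⊗≫ 𝟙 _  := by
    simp only [tensorμ]; monoidal
  rw [this]
  monoidal

theorem incl_aux_left {X Y Z E : V} (m : X ⊗ Y ⟶ Z) (e : 𝟙_ V ⟶ E) (m' : E ⊗ E ⟶ E)
    (h : (e ⊗ₘ e) ≫ m' = (λ_ _).hom ≫ e) :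
    m ≫ (ρ_ Z).inv ≫ Z ◁ e =
      (((ρ_ X).inv ≫ X ◁ e) ⊗ₘ ((ρ_ Y).inv ≫ Y ◁ e)) ≫ tensorμ X E Y E ≫ (m ⊗ₘ m') := by
  simp only [← tensorHom_comp_tensorHom, Category.assoc, ← id_tensorHom]
  rw [tensorμ_natural_assoc, tensorHom_comp_tensorHom, h, reassoc_of% mu_right,
    rightUnitor_inv_naturality_assoc]
  simp only [id_tensorHom_id, Category.id_comp, ← id_tensorHom, ← tensorHom_id,
    tensorHom_comp_tensorHom, Iso.inv_hom_id_assoc, Category.comp_id]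

theorem incl_aux_right {X Y Z E : V} (m : X ⊗ Y ⟶ Z) (e : 𝟙_ V ⟶ E) (m' : E ⊗ E ⟶ E)
    (h : (e ⊗ₘ e) ≫ m' = (λ_ _).hom ≫ e) :
    m ≫ (λ_ Z).inv ≫ e ▷ Z =
      (((λ_ X).inv ≫ e ▷ X) ⊗ₘ ((λ_ Y).inv ≫ e ▷ Y)) ≫ tensorμ E X E Y ≫ (m' ⊗ₘ m) := by
  simp only [← tensorHom_comp_tensorHom, Category.assoc, ← tensorHom_id]
  rw [tensorμ_natural_assoc, tensorHom_comp_tensorHom, h, reassoc_of% mu_left,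
    leftUnitor_inv_naturality_assoc]
  simp only [id_tensorHom_id, Category.id_comp, ← id_tensorHom, ← tensorHom_id,
    tensorHom_comp_tensorHom, Iso.inv_hom_id_assoc, Category.comp_id]

theorem incl_aux_comm {X Y E E' F F' : V} (e : 𝟙_ V ⟶ E) (f : 𝟙_ V ⟶ F) (e' : 𝟙_ V ⟶ E')
    (f' : 𝟙_ V ⟶ F') (mX : X ⊗ F ⟶ X) (mY : E ⊗ Y ⟶ Y) (nX : F' ⊗ X ⟶ X) (nY : Y ⊗ E' ⟶ Y)
    (hmX : X ◁ f ≫ mX = (ρ_ X).hom) (hmY : e ▷ Y ≫ mY = (λ_ Y).hom)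
    (hnX : f' ▷ X ≫ nX = (λ_ X).hom) (hnY : Y ◁ e' ≫ nY = (ρ_ Y).hom) :
    (((ρ_ X).inv ≫ X ◁ e) ⊗ₘ ((λ_ Y).inv ≫ f ▷ Y)) ≫ tensorμ X E F Y ≫ (mX ⊗ₘ mY) =
      (β_ X Y).hom ≫ (((λ_ Y).inv ≫ f' ▷ Y) ⊗ₘ ((ρ_ X).inv ≫ X ◁ e')) ≫
        tensorμ F' Y X E' ≫ (nX ⊗ₘ nY) := by
  simp only [← tensorHom_comp_tensorHom, Category.assoc, ← tensorHom_id, ← id_tensorHom]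
  rw [tensorμ_natural_assoc, tensorμ_natural_assoc, reassoc_of% mu_mid, reassoc_of% mu_swap,
    SymmetricCategory.symmetry_assoc]
  simp only [tensorHom_comp_tensorHom, id_tensorHom, tensorHom_id, hmX, hmY, hnX, hnY]
  simp

section Functors
universe u₁ u₂ u₃
/-- Objects of the tensor product `C ⊗ D` of two `V`-categories. -/
structure TensorCat (C : Type u₁) (D : Type u₂) where
  fst : C
  snd : D
noncomputable section

variable (V) in
/-- The tensor product of `V`-categories: the hom-object from `(c, d)` to `(c', d')` is
`C(c, c') ⊗ D(d, d')`. -/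
instance TensorCat.enriched (C : Type u₁) (D : Type u₂) [EnrichedCategory V C]
    [EnrichedCategory V D] : EnrichedCategory V (TensorCat C D) where
  Hom p q := (p.fst ⟶[V] q.fst) ⊗ (p.snd ⟶[V] q.snd)
  id p := (λ_ (𝟙_ V)).inv ≫ (eId V p.fst ⊗ₘ eId V p.snd)
  comp p q r := tensorμ _ _ _ _ ≫ (eComp V p.fst q.fst r.fst ⊗ₘ eComp V p.snd q.snd r.snd)
  id_comp p q := by
    rw [Iso.inv_comp_eq, tensor_left_unitality]
    simp only [comp_whiskerRight, Category.assoc, tensorμ_natural_left_assoc,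
      tensorHom_comp_tensorHom, Category.comp_id]
    congr 3 <;> rw [← Iso.inv_comp_eq_id, e_id_comp]
  comp_id p q := by
    rw [Iso.inv_comp_eq, tensor_right_unitality]
    simp only [MonoidalCategory.whiskerLeft_comp, Category.assoc, tensorμ_natural_right_assoc,
      tensorHom_comp_tensorHom, Category.comp_id]
    congr 3 <;> rw [← Iso.inv_comp_eq_id, e_comp_id]
  assoc p q r s := by
    rw [Iso.inv_comp_eq]
    simp only [MonoidalCategory.whiskerLeft_comp, comp_whiskerRight, Category.assoc,
      tensorμ_natural_right_assoc, tensorμ_natural_left_assoc, tensorHom_comp_tensorHom]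
    simp only [← e_assoc']
    rw [← tensorHom_comp_tensorHom, tensor_associativity_assoc]

variable {B : Type u₁} {C : Type u₂} {D : Type u₃} [EnrichedCategory V B] [EnrichedCategory V C]
  [EnrichedCategory V D]

variable (V) in
theorem e_id_comp_hom (x y : B) : eId V x ▷ _ ≫ eComp V x x y = (λ_ _).hom := by
  rw [← Iso.inv_comp_eq_id, e_id_comp]
variable (V) in
theorem e_comp_id_hom (x y : B) : _ ◁ eId V y ≫ eComp V x y y = (ρ_ _).hom := by
  rw [← Iso.inv_comp_eq_id, e_comp_id]

theorem TensorCat.comp_eq (p q r : TensorCat B C) : eComp V p q r =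
    tensorμ _ _ _ _ ≫ (eComp V p.fst q.fst r.fst ⊗ₘ eComp V p.snd q.snd r.snd) := rfl

theorem eId_eId (c : C) : (eId V c ⊗ₘ eId V c) ≫ eComp V c c c = (λ_ _).hom ≫ eId V c := by
  rw [tensorHom_def', Category.assoc, e_id_comp_hom, leftUnitor_naturality]

variable (V) in
/-- The `V`-functor `(-, c) : B → B ⊗ C`. -/
abbrev inclLeft (B : Type u₁) [EnrichedCategory V B] (c : C) :
    EnrichedFunctor V B (TensorCat B C) where
  obj b := ⟨b, c⟩
  map b b' := (ρ_ _).inv ≫ ((b ⟶[V] b') ◁ eId V c)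
  map_id b := by
    change _ ≫ _ ≫ _ = (λ_ (𝟙_ V)).inv ≫ (eId V b ⊗ₘ eId V c)
    rw [rightUnitor_inv_naturality_assoc, MonoidalCategory.tensorHom_def, unitors_inv_equal]
  map_comp _ _ _ := incl_aux_left _ _ _ (eId_eId c)

variable (V) in
/-- The `V`-functor `(b, -) : C → B ⊗ C`. -/
abbrev inclRight (b : B) (C : Type u₂) [EnrichedCategory V C] :
    EnrichedFunctor V C (TensorCat B C) where
  obj c := ⟨b, c⟩
  map c c' := (λ_ _).inv ≫ (eId V b ▷ (c ⟶[V] c'))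
  map_id c := by
    change _ ≫ _ ≫ _ = (λ_ (𝟙_ V)).inv ≫ (eId V b ⊗ₘ eId V c)
    rw [leftUnitor_inv_naturality_assoc, tensorHom_def']
  map_comp _ _ _ := incl_aux_right _ _ _ (eId_eId b)

theorem incl_comm (b b' : B) (c c' : C) :
    ((inclLeft V B c).map b b' ⊗ₘ (inclRight V b' C).map c c') ≫ eComp V _ _ _ =
      (β_ _ _).hom ≫ ((inclRight V b C).map c c' ⊗ₘ (inclLeft V B c').map b b') ≫ eComp V _ _ _ :=
  incl_aux_comm _ _ _ _ _ _ _ _ (e_comp_id_hom V _ _) (e_id_comp_hom V _ _)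
    (e_id_comp_hom V _ _) (e_comp_id_hom V _ _)

theorem eComp_assoc_tensor {W X Y Z : D} {P Q R : V} (x : P ⟶ (W ⟶[V] X)) (y : Q ⟶ (X ⟶[V] Y))
    (z : R ⟶ (Y ⟶[V] Z)) :
    (x ⊗ₘ ((y ⊗ₘ z) ≫ eComp V _ _ _)) ≫ eComp V _ _ _ =
      (α_ _ _ _).inv ≫ (((x ⊗ₘ y) ≫ eComp V _ _ _) ⊗ₘ z) ≫ eComp V _ _ _ := by
  rw [← tensorHom_comp_whiskerLeft, ← tensorHom_comp_whiskerRight, Category.assoc, Category.assoc,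
    ← e_assoc', associator_naturality_assoc, Iso.inv_hom_id_assoc]

/-- `V`-naturality of a family `q c : K ⟶ D(F c, G c)`. For `K = 𝟙_ V` this is `V`-naturality of a
family of morphisms `F c → G c` of the `V`-category `D`. -/
def IsGradedNat (F G : EnrichedFunctor V C D) {K : V}
    (q : ∀ c, K ⟶ (F.obj c ⟶[V] G.obj c)) : Prop :=
  ∀ c c' : C, (F.map c c' ⊗ₘ q c') ≫ eComp V _ _ _ =
    (β_ _ _).hom ≫ (q c ⊗ₘ G.map c c') ≫ eComp V _ _ _

theorem IsGradedNat.precomp {F G : EnrichedFunctor V C D} {K L : V}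
    {q : ∀ c, K ⟶ (F.obj c ⟶[V] G.obj c)} (hq : IsGradedNat F G q) (u : L ⟶ K) :
    IsGradedNat F G (fun c => u ≫ q c) := by
  intro c c'
  rw [← whiskerLeft_comp_tensorHom, Category.assoc, hq c c',
    BraidedCategory.braiding_naturality_right_assoc, whiskerRight_comp_tensorHom_assoc]

theorem IsGradedNat.id (F : EnrichedFunctor V C D) :
    IsGradedNat F F (fun c => eId V (F.obj c)) := by
  intro c c'
  rw [MonoidalCategory.tensorHom_def, Category.assoc, e_comp_id_hom, tensorHom_def',
    Category.assoc, e_id_comp_hom, leftUnitor_naturality, rightUnitor_naturality,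
    braiding_leftUnitor_assoc]

theorem IsGradedNat.comp {F G H : EnrichedFunctor V C D} {K L : V}
    {q : ∀ c, K ⟶ (F.obj c ⟶[V] G.obj c)} (hq : IsGradedNat F G q)
    {r : ∀ c, L ⟶ (G.obj c ⟶[V] H.obj c)} (hr : IsGradedNat G H r) :
    IsGradedNat F H (fun c => (q c ⊗ₘ r c) ≫ eComp V _ _ _) := by
  intro c c'
  have h1 := hq c c'
  have h2 := hr c c'
  have e : ∀ {X Y Z : V}, (α_ X Y Z).inv ≫ (β_ X Y).hom ▷ Z ≫ (α_ Y X Z).hom ≫ Y ◁ (β_ X Z).hom ≫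
      (α_ Y Z X).inv = (β_ X (Y ⊗ Z)).hom := by
    intros; simp
  rw [eComp_assoc_tensor, h1, ← whiskerRight_comp_tensorHom, Category.assoc, ← e]
  simp only [Category.assoc]
  have h3 := eComp_assoc_tensor (q c) (G.map c c') (r c')
  rw [h2, ← whiskerLeft_comp_tensorHom, Category.assoc, eComp_assoc_tensor] at h3
  rw [h3, Iso.hom_inv_id_assoc]

theorem map_comm (F : EnrichedFunctor V C D) {x y y' z : C} {P Q : V} (f : P ⟶ (x ⟶[V] y))
    (g : Q ⟶ (y ⟶[V] z)) (f' : Q ⟶ (x ⟶[V] y')) (g' : P ⟶ (y' ⟶[V] z))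
    (h : (f ⊗ₘ g) ≫ eComp V _ _ _ = (β_ _ _).hom ≫ (f' ⊗ₘ g') ≫ eComp V _ _ _) :
    ((f ≫ F.map _ _) ⊗ₘ (g ≫ F.map _ _)) ≫ eComp V _ _ _ =
      (β_ _ _).hom ≫ ((f' ≫ F.map _ _) ⊗ₘ (g' ≫ F.map _ _)) ≫ eComp V _ _ _ := by
  have h2 := h =≫ F.map _ _
  simpa only [Category.assoc, F.map_comp, tensorHom_comp_tensorHom_assoc] using h2

theorem partial_comm (F : EnrichedFunctor V (TensorCat B C) D) (b b' : B) (c c' : C) :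
    (((inclLeft V B c).comp V F).map b b' ⊗ₘ ((inclRight V b' C).comp V F).map c c') ≫
        eComp V (F.obj ⟨b, c⟩) (F.obj ⟨b', c⟩) (F.obj ⟨b', c'⟩) =
      (β_ _ _).hom ≫ (((inclRight V b C).comp V F).map c c' ⊗ₘ
        ((inclLeft V B c').comp V F).map b b') ≫
          eComp V (F.obj ⟨b, c⟩) (F.obj ⟨b, c'⟩) (F.obj ⟨b', c'⟩) :=
  map_comm F _ _ _ _ (incl_comm b b' c c')

theorem braid_swap {X Y Z : V} {a : X ⊗ Y ⟶ Z} {b : Y ⊗ X ⟶ Z} (h : a = (β_ X Y).hom ≫ b) :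
    b = (β_ Y X).hom ≫ a := by
  rw [h, SymmetricCategory.symmetry_assoc]

end
end Functors

section FunctorCategory
noncomputable section
universe u₂ u₃ u₄
variable [MonoidalClosed V] [HasLimits V]
variable {C : Type v} {D : Type u₃} [EnrichedCategory V C] [EnrichedCategory V D]

/-- First of the two maps whose equalizer is the end `∫_c D(F c, G c)`. -/
def natLeft (F G : EnrichedFunctor V C D) :
    (∏ᶜ fun c : C => (F.obj c ⟶[V] G.obj c)) ⟶
      ∏ᶜ fun c : C × C => (ihom (c.1 ⟶[V] c.2)).obj (F.obj c.1 ⟶[V] G.obj c.2) :=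
  Pi.lift fun c => MonoidalClosed.curry ((F.map c.1 c.2 ⊗ₘ Pi.π _ c.2) ≫ eComp V _ _ _)

/-- Second of the two maps whose equalizer is the end `∫_c D(F c, G c)`. -/
def natRight (F G : EnrichedFunctor V C D) :
    (∏ᶜ fun c : C => (F.obj c ⟶[V] G.obj c)) ⟶
      ∏ᶜ fun c : C × C => (ihom (c.1 ⟶[V] c.2)).obj (F.obj c.1 ⟶[V] G.obj c.2) :=
  Pi.lift fun c => MonoidalClosed.curry
    ((β_ _ _).hom ≫ (Pi.π _ c.1 ⊗ₘ G.map c.1 c.2) ≫ eComp V _ _ _)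

/-- The object `∫_c D(F c, G c)` of `V`-natural transformations, as an equalizer of products. -/
abbrev natObj (F G : EnrichedFunctor V C D) : V := equalizer (natLeft F G) (natRight F G)

/-- The projections of the end `∫_c D(F c, G c)`. -/
def natπ (F G : EnrichedFunctor V C D) (c : C) : natObj F G ⟶ (F.obj c ⟶[V] G.obj c) :=
  equalizer.ι _ _ ≫ Pi.π _ c

theorem isGradedNat_iff {F G : EnrichedFunctor V C D} {K : V}
    (u : K ⟶ ∏ᶜ fun c : C => (F.obj c ⟶[V] G.obj c)) :
    IsGradedNat F G (fun c => u ≫ Pi.π _ c) ↔ u ≫ natLeft F G = u ≫ natRight F G := by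
  have h1 : ∀ c c', MonoidalClosed.curry ((F.map c c' ⊗ₘ (u ≫ Pi.π _ c')) ≫ eComp V _ _ _) =
      u ≫ natLeft F G ≫ Pi.π _ (c, c') := by
    intro c c'
    rw [← whiskerLeft_comp_tensorHom, Category.assoc, MonoidalClosed.curry_natural_left,
      natLeft, Pi.lift_π]
  have h2 : ∀ c c', MonoidalClosed.curry ((β_ _ _).hom ≫ ((u ≫ Pi.π _ c) ⊗ₘ G.map c c') ≫
      eComp V _ _ _) = u ≫ natRight F G ≫ Pi.π _ (c, c') := by
    intro c c'
    rw [← whiskerRight_comp_tensorHom, Category.assoc,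
      ← BraidedCategory.braiding_naturality_right_assoc, MonoidalClosed.curry_natural_left,
      natRight, Pi.lift_π]
  constructor
  · intro h
    apply Pi.hom_ext
    rintro ⟨c, c'⟩
    rw [Category.assoc, Category.assoc, ← h1, ← h2, h c c']
  · intro h c c'
    apply MonoidalClosed.curry_injective
    rw [h1, h2, reassoc_of% h]

theorem natπ_isGradedNat (F G : EnrichedFunctor V C D) : IsGradedNat F G (natπ F G) :=
  (isGradedNat_iff _).2 (equalizer.condition _ _)

/-- The universal property of the end `∫_c D(F c, G c)`. -/
def natLift {F G : EnrichedFunctor V C D} {K : V} (q : ∀ c, K ⟶ (F.obj c ⟶[V] G.obj c))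
    (hq : IsGradedNat F G q) : K ⟶ natObj F G :=
  equalizer.lift (Pi.lift q) ((isGradedNat_iff _).1 (by simpa using hq))

theorem natLift_π {F G : EnrichedFunctor V C D} {K : V} (q : ∀ c, K ⟶ (F.obj c ⟶[V] G.obj c))
    (hq : IsGradedNat F G q) (c : C) : natLift q hq ≫ natπ F G c = q c := by
  rw [natLift, natπ, equalizer.lift_ι_assoc, Pi.lift_π]

theorem natObj_ext {F G : EnrichedFunctor V C D} {K : V} {u w : K ⟶ natObj F G}
    (h : ∀ c, u ≫ natπ F G c = w ≫ natπ F G c) : u = w := by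
  apply equalizer.hom_ext
  apply Pi.hom_ext
  intro c
  simpa only [natπ, Category.assoc] using h c

/-- The `V`-category `[C, D]` of `V`-functors, for `C` small. -/
instance functorEnriched : EnrichedCategory V (EnrichedFunctor V C D) where
  Hom F G := natObj F G
  id F := natLift _ (IsGradedNat.id F)
  comp F G H := natLift _ ((natπ_isGradedNat F G).comp (natπ_isGradedNat G H))
  id_comp F G := by
    apply natObj_ext
    intro c
    rw [Category.assoc, Category.assoc, natLift_π, whiskerRight_comp_tensorHom_assoc, natLift_π,
      tensorHom_def', Category.assoc, e_id_comp_hom, leftUnitor_naturality]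
    simp
  comp_id F G := by
    apply natObj_ext
    intro c
    rw [Category.assoc, Category.assoc, natLift_π, whiskerLeft_comp_tensorHom_assoc, natLift_π,
      MonoidalCategory.tensorHom_def, Category.assoc, e_comp_id_hom, rightUnitor_naturality]
    simp
  assoc F G H K := by
    apply natObj_ext
    intro c
    simp only [Category.assoc, natLift_π, whiskerRight_comp_tensorHom_assoc,
      whiskerLeft_comp_tensorHom_assoc]
    rw [eComp_assoc_tensor]

theorem functor_eId_π (F : EnrichedFunctor V C D) (c : C) :
    eId V F ≫ natπ F F c = eId V (F.obj c) := natLift_π _ (IsGradedNat.id F) c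

theorem functor_eComp_π (F G H : EnrichedFunctor V C D) (c : C) :
    eComp V F G H ≫ natπ F H c = (natπ F G c ⊗ₘ natπ G H c) ≫ eComp V _ _ _ :=
  natLift_π _ ((natπ_isGradedNat F G).comp (natπ_isGradedNat G H)) c

/-! ### Currying -/
variable {B : Type u₂} [EnrichedCategory V B]

/-- A `V`-functor `B → [C, D]` from its values and its (pointwise) action on hom-objects. -/
def toFunctorCat (obj : B → EnrichedFunctor V C D)
    (q : ∀ (b b' : B) (c : C), (b ⟶[V] b') ⟶ ((obj b).obj c ⟶[V] (obj b').obj c))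
    (hq : ∀ b b', IsGradedNat (obj b) (obj b') (q b b'))
    (hid : ∀ b c, eId V b ≫ q b b c = eId V ((obj b).obj c))
    (hcomp : ∀ b b' b'' c, eComp V b b' b'' ≫ q b b'' c =
      (q b b' c ⊗ₘ q b' b'' c) ≫ eComp V _ _ _) :
    EnrichedFunctor V B (EnrichedFunctor V C D) where
  obj := obj
  map b b' := natLift (q b b') (hq b b')
  map_id b := by
    apply natObj_ext
    intro c
    rw [Category.assoc, natLift_π, functor_eId_π, hid]
  map_comp b b' b'' := by
    apply natObj_ext
    intro c
    rw [Category.assoc, natLift_π, Category.assoc, functor_eComp_π, tensorHom_comp_tensorHom_assoc,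
      natLift_π, natLift_π, hcomp]

/-- The `V`-functor `b ↦ F (b, -)`. -/
def curryLeft (F : EnrichedFunctor V (TensorCat B C) D) :
    EnrichedFunctor V B (EnrichedFunctor V C D) :=
  toFunctorCat (fun b => (inclRight V b C).comp V F)
    (fun b b' c => ((inclLeft V B c).comp V F).map b b')
    (fun b b' c c' => braid_swap (partial_comm F b b' c c'))
    (fun b c => ((inclLeft V B c).comp V F).map_id b)
    (fun b b' b'' c => ((inclLeft V B c).comp V F).map_comp b b' b'')

/-- The `V`-functor `b ↦ F (-, b)`. -/
def curryRight (F : EnrichedFunctor V (TensorCat C B) D) :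
    EnrichedFunctor V B (EnrichedFunctor V C D) :=
  toFunctorCat (fun b => (inclLeft V C b).comp V F)
    (fun b b' c => ((inclRight V c B).comp V F).map b b')
    (fun b b' c c' => partial_comm F c c' b b')
    (fun b c => ((inclRight V c B).comp V F).map_id b)
    (fun b b' b'' c => ((inclRight V c B).comp V F).map_comp b b' b'')

/-- Precomposition `[C, D] → [C', D]` with a `V`-functor `F : C' → C`. -/
def whiskerL {C' : Type v} [EnrichedCategory V C'] (F : EnrichedFunctor V C' C) (D : Type u₃)
    [EnrichedCategory V D] :
    EnrichedFunctor V (EnrichedFunctor V C D) (EnrichedFunctor V C' D) :=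
  toFunctorCat (fun G => F.comp V G) (fun G G' c => natπ G G' (F.obj c))
    (fun G G' c c' => by
      have h := natπ_isGradedNat G G' (F.obj c) (F.obj c')
      have h2 := (F.map c c' ▷ _) ≫= h
      rw [whiskerRight_comp_tensorHom_assoc, BraidedCategory.braiding_naturality_left_assoc,
        whiskerLeft_comp_tensorHom_assoc] at h2
      exact h2)
    (fun G c => functor_eId_π G (F.obj c))
    (fun G G' G'' c => functor_eComp_π G G' G'' (F.obj c))

/-- Postcomposition `[C, D] → [C, D']` with a `V`-functor `F : D → D'`. -/
def whiskerR (C : Type v) [EnrichedCategory V C] {D' : Type u₂} [EnrichedCategory V D']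
    (F : EnrichedFunctor V D D') :
    EnrichedFunctor V (EnrichedFunctor V C D) (EnrichedFunctor V C D') :=
  toFunctorCat (fun G => G.comp V F) (fun G G' c => natπ G G' c ≫ F.map _ _)
    (fun G G' c c' => map_comm F _ _ _ _ (natπ_isGradedNat G G' c c'))
    (fun G c => ((reassoc_of% functor_eId_π) G c _).trans (F.map_id _))
    (fun G G' G'' c => ((reassoc_of% functor_eComp_π) G G' G'' c _).trans
      ((_ ≫= F.map_comp _ _ _).trans (tensorHom_comp_tensorHom_assoc _ _ _ _ _)))

/-- The opposite of a `V`-functor. -/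
abbrev opF {C : Type u₂} [EnrichedCategory V C] (F : EnrichedFunctor V C D) :
    EnrichedFunctor V Cᵒᵖ Dᵒᵖ where
  obj c := op (F.obj c.unop)
  map c c' := F.map c'.unop c.unop
  map_id c := F.map_id c.unop
  map_comp c c' c'' := by
    rw [tensorHom_eComp_op_eq, eComp_op_eq, Category.assoc]
    exact _ ≫= F.map_comp c''.unop c'.unop c.unop

variable (V) in
/-- The `V`-functor `C → Cᵒᵖᵒᵖ`, the identity on hom-objects. -/
abbrev opOp (C : Type u₂) [EnrichedCategory V C] : EnrichedFunctor V C Cᵒᵖᵒᵖ where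
  obj c := op (op c)
  map c c' := 𝟙 (c ⟶[V] c')
  map_id c := Category.comp_id (eId V c)
  map_comp c c' c'' := by
    rw [eComp_op_eq, eComp_op_eq]
    erw [Category.comp_id, id_tensorHom_id, Category.id_comp, SymmetricCategory.symmetry_assoc]

/-- The `V`-functor `[C, D]ᵒᵖ → [Cᵒᵖ, Dᵒᵖ]`, `G ↦ Gᵒᵖ`. -/
def opFunctor (C : Type v) [EnrichedCategory V C] (D : Type u₃) [EnrichedCategory V D] :
    EnrichedFunctor V (EnrichedFunctor V C D)ᵒᵖ (EnrichedFunctor V Cᵒᵖ Dᵒᵖ) :=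
  toFunctorCat (fun G => opF G.unop) (fun G G' c => natπ G'.unop G.unop c.unop)
    (fun G G' c c' =>
      (tensorHom_eComp_op_eq V (x := op (G'.unop.obj c'.unop)) (y := op (G.unop.obj c'.unop))
        (z := op (G.unop.obj c.unop)) _ _).trans
        (_ ≫= (braid_swap (natπ_isGradedNat G'.unop G.unop c'.unop c.unop)).trans
          (tensorHom_eComp_op_eq V (x := op (G'.unop.obj c'.unop)) (y := op (G'.unop.obj c.unop))
        (z := op (G.unop.obj c.unop)) _ _).symm))
    (fun G c => functor_eId_π G.unop c.unop)
    (fun G G' G'' c => (Category.assoc _ _ _).trans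
      ((_ ≫= functor_eComp_π G''.unop G'.unop G.unop c.unop).trans
        (tensorHom_eComp_op_eq V (x := op (G''.unop.obj c.unop)) (y := op (G'.unop.obj c.unop))
        (z := op (G.unop.obj c.unop)) _ _).symm))

end
end FunctorCategory

section Swap
/-- The symmetry exchanging the last two factors. -/
def swapRight (X Y Z : V) : (X ⊗ Y) ⊗ Z ⟶ (X ⊗ Z) ⊗ Y :=
  (α_ X Y Z).hom ≫ X ◁ (β_ Y Z).hom ≫ (α_ X Z Y).inv

theorem swapRight_nat_left {X X' : V} (f : X ⟶ X') (Y Z : V) :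
    (f ▷ Y) ▷ Z ≫ swapRight X' Y Z = swapRight X Y Z ≫ (f ▷ Z) ▷ Y := by
  simp only [swapRight, Category.assoc, associator_naturality_left_assoc,
    ← whisker_exchange_assoc, associator_inv_naturality_left]

theorem swapRight_nat_mid (X : V) {Y Y' : V} (g : Y ⟶ Y') (Z : V) :
    (X ◁ g) ▷ Z ≫ swapRight X Y' Z = swapRight X Y Z ≫ (X ⊗ Z) ◁ g := by
  simp only [swapRight, Category.assoc, associator_naturality_middle_assoc,
    ← MonoidalCategory.whiskerLeft_comp_assoc, BraidedCategory.braiding_naturality_left]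
  rw [MonoidalCategory.whiskerLeft_comp_assoc, associator_inv_naturality_right]

theorem swapRight_nat_right (X Y : V) {Z Z' : V} (h : Z ⟶ Z') :
    (X ⊗ Y) ◁ h ≫ swapRight X Y Z' = swapRight X Y Z ≫ (X ◁ h) ▷ Y := by
  simp only [swapRight, Category.assoc, associator_naturality_right_assoc,
    ← MonoidalCategory.whiskerLeft_comp_assoc, BraidedCategory.braiding_naturality_right]
  rw [MonoidalCategory.whiskerLeft_comp_assoc, associator_inv_naturality_middle]

theorem swapRight_unit (X Y : V) : swapRight X Y (𝟙_ V) ≫ (ρ_ X).hom ▷ Y = (ρ_ (X ⊗ Y)).hom := by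
  simp [swapRight]

theorem swapRight_tensor (X Y H K : V) :
    swapRight X Y (H ⊗ K) ≫ (α_ X H K).inv ▷ Y =
      (α_ (X ⊗ Y) H K).inv ≫ swapRight X Y H ▷ K ≫ swapRight (X ⊗ H) Y K := by
  simp only [swapRight, BraidedCategory.braiding_tensor_right_hom]
  monoidal

theorem swapRight_yb (X N A H : V) :
    (α_ X N A).hom ▷ H ≫ swapRight X (N ⊗ A) H ≫ (α_ (X ⊗ H) N A).inv ≫ swapRight (X ⊗ H) N A =
      swapRight X N A ▷ H ≫ swapRight (X ⊗ A) N H ≫ swapRight X A H ▷ N := by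
  have h := BraidedCategory.yang_baxter' N A H
  calc _ = 𝟙 (((X ⊗ N) ⊗ A) ⊗ H) ⊗≫ X ◁ (𝟙 ((N ⊗ A) ⊗ H) ⊗≫ (N ◁ (β_ A H).hom ⊗≫ (β_ N H).hom ▷ A ⊗≫ H ◁ (β_ N A).hom)
          ⊗≫ 𝟙 ((H ⊗ A) ⊗ N)) ⊗≫
          𝟙 (((X ⊗ H) ⊗ A) ⊗ N) := by
        simp only [swapRight, BraidedCategory.braiding_tensor_left_hom]
        monoidal
    _ = _ := by
        rw [← h]
        simp only [swapRight]
        monoidal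

theorem tenL_aux {X X' Y Y' P Q A H Z : V} {aM : X ⊗ A ⟶ Y} {aM' : X' ⊗ A ⟶ Y'} {aN : Q ⊗ A ⟶ P}
    {eX : X ⊗ H ⟶ X'} {eY : Y ⊗ H ⟶ Y'} {k : X' ⊗ P ⟶ Z} {l : Y' ⊗ Q ⟶ Z}
    (he : aM ▷ H ≫ eY = swapRight _ _ _ ≫ eX ▷ A ≫ aM')
    (hk : ((α_ _ _ _).hom ≫ X' ◁ aN) ≫ k = (swapRight _ _ _ ≫ aM' ▷ Q) ≫ l) :
    ((α_ _ _ _).hom ≫ X ◁ aN) ▷ H ≫ swapRight _ _ _ ≫ eX ▷ P ≫ k =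
      (swapRight _ _ _ ≫ aM ▷ Q) ▷ H ≫ swapRight _ _ _ ≫ eY ▷ Q ≫ l := by
  have hk2 := (α_ _ _ _).inv ≫= hk
  simp only [Category.assoc, Iso.inv_hom_id_assoc] at hk2
  have he2 := congrArg (fun t => t ▷ Q) he
  simp only [comp_whiskerRight] at he2
  simp only [comp_whiskerRight, Category.assoc, reassoc_of% swapRight_nat_mid, reassoc_of% swapRight_nat_left]
  rw [whisker_exchange_assoc, hk2, reassoc_of% he2, ← reassoc_of% swapRight_yb,
    ← reassoc_of% swapRight_nat_left]
  simp

theorem tenR_aux {X Y P P' Q Q' A H Z : V} {aM : X ⊗ A ⟶ Y} {aN : Q ⊗ A ⟶ P} {aN' : Q' ⊗ A ⟶ P'}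
    {eP : P ⊗ H ⟶ P'} {eQ : Q ⊗ H ⟶ Q'} {k : X ⊗ P' ⟶ Z} {l : Y ⊗ Q' ⟶ Z}
    (he : aN ▷ H ≫ eP = swapRight _ _ _ ≫ eQ ▷ A ≫ aN')
    (hk : ((α_ _ _ _).hom ≫ X ◁ aN') ≫ k = (swapRight _ _ _ ≫ aM ▷ Q') ≫ l) :
    ((α_ _ _ _).hom ≫ X ◁ aN) ▷ H ≫ (α_ _ _ _).hom ≫ X ◁ eP ≫ k =
      (swapRight _ _ _ ≫ aM ▷ Q) ▷ H ≫ (α_ _ _ _).hom ≫ Y ◁ eQ ≫ l := by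
  have he2 := congrArg (fun t => X ◁ t) he
  have hk2 := (α_ _ _ _).inv ≫= hk
  simp only [Category.assoc, Iso.inv_hom_id_assoc] at hk2
  simp only [MonoidalCategory.whiskerLeft_comp] at he2
  have e1 : (α_ X Q A).hom ▷ H ≫ (α_ X (Q ⊗ A) H).hom ≫ X ◁ swapRight Q A H ≫
      (α_ X (Q ⊗ H) A).inv ≫ swapRight X (Q ⊗ H) A = swapRight X Q A ▷ H ≫ (α_ (X ⊗ A) Q H).hom := by
    have e2 : (α_ Q A H).hom ≫ Q ◁ (β_ A H).hom ≫ (α_ Q H A).inv ≫ (β_ (Q ⊗ H) A).hom =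
        (β_ Q A).hom ▷ H ≫ (α_ A Q H).hom := by
      simp [← MonoidalCategory.whiskerLeft_comp_assoc]
    calc _ = 𝟙 (((X ⊗ Q) ⊗ A) ⊗ H) ⊗≫ X ◁ ((α_ Q A H).hom ≫ Q ◁ (β_ A H).hom ≫ (α_ Q H A).inv ≫
              (β_ (Q ⊗ H) A).hom) ⊗≫ 𝟙 ((X ⊗ A) ⊗ Q ⊗ H) := by
          simp only [swapRight]
          monoidal
      _ = _ := by
          rw [e2]
          simp only [swapRight]
          monoidal
  have e3 := reassoc_of% e1
  simp only [comp_whiskerRight, Category.assoc, associator_naturality_middle_assoc,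
    associator_naturality_left_assoc]
  rw [reassoc_of% he2, hk2, ← whisker_exchange_assoc, ← e3, ← reassoc_of% swapRight_nat_mid]
  simp
end Swap

section VValued
noncomputable section
attribute [local instance] MonoidalClosed.enrichedCategorySelf
universe u₁ u₂
variable [MonoidalClosed V]
variable {C : Type u₂} [EnrichedCategory V C]

/-- The action `F x ⊗ C(x, y) ⟶ F y` of a `V`-valued `V`-functor, the transpose of its action on
hom-objects. -/
def act (F : EnrichedFunctor V C V) (x y : C) : F.obj x ⊗ (x ⟶[V] y) ⟶ F.obj y :=
  MonoidalClosed.uncurry (F.map x y)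

theorem uncurry_eId (X : V) : MonoidalClosed.uncurry (eId V X) = (ρ_ X).hom :=
  MonoidalClosed.uncurry_curry _

theorem uncurry_comp {P Q X Y Z : V} (f : P ⟶ (ihom X).obj Y) (g : Q ⟶ (ihom Y).obj Z) :
    MonoidalClosed.uncurry ((f ⊗ₘ g) ≫ eComp V X Y Z) =
      (α_ _ _ _).inv ≫ MonoidalClosed.uncurry f ▷ Q ≫ MonoidalClosed.uncurry g := by
  have h : MonoidalClosed.uncurry (eComp V X Y Z) = MonoidalClosed.compTranspose X Y Z :=
    MonoidalClosed.uncurry_curry _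
  rw [MonoidalClosed.uncurry_natural_left, h, MonoidalClosed.compTranspose,
    MonoidalClosed.uncurry_eq, MonoidalClosed.uncurry_eq, comp_whiskerRight, Category.assoc,
    ← whisker_exchange_assoc]
  simp [MonoidalCategory.tensorHom_def]

theorem act_id (F : EnrichedFunctor V C V) (x : C) :
    F.obj x ◁ eId V x ≫ act F x x = (ρ_ _).hom := by
  rw [act, ← MonoidalClosed.uncurry_natural_left, F.map_id, uncurry_eId]

theorem act_comp (F : EnrichedFunctor V C V) (x y z : C) :
    F.obj x ◁ eComp V x y z ≫ act F x z =
      (α_ _ _ _).inv ≫ act F x y ▷ _ ≫ act F y z := by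
  rw [act, ← MonoidalClosed.uncurry_natural_left, F.map_comp, uncurry_comp]; rfl

/-- A `V`-valued `V`-functor given by its action `obj x ⊗ C(x, y) ⟶ obj y`. -/
def ofAct (obj : C → V) (a : ∀ x y, obj x ⊗ (x ⟶[V] y) ⟶ obj y)
    (hid : ∀ x, obj x ◁ eId V x ≫ a x x = (ρ_ _).hom)
    (hcomp : ∀ x y z, obj x ◁ eComp V x y z ≫ a x z = (α_ _ _ _).inv ≫ a x y ▷ _ ≫ a y z) :
    EnrichedFunctor V C V where
  obj := obj
  map x y := MonoidalClosed.curry (a x y)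
  map_id x := by
    apply MonoidalClosed.uncurry_injective
    rw [MonoidalClosed.uncurry_natural_left, MonoidalClosed.uncurry_curry, hid, uncurry_eId]
  map_comp x y z := by
    apply MonoidalClosed.uncurry_injective
    rw [MonoidalClosed.uncurry_natural_left, MonoidalClosed.uncurry_curry, hcomp, uncurry_comp,
      MonoidalClosed.uncurry_curry, MonoidalClosed.uncurry_curry]

/-- The representable `V`-functor `C(c, -)`. -/
def coyo (c : C) : EnrichedFunctor V C V :=
  ofAct (fun x => (c ⟶[V] x)) (fun x y => eComp V c x y) (fun x => e_comp_id_hom V c x)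
    (fun x y z => (e_assoc V c x y z).symm)

/-- `V`-naturality of a family of morphisms `F c ⟶ G c` of `V`, for `V`-valued `V`-functors. -/
def IsNatural (F G : EnrichedFunctor V C V) (u : ∀ c, F.obj c ⟶ G.obj c) : Prop :=
  ∀ c c', act F c c' ≫ u c' = u c ▷ _ ≫ act G c c'

/-- The contravariant representable `V`-functor `C(-, c)`. -/
def yo (c : C) : EnrichedFunctor V Cᵒᵖ V := coyo (op c)

end
end VValued

section Coend
noncomputable section
attribute [local instance] MonoidalClosed.enrichedCategorySelf
variable [MonoidalClosed V] [HasColimits V]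
variable {A : Type v} [EnrichedCategory V A]

variable (M : EnrichedFunctor V A V) (N : EnrichedFunctor V Aᵒᵖ V)

/-- The action of `C(x, y)` on the contravariant factor. -/
def balLeft (x y : A) : (M.obj x ⊗ N.obj (op y)) ⊗ (x ⟶[V] y) ⟶ M.obj x ⊗ N.obj (op x) :=
  (α_ _ _ _).hom ≫ M.obj x ◁ act N (op y) (op x)

/-- The action of `C(x, y)` on the covariant factor. -/
def balRight (x y : A) : (M.obj x ⊗ N.obj (op y)) ⊗ (x ⟶[V] y) ⟶ M.obj y ⊗ N.obj (op y) :=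
  swapRight _ _ _ ≫ act M x y ▷ N.obj (op y)

/-- First of the two maps whose coequalizer is the coend `∫^x M x ⊗ N x`. -/
def coendLeft : (∐ fun xy : A × A => (M.obj xy.1 ⊗ N.obj (op xy.2)) ⊗ (xy.1 ⟶[V] xy.2)) ⟶
    ∐ fun x : A => M.obj x ⊗ N.obj (op x) :=
  Sigma.desc fun xy => balLeft M N xy.1 xy.2 ≫
    Sigma.ι (fun x : A => M.obj x ⊗ N.obj (op x)) xy.1

/-- Second of the two maps whose coequalizer is the coend `∫^x M x ⊗ N x`. -/
def coendRight : (∐ fun xy : A × A => (M.obj xy.1 ⊗ N.obj (op xy.2)) ⊗ (xy.1 ⟶[V] xy.2)) ⟶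
    ∐ fun x : A => M.obj x ⊗ N.obj (op x) :=
  Sigma.desc fun xy => balRight M N xy.1 xy.2 ≫
    Sigma.ι (fun x : A => M.obj x ⊗ N.obj (op x)) xy.2

/-- The coend `∫^x M x ⊗ N x` of a covariant `M` and a contravariant `N`. -/
def tensorOver : V := coequalizer (coendLeft M N) (coendRight M N)

/-- The coprojections `M x ⊗ N x ⟶ ∫^x M x ⊗ N x`. -/
def coι (x : A) : M.obj x ⊗ N.obj (op x) ⟶ tensorOver M N :=
  Sigma.ι (fun x : A => M.obj x ⊗ N.obj (op x)) x ≫ coequalizer.π _ _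

theorem co_condition (x y : A) : balLeft M N x y ≫ coι M N x = balRight M N x y ≫ coι M N y := by
  have h := Sigma.ι (fun xy : A × A => (M.obj xy.1 ⊗ N.obj (op xy.2)) ⊗ (xy.1 ⟶[V] xy.2)) (x, y) ≫=
    coequalizer.condition (coendLeft M N) (coendRight M N)
  rw [coendLeft, coendRight, Sigma.ι_desc_assoc, Sigma.ι_desc_assoc, Category.assoc, Category.assoc] at h
  exact h

variable {M N}
/-- The universal property of the coend. -/
def coDesc {Z : V} (k : ∀ x : A, M.obj x ⊗ N.obj (op x) ⟶ Z)
    (hk : ∀ x y, balLeft M N x y ≫ k x = balRight M N x y ≫ k y) : tensorOver M N ⟶ Z :=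
  coequalizer.desc (Sigma.desc k) (by
    apply Sigma.hom_ext
    rintro ⟨x, y⟩
    rw [coendLeft, coendRight, Sigma.ι_desc_assoc, Sigma.ι_desc_assoc, Category.assoc,
      Category.assoc, Sigma.ι_desc, Sigma.ι_desc]
    exact hk x y)

theorem coι_desc {Z : V} (k : ∀ x : A, M.obj x ⊗ N.obj (op x) ⟶ Z)
    (hk : ∀ x y, balLeft M N x y ≫ k x = balRight M N x y ≫ k y) (x : A) :
    coι M N x ≫ coDesc k hk = k x := by
  exact (Category.assoc _ _ _).trans
    ((_ ≫= coequalizer.π_desc _ _).trans (Sigma.ι_desc k x))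

theorem co_ext {Z : V} {f g : tensorOver M N ⟶ Z} (h : ∀ x, coι M N x ≫ f = coι M N x ≫ g) :
    f = g := by
  apply coequalizer.hom_ext
  apply Sigma.hom_ext
  intro x
  exact (Category.assoc _ _ _).symm.trans ((h x).trans (Category.assoc _ _ _))

/-- The universal property of the coend tensored with an object `H`. -/
def coDescRight {Z H : V} (k : ∀ x : A, (M.obj x ⊗ N.obj (op x)) ⊗ H ⟶ Z)
    (hk : ∀ x y, balLeft M N x y ▷ H ≫ k x = balRight M N x y ▷ H ≫ k y) :
    tensorOver M N ⊗ H ⟶ Z :=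
  (β_ _ _).hom ≫ MonoidalClosed.uncurry
    (coDesc (fun x => MonoidalClosed.curry ((β_ _ _).hom ≫ k x)) (fun x y => by
      rw [← MonoidalClosed.curry_natural_left, ← MonoidalClosed.curry_natural_left,
        BraidedCategory.braiding_naturality_right_assoc,
        BraidedCategory.braiding_naturality_right_assoc, hk]))

theorem coι_descRight {Z H : V} (k : ∀ x : A, (M.obj x ⊗ N.obj (op x)) ⊗ H ⟶ Z)
    (hk : ∀ x y, balLeft M N x y ▷ H ≫ k x = balRight M N x y ▷ H ≫ k y) (x : A) :
    coι M N x ▷ H ≫ coDescRight k hk = k x := by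
  rw [coDescRight, BraidedCategory.braiding_naturality_left_assoc,
    ← MonoidalClosed.uncurry_natural_left, coι_desc, MonoidalClosed.uncurry_curry,
    SymmetricCategory.symmetry_assoc]

theorem co_ext_right {Z H : V} {f g : tensorOver M N ⊗ H ⟶ Z}
    (h : ∀ x, coι M N x ▷ H ≫ f = coι M N x ▷ H ≫ g) : f = g := by
  rw [← cancel_epi (β_ H (tensorOver M N)).hom]
  apply MonoidalClosed.curry_injective
  apply co_ext
  intro x
  rw [← MonoidalClosed.curry_natural_left, ← MonoidalClosed.curry_natural_left,
    BraidedCategory.braiding_naturality_right_assoc,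
    BraidedCategory.braiding_naturality_right_assoc, h]

variable [HasLimits V]

/-- Evaluation `F c ⊗ [C, V](F, G) ⟶ G c`. -/
def evalAt {C : Type v} [EnrichedCategory V C] (F G : EnrichedFunctor V C V) (c : C) :
    F.obj c ⊗ (F ⟶[V] G) ⟶ G.obj c :=
  MonoidalClosed.uncurry (natπ F G c)

theorem evalAt_id {C : Type v} [EnrichedCategory V C] (F : EnrichedFunctor V C V) (c : C) :
    F.obj c ◁ eId V F ≫ evalAt F F c = (ρ_ _).hom := by
  rw [evalAt, ← MonoidalClosed.uncurry_natural_left, functor_eId_π, uncurry_eId]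

theorem evalAt_comp {C : Type v} [EnrichedCategory V C] (F G H : EnrichedFunctor V C V) (c : C) :
    F.obj c ◁ eComp V F G H ≫ evalAt F H c =
      (α_ _ _ _).inv ≫ evalAt F G c ▷ _ ≫ evalAt G H c := by
  rw [evalAt, ← MonoidalClosed.uncurry_natural_left, functor_eComp_π, uncurry_comp]; rfl

theorem evalAt_act {C : Type v} [EnrichedCategory V C] (F G : EnrichedFunctor V C V) (c c' : C) :
    act F c c' ▷ _ ≫ evalAt F G c' = swapRight _ _ _ ≫ evalAt F G c ▷ _ ≫ act G c c' := by
  have h := congrArg MonoidalClosed.uncurry (natπ_isGradedNat F G c c')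
  rw [uncurry_comp, MonoidalClosed.uncurry_natural_left, uncurry_comp] at h
  have h2 := (α_ _ _ _).hom ≫= h
  rw [Iso.hom_inv_id_assoc] at h2
  simp only [swapRight, Category.assoc]
  exact h2

theorem ten_condition (M : EnrichedFunctor V A V) (N : EnrichedFunctor V Aᵒᵖ V) (x y : A) :
    ((α_ _ _ _).hom ≫ M.obj x ◁ act N (op y) (op x)) ≫ coι M N x =
      (swapRight _ _ _ ≫ act M x y ▷ N.obj (op y)) ≫ coι M N y :=
  co_condition M N x y

theorem tenL_dinat (M M' : EnrichedFunctor V A V) (N : EnrichedFunctor V Aᵒᵖ V) (x y : A) :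
    balLeft M N x y ▷ (M ⟶[V] M') ≫ swapRight _ _ _ ≫ evalAt M M' x ▷ _ ≫ coι M' N x =
      balRight M N x y ▷ (M ⟶[V] M') ≫ swapRight _ _ _ ≫ evalAt M M' y ▷ _ ≫ coι M' N y :=
  tenL_aux (evalAt_act M M' x y) (ten_condition M' N x y)

theorem tenR_dinat (M : EnrichedFunctor V A V) (N N' : EnrichedFunctor V Aᵒᵖ V) (x y : A) :
    balLeft M N x y ▷ (N ⟶[V] N') ≫ (α_ _ _ _).hom ≫ _ ◁ evalAt N N' (op x) ≫ coι M N' x =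
      balRight M N x y ▷ (N ⟶[V] N') ≫ (α_ _ _ _).hom ≫ _ ◁ evalAt N N' (op y) ≫ coι M N' y :=
  tenR_aux (evalAt_act N N' (op y) (op x)) (ten_condition M N' x y)

/-- The effect of `∫^x (-) x ⊗ N x` on hom-objects. -/
def tenLMap (M M' : EnrichedFunctor V A V) (N : EnrichedFunctor V Aᵒᵖ V) :
    tensorOver M N ⊗ (M ⟶[V] M') ⟶ tensorOver M' N :=
  coDescRight (fun x => swapRight _ _ _ ≫ evalAt M M' x ▷ _ ≫ coι M' N x) (tenL_dinat M M' N)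

theorem coι_tenLMap (M M' : EnrichedFunctor V A V) (N : EnrichedFunctor V Aᵒᵖ V) (x : A) :
    coι M N x ▷ _ ≫ tenLMap M M' N = swapRight _ _ _ ≫ evalAt M M' x ▷ _ ≫ coι M' N x :=
  coι_descRight _ (tenL_dinat M M' N) x

/-- The effect of `∫^x M x ⊗ (-) x` on hom-objects. -/
def tenRMap (M : EnrichedFunctor V A V) (N N' : EnrichedFunctor V Aᵒᵖ V) :
    tensorOver M N ⊗ (N ⟶[V] N') ⟶ tensorOver M N' :=
  coDescRight (fun x => (α_ _ _ _).hom ≫ _ ◁ evalAt N N' (op x) ≫ coι M N' x) (tenR_dinat M N N')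

theorem coι_tenRMap (M : EnrichedFunctor V A V) (N N' : EnrichedFunctor V Aᵒᵖ V) (x : A) :
    coι M N x ▷ _ ≫ tenRMap M N N' = (α_ _ _ _).hom ≫ _ ◁ evalAt N N' (op x) ≫ coι M N' x :=
  coι_descRight _ (tenR_dinat M N N') x

variable (A) in
/-- The `V`-functor `M ↦ ∫^x M x ⊗ N x` on `[A, V]`. -/
def tenL (N : EnrichedFunctor V Aᵒᵖ V) : EnrichedFunctor V (EnrichedFunctor V A V) V :=
  ofAct (fun M => tensorOver M N) (fun M M' => tenLMap M M' N)
    (fun M => by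
      apply co_ext_right
      intro x
      rw [← whisker_exchange_assoc, coι_tenLMap, reassoc_of% swapRight_nat_right,
        ← comp_whiskerRight_assoc, evalAt_id, reassoc_of% swapRight_unit, rightUnitor_naturality])
    (fun M M' M'' => by
      apply co_ext_right
      intro x
      rw [← whisker_exchange_assoc, coι_tenLMap, reassoc_of% swapRight_nat_right,
        ← comp_whiskerRight_assoc, evalAt_comp, associator_inv_naturality_left_assoc,
        ← comp_whiskerRight_assoc, coι_tenLMap]
      simp only [comp_whiskerRight, Category.assoc, coι_tenLMap]
      rw [reassoc_of% swapRight_tensor, reassoc_of% swapRight_nat_left])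

variable (A) in
/-- The `V`-functor `N ↦ ∫^x M x ⊗ N x` on `[Aᵒᵖ, V]`. -/
def tenR (M : EnrichedFunctor V A V) : EnrichedFunctor V (EnrichedFunctor V Aᵒᵖ V) V :=
  ofAct (fun N => tensorOver M N) (fun N N' => tenRMap M N N')
    (fun N => by
      apply co_ext_right
      intro x
      rw [← whisker_exchange_assoc, coι_tenRMap, associator_naturality_right_assoc,
        ← MonoidalCategory.whiskerLeft_comp_assoc, evalAt_id, rightUnitor_naturality]
      simp)
    (fun N N' N'' => by
      apply co_ext_right
      intro x
      rw [← whisker_exchange_assoc, coι_tenRMap, associator_naturality_right_assoc,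
        ← MonoidalCategory.whiskerLeft_comp_assoc, evalAt_comp,
        associator_inv_naturality_left_assoc,
        ← comp_whiskerRight_assoc, coι_tenRMap]
      simp only [comp_whiskerRight, Category.assoc, coι_tenRMap]
      simp)

end
end Coend

section Duality
noncomputable section
attribute [local instance] MonoidalClosed.enrichedCategorySelf

section Base
variable [MonoidalClosed V]

/-- The canonical morphism `X ⟶ [[X, D], D]`. -/
def doubleDual (D X : V) : X ⟶ (ihom ((ihom X).obj D)).obj D :=
  MonoidalClosed.curry ((β_ ((ihom X).obj D) X).hom ≫ (ihom.ev X).app D)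

variable (V) in
/-- A symmetric monoidal closed category is `*`-autonomous if it has a dualizing object `D`, that is,
one for which all the canonical morphisms `X ⟶ [[X, D], D]` are invertible. Then `X* = [X, D]`. -/
class StarAutonomousBase where
  dualizing : V
  isIso_doubleDual (X : V) : IsIso (doubleDual dualizing X)

theorem doubleDual_map {D X Y : V} (f : X ⟶ Y) :
    f ≫ doubleDual D Y =
      doubleDual D X ≫ (MonoidalClosed.pre ((MonoidalClosed.pre f).app D)).app D := by
  apply MonoidalClosed.uncurry_injective
  rw [MonoidalClosed.uncurry_natural_left, doubleDual, doubleDual, MonoidalClosed.uncurry_curry,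
    MonoidalClosed.uncurry_eq, MonoidalCategory.whiskerLeft_comp, Category.assoc,
    MonoidalClosed.id_tensor_pre_app_comp_ev, whisker_exchange_assoc,
    ← MonoidalClosed.uncurry_eq, MonoidalClosed.uncurry_curry,
    BraidedCategory.braiding_naturality_right_assoc,
    BraidedCategory.braiding_naturality_left_assoc,
    ← MonoidalClosed.id_tensor_pre_app_comp_ev]

/-- In a `*`-autonomous category `(-)*` is an equivalence `V ≌ Vᵒᵖ`. -/
def dualEquivalence [StarAutonomousBase V] : V ≌ Vᵒᵖ :=
  CategoryTheory.Equivalence.mk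
    (MonoidalClosed.internalHom.flip.obj (StarAutonomousBase.dualizing (V := V))).rightOp
    (MonoidalClosed.internalHom.flip.obj (StarAutonomousBase.dualizing (V := V)))
    (NatIso.ofComponents
      (fun X => @asIso _ _ _ _ (doubleDual (StarAutonomousBase.dualizing (V := V)) X)
        (StarAutonomousBase.isIso_doubleDual X))
      (fun f => doubleDual_map f))
    (NatIso.ofComponents
      (fun X => (@asIso _ _ _ _ (doubleDual (StarAutonomousBase.dualizing (V := V)) X.unop)
        (StarAutonomousBase.isIso_doubleDual X.unop)).op)
      (fun f => Quiver.Hom.unop_inj (doubleDual_map f.unop).symm))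

/-- A complete `*`-autonomous category is cocomplete. -/
instance hasColimits_of_starAutonomousBase [HasLimits V] [StarAutonomousBase V] :
    HasColimits V :=
  haveI : HasLimits Vᵒᵖ :=
    Adjunction.has_limits_of_equivalence (dualEquivalence (V := V)).inverse
  hasColimits_of_hasLimits_op
end Base
end
end Duality

section Star
noncomputable section
attribute [local instance] MonoidalClosed.enrichedCategorySelf
universe u₁ u₂
variable [MonoidalClosed V]

/-- The opposite `Sᵒᵖ : C → Cᵒᵖ` of a `V`-functor `S : Cᵒᵖ → C`. -/
abbrev Sop {C : Type u₁} [EnrichedCategory V C] (S : EnrichedFunctor V Cᵒᵖ C) :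
    EnrichedFunctor V C Cᵒᵖ :=
  (opOp V C).comp V (opF S)

variable (V) in
/-- The `V`-functor `(-)* = [-, D] : Vᵒᵖ → V`. -/
def dualFunctor [StarAutonomousBase V] : EnrichedFunctor V Vᵒᵖ V :=
  coyo (C := Vᵒᵖ) (op (StarAutonomousBase.dualizing (V := V)))

/-- The `V`-functor `[A, V]ᵒᵖ → [A, V]`, `f ↦ f*`, with `f* a = (f (S a))*`, obtained as the composite
`[A, V]ᵒᵖ → [Aᵒᵖ, Vᵒᵖ] → [A, Vᵒᵖ] → [A, V]`. -/
def starFunctor [HasLimits V] [StarAutonomousBase V] {A : Type v} [EnrichedCategory V A]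
    (S : EnrichedFunctor V Aᵒᵖ A) :
    EnrichedFunctor V (EnrichedFunctor V A V)ᵒᵖ (EnrichedFunctor V A V) :=
  (opFunctor A V).comp V
    ((whiskerL (Sop S) Vᵒᵖ).comp V (whiskerR A (dualFunctor V)))

theorem starFunctor_obj_obj [HasLimits V] [StarAutonomousBase V] {A : Type v}
    [EnrichedCategory V A] (S : EnrichedFunctor V Aᵒᵖ A) (f : EnrichedFunctor V A V) (a : A) :
    ((starFunctor S).obj (op f)).obj a =
      (ihom (f.obj (S.obj (op a)))).obj (StarAutonomousBase.dualizing (V := V)) := rfl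

/-! ### Isomorphisms in V-categories -/
section Isos
variable {C : Type u₁} {D : Type u₂} [EnrichedCategory V C] [EnrichedCategory V D]

variable (V) in
/-- Isomorphisms in (the underlying category of) a `V`-category. -/
abbrev VIso (X Y : C) := ForgetEnrichment.of V X ≅ ForgetEnrichment.of V Y

/-- The element `𝟙_ V ⟶ C(X, Y)` underlying an isomorphism. -/
abbrev VIso.elem {X Y : C} (e : VIso V X Y) : 𝟙_ V ⟶ (X ⟶[V] Y) :=
  ForgetEnrichment.homTo V e.hom

/-- `V`-natural isomorphisms of `V`-functors. -/
structure VNatIso (F G : EnrichedFunctor V C D) where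
  iso (c : C) : VIso V (F.obj c) (G.obj c)
  natural : IsGradedNat F G (fun c => (iso c).elem)

/-- An adjunction `F ⊣ G` of `V`-functors: an isomorphism `D(F c, d) ≅ C(c, G d)` in `V` that is
`V`-natural in both variables. -/
structure VAdjunction (F : EnrichedFunctor V C D) (G : EnrichedFunctor V D C) where
  iso (c : C) (d : D) : (F.obj c ⟶[V] d) ≅ (c ⟶[V] G.obj d)
  natural_right (c : C) :
    IsNatural (coyo (F.obj c)) (G.comp V (coyo c)) (fun d => (iso c d).hom)
  natural_left (d : D) :
    IsNatural ((opF F).comp V (yo d)) (yo (G.obj d)) (fun c => (iso c.unop d).hom)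

/-- An antipode: a `V`-functor `S : Cᵒᵖ → C` with `Sᵒᵖ ⊣ S` and `S² ≅ 1`. -/
structure Antipode (S : EnrichedFunctor V Cᵒᵖ C) where
  adj : VAdjunction (Sop S) S
  sq : VNatIso ((Sop S).comp V S) (EnrichedFunctor.id V C)
end Isos

/-! ### Monoidal V-categories -/
section Monoidal
variable {C : Type u₁} [EnrichedCategory V C]

/-- The `V`-functor `X ↦ T (X, Y)`. -/
abbrev partL (T : EnrichedFunctor V (TensorCat C C) C) (Y : C) : EnrichedFunctor V C C :=
  (inclLeft V C Y).comp V T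

/-- The `V`-functor `Y ↦ T (X, Y)`. -/
abbrev partR (T : EnrichedFunctor V (TensorCat C C) C) (X : C) : EnrichedFunctor V C C :=
  (inclRight V X C).comp V T

/-- A monoidal structure on the `V`-category `C` with tensor product `T` and unit object `U`. -/
structure MonoidalVCat (T : EnrichedFunctor V (TensorCat C C) C) (U : C) where
  assoc (X Y Z : C) : VIso V (T.obj ⟨T.obj ⟨X, Y⟩, Z⟩) (T.obj ⟨X, T.obj ⟨Y, Z⟩⟩)
  leftUnit (X : C) : VIso V (T.obj ⟨U, X⟩) X
  rightUnit (X : C) : VIso V (T.obj ⟨X, U⟩) X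
  assoc_natural₁ (Y Z : C) :
    IsGradedNat ((partL T Y).comp V (partL T Z)) (partL T (T.obj ⟨Y, Z⟩))
      (fun X => (assoc X Y Z).elem)
  assoc_natural₂ (X Z : C) :
    IsGradedNat ((partR T X).comp V (partL T Z)) ((partL T Z).comp V (partR T X))
      (fun Y => (assoc X Y Z).elem)
  assoc_natural₃ (X Y : C) :
    IsGradedNat (partR T (T.obj ⟨X, Y⟩)) ((partR T Y).comp V (partR T X))
      (fun Z => (assoc X Y Z).elem)
  leftUnit_natural :
    IsGradedNat (partR T U) (EnrichedFunctor.id V C) (fun X => (leftUnit X).elem)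
  rightUnit_natural :
    IsGradedNat (partL T U) (EnrichedFunctor.id V C) (fun X => (rightUnit X).elem)
  pentagon (W X Y Z : C) :
    (partL T Z).forget.map (assoc W X Y).hom ≫ (assoc W (T.obj ⟨X, Y⟩) Z).hom ≫
        (partR T W).forget.map (assoc X Y Z).hom =
      (assoc (T.obj ⟨W, X⟩) Y Z).hom ≫ (assoc W X (T.obj ⟨Y, Z⟩)).hom
  triangle (X Y : C) :
    (assoc X U Y).hom ≫ (partR T X).forget.map (leftUnit Y).hom =
      (partL T Y).forget.map (rightUnit X).hom

/-- The monoidal `V`-category `C` is `*`-autonomous under `S : Cᵒᵖ → C`: `Sᵒᵖ ⊣ S`, `S² ≅ 1`, and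
`C(X ⊗ Y, S Z) ≅ C(Y ⊗ Z, S X)`, `V`-naturally in `X`, `Y`, `Z`. Since `Z ≅ S (S Z)`, this makes `C`
closed on both sides: `C(X ⊗ Y, Z) ≅ C(Y ⊗ S Z, S X) ≅ C(X, S (Y ⊗ S Z))`, and similarly on the
other side. -/
structure StarAutonomous {T : EnrichedFunctor V (TensorCat C C) C} {U : C}
    (_M : MonoidalVCat T U) (S : EnrichedFunctor V Cᵒᵖ C) extends Antipode S where
  cyc (X Y Z : C) : (T.obj ⟨X, Y⟩ ⟶[V] S.obj (op Z)) ≅ (T.obj ⟨Y, Z⟩ ⟶[V] S.obj (op X))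
  cyc_natural₁ (Y Z : C) :
    IsNatural ((opF (partL T Y)).comp V (yo (S.obj (op Z))))
      (S.comp V (coyo (T.obj ⟨Y, Z⟩))) (fun X => (cyc X.unop Y Z).hom)
  cyc_natural₂ (X Z : C) :
    IsNatural ((opF (partR T X)).comp V (yo (S.obj (op Z))))
      ((opF (partL T Z)).comp V (yo (S.obj (op X)))) (fun Y => (cyc X Y.unop Z).hom)
  cyc_natural₃ (X Y : C) :
    IsNatural (S.comp V (coyo (T.obj ⟨X, Y⟩)))
      ((opF (partR T Y)).comp V (yo (S.obj (op X)))) (fun Z => (cyc X Y Z.unop).hom)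
end Monoidal
end
end Star

section Promonoidal
noncomputable section
attribute [local instance] MonoidalClosed.enrichedCategorySelf
variable [MonoidalClosed V] {A : Type v} [EnrichedCategory V A]

section Kernel
variable (p : EnrichedFunctor V (TensorCat Aᵒᵖ (TensorCat Aᵒᵖ A)) V)

/-- `p(a, b, -)` -/
abbrev ker₃ (a b : A) : EnrichedFunctor V A V :=
  (inclRight V (op b) A).comp V ((inclRight V (op a) (TensorCat Aᵒᵖ A)).comp V p)

/-- `p(a, -, c)` -/
abbrev ker₂ (a c : A) : EnrichedFunctor V Aᵒᵖ V :=
  (inclLeft V Aᵒᵖ c).comp V ((inclRight V (op a) (TensorCat Aᵒᵖ A)).comp V p)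

/-- `p(-, b, c)` -/
abbrev ker₁ (b c : A) : EnrichedFunctor V Aᵒᵖ V :=
  (inclLeft V Aᵒᵖ (⟨op b, c⟩ : TensorCat Aᵒᵖ A)).comp V p

variable [HasLimits V]

/-- `b ↦ p(-, b, c)` -/
abbrev ker₁ofSnd (c : A) : EnrichedFunctor V Aᵒᵖ (EnrichedFunctor V Aᵒᵖ V) :=
  (inclLeft V Aᵒᵖ c).comp V (curryRight p)

/-- `c ↦ p(-, b, c)` -/
abbrev ker₁ofThd (b : A) : EnrichedFunctor V A (EnrichedFunctor V Aᵒᵖ V) :=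
  (inclRight V (op b) A).comp V (curryRight p)

/-- `a ↦ p(a, -, c)` -/
abbrev ker₂ofFst (c : A) : EnrichedFunctor V Aᵒᵖ (EnrichedFunctor V Aᵒᵖ V) :=
  (curryLeft p).comp V (whiskerL (inclLeft V Aᵒᵖ c) V)

/-- `c ↦ p(a, -, c)` -/
abbrev ker₂ofThd (a : A) : EnrichedFunctor V A (EnrichedFunctor V Aᵒᵖ V) :=
  curryRight ((inclRight V (op a) (TensorCat Aᵒᵖ A)).comp V p)

/-- `a ↦ p(a, b, -)` -/
abbrev ker₃ofFst (b : A) : EnrichedFunctor V Aᵒᵖ (EnrichedFunctor V A V) :=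
  (curryLeft p).comp V (whiskerL (inclRight V (op b) A) V)

/-- `b ↦ p(a, b, -)` -/
abbrev ker₃ofSnd (a : A) : EnrichedFunctor V Aᵒᵖ (EnrichedFunctor V A V) :=
  curryLeft ((inclRight V (op a) (TensorCat Aᵒᵖ A)).comp V p)
end Kernel

/-- The symmetry exchanging the first two factors. -/
abbrev swapLeft (X Y Z : V) : X ⊗ (Y ⊗ Z) ⟶ Y ⊗ (X ⊗ Z) :=
  (α_ X Y Z).inv ≫ (β_ X Y).hom ▷ Z ≫ (α_ Y X Z).hom

variable [HasLimits V] [HasColimits V]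

variable (V A) in
/-- A promonoidal structure on the small `V`-category `A`: `V`-functors `p : Aᵒᵖ ⊗ Aᵒᵖ ⊗ A → V` and
`j : A → V` with `V`-natural isomorphisms
`∫^x p(a, b, x) ⊗ p(x, c, d) ≅ ∫^y p(b, c, y) ⊗ p(a, y, d)`,
`∫^x j x ⊗ p(x, b, c) ≅ A(b, c)` and `∫^x j x ⊗ p(a, x, c) ≅ A(a, c)`
satisfying the pentagon and the triangle axiom.

The pentagon compares two maps from `∫^{x,y} p(a, b, x) ⊗ p(x, c, y) ⊗ p(y, d, e)` to
`∫^{z,w} p(c, d, z) ⊗ p(b, z, w) ⊗ p(a, w, e)`, and the triangle two maps from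
`∫^{x,y} j y ⊗ p(a, y, x) ⊗ p(x, b, c)` to `p(a, b, c)`. They are written out on the summands of the
coends; the maps `m₁`, `m₂`, `n₁`, `n₂`, `m` are the unique ones induced on a coend (tensored with an
object) by the displayed formulas. -/
structure Promonoidal where
  p : EnrichedFunctor V (TensorCat Aᵒᵖ (TensorCat Aᵒᵖ A)) V
  j : EnrichedFunctor V A V
  assoc (a b c d : A) :
    tensorOver (ker₃ p a b) (ker₁ p c d) ≅ tensorOver (ker₃ p b c) (ker₂ p a d)
  leftUnit (b c : A) : tensorOver j (ker₁ p b c) ≅ (b ⟶[V] c)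
  rightUnit (a c : A) : tensorOver j (ker₂ p a c) ≅ (a ⟶[V] c)
  assoc_natural₁ (b c d : A) :
    IsNatural ((ker₃ofFst p b).comp V (tenL A (ker₁ p c d)))
      ((ker₂ofFst p d).comp V (tenR A (ker₃ p b c))) (fun a => (assoc a.unop b c d).hom)
  assoc_natural₂ (a c d : A) :
    IsNatural ((ker₃ofSnd p a).comp V (tenL A (ker₁ p c d)))
      ((ker₃ofFst p c).comp V (tenL A (ker₂ p a d))) (fun b => (assoc a b.unop c d).hom)
  assoc_natural₃ (a b d : A) :
    IsNatural ((ker₁ofSnd p d).comp V (tenR A (ker₃ p a b)))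
      ((ker₃ofSnd p b).comp V (tenL A (ker₂ p a d))) (fun c => (assoc a b c.unop d).hom)
  assoc_natural₄ (a b c : A) :
    IsNatural ((ker₁ofThd p c).comp V (tenR A (ker₃ p a b)))
      ((ker₂ofThd p a).comp V (tenR A (ker₃ p b c))) (fun d => (assoc a b c d).hom)
  leftUnit_natural₁ (c : A) :
    IsNatural ((ker₁ofSnd p c).comp V (tenR A j)) (yo c) (fun b => (leftUnit b.unop c).hom)
  leftUnit_natural₂ (b : A) :
    IsNatural ((ker₁ofThd p b).comp V (tenR A j)) (coyo b) (fun c => (leftUnit b c).hom)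
  rightUnit_natural₁ (c : A) :
    IsNatural ((ker₂ofFst p c).comp V (tenR A j)) (yo c) (fun a => (rightUnit a.unop c).hom)
  rightUnit_natural₂ (a : A) :
    IsNatural ((ker₂ofThd p a).comp V (tenR A j)) (coyo a) (fun c => (rightUnit a c).hom)
  pentagon (a b c d e : A) :
    ∃ (m₂ : ∀ z : A, (ker₃ p c d).obj z ⊗ tensorOver (ker₃ p b z) (ker₂ p a e) ⟶
          tensorOver ((ker₂ofThd p b).comp V (tenR A (ker₃ p c d))) (ker₂ p a e))
      (m₁ : ∀ x : A, (ker₃ p a b).obj x ⊗ tensorOver (ker₃ p c d) (ker₂ p x e) ⟶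
          tensorOver ((ker₂ofThd p b).comp V (tenR A (ker₃ p c d))) (ker₂ p a e))
      (n₂ : ∀ z : A, (ker₃ p b c).obj z ⊗ tensorOver (ker₃ p z d) (ker₂ p a e) ⟶
          tensorOver ((ker₂ofThd p b).comp V (tenR A (ker₃ p c d))) (ker₂ p a e))
      (n₁ : ∀ y : A, tensorOver (ker₃ p b c) (ker₂ p a y) ⊗ (ker₁ p d e).obj (op y) ⟶
          tensorOver ((ker₂ofThd p b).comp V (tenR A (ker₃ p c d))) (ker₂ p a e)),
      (∀ z w : A, _ ◁ coι (ker₃ p b z) (ker₂ p a e) w ≫ m₂ z =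
        (α_ _ _ _).inv ≫ coι (ker₃ p c d) (ker₂ p b w) z ▷ _ ≫
          coι ((ker₂ofThd p b).comp V (tenR A (ker₃ p c d))) (ker₂ p a e) w) ∧
      (∀ x z : A, _ ◁ coι (ker₃ p c d) (ker₂ p x e) z ≫ m₁ x =
        swapLeft _ _ _ ≫ _ ◁ (coι (ker₃ p a b) (ker₁ p z e) x ≫ (assoc a b z e).hom) ≫ m₂ z) ∧
      (∀ z w : A, _ ◁ coι (ker₃ p z d) (ker₂ p a e) w ≫ n₂ z =
        (α_ _ _ _).inv ≫ (coι (ker₃ p b c) (ker₁ p d w) z ≫ (assoc b c d w).hom) ▷ _ ≫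
          coι ((ker₂ofThd p b).comp V (tenR A (ker₃ p c d))) (ker₂ p a e) w) ∧
      (∀ y z : A, coι (ker₃ p b c) (ker₂ p a y) z ▷ _ ≫ n₁ y =
        (α_ _ _ _).hom ≫ _ ◁ (coι (ker₃ p a z) (ker₁ p d e) y ≫ (assoc a z d e).hom) ≫ n₂ z) ∧
      ∀ x y : A,
        (α_ _ _ _).inv ≫ (coι (ker₃ p a b) (ker₁ p c y) x ≫ (assoc a b c y).hom) ▷ _ ≫ n₁ y =
          _ ◁ (coι (ker₃ p x c) (ker₁ p d e) y ≫ (assoc x c d e).hom) ≫ m₁ x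
  triangle (a b c y : A) :
    ∃ m : j.obj y ⊗ tensorOver (ker₃ p y b) (ker₂ p a c) ⟶ (ker₃ p a b).obj c,
      (∀ z : A, _ ◁ coι (ker₃ p y b) (ker₂ p a c) z ≫ m =
        (α_ _ _ _).inv ≫ (coι j (ker₁ p b z) y ≫ (leftUnit b z).hom) ▷ _ ≫ (β_ _ _).hom ≫
          act (ker₂ p a c) (op z) (op b)) ∧
      ∀ x : A, _ ◁ (coι (ker₃ p a y) (ker₁ p b c) x ≫ (assoc a y b c).hom) ≫ m =
        (α_ _ _ _).inv ≫ (coι j (ker₂ p a x) y ≫ (rightUnit a x).hom) ▷ _ ≫ (β_ _ _).hom ≫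
          act (ker₁ p b c) (op x) (op a)

/-- `(A, p, j)` is `S`-autonomous: `S` is an antipode and `p(a, b, S c) ≅ p(b, c, S a)`, `V`-naturally
in `a`, `b`, `c`. -/
structure SAutonomous (p : EnrichedFunctor V (TensorCat Aᵒᵖ (TensorCat Aᵒᵖ A)) V)
    (S : EnrichedFunctor V Aᵒᵖ A) extends Antipode S where
  cyc (a b c : A) :
    p.obj ⟨op a, ⟨op b, S.obj (op c)⟩⟩ ≅ p.obj ⟨op b, ⟨op c, S.obj (op a)⟩⟩
  cyc_natural₁ (b c : A) :
    IsNatural (ker₁ p b (S.obj (op c))) (S.comp V (ker₃ p b c)) (fun a => (cyc a.unop b c).hom)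
  cyc_natural₂ (a c : A) :
    IsNatural (ker₂ p a (S.obj (op c))) (ker₁ p c (S.obj (op a))) (fun b => (cyc a b.unop c).hom)
  cyc_natural₃ (a b : A) :
    IsNatural (S.comp V (ker₃ p a b)) (ker₂ p b (S.obj (op a))) (fun c => (cyc a b c.unop).hom)

/-! ### Convolution -/

/-- `V`-dinaturality, in `a` and in `b`, of a family `f a ⊗ g b ⊗ p(a, b, c) ⟶ X`. -/
structure IsCowedge (p : EnrichedFunctor V (TensorCat Aᵒᵖ (TensorCat Aᵒᵖ A)) V)
    (f g : EnrichedFunctor V A V) (c : A) {X : V}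
    (k : ∀ a b : A, f.obj a ⊗ (g.obj b ⊗ (ker₃ p a b).obj c) ⟶ X) : Prop where
  fst (a a' b : A) :
    (α_ _ _ _).hom ≫ f.obj a ◁ ((α_ _ _ _).hom ≫ g.obj b ◁ act (ker₁ p b c) (op a') (op a)) ≫
        k a b =
      swapRight (f.obj a) (g.obj b ⊗ (ker₁ p b c).obj (op a')) (a ⟶[V] a') ≫
        act f a a' ▷ _ ≫ k a' b
  snd (a b b' : A) :
    f.obj a ◁ ((α_ _ _ _).hom ≫ g.obj b ◁ act (ker₂ p a c) (op b') (op b)) ≫ k a b =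
      f.obj a ◁ (swapRight (g.obj b) ((ker₂ p a c).obj (op b')) (b ⟶[V] b') ≫
        act g b b' ▷ _) ≫ k a b'

/-- The component at `c` of an isomorphism of `V`-functors `f ≅ g`. -/
def compAt {f g : EnrichedFunctor V A V} (e : VIso V f g) (c : A) : f.obj c ⟶ g.obj c :=
  (ρ_ _).inv ≫ f.obj c ◁ e.elem ≫ evalAt f g c

/-- The upper convolution monoidal structure on `[A, V]`: its tensor product is
`T (f, g) = ∫^{a,b} f a ⊗ g b ⊗ p(a, b, -)`, given by universal coprojections `ι` that are `V`-natural
in all variables, its unit is `j`, and its associativity and unit constraints are the ones induced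
by those of `(A, p, j)`. -/
structure UpperConvolution (P : Promonoidal V A) where
  T : EnrichedFunctor V (TensorCat (EnrichedFunctor V A V) (EnrichedFunctor V A V))
    (EnrichedFunctor V A V)
  monoidal : MonoidalVCat T P.j
  ι (f g : EnrichedFunctor V A V) (a b c : A) :
    f.obj a ⊗ (g.obj b ⊗ (ker₃ P.p a b).obj c) ⟶ (T.obj ⟨f, g⟩).obj c
  ι_cowedge (f g : EnrichedFunctor V A V) (c : A) :
    IsCowedge P.p f g c (fun a b => ι f g a b c)
  ι_universal (f g : EnrichedFunctor V A V) (c : A) {X : V}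
    (k : ∀ a b : A, f.obj a ⊗ (g.obj b ⊗ (ker₃ P.p a b).obj c) ⟶ X)
    (hk : IsCowedge P.p f g c k) :
    ∃! m : (T.obj ⟨f, g⟩).obj c ⟶ X, ∀ a b, ι f g a b c ≫ m = k a b
  ι_natural (f g : EnrichedFunctor V A V) (a b c c' : A) :
    ι f g a b c ▷ _ ≫ act (T.obj ⟨f, g⟩) c c' =
      (α_ _ _ _).hom ≫ f.obj a ◁ ((α_ _ _ _).hom ≫ g.obj b ◁ act (ker₃ P.p a b) c c') ≫
        ι f g a b c'
  ι_natural_fst (f f' g : EnrichedFunctor V A V) (a b c : A) :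
    ι f g a b c ▷ _ ≫ _ ◁ (partL T g).map f f' ≫ evalAt (T.obj ⟨f, g⟩) (T.obj ⟨f', g⟩) c =
      swapRight _ _ _ ≫ evalAt f f' a ▷ _ ≫ ι f' g a b c
  ι_natural_snd (f g g' : EnrichedFunctor V A V) (a b c : A) :
    ι f g a b c ▷ _ ≫ _ ◁ (partR T f).map g g' ≫ evalAt (T.obj ⟨f, g⟩) (T.obj ⟨f, g'⟩) c =
      (α_ _ _ _).hom ≫ f.obj a ◁ (swapRight _ _ _ ≫ evalAt g g' b ▷ _) ≫ ι f g' a b c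
  ι_assoc (f g h : EnrichedFunctor V A V) (a b c d : A) :
    ∃ m : ((f.obj a ⊗ g.obj b) ⊗ h.obj c) ⊗ tensorOver (ker₃ P.p b c) (ker₂ P.p a d) ⟶
        (T.obj ⟨f, T.obj ⟨g, h⟩⟩).obj d,
      (∀ y : A, _ ◁ coι (ker₃ P.p b c) (ker₂ P.p a d) y ≫ m =
        (α_ _ _ _).hom ≫ (α_ _ _ _).hom ≫ f.obj a ◁ (g.obj b ◁ (α_ _ _ _).inv ≫
          (α_ _ _ _).inv ≫ ι g h b c y ▷ _) ≫ ι f (T.obj ⟨g, h⟩) a y d) ∧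
      ∀ x : A, _ ◁ (coι (ker₃ P.p a b) (ker₁ P.p c d) x ≫ (P.assoc a b c d).hom) ≫ m =
        tensorμ _ _ _ _ ≫ ((α_ _ _ _).hom ≫ ι f g a b x) ▷ _ ≫ ι (T.obj ⟨f, g⟩) h x c d ≫
          compAt (monoidal.assoc f g h) d
  ι_leftUnit (f : EnrichedFunctor V A V) (a b c : A) :
    ι P.j f a b c ≫ compAt (monoidal.leftUnit f) c =
      swapLeft _ _ _ ≫ f.obj b ◁ (coι P.j (ker₁ P.p b c) a ≫ (P.leftUnit b c).hom) ≫ act f b c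
  ι_rightUnit (f : EnrichedFunctor V A V) (a b c : A) :
    ι f P.j a b c ≫ compAt (monoidal.rightUnit f) c =
      f.obj a ◁ (coι P.j (ker₂ P.p a c) b ≫ (P.rightUnit a c).hom) ≫ act f a c
end
end Promonoidal

end Main

end StarAut

open StarAut

attribute [local instance] MonoidalClosed.enrichedCategorySelf

/-! Method. The equations to be proved are between morphisms out of iterated tensor products and
coends. They are checked on generalized elements: `Elem l X` consists of linear terms of type `X` in
the variables `l`, `⋆` applies a morphism to a term and `⊠` forms a pure tensor. Structural
isomorphisms permute and rebracket pure tensors (`braiding_app`, `associator_hom_app`). A morphism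
out of a tensor product is determined by pure tensors (`elem_ext₂` and its relatives). A morphism
out of a coend tensored with other objects is determined by the generators of the coend
(`co_ext_elem₁`, `IsDayCoend.elem_ext_right`), because tensoring is a left adjoint. Everything then
reads like algebra over a ring with several objects: a `V`-functor `A → V` is a module with action
`smul`, and a coend is a tensor product over `A`. One point needs care: an element of a tensor
product or of a coend need not be a generator. An identity known on generators is therefore first
turned into an equality of morphisms, and only then evaluated at an arbitrary element.

Convolution. The double coend exists as an iterated one (`exists_isDayCoend`) and is functorial in
all variables (`dayTensor`). Both triple convolutions are coends over `a`, `b`, `c` of `f a ⊗ g b ⊗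
h c` tensored with one of the two coends of kernels compared by the associativity of `p`, so that
associativity induces mutually inverse maps (`exists_assoc`). The unit constraints are the co-Yoneda
lemma combined with the unit isomorphisms of `p` (`exists_leftUnit`). The pentagon for `f`, `g`,
`h`, `k` is the pentagon of `p` tensored with `f a ⊗ g b ⊗ h c ⊗ k d` (`pentagon_el`), and the
triangle is similar (`triangle_el`).

Duality. Let `pr` be the evaluation pairing of `f (S a)` with `f* a`. Under it the action of `A` on
`f*` is the transpose of the action on `f` through `S` (`pr_smul`), and the effect of the dual on
natural transformations is transposition (`pr_evl`). A transformation `g → f*` is thus a pairing of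
`g` and `f`; the unit and counit of the adjunction of `S` exchange the two roles, giving `[A, V](g,
f*) ≅ [A, V](f, g*)` (`exists_transposeIso`). Since `f** a` is the double dual of `f (S (S a))`, the
isomorphism `S² ≅ 1` and the dualizing property give `f ≅ f**` (`exists_doubleStar`).

Cyclic symmetry. A transformation `h → (f * g)*` is a family of pairings on `f a ⊗ g b ⊗ h c ⊗ p(a,
b, S c)`, dinatural in `a`, `b`, `c`. Replacing `p(a, b, S c)` by `p(b, c, S a)` gives exactly a
transformation `f → (g * h)*` (`exists_flipIso`). Conjugating by the transpositions above yields
`[A, V](f * g, h*) ≅ [A, V](g * h, f*)`. Only the universal property of the tensor product and the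
naturality of its coprojections enter; `DayData` records these, so the argument applies to every
choice of the coends. -/

set_option linter.unusedSectionVars false

namespace StarAut

/-! ### Generalized elements

`Elem Γ X` is a set of elements of `X` depending linearly on some of the variables in the list `Γ`
(each used at most once). It is a lax symmetric monoidal functor of `X` to sets, and maps out of a
tensor product are determined by their effect on pure tensors of elements. -/
section Elements
variable {V : Type u} [Category.{v} V] [MonoidalCategory V] [SymmetricCategory V]
  [MonoidalClosed V]

/-- The strength `[Y, X] ⊗ X' ⟶ [Y, X ⊗ X']`. -/
def strL (Y X X' : V) : (ihom Y).obj X ⊗ X' ⟶ (ihom Y).obj (X ⊗ X') :=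
  MonoidalClosed.curry ((α_ _ _ _).inv ≫ (ihom.ev Y).app X ▷ X')

/-- The strength `X ⊗ [Y, X'] ⟶ [Y, X ⊗ X']`. -/
def strR (Y X X' : V) : X ⊗ (ihom Y).obj X' ⟶ (ihom Y).obj (X ⊗ X') :=
  MonoidalClosed.curry (swapLeft _ _ _ ≫ X ◁ (ihom.ev Y).app X')

theorem uncurry_strL (Y X X' : V) : MonoidalClosed.uncurry (strL Y X X') =
    (α_ _ _ _).inv ≫ (ihom.ev Y).app X ▷ X' := MonoidalClosed.uncurry_curry _

theorem uncurry_strR (Y X X' : V) : MonoidalClosed.uncurry (strR Y X X') =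
    swapLeft _ _ _ ≫ X ◁ (ihom.ev Y).app X' := MonoidalClosed.uncurry_curry _

theorem whiskerLeft_strL (Y X X' : V) : Y ◁ strL Y X X' ≫ (ihom.ev Y).app _ =
    (α_ _ _ _).inv ≫ (ihom.ev Y).app X ▷ X' := by
  rw [← MonoidalClosed.uncurry_eq, uncurry_strL]

theorem whiskerLeft_strR (Y X X' : V) : Y ◁ strR Y X X' ≫ (ihom.ev Y).app _ =
    swapLeft _ _ _ ≫ X ◁ (ihom.ev Y).app X' := by
  rw [← MonoidalClosed.uncurry_eq, uncurry_strR]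

theorem strL_natural {Y X X' Z Z' : V} (f : X ⟶ Z) (g : X' ⟶ Z') :
    ((ihom Y).map f ⊗ₘ g) ≫ strL Y Z Z' = strL Y X X' ≫ (ihom Y).map (f ⊗ₘ g) := by
  apply MonoidalClosed.uncurry_injective
  rw [MonoidalClosed.uncurry_natural_left, MonoidalClosed.uncurry_natural_right, uncurry_strL,
    uncurry_strL, MonoidalCategory.tensorHom_def, MonoidalCategory.tensorHom_def]
  simp only [MonoidalCategory.whiskerLeft_comp, Category.assoc]
  rw [associator_inv_naturality_right_assoc, whisker_exchange,
    associator_inv_naturality_middle_assoc, ← comp_whiskerRight_assoc, ihom.ev_naturality]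
  simp

theorem swapLeft_natural {X X' Y Y' Z Z' : V} (f : X ⟶ X') (g : Y ⟶ Y') (h : Z ⟶ Z') :
    (f ⊗ₘ (g ⊗ₘ h)) ≫ swapLeft X' Y' Z' = swapLeft X Y Z ≫ (g ⊗ₘ (f ⊗ₘ h)) := by
  simp only [swapLeft, Category.assoc, ← associator_naturality, associator_inv_naturality_assoc]
  simp only [← tensorHom_id, tensorHom_comp_tensorHom_assoc,
    BraidedCategory.braiding_naturality, Category.comp_id, Category.id_comp]

theorem strR_natural {Y X X' Z Z' : V} (f : X ⟶ Z) (g : X' ⟶ Z') :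
    (f ⊗ₘ (ihom Y).map g) ≫ strR Y Z Z' = strR Y X X' ≫ (ihom Y).map (f ⊗ₘ g) := by
  apply MonoidalClosed.uncurry_injective
  rw [MonoidalClosed.uncurry_natural_left, MonoidalClosed.uncurry_natural_right, uncurry_strR,
    uncurry_strR, ← id_tensorHom, ← Category.assoc, swapLeft_natural]
  simp only [← id_tensorHom, Category.assoc, tensorHom_comp_tensorHom, Category.comp_id,
    Category.id_comp]
  rw [id_tensorHom, ihom.ev_naturality]

theorem strL_braiding (Y X X' : V) : strL Y X X' ≫ (ihom Y).map (β_ X X').hom =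
    (β_ _ _).hom ≫ strR Y X' X := by
  apply MonoidalClosed.uncurry_injective
  rw [MonoidalClosed.uncurry_natural_right, MonoidalClosed.uncurry_natural_left, uncurry_strR,
    uncurry_strL]
  simp [swapLeft]

theorem strR_braiding (Y X X' : V) : strR Y X X' ≫ (ihom Y).map (β_ X X').hom =
    (β_ _ _).hom ≫ strL Y X' X := by
  rw [← cancel_mono ((ihom Y).map (β_ X' X).hom), Category.assoc, Category.assoc, strL_braiding,
    ← Functor.map_comp]
  simp

/-- In a threefold tensor the variable `Y` can occur in the first, the middle or the last factor.
This lemma and the two after it are these three cases of the associativity of `⊠`. -/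
theorem strL_assoc (Y X X' X'' : V) :
    strL Y X X' ▷ X'' ≫ strL Y _ X'' ≫ (ihom Y).map (α_ X X' X'').hom =
      (α_ _ _ _).hom ≫ strL Y X (X' ⊗ X'') := by
  apply MonoidalClosed.uncurry_injective
  rw [MonoidalClosed.uncurry_natural_left, MonoidalClosed.uncurry_natural_right, uncurry_strL,
    MonoidalClosed.uncurry_natural_left, uncurry_strL, Category.assoc,
    associator_inv_naturality_middle_assoc, ← comp_whiskerRight_assoc, whiskerLeft_strL]
  simp

theorem strLR_assoc (Y X X' X'' : V) :
    strR Y X X' ▷ X'' ≫ strL Y _ X'' ≫ (ihom Y).map (α_ X X' X'').hom =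
      (α_ _ _ _).hom ≫ X ◁ strL Y X' X'' ≫ strR Y X (X' ⊗ X'') := by
  apply MonoidalClosed.uncurry_injective
  rw [MonoidalClosed.uncurry_natural_left, MonoidalClosed.uncurry_natural_right, uncurry_strL,
    MonoidalClosed.uncurry_natural_left, MonoidalClosed.uncurry_natural_left, uncurry_strR,
    Category.assoc,
    associator_inv_naturality_middle_assoc, ← comp_whiskerRight_assoc, whiskerLeft_strR]
  have h := swapLeft_natural (𝟙 Y) (𝟙 X) (strL Y X' X'')
  simp only [id_tensorHom] at h
  rw [← Category.assoc (Y ◁ X ◁ _), h, Category.assoc (swapLeft _ _ _ : _ ⟶ _ ⊗ _) (X ◁ _),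
      ← MonoidalCategory.whiskerLeft_comp,
    whiskerLeft_strL]
  simp only [swapLeft]
  monoidal

theorem strR_assoc (Y X X' X'' : V) :
    strR Y (X ⊗ X') X'' ≫ (ihom Y).map (α_ X X' X'').hom =
      (α_ _ _ _).hom ≫ X ◁ strR Y X' X'' ≫ strR Y X (X' ⊗ X'') := by
  apply MonoidalClosed.uncurry_injective
  rw [MonoidalClosed.uncurry_natural_right, uncurry_strR,
    MonoidalClosed.uncurry_natural_left, MonoidalClosed.uncurry_natural_left, uncurry_strR]
  have h := swapLeft_natural (𝟙 Y) (𝟙 X) (strR Y X' X'')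
  simp only [id_tensorHom] at h
  rw [← Category.assoc (Y ◁ X ◁ _), h, Category.assoc (swapLeft _ _ _ : _ ⟶ _ ⊗ _) (X ◁ _),
      ← MonoidalCategory.whiskerLeft_comp,
    whiskerLeft_strR]
  simp only [swapLeft, BraidedCategory.braiding_tensor_right_hom]
  monoidal

theorem strR_unit (Y X : V) : strR Y (𝟙_ V) X ≫ (ihom Y).map (λ_ X).hom = (λ_ _).hom := by
  apply MonoidalClosed.uncurry_injective
  rw [MonoidalClosed.uncurry_natural_right, uncurry_strR, MonoidalClosed.uncurry_eq]
  simp [swapLeft]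

/-- Elements of `X` depending linearly on some of the variables in a list. -/
def LinElem : List V → V → Type v
  | [], X => 𝟙_ V ⟶ X
  | Y :: l, X => LinElem l X ⊕ LinElem l ((ihom Y).obj X)

/-- The effect of a morphism on linear elements. -/
def LinElem.map : {l : List V} → {X Y : V} → (X ⟶ Y) → LinElem l X → LinElem l Y
  | [], _, _, f, x => x ≫ f
  | Y :: _, _, _, f, x => Sum.map (LinElem.map f) (LinElem.map ((ihom Y).map f)) x

/-- The pure tensor of two linear elements; it is undefined if they have a variable in common. -/
def LinElem.pair : {l : List V} → {X Y : V} → LinElem l X → LinElem l Y → Option (LinElem l (X ⊗ Y))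
  | [], _, _, x, y => some ((λ_ _).inv ≫ (x ⊗ₘ y))
  | _ :: _, _, _, .inl a, .inl b => (LinElem.pair a b).map Sum.inl
  | Y :: _, _, _, .inl a, .inr b => ((LinElem.pair a b).map (LinElem.map (strR Y _ _))).map Sum.inr
  | Y :: _, _, _, .inr a, .inl b => ((LinElem.pair a b).map (LinElem.map (strL Y _ _))).map Sum.inr
  | _ :: _, _, _, .inr _, .inr _ => none

/-- An element of the monoidal unit without variables. -/
def LinElem.unit : (l : List V) → LinElem l (𝟙_ V)
  | [] => 𝟙 (𝟙_ V)
  | _ :: l => .inl (LinElem.unit l)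

/-- Linear elements, and an undefined element. -/
def Elem (l : List V) (X : V) : Type v := Option (LinElem l X)

namespace Elem
variable {l : List V} {X Y Z W : V}

/-- The effect of a morphism on elements. -/
def app (f : X ⟶ Y) (x : Elem l X) : Elem l Y := Option.map (LinElem.map f) x

infixr:80 " ⋆ " => Elem.app

/-- The pure tensor of two elements. -/
def pair (x : Elem l X) (y : Elem l Y) : Elem l (X ⊗ Y) :=
  Option.bind x fun a => Option.bind y fun b => LinElem.pair a b

infixr:85 " ⊠ " => Elem.pair

/-- The generic element of the monoidal unit. -/
def unit : Elem l (𝟙_ V) := some (LinElem.unit l)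

/-- The undefined element. -/
def bot : Elem l X := none

/-- An element not depending on any variable. -/
def base (x : 𝟙_ V ⟶ X) : Elem [] X := some x

/-- An element not depending on the first variable. -/
def con (x : Elem l X) : Elem (Y :: l) X := Option.map Sum.inl x

/-- An element depending on the first variable. -/
def lin (x : Elem l ((ihom Y).obj X)) : Elem (Y :: l) X := Option.map Sum.inr x

theorem nil_cases {p : Elem ([] : List V) X → Prop} (hn : p bot) (hb : ∀ x, p (base x)) :
    ∀ x, p x
  | none => hn
  | some x => hb x

theorem cons_cases {p : Elem (Y :: l) X → Prop} (hc : ∀ x, p (con x)) (hl : ∀ x, p (lin x)) :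
    ∀ x, p x
  -- The undefined element is `con` of the undefined element, so it needs no case of its own.
  | none => hc none
  | some (.inl a) => hc (some a)
  | some (.inr a) => hl (some a)

theorem base_injective : Function.Injective (base : (𝟙_ V ⟶ X) → Elem [] X) :=
  Option.some_injective _

theorem lin_injective : Function.Injective (lin : Elem l ((ihom Y).obj X) → Elem (Y :: l) X) :=
  Option.map_injective Sum.inr_injective

theorem app_base (f : X ⟶ Y) (x : 𝟙_ V ⟶ X) : f ⋆ base x = base (x ≫ f) := rfl

theorem app_con (f : X ⟶ Z) (x : Elem l X) : f ⋆ (con x : Elem (Y :: l) X) = con (f ⋆ x) := by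
  cases x <;> rfl

theorem app_lin (f : X ⟶ Z) (x : Elem l ((ihom Y).obj X)) :
    f ⋆ lin x = lin ((ihom Y).map f ⋆ x) := by
  cases x <;> rfl

theorem base_pair_base (x : 𝟙_ V ⟶ X) (y : 𝟙_ V ⟶ Y) :
    base x ⊠ base y = base ((λ_ _).inv ≫ (x ⊗ₘ y)) := rfl

theorem con_pair_con (x : Elem l X) (y : Elem l Z) :
    (con x : Elem (Y :: l) X) ⊠ (con y : Elem (Y :: l) Z) = con (x ⊠ y) := by
  cases x <;> cases y <;> rfl

theorem con_pair_lin (x : Elem l X) (y : Elem l ((ihom Y).obj Z)) :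
    (con x : Elem (Y :: l) X) ⊠ lin y = lin (strR _ _ _ ⋆ x ⊠ y) := by
  cases x <;> cases y <;> rfl

theorem lin_pair_con (x : Elem l ((ihom Y).obj X)) (y : Elem l Z) :
    lin x ⊠ (con y : Elem (Y :: l) Z) = lin (strL _ _ _ ⋆ x ⊠ y) := by
  cases x <;> cases y <;> rfl

/-- A variable used twice makes a pair undefined. Hence the rules of the calculus need no
disjointness hypotheses: when variables clash, both sides are `bot`. -/
theorem lin_pair_lin (x : Elem l ((ihom Y).obj X)) (y : Elem l ((ihom Y).obj Z)) :
    lin x ⊠ lin y = bot := by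
  cases x <;> cases y <;> rfl

theorem app_bot (f : X ⟶ Y) : f ⋆ (bot : Elem l X) = bot := rfl

theorem bot_pair (y : Elem l Y) : (bot : Elem l X) ⊠ y = bot := rfl

theorem pair_bot (x : Elem l X) : x ⊠ (bot : Elem l Y) = bot := by
  cases x <;> rfl

theorem unit_nil : (unit : Elem ([] : List V) (𝟙_ V)) = base (𝟙 _) := rfl

theorem unit_cons : (unit : Elem (X :: l) (𝟙_ V)) = con unit := rfl

@[simp]
theorem comp_app (f : X ⟶ Y) (g : Y ⟶ Z) (x : Elem l X) : (f ≫ g) ⋆ x = g ⋆ f ⋆ x := by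
  induction l generalizing X Y Z with
  | nil => induction x using nil_cases <;> simp only [app_bot, app_base, Category.assoc]
  | cons Y l ih => induction x using cons_cases <;> simp only [app_con, app_lin, ih,
      Functor.map_comp]

@[simp]
theorem id_app (x : Elem l X) : 𝟙 X ⋆ x = x := by
  induction l generalizing X with
  | nil => induction x using nil_cases <;> simp only [app_bot, app_base, Category.comp_id]
  | cons Y l ih =>
    induction x using cons_cases <;> simp only [app_con, app_lin, ih]
    rw [CategoryTheory.Functor.map_id, ih]

-- By induction on the context. If the head variable occurs in one factor only, the claim is
-- naturality of a strength; if it occurs in both, both sides are undefined.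
@[simp]
theorem tensorHom_app (f : X ⟶ Z) (g : Y ⟶ W) (x : Elem l X) (y : Elem l Y) :
    (f ⊗ₘ g) ⋆ x ⊠ y = (f ⋆ x) ⊠ (g ⋆ y) := by
  induction l generalizing X Y Z W with
  | nil =>
    induction x using nil_cases <;> induction y using nil_cases <;>
      simp only [app_bot, bot_pair, pair_bot, base_pair_base, app_base, Category.assoc,
        tensorHom_comp_tensorHom]
  | cons T l ih =>
    induction x using cons_cases <;> induction y using cons_cases <;>
      simp only [con_pair_con, con_pair_lin, lin_pair_con, lin_pair_lin, app_con, app_lin, ih,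
        app_bot, ← comp_app, ← strL_natural, ← strR_natural] <;> rw [comp_app, ih]

@[simp]
theorem whiskerRight_app (f : X ⟶ Z) (x : Elem l X) (y : Elem l Y) :
    (f ▷ Y) ⋆ x ⊠ y = (f ⋆ x) ⊠ y := by
  rw [← tensorHom_id, tensorHom_app, id_app]

@[simp]
theorem whiskerLeft_app (g : Y ⟶ Z) (x : Elem l X) (y : Elem l Y) :
    (X ◁ g) ⋆ x ⊠ y = x ⊠ (g ⋆ y) := by
  rw [← id_tensorHom, tensorHom_app, id_app]

@[simp]
theorem braiding_app (x : Elem l X) (y : Elem l Y) : (β_ X Y).hom ⋆ x ⊠ y = y ⊠ x := by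
  induction l generalizing X Y with
  | nil =>
    induction x using nil_cases <;> induction y using nil_cases <;>
      simp only [app_bot, bot_pair, pair_bot, base_pair_base, app_base, Category.assoc,
        BraidedCategory.braiding_naturality]
    simp [unitors_inv_equal]
  | cons T l ih =>
    induction x using cons_cases <;> induction y using cons_cases <;>
      simp only [con_pair_con, con_pair_lin, lin_pair_con, lin_pair_lin, app_con, app_lin, ih,
        app_bot]
    · rw [← comp_app, strR_braiding, comp_app, ih]
    · rw [← comp_app, strL_braiding, comp_app, ih]

-- Of the eight cases for the head variable, one is the induction hypothesis, three are the
-- associativity laws of the strengths, and in the remaining four the variable is repeated and both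
-- sides are undefined.
@[simp]
theorem associator_hom_app (x : Elem l X) (y : Elem l Y) (z : Elem l Z) :
    (α_ X Y Z).hom ⋆ (x ⊠ y) ⊠ z = x ⊠ y ⊠ z := by
  induction l generalizing X Y Z with
  | nil =>
    induction x using nil_cases <;> induction y using nil_cases <;> induction z using nil_cases <;>
      simp only [app_bot, bot_pair, pair_bot, base_pair_base, app_base]
    rw [← whiskerRight_comp_tensorHom, ← whiskerLeft_comp_tensorHom, Category.assoc,
      Category.assoc, associator_naturality]
    congr 1
    monoidal
  | cons T l ih =>
    induction x using cons_cases <;> induction y using cons_cases <;>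
      induction z using cons_cases <;>
      simp only [con_pair_con, con_pair_lin, lin_pair_con, lin_pair_lin, app_con, app_lin, ih,
        app_bot, bot_pair, pair_bot, ← whiskerRight_app, ← whiskerLeft_app] <;>
      simp only [← comp_app, Category.assoc, strL_assoc, strR_assoc, strLR_assoc] <;>
      simp only [comp_app, ih, whiskerLeft_app]

@[simp]
theorem associator_inv_app (x : Elem l X) (y : Elem l Y) (z : Elem l Z) :
    (α_ X Y Z).inv ⋆ x ⊠ y ⊠ z = (x ⊠ y) ⊠ z := by
  rw [← associator_hom_app, ← comp_app, Iso.hom_inv_id, id_app]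

@[simp]
theorem leftUnitor_hom_app (x : Elem l X) : (λ_ X).hom ⋆ unit ⊠ x = x := by
  induction l generalizing X with
  | nil =>
    induction x using nil_cases <;>
      simp only [unit_nil, app_bot, pair_bot, base_pair_base, app_base]
    simp
  | cons T l ih =>
    induction x using cons_cases <;>
      simp only [unit_cons, con_pair_con, con_pair_lin, app_con, app_lin, ih]
    rw [← comp_app, strR_unit, ih]

@[simp]
theorem leftUnitor_inv_app (x : Elem l X) : (λ_ X).inv ⋆ x = unit ⊠ x := by
  conv_lhs => rw [← leftUnitor_hom_app x]
  rw [← comp_app, Iso.hom_inv_id, id_app]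

@[simp]
theorem rightUnitor_hom_app (x : Elem l X) : (ρ_ X).hom ⋆ x ⊠ unit = x := by
  rw [← braiding_leftUnitor, comp_app, braiding_app, leftUnitor_hom_app]

@[simp]
theorem rightUnitor_inv_app (x : Elem l X) : (ρ_ X).inv ⋆ x = x ⊠ unit := by
  conv_lhs => rw [← rightUnitor_hom_app x]
  rw [← comp_app, Iso.hom_inv_id, id_app]

@[simp]
theorem tensorμ_app (x : Elem l X) (y : Elem l Y) (z : Elem l Z) (w : Elem l W) :
    tensorμ X Y Z W ⋆ (x ⊠ y) ⊠ (z ⊠ w) = (x ⊠ z) ⊠ (y ⊠ w) := by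
  simp [tensorμ]

@[simp]
theorem swapRight_app (x : Elem l X) (y : Elem l Y) (z : Elem l Z) :
    swapRight X Y Z ⋆ (x ⊠ y) ⊠ z = (x ⊠ z) ⊠ y := by
  simp [swapRight]

@[simp]
theorem hom_inv_app (e : X ≅ Y) (x : Elem l X) : e.inv ⋆ e.hom ⋆ x = x := by
  rw [← comp_app, Iso.hom_inv_id, id_app]

@[simp]
theorem inv_hom_app (e : X ≅ Y) (x : Elem l Y) : e.hom ⋆ e.inv ⋆ x = x := by
  rw [← comp_app, Iso.inv_hom_id, id_app]

theorem app_congr {f g : X ⟶ Y} (h : f = g) (x : Elem l X) : f ⋆ x = g ⋆ x := by rw [h]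

/-- The generic element. -/
def var : Elem (X :: l) X :=
  lin (MonoidalClosed.curry (ρ_ X).hom ⋆ unit)

/-- The generic element is a transposed unitor, and strengthening it against `y` produces the unit
of the tensor-hom adjunction. Applying `f` to the pair therefore transposes `f`, which is why linear
elements separate morphisms out of tensor products. -/
theorem var_pair_con (y : Elem l Y) :
    (var : Elem (X :: l) X) ⊠ (con y : Elem (X :: l) Y) = lin ((ihom.coev X).app Y ⋆ y) := by
  have h : (λ_ Y).inv ≫ MonoidalClosed.curry (ρ_ X).hom ▷ Y ≫ strL X X Y = (ihom.coev X).app Y := by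
    apply MonoidalClosed.uncurry_injective
    rw [← MonoidalClosed.curry_id_eq_coev, MonoidalClosed.uncurry_curry,
      MonoidalClosed.uncurry_natural_left, MonoidalClosed.uncurry_natural_left, uncurry_strL,
      associator_inv_naturality_middle_assoc, ← comp_whiskerRight, ← MonoidalClosed.uncurry_eq,
      MonoidalClosed.uncurry_curry]
    simp
  rw [var, lin_pair_con, ← h, comp_app, comp_app, leftUnitor_inv_app (X := Y),
    whiskerRight_app]

theorem app_var_pair_con (f : X ⊗ Y ⟶ Z) (y : Elem l Y) :
    f ⋆ (var : Elem (X :: l) X) ⊠ (con y : Elem (X :: l) Y) = lin (MonoidalClosed.curry f ⋆ y) := by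
  rw [var_pair_con, app_lin, ← comp_app, MonoidalClosed.curry_eq]

theorem eq_of_unit {f g : 𝟙_ V ⟶ X}
    (h : f ⋆ (unit : Elem [] (𝟙_ V)) = g ⋆ (unit : Elem [] (𝟙_ V))) : f = g := by
  rw [unit_nil, app_base, app_base] at h
  have h2 := base_injective h
  simpa using h2

end Elem
open Elem

theorem elem_ext₀ {X : V} {f g : 𝟙_ V ⟶ X} (h : ∀ l, f ⋆ (unit : Elem l _) = g ⋆ unit) : f = g :=
  eq_of_unit (h _)

/-- It is enough to test on the generic element of `X`, tensored with the unit and passed through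
the unitor. -/
theorem elem_ext₁ {X Y : V} {f g : X ⟶ Y} (h : ∀ l (x : Elem l X), f ⋆ x = g ⋆ x) : f = g := by
  rw [← cancel_epi (ρ_ X).hom]
  apply MonoidalClosed.curry_injective
  apply elem_ext₀
  intro l
  apply lin_injective
  rw [← app_var_pair_con, ← app_var_pair_con, comp_app, comp_app, h]

/-- The basic step in the proof that maps out of tensor products are determined by their effect on
pure tensors. -/
theorem curry_app_eq {X Y Z : V} {f g : X ⊗ Y ⟶ Z} {l : List V} {y : Elem l Y}
    (h : f ⋆ (var : Elem (X :: l) X) ⊠ con y = g ⋆ (var : Elem (X :: l) X) ⊠ con y) :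
    MonoidalClosed.curry f ⋆ y = MonoidalClosed.curry g ⋆ y := by
  apply lin_injective
  rw [← app_var_pair_con, ← app_var_pair_con, h]

/-! ### Morphisms out of iterated tensor products are determined on pure tensors. -/

section Ext
variable {A B C D E F G H Z : V}

/-- Induction on the number of factors: the first factor is curried away and fed a fresh generic
variable, while the other elements are weakened by `con`. -/
theorem elem_ext₂ {f g : A ⊗ B ⟶ Z}
    (h : ∀ l (a : Elem l A) (b : Elem l B), f ⋆ a ⊠ b = g ⋆ a ⊠ b) : f = g :=
  MonoidalClosed.curry_injective (elem_ext₁ fun _ _ => curry_app_eq (h _ _ _))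

theorem elem_ext₃ {f g : A ⊗ B ⊗ C ⟶ Z}
    (h : ∀ l (a : Elem l A) (b : Elem l B) (c : Elem l C), f ⋆ a ⊠ b ⊠ c = g ⋆ a ⊠ b ⊠ c) :
    f = g :=
  MonoidalClosed.curry_injective (elem_ext₂ fun _ b c => curry_app_eq (by
    simpa only [con_pair_con] using h _ var (con b) (con c)))

theorem elem_ext₄ {f g : A ⊗ B ⊗ C ⊗ D ⟶ Z}
    (h : ∀ l (a : Elem l A) (b : Elem l B) (c : Elem l C) (d : Elem l D),
      f ⋆ a ⊠ b ⊠ c ⊠ d = g ⋆ a ⊠ b ⊠ c ⊠ d) : f = g :=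
  MonoidalClosed.curry_injective (elem_ext₃ fun _ b c d => curry_app_eq (by
    simpa only [con_pair_con] using h _ var (con b) (con c) (con d)))

theorem elem_ext₅ {f g : A ⊗ B ⊗ C ⊗ D ⊗ E ⟶ Z}
    (h : ∀ l (a : Elem l A) (b : Elem l B) (c : Elem l C) (d : Elem l D) (e : Elem l E),
      f ⋆ a ⊠ b ⊠ c ⊠ d ⊠ e = g ⋆ a ⊠ b ⊠ c ⊠ d ⊠ e) : f = g :=
  MonoidalClosed.curry_injective (elem_ext₄ fun _ b c d e => curry_app_eq (by
    simpa only [con_pair_con] using h _ var (con b) (con c) (con d) (con e)))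

theorem elem_ext₆ {f g : A ⊗ B ⊗ C ⊗ D ⊗ E ⊗ F ⟶ Z}
    (h : ∀ l (a : Elem l A) (b : Elem l B) (c : Elem l C) (d : Elem l D) (e : Elem l E)
      (x : Elem l F), f ⋆ a ⊠ b ⊠ c ⊠ d ⊠ e ⊠ x = g ⋆ a ⊠ b ⊠ c ⊠ d ⊠ e ⊠ x) : f = g :=
  MonoidalClosed.curry_injective (elem_ext₅ fun _ b c d e x => curry_app_eq (by
    simpa only [con_pair_con] using h _ var (con b) (con c) (con d) (con e) (con x)))

theorem elem_ext₇ {f g : A ⊗ B ⊗ C ⊗ D ⊗ E ⊗ F ⊗ G ⟶ Z}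
    (h : ∀ l (a : Elem l A) (b : Elem l B) (c : Elem l C) (d : Elem l D) (e : Elem l E)
      (x : Elem l F) (y : Elem l G),
      f ⋆ a ⊠ b ⊠ c ⊠ d ⊠ e ⊠ x ⊠ y = g ⋆ a ⊠ b ⊠ c ⊠ d ⊠ e ⊠ x ⊠ y) : f = g :=
  MonoidalClosed.curry_injective (elem_ext₆ fun _ b c d e x y => curry_app_eq (by
    simpa only [con_pair_con] using h _ var (con b) (con c) (con d) (con e) (con x) (con y)))

end Ext
end Elements
end StarAut

namespace StarAut

/-! ### Elements of hom-objects and of values of `V`-functors -/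
section EnrichedElements
variable {V : Type u} [Category.{v} V] [MonoidalCategory V] [SymmetricCategory V]
  [MonoidalClosed V]
universe u₁ u₂ u₃
variable {C : Type u₁} {D : Type u₂} [EnrichedCategory V C] [EnrichedCategory V D] {l : List V}

namespace Elem

/-- Composition of elements of hom-objects. -/
def cmp {a b c : C} (s : Elem l (a ⟶[V] b)) (t : Elem l (b ⟶[V] c)) : Elem l (a ⟶[V] c) :=
  eComp V a b c ⋆ s ⊠ t

/-- The identity as an element of a hom-object. -/
def idn (a : C) : Elem l (a ⟶[V] a) := eId V a ⋆ unit

@[simp]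
theorem eComp_app {a b c : C} (s : Elem l (a ⟶[V] b)) (t : Elem l (b ⟶[V] c)) :
    eComp V a b c ⋆ s ⊠ t = cmp s t := rfl

@[simp]
theorem eId_app (a : C) : eId V a ⋆ (unit : Elem l _) = idn a := rfl

@[simp]
theorem idn_cmp {a b : C} (s : Elem l (a ⟶[V] b)) : cmp (idn a) s = s := by
  have h := app_congr (e_id_comp_hom V a b) (unit ⊠ s)
  simpa using h

@[simp]
theorem cmp_idn {a b : C} (s : Elem l (a ⟶[V] b)) : cmp s (idn b) = s := by
  have h := app_congr (e_comp_id_hom V a b) (s ⊠ unit)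
  simpa using h

theorem cmp_cmp {a b c d : C} (s : Elem l (a ⟶[V] b)) (t : Elem l (b ⟶[V] c))
    (w : Elem l (c ⟶[V] d)) : cmp (cmp s t) w = cmp s (cmp t w) := by
  have h := app_congr (e_assoc V a b c d) (s ⊠ t ⊠ w)
  simpa only [comp_app, associator_inv_app, whiskerRight_app, whiskerLeft_app, eComp_app] using h

/-- The effect of a `V`-functor on elements of hom-objects. -/
def fmap (F : EnrichedFunctor V C D) {a b : C} (s : Elem l (a ⟶[V] b)) :
    Elem l (F.obj a ⟶[V] F.obj b) := F.map a b ⋆ s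

/-- The action of an element of a hom-object on elements of the values of a `V`-functor. -/
def smul (F : EnrichedFunctor V C V) {a b : C} (x : Elem l (F.obj a)) (s : Elem l (a ⟶[V] b)) :
    Elem l (F.obj b) := act F a b ⋆ x ⊠ s

@[simp]
theorem act_app (F : EnrichedFunctor V C V) {a b : C} (x : Elem l (F.obj a))
    (s : Elem l (a ⟶[V] b)) : act F a b ⋆ x ⊠ s = smul F x s := rfl

@[simp]
theorem smul_idn (F : EnrichedFunctor V C V) {a : C} (x : Elem l (F.obj a)) :
    smul F x (idn a) = x := by
  have h := app_congr (act_id F a) (x ⊠ unit)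
  simpa using h

theorem smul_smul (F : EnrichedFunctor V C V) {a b c : C} (x : Elem l (F.obj a))
    (s : Elem l (a ⟶[V] b)) (t : Elem l (b ⟶[V] c)) :
    smul F (smul F x s) t = smul F x (cmp s t) := by
  have h := app_congr (act_comp F a b c) (x ⊠ s ⊠ t)
  simpa using h.symm

/-- The action of an element of a hom-object on elements of the values of a contravariant
`V`-functor. -/
def opsmul (N : EnrichedFunctor V Cᵒᵖ V) {a b : C} (x : Elem l (N.obj (op b)))
    (s : Elem l (a ⟶[V] b)) : Elem l (N.obj (op a)) :=
  act N (op b) (op a) ⋆ Elem.pair (Y := (op b : Cᵒᵖ) ⟶[V] op a) x s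

/-- Composition in the opposite `V`-category is braided composition, and the braiding only swaps the
two entries of a pure tensor. -/
theorem cmp_op {a b c : C} (s : Elem l (a ⟶[V] b)) (t : Elem l (b ⟶[V] c)) :
    cmp (C := Cᵒᵖ) (a := op c) (b := op b) (c := op a) t s = cmp s t := by
  unfold cmp
  rw [eComp_op_eq, comp_app]
  exact congrArg _ (braiding_app _ _)

/-- `V`-naturality on elements. -/
theorem isNatural_iff {F G : EnrichedFunctor V C V} {t : ∀ c, F.obj c ⟶ G.obj c} :
    IsNatural F G t ↔ ∀ (l : List V) (a b : C) (x : Elem l (F.obj a)) (s : Elem l (a ⟶[V] b)),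
      t b ⋆ smul F x s = smul G (t a ⋆ x) s := by
  constructor
  · intro h l a b x s
    simpa [act_app] using app_congr (h a b) (x ⊠ s)
  · intro h a b
    apply elem_ext₂
    intro l x s
    simpa [act_app] using h l a b x s

/-- The hom-objects of `Cᵒᵖ` are by definition those of `C` with the ends exchanged; this form keeps
all arrows in `C`. -/
theorem isNatural_op_iff {F G : EnrichedFunctor V Cᵒᵖ V} {t : ∀ c, F.obj c ⟶ G.obj c} :
    IsNatural F G t ↔ ∀ (l : List V) (a b : C) (x : Elem l (F.obj (op b))) (s : Elem l (a ⟶[V] b)),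
      t (op a) ⋆ opsmul F x s = opsmul G (t (op b) ⋆ x) s :=
  isNatural_iff.trans ⟨fun h l a b x s => h l (op b) (op a) x s,
    fun h l a b x s => h l b.unop a.unop x s⟩

theorem isNatural_inv {F G : EnrichedFunctor V C V} {t : ∀ c, F.obj c ≅ G.obj c}
    (h : IsNatural F G fun c => (t c).hom) : IsNatural G F fun c => (t c).inv := by
  intro c c'
  rw [← cancel_mono (t c').hom, Category.assoc, Category.assoc, h c c', Iso.inv_hom_id,
    Category.comp_id, ← comp_whiskerRight_assoc, Iso.inv_hom_id, id_whiskerRight, Category.id_comp]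

/-- The value of an element of an internal hom. -/
def ap {X Y : V} (x : Elem l X) (t : Elem l ((ihom X).obj Y)) : Elem l Y :=
  (ihom.ev X).app Y ⋆ x ⊠ t

@[simp]
theorem ev_app {X Y : V} (x : Elem l X) (t : Elem l ((ihom X).obj Y)) :
    (ihom.ev X).app Y ⋆ x ⊠ t = ap x t := rfl

theorem uncurry_app {X Y Z : V} (f : Y ⟶ (ihom X).obj Z) (x : Elem l X) (y : Elem l Y) :
    MonoidalClosed.uncurry f ⋆ x ⊠ y = ap x (f ⋆ y) := by
  rw [MonoidalClosed.uncurry_eq, comp_app, whiskerLeft_app]; rfl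

theorem ap_curry {X Y Z : V} (f : X ⊗ Y ⟶ Z) (x : Elem l X) (y : Elem l Y) :
    ap x (MonoidalClosed.curry f ⋆ y) = f ⋆ x ⊠ y := by
  rw [← uncurry_app, MonoidalClosed.uncurry_curry]

theorem smul_eq_ap (F : EnrichedFunctor V C V) {a b : C} (x : Elem l (F.obj a))
    (s : Elem l (a ⟶[V] b)) : smul F x s = ap x (fmap F s) := by
  rw [smul, act, uncurry_app]; rfl

/-- This is `uncurry_comp` for two identity morphisms: composing in the self-enrichment means
evaluating twice. -/
theorem ap_cmp {X Y Z : V} (x : Elem l X) (s : Elem l (EnrichedCategory.Hom (V := V) X Y))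
    (t : Elem l (EnrichedCategory.Hom (V := V) Y Z)) :
    ap x (cmp s t) = ap (ap x s) t := by
  have h := app_congr (uncurry_comp (𝟙 ((ihom X).obj Y)) (𝟙 ((ihom Y).obj Z))) (x ⊠ s ⊠ t)
  simp only [uncurry_app, comp_app, tensorHom_app, id_app, associator_inv_app,
    whiskerRight_app] at h
  exact h

/-- Extensionality for morphisms into an internal hom. -/
theorem ihom_ext {X Y Z : V} {f g : Y ⟶ (ihom X).obj Z}
    (h : MonoidalClosed.uncurry f = MonoidalClosed.uncurry g) : f = g :=
  MonoidalClosed.uncurry_injective h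

end Elem
open Elem

/-! ### Objects of `V`-natural transformations on elements. -/

section FunctorCategories
variable [HasLimits V] [HasColimits V]
variable {C : Type v} [EnrichedCategory V C] {F G H : EnrichedFunctor V C V} {K : V}

namespace Elem
/-- The component of an element of an object of `V`-natural transformations, on elements. -/
noncomputable def evl {c : C} (x : Elem l (F.obj c)) (t : Elem l (F ⟶[V] G)) : Elem l (G.obj c) :=
  evalAt F G c ⋆ x ⊠ t

@[simp]
theorem evalAt_app {c : C} (x : Elem l (F.obj c)) (t : Elem l (F ⟶[V] G)) :
    evalAt F G c ⋆ x ⊠ t = evl x t := rfl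

/-- Elements of the end are module homomorphisms: this is its defining wedge condition. -/
theorem evl_smul {c c' : C} (x : Elem l (F.obj c)) (s : Elem l (c ⟶[V] c'))
    (t : Elem l (F ⟶[V] G)) : evl (smul F x s) t = smul G (evl x t) s := by
  have h := app_congr (evalAt_act F G c c') ((x ⊠ s) ⊠ t)
  simpa using h

@[simp]
theorem evl_idn {c : C} (x : Elem l (F.obj c)) : evl x (idn F) = x := by
  have h := app_congr (evalAt_id F c) (x ⊠ unit)
  simpa using h

theorem evl_cmp {c : C} (x : Elem l (F.obj c)) (s : Elem l (F ⟶[V] G)) (t : Elem l (G ⟶[V] H)) :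
    evl x (cmp s t) = evl (evl x s) t := by
  have h := app_congr (evalAt_comp F G H c) (x ⊠ s ⊠ t)
  simpa using h

theorem evl_eq_ap {c : C} (x : Elem l (F.obj c)) (t : Elem l (F ⟶[V] G)) :
    evl x t = ap x (natπ F G c ⋆ t) := by
  rw [evl, evalAt, uncurry_app]
end Elem

/-- A morphism to the object of `V`-natural transformations from its components. -/
noncomputable def natOf (k : ∀ c, F.obj c ⊗ K ⟶ G.obj c)
    (hk : ∀ (l : List V) (c c' : C) (x : Elem l (F.obj c)) (s : Elem l (c ⟶[V] c')) (t : Elem l K),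
      k c' ⋆ smul F x s ⊠ t = smul G (k c ⋆ x ⊠ t) s) : K ⟶ (F ⟶[V] G) :=
  natLift (fun c => MonoidalClosed.curry (k c)) (by
    intro c c'
    apply ihom_ext
    apply elem_ext₃
    intro l x s t
    rw [uncurry_app, uncurry_app]
    simp only [comp_app, tensorHom_app, braiding_app, eComp_app]
    refine (ap_cmp _ _ _).trans (Eq.trans ?_ (ap_cmp _ _ _).symm)
    have h := hk l c c' x s t
    simp only [smul_eq_ap, fmap] at h
    exact (ap_curry _ _ _).trans (h.trans (congrArg (fun z => ap z _) (ap_curry _ _ _).symm)))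

theorem evl_natOf (k : ∀ c, F.obj c ⊗ K ⟶ G.obj c) (hk) {c : C} (x : Elem l (F.obj c))
    (t : Elem l K) : evl x (natOf k hk ⋆ t) = k c ⋆ x ⊠ t := by
  rw [evl_eq_ap, ← comp_app]
  exact (congrArg (ap x) (app_congr (natLift_π _ _ c) t)).trans (ap_curry _ _ _)

theorem natObj_hom_ext {s t : K ⟶ (F ⟶[V] G)}
    (h : ∀ c, F.obj c ◁ s ≫ evalAt F G c = F.obj c ◁ t ≫ evalAt F G c) : s = t := by
  refine natObj_ext (F := F) (G := G) fun c => ?_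
  apply MonoidalClosed.uncurry_injective
  have := h c
  rw [evalAt, ← MonoidalClosed.uncurry_natural_left, ← MonoidalClosed.uncurry_natural_left] at this
  exact this

theorem natObj_elem_ext₁ {s t : K ⟶ (F ⟶[V] G)}
    (h : ∀ (l : List V) (c : C) (x : Elem l (F.obj c)) (k : Elem l K),
      evl x (s ⋆ k) = evl x (t ⋆ k)) : s = t := by
  apply natObj_hom_ext
  intro c
  apply elem_ext₂
  intro l x k
  simpa [evalAt_app] using h l c x k

end FunctorCategories

end EnrichedElements
end StarAut

namespace StarAut
open Elem

/-! ### Elements of functor categories and of coends -/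
section FunctorElements
variable {V : Type u} [Category.{v} V] [MonoidalCategory V] [SymmetricCategory V]
  [MonoidalClosed V]
universe u₁ u₂ u₃
variable {l : List V}

namespace Elem
section
variable {B : Type u₁} {C : Type u₂} {D : Type u₃} [EnrichedCategory V B] [EnrichedCategory V C]
  [EnrichedCategory V D]

theorem fmap_comp (F : EnrichedFunctor V B C) (G : EnrichedFunctor V C D) {a b : B}
    (s : Elem l (a ⟶[V] b)) : fmap (F.comp V G) s = fmap G (fmap F s) :=
  comp_app (F.map a b) (G.map _ _) s

theorem smul_comp (F : EnrichedFunctor V B C) (G : EnrichedFunctor V C V) {a b : B}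
    (x : Elem l (G.obj (F.obj a))) (s : Elem l (a ⟶[V] b)) :
    smul (F.comp V G) x s = smul G x (fmap F s) := by
  exact (smul_eq_ap (F.comp V G) x s).trans ((congrArg (ap x) (fmap_comp F G s)).trans
    (smul_eq_ap G x (fmap F s)).symm)

theorem tensorHom_eComp_app {P Q : V} {a b c : C} (f : P ⟶ (a ⟶[V] b)) (g : Q ⟶ (b ⟶[V] c))
    (s : Elem l P) (t : Elem l Q) :
    ((f ⊗ₘ g) ≫ eComp V a b c) ⋆ s ⊠ t = cmp (f ⋆ s) (g ⋆ t) := by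
  rw [comp_app, tensorHom_app, eComp_app]

theorem braiding_tensorHom_eComp_app {P Q : V} {a b c : C} (f : P ⟶ (a ⟶[V] b))
    (g : Q ⟶ (b ⟶[V] c)) (s : Elem l P) (t : Elem l Q) :
    ((β_ Q P).hom ≫ (f ⊗ₘ g) ≫ eComp V a b c) ⋆ t ⊠ s = cmp (f ⋆ s) (g ⋆ t) := by
  rw [comp_app, braiding_app, tensorHom_eComp_app]

/-- The two partial actions of a functor of two variables commute. -/
theorem smul_partial_comm (F : EnrichedFunctor V (TensorCat B C) V) {b b' : B} {c c' : C}
    (x : Elem l (F.obj ⟨b, c⟩)) (s : Elem l (b ⟶[V] b')) (t : Elem l (c ⟶[V] c')) :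
    smul ((inclRight V b' C).comp V F) (smul ((inclLeft V B c).comp V F) x s) t =
      smul ((inclLeft V B c').comp V F) (smul ((inclRight V b C).comp V F) x t) s := by
  have h := ((tensorHom_eComp_app _ _ s t).symm.trans
    (app_congr (partial_comm F b b' c c') (s ⊠ t))).trans (braiding_tensorHom_eComp_app _ _ _ _)
  have h₁ := congrArg (fun z => ap z (fmap ((inclRight V b' C).comp V F) t))
    (smul_eq_ap ((inclLeft V B c).comp V F) x s)
  have h₂ := congrArg (fun z => ap z (fmap ((inclLeft V B c').comp V F) s))
    (smul_eq_ap ((inclRight V b C).comp V F) x t)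
  exact ((smul_eq_ap ((inclRight V b' C).comp V F) _ t).trans (h₁.trans
    ((ap_cmp _ _ _).symm.trans ((congrArg (ap x) h).trans (ap_cmp _ _ _))))).trans
    ((smul_eq_ap ((inclLeft V B c').comp V F) _ s).trans h₂).symm

theorem smul_coyo {a b c : C} (x : Elem l (a ⟶[V] b)) (s : Elem l (b ⟶[V] c)) :
    smul (coyo a) x s = cmp x s :=
  app_congr (MonoidalClosed.uncurry_curry (eComp V a b c)) (x ⊠ s)

theorem opsmul_yo {a b c : C} (x : Elem l (b ⟶[V] c)) (s : Elem l (a ⟶[V] b)) :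
    opsmul (yo c) x s = cmp s x :=
  (smul_coyo (C := Cᵒᵖ) (a := op c) (b := op b) (c := op a) x s).trans (cmp_op s x)

theorem smul_ofAct {obj : C → V} (a : ∀ x y, obj x ⊗ (x ⟶[V] y) ⟶ obj y) (hid) (hcomp) {x y : C}
    (t : Elem l (obj x)) (s : Elem l (x ⟶[V] y)) :
    smul (ofAct obj a hid hcomp) t s = a x y ⋆ t ⊠ s :=
  app_congr (MonoidalClosed.uncurry_curry (a x y)) (t ⊠ s)
end

variable [HasLimits V] [HasColimits V]
section
variable {B : Type u₁} [EnrichedCategory V B] {C C' : Type v} [EnrichedCategory V C]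
  [EnrichedCategory V C']

/-- A `V`-functor into a functor category is known on hom-objects only through the projections of an
end. This converts such a projection formula into the effect on elements. -/
theorem evl_of_comp_π {F G : EnrichedFunctor V C V} {K : V} (m : K ⟶ natObj F G) {c : C}
    (q : K ⟶ EnrichedCategory.Hom (V := V) (F.obj c) (G.obj c)) (hq : m ≫ natπ F G c = q)
    (x : Elem l (F.obj c)) (s : Elem l K) : evl (F := F) (G := G) x (m ⋆ s) = ap x (q ⋆ s) :=
  (evl_eq_ap x _).trans (congrArg (ap x) ((comp_app _ _ _).symm.trans (app_congr hq s)))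

theorem toFunctorCat_map_π (obj : B → EnrichedFunctor V C V) (q) (hq) (hid) (hcomp) (b b' : B)
    (c : C) : (toFunctorCat obj q hq hid hcomp).map b b' ≫ natπ (obj b) (obj b') c = q b b' c :=
  natLift_π (q b b') (hq b b') c

theorem evl_curryLeft (F : EnrichedFunctor V (TensorCat B C) V) {b b' : B} {c : C}
    (x : Elem l (F.obj ⟨b, c⟩)) (s : Elem l (b ⟶[V] b')) :
    evl (F := (inclRight V b C).comp V F) (G := (inclRight V b' C).comp V F) (c := c) x
      (fmap (curryLeft F) s) = smul ((inclLeft V B c).comp V F) x s :=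
  (evl_of_comp_π (F := (inclRight V b C).comp V F) (G := (inclRight V b' C).comp V F)
    ((curryLeft F).map b b') (c := c) (((inclLeft V B c).comp V F).map b b')
    (toFunctorCat_map_π _ _ _ _ _ _ _ c) x s).trans
    (smul_eq_ap ((inclLeft V B c).comp V F) x s).symm

theorem evl_curryRight (F : EnrichedFunctor V (TensorCat C B) V) {b b' : B} {c : C}
    (x : Elem l (F.obj ⟨c, b⟩)) (s : Elem l (b ⟶[V] b')) :
    evl (F := (inclLeft V C b).comp V F) (G := (inclLeft V C b').comp V F) (c := c) x
      (fmap (curryRight F) s) = smul ((inclRight V c B).comp V F) x s :=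
  (evl_of_comp_π (F := (inclLeft V C b).comp V F) (G := (inclLeft V C b').comp V F)
    ((curryRight F).map b b') (c := c) (((inclRight V c B).comp V F).map b b')
    (toFunctorCat_map_π _ _ _ _ _ _ _ c) x s).trans
    (smul_eq_ap ((inclRight V c B).comp V F) x s).symm

theorem evl_whiskerL (F : EnrichedFunctor V C' C) {G G' : EnrichedFunctor V C V} {c : C'}
    (x : Elem l (G.obj (F.obj c))) (s : Elem l (G ⟶[V] G')) :
    evl (F := F.comp V G) (G := F.comp V G') (c := c) x (fmap (whiskerL F V) s) = evl x s :=
  (evl_of_comp_π (F := F.comp V G) (G := F.comp V G') ((whiskerL F V).map G G') (c := c)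
    (natπ G G' (F.obj c)) (toFunctorCat_map_π _ _ _ _ _ _ _ c) x s).trans (evl_eq_ap x s).symm
end

section
variable {A : Type v} [EnrichedCategory V A] {M M' : EnrichedFunctor V A V}
  {N N' : EnrichedFunctor V Aᵒᵖ V}

/-- The element of a coend given by elements of the factors. -/
noncomputable def co {x : A} (m : Elem l (M.obj x)) (n : Elem l (N.obj (op x))) :
    Elem l (tensorOver M N) := coι M N x ⋆ m ⊠ n

@[simp]
theorem coι_app {x : A} (m : Elem l (M.obj x)) (n : Elem l (N.obj (op x))) :
    coι M N x ⋆ m ⊠ n = co m n := rfl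

theorem co_smul {x y : A} (m : Elem l (M.obj x)) (s : Elem l (x ⟶[V] y))
    (n : Elem l (N.obj (op y))) : co (smul M m s) n = co m (opsmul N n s) := by
  have h := app_congr (ten_condition M N x y) ((m ⊠ n) ⊠ s)
  simp only [comp_app, associator_hom_app, whiskerLeft_app, swapRight_app, whiskerRight_app,
    act_app, coι_app] at h
  exact h.symm

theorem smul_tenL {x : A} (m : Elem l (M.obj x)) (n : Elem l (N.obj (op x)))
    (t : Elem l (M ⟶[V] M')) : smul (tenL A N) (a := M) (b := M') (co m n) t = co (evl m t) n := by
  refine (smul_ofAct _ _ _ _ _).trans ?_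
  have h := app_congr (coι_tenLMap M M' N x) ((m ⊠ n) ⊠ t)
  simp only [comp_app, swapRight_app, whiskerRight_app, evalAt_app, coι_app] at h
  exact h

theorem smul_tenR {x : A} (m : Elem l (M.obj x)) (n : Elem l (N.obj (op x)))
    (t : Elem l (N ⟶[V] N')) : smul (tenR A M) (a := N) (b := N') (co m n) t = co m (evl n t) := by
  refine (smul_ofAct _ _ _ _ _).trans ?_
  have h := app_congr (coι_tenRMap M N N' x) ((m ⊠ n) ⊠ t)
  simp only [comp_app, associator_hom_app, whiskerLeft_app, whiskerRight_app, evalAt_app,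
    coι_app] at h
  exact h

end
end Elem

/-! ### Coends tensored with a further object. -/

section Coends
variable [HasColimits V]
variable {A : Type v} [EnrichedCategory V A] {M : EnrichedFunctor V A V}
  {N : EnrichedFunctor V Aᵒᵖ V} {H Z : V}

/-- The universal property of a coend tensored on the left with an object. -/
noncomputable def coDescLeft (k : ∀ x, H ⊗ (M.obj x ⊗ N.obj (op x)) ⟶ Z)
    (hk : ∀ (l : List V) (x y : A) (h : Elem l H) (m : Elem l (M.obj x)) (s : Elem l (x ⟶[V] y))
      (n : Elem l (N.obj (op y))), k x ⋆ h ⊠ m ⊠ opsmul N n s = k y ⋆ h ⊠ smul M m s ⊠ n) :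
    H ⊗ tensorOver M N ⟶ Z :=
  (β_ _ _).hom ≫ coDescRight (fun x => (β_ _ _).hom ≫ k x) (by
    intro x y
    rw [← cancel_epi (α_ _ _ _).inv, ← cancel_epi (α_ _ _ _).inv]
    apply elem_ext₄
    intro l m n s h
    simpa [balLeft, balRight, opsmul] using hk l x y h m s n)

theorem coDescLeft_app (k : ∀ x, H ⊗ (M.obj x ⊗ N.obj (op x)) ⟶ Z) (hk) {l : List V} {x : A}
    (h : Elem l H) (m : Elem l (M.obj x)) (n : Elem l (N.obj (op x))) :
    coDescLeft k hk ⋆ h ⊠ co m n = k x ⋆ h ⊠ m ⊠ n := by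
  rw [coDescLeft, comp_app, braiding_app, co, ← whiskerRight_app, ← comp_app, coι_descRight,
    comp_app, braiding_app]

theorem co_ext_left {f g : H ⊗ tensorOver M N ⟶ Z}
    (h : ∀ x, H ◁ coι M N x ≫ f = H ◁ coι M N x ≫ g) : f = g := by
  rw [← cancel_epi (β_ _ _).hom]
  apply co_ext_right
  intro x
  rw [BraidedCategory.braiding_naturality_left_assoc,
    BraidedCategory.braiding_naturality_left_assoc, h]

end Coends
end FunctorElements

/-! ### Elements of kernels -/
section KernelElements
variable {V : Type u} [Category.{v} V] [MonoidalCategory V] [SymmetricCategory V]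
  [MonoidalClosed V] {A : Type v} [EnrichedCategory V A] {l : List V}
  (p : EnrichedFunctor V (TensorCat Aᵒᵖ (TensorCat Aᵒᵖ A)) V)

/-- The value `p(a, b, c)`. -/
abbrev ker (a b c : A) : V := p.obj ⟨op a, ⟨op b, c⟩⟩

/-- The action on the first variable of `p(a, b, c)`. -/
def pact₁ {a a' b c : A} (r : Elem l (ker p a' b c)) (s : Elem l (a ⟶[V] a')) :
    Elem l (ker p a b c) := opsmul (ker₁ p b c) r s

/-- The action on the second variable of `p(a, b, c)`. -/
def pact₂ {a b b' c : A} (r : Elem l (ker p a b' c)) (s : Elem l (b ⟶[V] b')) :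
    Elem l (ker p a b c) := opsmul (ker₂ p a c) r s

/-- The action on the third variable of `p(a, b, c)`. -/
def pact₃ {a b c c' : A} (r : Elem l (ker p a b c)) (s : Elem l (c ⟶[V] c')) :
    Elem l (ker p a b c') := smul (ker₃ p a b) r s

variable {p}

theorem pact₃_idn {a b c : A} (r : Elem l (ker p a b c)) : pact₃ p r (idn c) = r :=
  smul_idn (ker₃ p a b) r

theorem pact₃_pact₃ {a b c c' c'' : A} (r : Elem l (ker p a b c)) (s : Elem l (c ⟶[V] c'))
    (t : Elem l (c' ⟶[V] c'')) : pact₃ p (pact₃ p r s) t = pact₃ p r (cmp s t) :=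
  smul_smul (ker₃ p a b) r s t

theorem pact₂_eq {a b b' c : A} (r : Elem l (ker p a b' c)) (s : Elem l (b ⟶[V] b')) :
    pact₂ p r s = smul ((inclRight V (op a) (TensorCat Aᵒᵖ A)).comp V p) (a := ⟨op b', c⟩)
      (b := ⟨op b, c⟩) r (fmap (inclLeft V Aᵒᵖ c) (a := op b') (b := op b) s) :=
  smul_comp (inclLeft V Aᵒᵖ c) ((inclRight V (op a) (TensorCat Aᵒᵖ A)).comp V p)
    (a := op b') (b := op b) r s

theorem pact₃_eq {a b c c' : A} (r : Elem l (ker p a b c)) (s : Elem l (c ⟶[V] c')) :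
    pact₃ p r s = smul ((inclRight V (op a) (TensorCat Aᵒᵖ A)).comp V p) (a := ⟨op b, c⟩)
      (b := ⟨op b, c'⟩) r (fmap (inclRight V (op b) A) s) :=
  smul_comp (inclRight V (op b) A) ((inclRight V (op a) (TensorCat Aᵒᵖ A)).comp V p) r s

/-- Actions on different variables of a `V`-functor commute. Together with the next lemma this lets
the action on the third variable of `p` descend to the convolution, a coend over the first two. -/
theorem pact₁_pact₃ {a a' b c c' : A} (r : Elem l (ker p a' b c)) (s : Elem l (a ⟶[V] a'))
    (t : Elem l (c ⟶[V] c')) : pact₁ p (pact₃ p r t) s = pact₃ p (pact₁ p r s) t := by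
  rw [pact₃_eq, pact₃_eq]
  exact (smul_partial_comm p (b := op a') (b' := op a) (c := ⟨op b, c⟩) (c' := ⟨op b, c'⟩) r s
    (fmap (inclRight V (op b) A) t)).symm

theorem pact₂_pact₃ {a b b' c c' : A} (r : Elem l (ker p a b' c)) (s : Elem l (b ⟶[V] b'))
    (t : Elem l (c ⟶[V] c')) : pact₂ p (pact₃ p r t) s = pact₃ p (pact₂ p r s) t :=
  (smul_partial_comm ((inclRight V (op a) (TensorCat Aᵒᵖ A)).comp V p) (b := op b') (b' := op b)
    (c := c) (c' := c') r s t).symm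

variable [HasLimits V] [HasColimits V]

/-- Six `V`-functors into functor categories arise by currying `p`. This lemma and the following
ones identify the effect of each with one of the three actions on `p`, so that no curried functor
occurs in later computations. -/
theorem evl_ker₁ofSnd {a b b' c : A} (r : Elem l (ker p a b' c)) (s : Elem l (b ⟶[V] b')) :
    evl (F := ker₁ p b' c) (G := ker₁ p b c) (c := op a) r
      (fmap (ker₁ofSnd p c) (a := op b') (b := op b) s) = pact₂ p r s :=
  (congrArg _ (fmap_comp _ _ _)).trans ((evl_curryRight p (b := ⟨op b', c⟩) (b' := ⟨op b, c⟩)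
    (c := op a) r _).trans (pact₂_eq r s).symm)

theorem evl_ker₁ofThd {a b c c' : A} (r : Elem l (ker p a b c)) (s : Elem l (c ⟶[V] c')) :
    evl (F := ker₁ p b c) (G := ker₁ p b c') (c := op a) r (fmap (ker₁ofThd p b) s) =
      pact₃ p r s :=
  (congrArg _ (fmap_comp _ _ _)).trans ((evl_curryRight p (b := ⟨op b, c⟩) (b' := ⟨op b, c'⟩)
    (c := op a) r _).trans (pact₃_eq r s).symm)

theorem evl_ker₂ofThd {a b c c' : A} (r : Elem l (ker p a b c)) (s : Elem l (c ⟶[V] c')) :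
    evl (F := ker₂ p a c) (G := ker₂ p a c') (c := op b) r (fmap (ker₂ofThd p a) s) =
      pact₃ p r s :=
  evl_curryRight ((inclRight V (op a) (TensorCat Aᵒᵖ A)).comp V p) (c := op b) r s

theorem evl_ker₃ofSnd {a b b' c : A} (r : Elem l (ker p a b' c)) (s : Elem l (b ⟶[V] b')) :
    evl (F := ker₃ p a b') (G := ker₃ p a b) (c := c) r
      (fmap (ker₃ofSnd p a) (a := op b') (b := op b) s) = pact₂ p r s :=
  evl_curryLeft ((inclRight V (op a) (TensorCat Aᵒᵖ A)).comp V p) (b := op b') (b' := op b)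
    (c := c) r s

theorem evl_ker₂ofFst {a a' b c : A} (r : Elem l (ker p a' b c)) (s : Elem l (a ⟶[V] a')) :
    evl (F := ker₂ p a' c) (G := ker₂ p a c) (c := op b) r
      (fmap (ker₂ofFst p c) (a := op a') (b := op a) s) = pact₁ p r s :=
  (congrArg _ (fmap_comp _ _ _)).trans ((evl_whiskerL (inclLeft V Aᵒᵖ c)
    (G := (inclRight V (op a') (TensorCat Aᵒᵖ A)).comp V p)
    (G' := (inclRight V (op a) (TensorCat Aᵒᵖ A)).comp V p) (c := op b) r
    (fmap (curryLeft p) (a := op a') (b := op a) s)).trans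
    (evl_curryLeft p (b := op a') (b' := op a) (c := ⟨op b, c⟩) r s))

theorem evl_ker₃ofFst {a a' b c : A} (r : Elem l (ker p a' b c)) (s : Elem l (a ⟶[V] a')) :
    evl (F := ker₃ p a' b) (G := ker₃ p a b) (c := c) r
      (fmap (ker₃ofFst p b) (a := op a') (b := op a) s) = pact₁ p r s :=
  (congrArg _ (fmap_comp _ _ _)).trans ((evl_whiskerL (inclRight V (op b) A)
    (G := (inclRight V (op a') (TensorCat Aᵒᵖ A)).comp V p)
    (G' := (inclRight V (op a) (TensorCat Aᵒᵖ A)).comp V p) (c := c) r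
    (fmap (curryLeft p) (a := op a') (b := op a) s)).trans
    (evl_curryLeft p (b := op a') (b' := op a) (c := ⟨op b, c⟩) r s))

end KernelElements
end StarAut

namespace StarAut
open Elem

/-! ### Day convolution of two functors -/
section DayCoend
variable {V : Type u} [Category.{v} V] [MonoidalCategory V] [SymmetricCategory V]
  [MonoidalClosed V] {A : Type v} [EnrichedCategory V A] {l : List V}
  (p : EnrichedFunctor V (TensorCat Aᵒᵖ (TensorCat Aᵒᵖ A)) V)

/-- The action on the first variable of `p(a, b, c)`, as a morphism. -/
def kact₁ (a a' b c : A) : ker p a' b c ⊗ (a ⟶[V] a') ⟶ ker p a b c :=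
  act (ker₁ p b c) (op a') (op a)

/-- The action on the second variable of `p(a, b, c)`, as a morphism. -/
def kact₂ (a b b' c : A) : ker p a b' c ⊗ (b ⟶[V] b') ⟶ ker p a b c :=
  act (ker₂ p a c) (op b') (op b)

/-- The action on the third variable of `p(a, b, c)`, as a morphism. -/
def kact₃ (a b c c' : A) : ker p a b c ⊗ (c ⟶[V] c') ⟶ ker p a b c' :=
  act (ker₃ p a b) c c'

variable {p}

@[simp]
theorem kact₁_app {a a' b c : A} (r : Elem l (ker p a' b c)) (s : Elem l (a ⟶[V] a')) :
    kact₁ p a a' b c ⋆ r ⊠ s = pact₁ p r s := rfl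

@[simp]
theorem kact₂_app {a b b' c : A} (r : Elem l (ker p a b' c)) (s : Elem l (b ⟶[V] b')) :
    kact₂ p a b b' c ⋆ r ⊠ s = pact₂ p r s := rfl

@[simp]
theorem kact₃_app {a b c c' : A} (r : Elem l (ker p a b c)) (s : Elem l (c ⟶[V] c')) :
    kact₃ p a b c c' ⋆ r ⊠ s = pact₃ p r s := rfl

variable {f g : EnrichedFunctor V A V} {c : A}

variable (p f g c) in
/-- `V`-dinaturality of a family `f a ⊗ g b ⊗ p(a, b, c) ⟶ X`. -/
def IsDayCowedge {X : V} (k : ∀ a b : A, f.obj a ⊗ (g.obj b ⊗ ker p a b c) ⟶ X) : Prop :=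
  IsCowedge p f g c k

/-- The two diagrams of a cowedge start at fourfold tensor products up to rebracketing, so they may
be tested on pure tensors, where they say that `k` is balanced over `A` in both variables. -/
theorem isDayCowedge_iff {X : V} {k : ∀ a b : A, f.obj a ⊗ (g.obj b ⊗ ker p a b c) ⟶ X} :
    IsDayCowedge p f g c k ↔
      (∀ (l : List V) (a a' b : A) (x : Elem l (f.obj a)) (y : Elem l (g.obj b))
        (r : Elem l (ker p a' b c)) (s : Elem l (a ⟶[V] a')),
        k a b ⋆ x ⊠ y ⊠ pact₁ p r s = k a' b ⋆ smul f x s ⊠ y ⊠ r) ∧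
      (∀ (l : List V) (a b b' : A) (x : Elem l (f.obj a)) (y : Elem l (g.obj b))
        (r : Elem l (ker p a b' c)) (s : Elem l (b ⟶[V] b')),
        k a b ⋆ x ⊠ y ⊠ pact₂ p r s = k a b' ⋆ x ⊠ smul g y s ⊠ r) := by
  constructor
  · intro hk
    refine ⟨fun l a a' b x y r s => ?_, fun l a b b' x y r s => ?_⟩
    · have h : (α_ _ _ _).hom ≫ f.obj a ◁ ((α_ _ _ _).hom ≫ g.obj b ◁ kact₁ p a a' b c) ≫ k a b =
          swapRight (f.obj a) (g.obj b ⊗ ker p a' b c) (a ⟶[V] a') ≫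
          act f a a' ▷ _ ≫ k a' b := hk.fst a a' b
      simpa using app_congr h ((x ⊠ y ⊠ r) ⊠ s)
    · have h : f.obj a ◁ ((α_ _ _ _).hom ≫ g.obj b ◁ kact₂ p a b b' c) ≫ k a b =
          f.obj a ◁ (swapRight (g.obj b) (ker p a b' c) (b ⟶[V] b') ≫
          act g b b' ▷ _) ≫ k a b' := hk.snd a b b'
      simpa using app_congr h (x ⊠ (y ⊠ r) ⊠ s)
  · rintro ⟨h₁, h₂⟩
    constructor
    · intro a a' b
      change (α_ _ _ _).hom ≫ f.obj a ◁ ((α_ _ _ _).hom ≫ g.obj b ◁ kact₁ p a a' b c) ≫ k a b =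
          swapRight (f.obj a) (g.obj b ⊗ ker p a' b c) (a ⟶[V] a') ≫
          act f a a' ▷ _ ≫ k a' b
      rw [← cancel_epi (α_ _ _ _).inv, ← cancel_epi (_ ◁ (α_ _ _ _).inv)]
      apply elem_ext₄
      intro l x y r s
      simpa using h₁ l a a' b x y r s
    · intro a b b'
      change f.obj a ◁ ((α_ _ _ _).hom ≫ g.obj b ◁ kact₂ p a b b' c) ≫ k a b =
          f.obj a ◁ (swapRight (g.obj b) (ker p a b' c) (b ⟶[V] b') ≫
          act g b b' ▷ _) ≫ k a b'
      rw [← cancel_epi (_ ◁ (α_ _ _ _).inv)]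
      apply elem_ext₄
      intro l x y r s
      simpa using h₂ l a b b' x y r s

variable (p f g c) in
/-- `X` is the coend `∫^{a,b} f a ⊗ g b ⊗ p(a, b, c)`, with coprojections `ι`. -/
structure IsDayCoend {X : V} (ι : ∀ a b : A, f.obj a ⊗ (g.obj b ⊗ ker p a b c) ⟶ X) : Prop where
  cowedge : IsDayCowedge p f g c ι
  universal {Z : V} (k : ∀ a b : A, f.obj a ⊗ (g.obj b ⊗ ker p a b c) ⟶ Z)
    (hk : IsDayCowedge p f g c k) : ∃! m : X ⟶ Z, ∀ a b, ι a b ≫ m = k a b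

namespace IsDayCoend
variable {X : V} {ι : ∀ a b : A, f.obj a ⊗ (g.obj b ⊗ ker p a b c) ⟶ X}

theorem ι_pact₁ (hι : IsDayCoend p f g c ι) {a a' b : A} (x : Elem l (f.obj a))
    (y : Elem l (g.obj b)) (r : Elem l (ker p a' b c)) (s : Elem l (a ⟶[V] a')) :
    ι a b ⋆ x ⊠ y ⊠ pact₁ p r s = ι a' b ⋆ smul f x s ⊠ y ⊠ r :=
  (isDayCowedge_iff.1 hι.cowedge).1 l a a' b x y r s

theorem ι_pact₂ (hι : IsDayCoend p f g c ι) {a b b' : A} (x : Elem l (f.obj a))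
    (y : Elem l (g.obj b)) (r : Elem l (ker p a b' c)) (s : Elem l (b ⟶[V] b')) :
    ι a b ⋆ x ⊠ y ⊠ pact₂ p r s = ι a b' ⋆ x ⊠ smul g y s ⊠ r :=
  (isDayCowedge_iff.1 hι.cowedge).2 l a b b' x y r s

theorem hom_ext (hι : IsDayCoend p f g c ι) {Z : V} {m n : X ⟶ Z}
    (h : ∀ a b, ι a b ≫ m = ι a b ≫ n) : m = n := by
  -- Uniqueness is available only for families known to be cowedges, so the family induced by `n` is
  -- first shown to be one.
  have hk : IsDayCowedge p f g c fun a b => ι a b ≫ n := by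
    refine isDayCowedge_iff.2 ⟨fun l a a' b x y r s => ?_, fun l a b b' x y r s => ?_⟩
    · rw [comp_app, hι.ι_pact₁, comp_app]
    · rw [comp_app, hι.ι_pact₂, comp_app]
  exact (hι.universal _ hk).unique h fun _ _ => rfl

theorem hom_ext_right (hι : IsDayCoend p f g c ι) {H Z : V} {m n : X ⊗ H ⟶ Z}
    (h : ∀ a b, ι a b ▷ H ≫ m = ι a b ▷ H ≫ n) : m = n := by
  rw [← cancel_epi (β_ _ _).hom]
  apply MonoidalClosed.curry_injective
  apply hι.hom_ext
  intro a b
  rw [← MonoidalClosed.curry_natural_left, ← MonoidalClosed.curry_natural_left,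
    BraidedCategory.braiding_naturality_right_assoc,
    BraidedCategory.braiding_naturality_right_assoc, h]

/-- Tensoring with `H` is a left adjoint and preserves the coend: the family is transposed,
descended and transposed back. -/
theorem exists_desc (hι : IsDayCoend p f g c ι) {H Z : V}
    (k : ∀ a b : A, (f.obj a ⊗ (g.obj b ⊗ ker p a b c)) ⊗ H ⟶ Z)
    (h₁ : ∀ (l : List V) (a a' b : A) (x : Elem l (f.obj a)) (y : Elem l (g.obj b))
        (r : Elem l (ker p a' b c)) (s : Elem l (a ⟶[V] a')) (t : Elem l H),
        k a b ⋆ (x ⊠ y ⊠ pact₁ p r s) ⊠ t = k a' b ⋆ (smul f x s ⊠ y ⊠ r) ⊠ t)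
    (h₂ : ∀ (l : List V) (a b b' : A) (x : Elem l (f.obj a)) (y : Elem l (g.obj b))
        (r : Elem l (ker p a b' c)) (s : Elem l (b ⟶[V] b')) (t : Elem l H),
        k a b ⋆ (x ⊠ y ⊠ pact₂ p r s) ⊠ t = k a b' ⋆ (x ⊠ smul g y s ⊠ r) ⊠ t) :
    ∃ m : X ⊗ H ⟶ Z, ∀ a b, ι a b ▷ H ≫ m = k a b := by
  have hk : IsDayCowedge p f g c fun a b => MonoidalClosed.curry ((β_ _ _).hom ≫ k a b) := by
    constructor
    · intro a a' b
      change (α_ _ _ _).hom ≫ f.obj a ◁ ((α_ _ _ _).hom ≫ g.obj b ◁ kact₁ p a a' b c) ≫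
          MonoidalClosed.curry ((β_ _ _).hom ≫ k a b) =
          swapRight (f.obj a) (g.obj b ⊗ ker p a' b c) (a ⟶[V] a') ≫
          act f a a' ▷ _ ≫ MonoidalClosed.curry ((β_ _ _).hom ≫ k a' b)
      apply MonoidalClosed.uncurry_injective
      rw [← cancel_epi (_ ◁ (α_ _ _ _).inv), ← cancel_epi (_ ◁ _ ◁ (α_ _ _ _).inv)]
      apply elem_ext₅
      intro l t x y r s
      simpa [uncurry_app, ap_curry] using h₁ l a a' b x y r s t
    · intro a b b'
      change f.obj a ◁ ((α_ _ _ _).hom ≫ g.obj b ◁ kact₂ p a b b' c) ≫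
          MonoidalClosed.curry ((β_ _ _).hom ≫ k a b) =
          f.obj a ◁ (swapRight (g.obj b) (ker p a b' c) (b ⟶[V] b') ≫
          act g b b' ▷ _) ≫ MonoidalClosed.curry ((β_ _ _).hom ≫ k a b')
      apply MonoidalClosed.uncurry_injective
      rw [← cancel_epi (_ ◁ _ ◁ (α_ _ _ _).inv)]
      apply elem_ext₅
      intro l t x y r s
      simpa [uncurry_app, ap_curry] using h₂ l a b b' x y r s t
  obtain ⟨m, hm, -⟩ := hι.universal _ hk
  refine ⟨(β_ _ _).hom ≫ MonoidalClosed.uncurry m, fun a b => ?_⟩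
  rw [BraidedCategory.braiding_naturality_left_assoc, ← MonoidalClosed.uncurry_natural_left, hm,
    MonoidalClosed.uncurry_curry, SymmetricCategory.symmetry_assoc]

end IsDayCoend

variable [HasLimits V] [HasColimits V]

-- Fubini: the double coend is built as `∫^a f a ⊗ N a` with the inner coend `N a = ∫^b g b ⊗ p(a,
-- b, c)`, which is a contravariant `V`-functor of `a` through the first variable of `p`.
variable (p f g c) in
theorem exists_isDayCoend : ∃ (X : V) (ι : ∀ a b : A, f.obj a ⊗ (g.obj b ⊗ ker p a b c) ⟶ X),
    IsDayCoend p f g c ι := by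
  let N : EnrichedFunctor V Aᵒᵖ V := (ker₂ofFst p c).comp V (tenR A g)
  let ιN : ∀ a b : A, g.obj b ⊗ ker p a b c ⟶ N.obj (op a) := fun a b => coι g (ker₂ p a c) b
  have hN₁ : ∀ (l : List V) (a a' b : A) (y : Elem l (g.obj b)) (r : Elem l (ker p a' b c))
      (s : Elem l (a ⟶[V] a')), opsmul N (ιN a' b ⋆ y ⊠ r) s = ιN a b ⋆ y ⊠ pact₁ p r s := by
    intro l a a' b y r s
    exact (smul_comp (ker₂ofFst p c) (tenR A g) (a := op a') (b := op a) _ _).trans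
      ((smul_tenR (N := ker₂ p a' c) (N' := ker₂ p a c) y r _).trans
        (congrArg (co y) (evl_ker₂ofFst r s)))
  have hN₂ : ∀ (l : List V) (a b b' : A) (y : Elem l (g.obj b)) (r : Elem l (ker p a b' c))
      (s : Elem l (b ⟶[V] b')), ιN a b ⋆ y ⊠ pact₂ p r s = ιN a b' ⋆ smul g y s ⊠ r :=
    fun l a b b' y r s => (co_smul (M := g) (N := ker₂ p a c) y s r).symm
  have hN₃ : ∀ (a : A) {H Z : V} {m n : H ⊗ N.obj (op a) ⟶ Z},
      (∀ b, H ◁ ιN a b ≫ m = H ◁ ιN a b ≫ n) → m = n := fun a _ _ _ _ h =>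
    co_ext_left (M := g) (N := ker₂ p a c) h
  have hN₄ : ∀ (a : A) {H Z : V} (k : ∀ b, H ⊗ (g.obj b ⊗ ker p a b c) ⟶ Z),
      (∀ (l : List V) (b b' : A) (h : Elem l H) (y : Elem l (g.obj b)) (r : Elem l (ker p a b' c))
      (s : Elem l (b ⟶[V] b')), k b ⋆ h ⊠ y ⊠ pact₂ p r s = k b' ⋆ h ⊠ smul g y s ⊠ r) →
      ∃ m : H ⊗ N.obj (op a) ⟶ Z, ∀ b, H ◁ ιN a b ≫ m = k b := by
    intro a H Z k hk
    refine ⟨coDescLeft (M := g) (N := ker₂ p a c) k (fun l b b' h y s r => hk l b b' h y r s),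
      fun b => ?_⟩
    apply elem_ext₃
    intro l h y r
    exact (comp_app _ _ _).trans <| (congrArg _ (whiskerLeft_app _ _ _)).trans <|
      coDescLeft_app (M := g) (N := ker₂ p a c) k _ h y r
  -- From here on only four facts about the inner coend are used: its action of `A`, its balancing
  -- relation, and uniqueness and existence of maps out of it after tensoring on the left.
  clear_value N ιN
  refine ⟨tensorOver f N, fun a b => f.obj a ◁ ιN a b ≫ coι f N a, ?_, ?_⟩
  · refine isDayCowedge_iff.2 ⟨fun l a a' b x y r s => ?_, fun l a b b' x y r s => ?_⟩
    · simp [← hN₁, co_smul]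
    · simp [hN₂]
  · intro Z k hk
    rw [isDayCowedge_iff] at hk
    choose m hm using fun a => hN₄ a (k a) fun l b b' h y r s => hk.2 l a b b' h y r s
    have hm' : ∀ (l : List V) (a b : A) (x : Elem l (f.obj a)) (y : Elem l (g.obj b))
        (r : Elem l (ker p a b c)), m a ⋆ x ⊠ (ιN a b ⋆ y ⊠ r) = k a b ⋆ x ⊠ y ⊠ r := by
      intro l a b x y r
      simpa using app_congr (hm a b) (x ⊠ y ⊠ r)
    -- Balancing in `a`. Once the inner coend is moved to the last tensor factor, the equation can
    -- be tested on its generators, where it is the first half of `hk`.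
    have hm₂ : ∀ a a', balLeft f N a a' ≫ m a = balRight f N a a' ≫ m a' := by
      intro a a'
      rw [← cancel_epi (β_ _ _).hom, ← cancel_epi (α_ _ _ _).hom]
      apply hN₃
      intro b
      rw [← cancel_epi (α_ _ _ _).inv]
      apply elem_ext₄
      intro l s x y r
      have h := hN₁ l a a' b y r s
      rw [opsmul] at h
      simp [balLeft, balRight, h, hm', hk.1]
    refine ⟨coDesc m hm₂, fun a b => ?_, fun m' hm₃ => ?_⟩
    · simp only [Category.assoc, coι_desc, hm]
    · apply co_ext
      intro a
      apply hN₃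
      intro b
      rw [coι_desc, hm, ← hm₃, Category.assoc]

end DayCoend
end StarAut

namespace StarAut
open Elem

/-! ### The Day convolution functor -/
section DayFunctor
variable {V : Type u} [Category.{v} V] [MonoidalCategory V] [SymmetricCategory V]
  [MonoidalClosed V] {A : Type v} [EnrichedCategory V A] {l : List V}
  {p : EnrichedFunctor V (TensorCat Aᵒᵖ (TensorCat Aᵒᵖ A)) V}

namespace IsDayCoend
variable {f g : EnrichedFunctor V A V} {c : A}
variable {X : V} {ι : ∀ a b : A, f.obj a ⊗ (g.obj b ⊗ ker p a b c) ⟶ X}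

theorem elem_ext (hι : IsDayCoend p f g c ι) {Z : V} {m n : X ⟶ Z}
    (h : ∀ (l : List V) (a b : A) (x : Elem l (f.obj a)) (y : Elem l (g.obj b))
      (r : Elem l (ker p a b c)), m ⋆ ι a b ⋆ x ⊠ y ⊠ r = n ⋆ ι a b ⋆ x ⊠ y ⊠ r) : m = n := by
  apply hι.hom_ext
  intro a b
  apply elem_ext₃
  intro l x y r
  simpa using h l a b x y r

theorem elem_ext_right (hι : IsDayCoend p f g c ι) {H Z : V} {m n : X ⊗ H ⟶ Z}
    (h : ∀ (l : List V) (a b : A) (x : Elem l (f.obj a)) (y : Elem l (g.obj b))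
      (r : Elem l (ker p a b c)) (t : Elem l H),
      m ⋆ (ι a b ⋆ x ⊠ y ⊠ r) ⊠ t = n ⋆ (ι a b ⋆ x ⊠ y ⊠ r) ⊠ t) : m = n := by
  apply hι.hom_ext_right
  intro a b
  rw [← cancel_epi (α_ _ _ _).inv, ← cancel_epi (_ ◁ (α_ _ _ _).inv)]
  apply elem_ext₄
  intro l x y r t
  simpa using h l a b x y r t

/-- Not a special case of `elem_ext_right`: an element of `H ⊗ H'` need not be a pure tensor, so the
hypothesis here is weaker. The same applies to the versions with more factors. -/
theorem elem_ext_right₂ (hι : IsDayCoend p f g c ι) {H H' Z : V} {m n : X ⊗ H ⊗ H' ⟶ Z}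
    (h : ∀ (l : List V) (a b : A) (x : Elem l (f.obj a)) (y : Elem l (g.obj b))
      (r : Elem l (ker p a b c)) (t : Elem l H) (t' : Elem l H'),
      m ⋆ (ι a b ⋆ x ⊠ y ⊠ r) ⊠ t ⊠ t' = n ⋆ (ι a b ⋆ x ⊠ y ⊠ r) ⊠ t ⊠ t') : m = n := by
  apply hι.hom_ext_right
  intro a b
  rw [← cancel_epi (α_ _ _ _).inv, ← cancel_epi (_ ◁ (α_ _ _ _).inv)]
  apply elem_ext₅
  intro l x y r t t'
  simpa using h l a b x y r t t'

theorem elem_ext_right₃ (hι : IsDayCoend p f g c ι) {H H' H'' Z : V}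
    {m n : X ⊗ H ⊗ H' ⊗ H'' ⟶ Z}
    (h : ∀ (l : List V) (a b : A) (x : Elem l (f.obj a)) (y : Elem l (g.obj b))
      (r : Elem l (ker p a b c)) (t : Elem l H) (t' : Elem l H') (t'' : Elem l H''),
      m ⋆ (ι a b ⋆ x ⊠ y ⊠ r) ⊠ t ⊠ t' ⊠ t'' = n ⋆ (ι a b ⋆ x ⊠ y ⊠ r) ⊠ t ⊠ t' ⊠ t'') :
    m = n := by
  apply hι.hom_ext_right
  intro a b
  rw [← cancel_epi (α_ _ _ _).inv, ← cancel_epi (_ ◁ (α_ _ _ _).inv)]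
  apply elem_ext₆
  intro l x y r t t' t''
  simpa using h l a b x y r t t' t''

theorem elem_ext_right₄ (hι : IsDayCoend p f g c ι) {H H' K K' Z : V}
    {m n : X ⊗ H ⊗ H' ⊗ K ⊗ K' ⟶ Z}
    (h : ∀ (l : List V) (a b : A) (x : Elem l (f.obj a)) (y : Elem l (g.obj b))
      (r : Elem l (ker p a b c)) (t : Elem l H) (t' : Elem l H') (w : Elem l K) (w' : Elem l K'),
      m ⋆ (ι a b ⋆ x ⊠ y ⊠ r) ⊠ t ⊠ t' ⊠ w ⊠ w' = n ⋆ (ι a b ⋆ x ⊠ y ⊠ r) ⊠ t ⊠ t' ⊠ w ⊠ w') :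
    m = n := by
  apply hι.hom_ext_right
  intro a b
  rw [← cancel_epi (α_ _ _ _).inv, ← cancel_epi (_ ◁ (α_ _ _ _).inv)]
  apply elem_ext₇
  intro l x y r t t' w w'
  simpa using h l a b x y r t t' w w'

theorem exists_elem_desc (hι : IsDayCoend p f g c ι) {H Z : V}
    (k : ∀ a b : A, (f.obj a ⊗ (g.obj b ⊗ ker p a b c)) ⊗ H ⟶ Z)
    (h₁ : ∀ (l : List V) (a a' b : A) (x : Elem l (f.obj a)) (y : Elem l (g.obj b))
        (r : Elem l (ker p a' b c)) (s : Elem l (a ⟶[V] a')) (t : Elem l H),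
        k a b ⋆ (x ⊠ y ⊠ pact₁ p r s) ⊠ t = k a' b ⋆ (smul f x s ⊠ y ⊠ r) ⊠ t)
    (h₂ : ∀ (l : List V) (a b b' : A) (x : Elem l (f.obj a)) (y : Elem l (g.obj b))
        (r : Elem l (ker p a b' c)) (s : Elem l (b ⟶[V] b')) (t : Elem l H),
        k a b ⋆ (x ⊠ y ⊠ pact₂ p r s) ⊠ t = k a b' ⋆ (x ⊠ smul g y s ⊠ r) ⊠ t) :
    ∃ m : X ⊗ H ⟶ Z, ∀ (l : List V) (a b : A) (x : Elem l (f.obj a)) (y : Elem l (g.obj b))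
      (r : Elem l (ker p a b c)) (t : Elem l H),
      m ⋆ (ι a b ⋆ x ⊠ y ⊠ r) ⊠ t = k a b ⋆ (x ⊠ y ⊠ r) ⊠ t := by
  obtain ⟨m, hm⟩ := hι.exists_desc k h₁ h₂
  refine ⟨m, fun l a b x y r t => ?_⟩
  rw [← hm a b, comp_app, whiskerRight_app]

/-- Balancing is assumed only on pure tensors of `H ⊗ H'`. It is first upgraded to an equality of
morphisms, which then holds at every element of `H ⊗ H'`. -/
theorem exists_elem_desc₂ (hι : IsDayCoend p f g c ι) {H H' Z : V}
    (k : ∀ a b : A, (f.obj a ⊗ (g.obj b ⊗ ker p a b c)) ⊗ (H ⊗ H') ⟶ Z)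
    (h₁ : ∀ (l : List V) (a a' b : A) (x : Elem l (f.obj a)) (y : Elem l (g.obj b))
        (r : Elem l (ker p a' b c)) (s : Elem l (a ⟶[V] a')) (t : Elem l H) (t' : Elem l H'),
        k a b ⋆ (x ⊠ y ⊠ pact₁ p r s) ⊠ t ⊠ t' = k a' b ⋆ (smul f x s ⊠ y ⊠ r) ⊠ t ⊠ t')
    (h₂ : ∀ (l : List V) (a b b' : A) (x : Elem l (f.obj a)) (y : Elem l (g.obj b))
        (r : Elem l (ker p a b' c)) (s : Elem l (b ⟶[V] b')) (t : Elem l H) (t' : Elem l H'),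
        k a b ⋆ (x ⊠ y ⊠ pact₂ p r s) ⊠ t ⊠ t' = k a b' ⋆ (x ⊠ smul g y s ⊠ r) ⊠ t ⊠ t') :
    ∃ m : X ⊗ (H ⊗ H') ⟶ Z, ∀ (l : List V) (a b : A) (x : Elem l (f.obj a))
      (y : Elem l (g.obj b)) (r : Elem l (ker p a b c)) (t : Elem l H) (t' : Elem l H'),
      m ⋆ (ι a b ⋆ x ⊠ y ⊠ r) ⊠ t ⊠ t' = k a b ⋆ (x ⊠ y ⊠ r) ⊠ t ⊠ t' := by
  obtain ⟨m, hm⟩ := hι.exists_elem_desc k (by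
    intro l a a' b x y r s t
    have h : f.obj a ◁ g.obj b ◁ ((α_ _ _ _).inv ≫ kact₁ p a a' b c ▷ (H ⊗ H')) ≫
        f.obj a ◁ (α_ _ _ _).inv ≫ (α_ _ _ _).inv ≫ k a b =
        f.obj a ◁ (g.obj b ◁ swapLeft _ _ _ ≫ swapLeft _ _ _) ≫ (α_ _ _ _).inv ≫
        act f a a' ▷ _ ≫ f.obj a' ◁ (α_ _ _ _).inv ≫ (α_ _ _ _).inv ≫ k a' b := by
      apply elem_ext₆
      intro l x y r s t t'
      simpa using h₁ l a a' b x y r s t t'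
    simpa only [comp_app, whiskerLeft_app, whiskerRight_app, associator_inv_app,
      associator_hom_app, braiding_app, kact₁_app, kact₂_app, act_app] using
      app_congr h (x ⊠ y ⊠ r ⊠ s ⊠ t)) (by
    intro l a b b' x y r s t
    have h : f.obj a ◁ g.obj b ◁ ((α_ _ _ _).inv ≫ kact₂ p a b b' c ▷ (H ⊗ H')) ≫
        f.obj a ◁ (α_ _ _ _).inv ≫ (α_ _ _ _).inv ≫ k a b =
        f.obj a ◁ (g.obj b ◁ swapLeft _ _ _ ≫ (α_ _ _ _).inv ≫ act g b b' ▷ _) ≫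
        f.obj a ◁ (α_ _ _ _).inv ≫ (α_ _ _ _).inv ≫ k a b' := by
      apply elem_ext₆
      intro l x y r s t t'
      simpa using h₂ l a b b' x y r s t t'
    simpa only [comp_app, whiskerLeft_app, whiskerRight_app, associator_inv_app,
      associator_hom_app, braiding_app, kact₁_app, kact₂_app, act_app] using
      app_congr h (x ⊠ y ⊠ r ⊠ s ⊠ t))
  exact ⟨m, fun l a b x y r t t' => hm l a b x y r (t ⊠ t')⟩

end IsDayCoend

variable [HasLimits V] [HasColimits V]

variable (p) in
/-- A `V`-functor `T (f, g) = ∫^{a,b} f a ⊗ g b ⊗ p(a, b, -)`, with coprojections `ι`. -/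
structure DayData where
  T : EnrichedFunctor V (TensorCat (EnrichedFunctor V A V) (EnrichedFunctor V A V))
    (EnrichedFunctor V A V)
  ι (f g : EnrichedFunctor V A V) (a b c : A) :
    f.obj a ⊗ (g.obj b ⊗ ker p a b c) ⟶ (T.obj ⟨f, g⟩).obj c
  isDayCoend (f g : EnrichedFunctor V A V) (c : A) :
    IsDayCoend p f g c (fun a b => ι f g a b c)
  smul_ι {f g : EnrichedFunctor V A V} {l : List V} {a b c c' : A} (x : Elem l (f.obj a))
    (y : Elem l (g.obj b)) (r : Elem l (ker p a b c)) (s : Elem l (c ⟶[V] c')) :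
    smul (T.obj ⟨f, g⟩) (ι f g a b c ⋆ x ⊠ y ⊠ r) s = ι f g a b c' ⋆ x ⊠ y ⊠ pact₃ p r s
  evl_ι_fst {f f' g : EnrichedFunctor V A V} {l : List V} {a b c : A} (x : Elem l (f.obj a))
    (y : Elem l (g.obj b)) (r : Elem l (ker p a b c)) (t : Elem l (f ⟶[V] f')) :
    evl (F := T.obj ⟨f, g⟩) (G := T.obj ⟨f', g⟩) (ι f g a b c ⋆ x ⊠ y ⊠ r)
      (fmap (partL T g) t) = ι f' g a b c ⋆ evl x t ⊠ y ⊠ r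
  evl_ι_snd {f g g' : EnrichedFunctor V A V} {l : List V} {a b c : A} (x : Elem l (f.obj a))
    (y : Elem l (g.obj b)) (r : Elem l (ker p a b c)) (t : Elem l (g ⟶[V] g')) :
    evl (F := T.obj ⟨f, g⟩) (G := T.obj ⟨f, g'⟩) (ι f g a b c ⋆ x ⊠ y ⊠ r)
      (fmap (partR T f) t) = ι f g' a b c ⋆ x ⊠ evl y t ⊠ r

variable (p) in
/-- A `V`-functor `∫^{a,b} f a ⊗ g b ⊗ p(a, b, -)`, with coprojections `ι`. -/
structure DayConv (f g : EnrichedFunctor V A V) where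
  F : EnrichedFunctor V A V
  ι (a b c : A) : f.obj a ⊗ (g.obj b ⊗ ker p a b c) ⟶ F.obj c
  isDayCoend (c : A) : IsDayCoend p f g c (fun a b => ι a b c)
  smul_ι {l : List V} {a b c c' : A} (x : Elem l (f.obj a)) (y : Elem l (g.obj b))
    (r : Elem l (ker p a b c)) (s : Elem l (c ⟶[V] c')) :
    smul F (ι a b c ⋆ x ⊠ y ⊠ r) s = ι a b c' ⋆ x ⊠ y ⊠ pact₃ p r s

-- The action of `A` on the convolution comes from the third variable of `p`. It descends because
-- that action commutes with those on the first two variables, and the functor laws hold because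
-- they hold for `p` on generators.
variable (p) in
theorem nonempty_dayConv (f g : EnrichedFunctor V A V) : Nonempty (DayConv p f g) := by
  obtain ⟨X, h₀⟩ := Classical.axiom_of_choice fun c => exists_isDayCoend p f g c
  obtain ⟨ι, hι⟩ := Classical.axiom_of_choice h₀
  have h : ∀ c c', ∃ m : X c ⊗ (c ⟶[V] c') ⟶ X c',
      ∀ (l : List V) (a b : A) (x : Elem l (f.obj a)) (y : Elem l (g.obj b))
      (r : Elem l (ker p a b c)) (s : Elem l (c ⟶[V] c')),
      m ⋆ (ι c a b ⋆ x ⊠ y ⊠ r) ⊠ s = ι c' a b ⋆ x ⊠ y ⊠ pact₃ p r s := by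
    intro c c'
    obtain ⟨m, hm⟩ := (hι c).exists_elem_desc (H := (c ⟶[V] c'))
      (fun a b => (α_ _ _ _).hom ≫ f.obj a ◁ ((α_ _ _ _).hom ≫ g.obj b ◁ kact₃ p a b c c') ≫
        ι c' a b) (by
        intro l a a' b x y r s t
        simp [← pact₁_pact₃, (hι c').ι_pact₁]) (by
        intro l a b b' x y r s t
        simp [← pact₂_pact₃, (hι c').ι_pact₂])
    refine ⟨m, fun l a b x y r s => ?_⟩
    simpa using hm l a b x y r s
  choose m hm using h
  refine ⟨⟨ofAct X m ?_ ?_, fun a b c => ι c a b, hι, fun x y r s => ?_⟩⟩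
  · intro c
    rw [← cancel_epi (ρ_ _).inv]
    apply (hι c).elem_ext
    intro l a b x y r
    simp [hm, pact₃_idn]
  · intro c c' c''
    apply (hι c).elem_ext_right₂
    intro l a b x y r s t
    simp [hm, pact₃_pact₃]
  · exact (smul_ofAct _ _ _ _ s).trans (hm _ _ _ _ _ x y r s)

variable (p) in
/-- A choice of the Day convolution of two `V`-functors. -/
noncomputable def dayConv (f g : EnrichedFunctor V A V) : DayConv p f g :=
  (nonempty_dayConv p f g).some

/-- Transformations act on generators by applying one to each functor factor and leaving the kernel
alone; this respects the balancing because transformations commute with the action of `A`. -/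
theorem DayConv.exists_map {f f' g g' : EnrichedFunctor V A V} (T : DayConv p f g)
    (T' : DayConv p f' g') :
    ∃ m : (f ⟶[V] f') ⊗ (g ⟶[V] g') ⟶ (T.F ⟶[V] T'.F),
      ∀ (l : List V) (a b c : A) (x : Elem l (f.obj a)) (y : Elem l (g.obj b))
      (r : Elem l (ker p a b c)) (s : Elem l (f ⟶[V] f')) (t : Elem l (g ⟶[V] g')),
      evl (T.ι a b c ⋆ x ⊠ y ⊠ r) (m ⋆ s ⊠ t) = T'.ι a b c ⋆ evl x s ⊠ evl y t ⊠ r := by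
  have h : ∀ c, ∃ m : T.F.obj c ⊗ ((f ⟶[V] f') ⊗ (g ⟶[V] g')) ⟶ T'.F.obj c,
      ∀ (l : List V) (a b : A) (x : Elem l (f.obj a)) (y : Elem l (g.obj b))
      (r : Elem l (ker p a b c)) (s : Elem l (f ⟶[V] f')) (t : Elem l (g ⟶[V] g')),
      m ⋆ (T.ι a b c ⋆ x ⊠ y ⊠ r) ⊠ s ⊠ t = T'.ι a b c ⋆ evl x s ⊠ evl y t ⊠ r := by
    intro c
    let k : ∀ a b : A, (f.obj a ⊗ (g.obj b ⊗ ker p a b c)) ⊗ ((f ⟶[V] f') ⊗ (g ⟶[V] g')) ⟶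
        T'.F.obj c := fun a b => tensorμ _ _ _ _ ≫
          (evalAt f f' a ⊗ₘ (swapRight _ _ _ ≫ evalAt g g' b ▷ _)) ≫ T'.ι a b c
    have hk : ∀ (l : List V) (a b : A) (x : Elem l (f.obj a)) (y : Elem l (g.obj b))
        (r : Elem l (ker p a b c)) (s : Elem l (f ⟶[V] f')) (t : Elem l (g ⟶[V] g')),
        k a b ⋆ (x ⊠ y ⊠ r) ⊠ s ⊠ t = T'.ι a b c ⋆ evl x s ⊠ evl y t ⊠ r := by
      intro l a b x y r s t
      simp [k]
    clear_value k
    obtain ⟨m, hm⟩ := (T.isDayCoend c).exists_elem_desc₂ k (by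
        intro l a a' b x y r s t t'
        rw [hk, hk, evl_smul, (T'.isDayCoend c).ι_pact₁]) (by
        intro l a b b' x y r s t t'
        rw [hk, hk, evl_smul, (T'.isDayCoend c).ι_pact₂])
    exact ⟨m, fun l a b x y r s t => by rw [hm, hk]⟩
  choose m hm using h
  refine ⟨natOf m ?_, fun l a b c x y r s t => (evl_natOf _ _ _ _).trans (hm _ _ _ _ _ _ _ _ _)⟩
  intro l c c' x s t
  -- Naturality in `c` is needed at arbitrary elements, so it is stated as an equality of morphisms
  -- and then tested on generators.
  have h : act T.F c c' ▷ ((f ⟶[V] f') ⊗ (g ⟶[V] g')) ≫ m c' =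
      (α_ _ _ _).hom ≫ _ ◁ (β_ _ _).hom ≫ (α_ _ _ _).inv ≫ m c ▷ (c ⟶[V] c') ≫
      act T'.F c c' := by
    rw [← cancel_epi (α_ _ _ _).inv]
    apply (T.isDayCoend c).elem_ext_right₃
    intro l a b x y r w s t
    simp only [comp_app, whiskerLeft_app, whiskerRight_app, associator_inv_app,
      associator_hom_app, braiding_app, act_app, hm, T.smul_ι, T'.smul_ι]
  simpa only [comp_app, whiskerLeft_app, whiskerRight_app, associator_inv_app,
      associator_hom_app, braiding_app, act_app] using app_congr h ((x ⊠ s) ⊠ t)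

variable (p) in
/-- The effect of the Day convolution on hom-objects. -/
noncomputable def dayMap (f f' g g' : EnrichedFunctor V A V) :
    (f ⟶[V] f') ⊗ (g ⟶[V] g') ⟶ ((dayConv p f g).F ⟶[V] (dayConv p f' g').F) :=
  (DayConv.exists_map _ _).choose

@[simp]
theorem evl_dayMap {f f' g g' : EnrichedFunctor V A V} {a b c : A} (x : Elem l (f.obj a))
    (y : Elem l (g.obj b)) (r : Elem l (ker p a b c)) (s : Elem l (f ⟶[V] f'))
    (t : Elem l (g ⟶[V] g')) :
    evl ((dayConv p f g).ι a b c ⋆ x ⊠ y ⊠ r) (dayMap p f f' g g' ⋆ s ⊠ t) =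
      (dayConv p f' g').ι a b c ⋆ evl x s ⊠ evl y t ⊠ r :=
  (DayConv.exists_map (dayConv p f g) (dayConv p f' g')).choose_spec l a b c x y r s t

variable (p) in
/-- The Day convolution as a functor of two variables. -/
noncomputable def dayTensor :
    EnrichedFunctor V (TensorCat (EnrichedFunctor V A V) (EnrichedFunctor V A V))
      (EnrichedFunctor V A V) where
  obj X := (dayConv p X.fst X.snd).F
  map X Y := dayMap p X.fst Y.fst X.snd Y.snd
  map_id := by
    rintro ⟨f, g⟩
    change ((λ_ (𝟙_ V)).inv ≫ (eId V f ⊗ₘ eId V g)) ≫ dayMap p f f g g =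
      eId V (dayConv p f g).F
    apply natObj_hom_ext
    intro c
    rw [← cancel_epi (ρ_ _).inv]
    apply ((dayConv p f g).isDayCoend c).elem_ext
    intro l a b x y r
    simp only [comp_app, whiskerLeft_app, rightUnitor_inv_app, leftUnitor_inv_app, tensorHom_app,
      eId_app, evalAt_app, evl_dayMap, evl_idn]
  map_comp := by
    rintro ⟨f, g⟩ ⟨f', g'⟩ ⟨f'', g''⟩
    change (tensorμ _ _ _ _ ≫ (eComp V f f' f'' ⊗ₘ eComp V g g' g'')) ≫ dayMap p f f'' g g'' =
      (dayMap p f f' g g' ⊗ₘ dayMap p f' f'' g' g'') ≫ eComp V _ _ _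
    rw [← cancel_epi (α_ _ _ _).inv]
    apply natObj_hom_ext
    intro c
    apply ((dayConv p f g).isDayCoend c).elem_ext_right₄
    intro l a b x y r s t s' t'
    simp only [comp_app, whiskerLeft_app, associator_inv_app, tensorμ_app, tensorHom_app,
      evalAt_app, eComp_app, evl_dayMap, evl_cmp]

/-- Fixing one variable of a `V`-functor of two variables amounts to feeding it the identity there.
-/
theorem fmap_partL_dayTensor {f f' g : EnrichedFunctor V A V} (s : Elem l (f ⟶[V] f')) :
    fmap (partL (dayTensor p) g) s = dayMap p f f' g g ⋆ s ⊠ idn g := by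
  refine (fmap_comp _ _ _).trans ?_
  have h : ((ρ_ _).inv ≫ (_ ◁ eId V g)) ⋆ s = s ⊠ idn g := by
    simp
  exact congrArg (dayMap p f f' g g ⋆ ·) h

theorem fmap_partR_dayTensor {f g g' : EnrichedFunctor V A V} (s : Elem l (g ⟶[V] g')) :
    fmap (partR (dayTensor p) f) s = dayMap p f f g g' ⋆ idn f ⊠ s := by
  refine (fmap_comp _ _ _).trans ?_
  have h : ((λ_ _).inv ≫ (eId V f ▷ _)) ⋆ s = idn f ⊠ s := by
    simp
  exact congrArg (dayMap p f f g g' ⋆ ·) h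

variable (p) in
/-- The Day convolution. -/
noncomputable def dayData : DayData p where
  T := dayTensor p
  ι f g a b c := (dayConv p f g).ι a b c
  isDayCoend f g c := (dayConv p f g).isDayCoend c
  smul_ι := (dayConv p _ _).smul_ι
  evl_ι_fst {f f' g l a b c} x y r t := by
    rw [fmap_partL_dayTensor]
    exact (evl_dayMap x y r t (idn _)).trans
      (congrArg (fun z => (dayConv p f' g).ι a b c ⋆ evl x t ⊠ z ⊠ r) (evl_idn y))
  evl_ι_snd {f g g' l a b c} x y r t := by
    rw [fmap_partR_dayTensor]
    exact (evl_dayMap x y r (idn _) t).trans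
      (congrArg (fun z => (dayConv p f g').ι a b c ⋆ z ⊠ evl y t ⊠ r) (evl_idn x))

end DayFunctor
end StarAut

namespace StarAut
open Elem

/-! ### Coends of products of kernels -/
section CoendElements
variable {V : Type u} [Category.{v} V] [MonoidalCategory V] [SymmetricCategory V]
  [MonoidalClosed V] [HasLimits V] [HasColimits V] {A : Type v} [EnrichedCategory V A]
  {l : List V} {M : EnrichedFunctor V A V} {N : EnrichedFunctor V Aᵒᵖ V} {X Y Z W U Q : V}

theorem co_con_con {i : A} (m : Elem l (M.obj i)) (n : Elem l (N.obj (op i))) :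
    co (con m) (con n) = (con (co m n) : Elem (X :: l) _) := by
  rw [co, co, con_pair_con, app_con]

theorem co_ext_elem₁ {f g : X ⊗ tensorOver M N ⟶ Q}
    (h : ∀ (l : List V) (i : A) (x : Elem l X) (m : Elem l (M.obj i)) (n : Elem l (N.obj (op i))),
      f ⋆ x ⊠ co m n = g ⋆ x ⊠ co m n) : f = g := by
  apply co_ext_left
  intro i
  apply elem_ext₃
  intro l x m n
  simpa using h l i x m n

/-- Currying induction as for `elem_ext₂`; generators of the coend are stable under weakening by
`co_con_con`. -/
theorem co_ext_elem₂ {f g : X ⊗ Y ⊗ tensorOver M N ⟶ Q}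
    (h : ∀ (l : List V) (i : A) (x : Elem l X) (y : Elem l Y)
      (m : Elem l (M.obj i)) (n : Elem l (N.obj (op i))),
      f ⋆ x ⊠ y ⊠ co m n = g ⋆ x ⊠ y ⊠ co m n) : f = g := by
  apply MonoidalClosed.curry_injective
  apply co_ext_elem₁
  intro l i y m n
  apply curry_app_eq
  simpa only [con_pair_con, co_con_con] using
    h _ _ var (con y) (con m) (con n)

theorem co_ext_elem₃ {f g : X ⊗ Y ⊗ Z ⊗ tensorOver M N ⟶ Q}
    (h : ∀ (l : List V) (i : A) (x : Elem l X) (y : Elem l Y) (z : Elem l Z)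
      (m : Elem l (M.obj i)) (n : Elem l (N.obj (op i))),
      f ⋆ x ⊠ y ⊠ z ⊠ co m n = g ⋆ x ⊠ y ⊠ z ⊠ co m n) : f = g := by
  apply MonoidalClosed.curry_injective
  apply co_ext_elem₂
  intro l i y z m n
  apply curry_app_eq
  simpa only [con_pair_con, co_con_con] using
    h _ _ var (con y) (con z) (con m) (con n)

theorem co_ext_elem₄ {f g : X ⊗ Y ⊗ Z ⊗ W ⊗ tensorOver M N ⟶ Q}
    (h : ∀ (l : List V) (i : A) (x : Elem l X) (y : Elem l Y) (z : Elem l Z) (w : Elem l W)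
      (m : Elem l (M.obj i)) (n : Elem l (N.obj (op i))),
      f ⋆ x ⊠ y ⊠ z ⊠ w ⊠ co m n = g ⋆ x ⊠ y ⊠ z ⊠ w ⊠ co m n) : f = g := by
  apply MonoidalClosed.curry_injective
  apply co_ext_elem₃
  intro l i y z w m n
  apply curry_app_eq
  simpa only [con_pair_con, co_con_con] using
    h _ _ var (con y) (con z) (con w) (con m) (con n)

theorem co_ext_elem₅ {f g : X ⊗ Y ⊗ Z ⊗ W ⊗ U ⊗ tensorOver M N ⟶ Q}
    (h : ∀ (l : List V) (i : A) (x : Elem l X) (y : Elem l Y) (z : Elem l Z) (w : Elem l W) (u :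
        Elem l U)
      (m : Elem l (M.obj i)) (n : Elem l (N.obj (op i))),
      f ⋆ x ⊠ y ⊠ z ⊠ w ⊠ u ⊠ co m n = g ⋆ x ⊠ y ⊠ z ⊠ w ⊠ u ⊠ co m n) : f = g := by
  apply MonoidalClosed.curry_injective
  apply co_ext_elem₄
  intro l i y z w u m n
  apply curry_app_eq
  simpa only [con_pair_con, co_con_con] using
    h _ _ var (con y) (con z) (con w) (con u) (con m) (con n)

/-- Morphisms out of a coend tensored with three objects. -/
theorem co_exists_desc₃ (k : ∀ i, X ⊗ Y ⊗ Z ⊗ (M.obj i ⊗ N.obj (op i)) ⟶ Q)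
    (hk : ∀ (l : List V) (i i' : A) (x : Elem l X) (y : Elem l Y) (z : Elem l Z)
      (m : Elem l (M.obj i)) (s : Elem l (i ⟶[V] i')) (n : Elem l (N.obj (op i'))),
      k i ⋆ x ⊠ y ⊠ z ⊠ m ⊠ opsmul N n s = k i' ⋆ x ⊠ y ⊠ z ⊠ smul M m s ⊠ n) :
    ∃ f : X ⊗ Y ⊗ Z ⊗ tensorOver M N ⟶ Q, ∀ (l : List V) (i : A) (x : Elem l X) (y :
        Elem l Y) (z : Elem l Z)
      (m : Elem l (M.obj i)) (n : Elem l (N.obj (op i))),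
      f ⋆ x ⊠ y ⊠ z ⊠ co m n = k i ⋆ x ⊠ y ⊠ z ⊠ m ⊠ n := by
  -- Rebracketing makes the three objects into the single object `H` of `coDescLeft`. Only the
  -- values of `e` on pure tensors matter afterwards.
  let e (T : V) : (X ⊗ Y ⊗ Z) ⊗ T ≅ X ⊗ Y ⊗ Z ⊗ T :=
    α_ _ _ _ ≪≫ whiskerLeftIso X (α_ _ _ _)
  have he : ∀ (T : V) (l : List V) (x : Elem l X) (y : Elem l Y) (z : Elem l Z) (t : Elem l T),
      (e T).hom ⋆ (x ⊠ y ⊠ z) ⊠ t = x ⊠ y ⊠ z ⊠ t := by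
    intro T l x y z t
    simp [e]
  have he' : ∀ (T : V) (l : List V) (x : Elem l X) (y : Elem l Y) (z : Elem l Z) (t : Elem l T),
      (e T).inv ⋆ x ⊠ y ⊠ z ⊠ t = (x ⊠ y ⊠ z) ⊠ t := by
    intro T l x y z t
    simp [e]
  clear_value e
  refine ⟨(e _).inv ≫ coDescLeft (fun i => (e _).hom ≫ k i) ?_, fun l i x y z m n => ?_⟩
  · intro l i i' h m s n
    -- The element `h` of `X ⊗ Y ⊗ Z` need not be a pure tensor, so `hk` is lifted to an equality of
    -- morphisms before it is used.
    have h' : (X ⊗ Y ⊗ Z) ◁ M.obj i ◁ act N (op i') (op i) ≫ (e _).hom ≫ k i =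
        (X ⊗ Y ⊗ Z) ◁ (M.obj i ◁ (β_ _ (i ⟶[V] i')).hom ≫ (α_ _ _ _).inv ≫
          act M i i' ▷ _) ≫ (e _).hom ≫ k i' := by
      rw [← cancel_epi (e _).inv]
      apply elem_ext₆
      intro l x y z m n s
      simpa only [comp_app, he, he', whiskerLeft_app, whiskerRight_app, braiding_app,
        associator_inv_app, act_app, opsmul] using hk l i i' x y z m s n
    simpa only [comp_app, whiskerLeft_app, whiskerRight_app, braiding_app,
        associator_inv_app, act_app, opsmul] using app_congr h' (h ⊠ m ⊠ n ⊠ s)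
  · rw [comp_app, he', coDescLeft_app, comp_app, he]

/-- Morphisms out of a coend tensored with four objects. -/
theorem co_exists_desc₄ (k : ∀ i, X ⊗ Y ⊗ Z ⊗ W ⊗ (M.obj i ⊗ N.obj (op i)) ⟶ Q)
    (hk : ∀ (l : List V) (i i' : A) (x : Elem l X) (y : Elem l Y) (z : Elem l Z) (w : Elem l W)
      (m : Elem l (M.obj i)) (s : Elem l (i ⟶[V] i')) (n : Elem l (N.obj (op i'))),
      k i ⋆ x ⊠ y ⊠ z ⊠ w ⊠ m ⊠ opsmul N n s = k i' ⋆ x ⊠ y ⊠ z ⊠ w ⊠ smul M m s ⊠ n) :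
    ∃ f : X ⊗ Y ⊗ Z ⊗ W ⊗ tensorOver M N ⟶ Q, ∀ (l : List V) (i : A) (x : Elem l X) (y :
        Elem l Y) (z : Elem l Z) (w : Elem l W)
      (m : Elem l (M.obj i)) (n : Elem l (N.obj (op i))),
      f ⋆ x ⊠ y ⊠ z ⊠ w ⊠ co m n = k i ⋆ x ⊠ y ⊠ z ⊠ w ⊠ m ⊠ n := by
  let e (T : V) : (X ⊗ Y ⊗ Z ⊗ W) ⊗ T ≅ X ⊗ Y ⊗ Z ⊗ W ⊗ T :=
    α_ _ _ _ ≪≫ whiskerLeftIso X (α_ _ _ _ ≪≫ whiskerLeftIso Y (α_ _ _ _))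
  have he : ∀ (T : V) (l : List V) (x : Elem l X) (y : Elem l Y) (z : Elem l Z) (w :
      Elem l W) (t : Elem l T),
      (e T).hom ⋆ (x ⊠ y ⊠ z ⊠ w) ⊠ t = x ⊠ y ⊠ z ⊠ w ⊠ t := by
    intro T l x y z w t
    simp [e]
  have he' : ∀ (T : V) (l : List V) (x : Elem l X) (y : Elem l Y) (z : Elem l Z) (w :
      Elem l W) (t : Elem l T),
      (e T).inv ⋆ x ⊠ y ⊠ z ⊠ w ⊠ t = (x ⊠ y ⊠ z ⊠ w) ⊠ t := by
    intro T l x y z w t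
    simp [e]
  clear_value e
  refine ⟨(e _).inv ≫ coDescLeft (fun i => (e _).hom ≫ k i) ?_, fun l i x y z w m n => ?_⟩
  · intro l i i' h m s n
    have h' : (X ⊗ Y ⊗ Z ⊗ W) ◁ M.obj i ◁ act N (op i') (op i) ≫ (e _).hom ≫ k i =
        (X ⊗ Y ⊗ Z ⊗ W) ◁ (M.obj i ◁ (β_ _ (i ⟶[V] i')).hom ≫ (α_ _ _ _).inv ≫
          act M i i' ▷ _) ≫ (e _).hom ≫ k i' := by
      rw [← cancel_epi (e _).inv]
      apply elem_ext₇
      intro l x y z w m n s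
      simpa only [comp_app, he, he', whiskerLeft_app, whiskerRight_app, braiding_app,
        associator_inv_app, act_app, opsmul] using hk l i i' x y z w m s n
    simpa only [comp_app, whiskerLeft_app, whiskerRight_app, braiding_app,
        associator_inv_app, act_app, opsmul] using app_congr h' (h ⊠ m ⊠ n ⊠ s)
  · rw [comp_app, he', coDescLeft_app, comp_app, he]

end CoendElements

/-! ### The two coends of a product of kernels and their four actions of `A`. -/

section KernelCoends
variable {V : Type u} [Category.{v} V] [MonoidalCategory V] [SymmetricCategory V]
  [MonoidalClosed V] [HasLimits V] [HasColimits V] {A : Type v} [EnrichedCategory V A]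
  {l : List V} (p : EnrichedFunctor V (TensorCat Aᵒᵖ (TensorCat Aᵒᵖ A)) V)

/-- The coend `∫^x p(a, b, x) ⊗ p(x, c, d)`. -/
noncomputable abbrev assocL (a b c d : A) : V := tensorOver (ker₃ p a b) (ker₁ p c d)

/-- The coend `∫^y p(b, c, y) ⊗ p(a, y, d)`. -/
noncomputable abbrev assocR (a b c d : A) : V := tensorOver (ker₃ p b c) (ker₂ p a d)

/-- The element of `∫^x p(a, b, x) ⊗ p(x, c, d)` given by elements of the factors. -/
noncomputable def coL {a b c d x : A} (r : Elem l (ker p a b x)) (s : Elem l (ker p x c d)) :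
    Elem l (assocL p a b c d) := co (M := ker₃ p a b) (N := ker₁ p c d) r s

/-- The element of `∫^y p(b, c, y) ⊗ p(a, y, d)` given by elements of the factors. -/
noncomputable def coR {a b c d y : A} (r : Elem l (ker p b c y)) (s : Elem l (ker p a y d)) :
    Elem l (assocR p a b c d) := co (M := ker₃ p b c) (N := ker₂ p a d) r s

/-- The action on the first variable of the coend `assocL`. -/
noncomputable def actL₁ (a a' b c d : A) : assocL p a' b c d ⊗ (a ⟶[V] a') ⟶ assocL p a b c d :=
  act ((ker₃ofFst p b).comp V (tenL A (ker₁ p c d))) (op a') (op a)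

/-- The action on the second variable of the coend `assocL`. -/
noncomputable def actL₂ (a b b' c d : A) : assocL p a b' c d ⊗ (b ⟶[V] b') ⟶ assocL p a b c d :=
  act ((ker₃ofSnd p a).comp V (tenL A (ker₁ p c d))) (op b') (op b)

/-- The action on the third variable of the coend `assocL`. -/
noncomputable def actL₃ (a b c c' d : A) : assocL p a b c' d ⊗ (c ⟶[V] c') ⟶ assocL p a b c d :=
  act ((ker₁ofSnd p d).comp V (tenR A (ker₃ p a b))) (op c') (op c)

/-- The action on the fourth variable of the coend `assocL`. -/
noncomputable def actL₄ (a b c d d' : A) : assocL p a b c d ⊗ (d ⟶[V] d') ⟶ assocL p a b c d' :=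
  act ((ker₁ofThd p c).comp V (tenR A (ker₃ p a b))) d d'

/-- The action on the first variable of the coend `assocR`. -/
noncomputable def actR₁ (a a' b c d : A) : assocR p a' b c d ⊗ (a ⟶[V] a') ⟶ assocR p a b c d :=
  act ((ker₂ofFst p d).comp V (tenR A (ker₃ p b c))) (op a') (op a)

/-- The action on the second variable of the coend `assocR`. -/
noncomputable def actR₂ (a b b' c d : A) : assocR p a b' c d ⊗ (b ⟶[V] b') ⟶ assocR p a b c d :=
  act ((ker₃ofFst p c).comp V (tenL A (ker₂ p a d))) (op b') (op b)

/-- The action on the third variable of the coend `assocR`. -/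
noncomputable def actR₃ (a b c c' d : A) : assocR p a b c' d ⊗ (c ⟶[V] c') ⟶ assocR p a b c d :=
  act ((ker₃ofSnd p b).comp V (tenL A (ker₂ p a d))) (op c') (op c)

/-- The action on the fourth variable of the coend `assocR`. -/
noncomputable def actR₄ (a b c d d' : A) : assocR p a b c d ⊗ (d ⟶[V] d') ⟶ assocR p a b c d' :=
  act ((ker₂ofThd p a).comp V (tenR A (ker₃ p b c))) d d'

variable {p}

-- Each of the four actions goes through the factor of the generator containing the variable in
-- question. For `assocL` the variables `a`, `b` sit in the first factor and `c`, `d` in the second;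
-- for `assocR` it is `b`, `c` in the first and `a`, `d` in the second.
@[simp]
theorem actL₁_co {a a' b c d x : A} (r : Elem l (ker p a' b x)) (s : Elem l (ker p x c d))
    (u : Elem l (a ⟶[V] a')) : actL₁ p a a' b c d ⋆ coL p r s ⊠ u = coL p (pact₁ p r u) s :=
  (smul_comp (ker₃ofFst p b) (tenL A (ker₁ p c d)) (a := op a') (b := op a) _ u).trans ((smul_tenL
      (M := ker₃ p a' b) (M' := ker₃ p a b) (N := ker₁ p c d) r s _).trans
    (congrArg (fun z => co (M := ker₃ p a b) (N := ker₁ p c d) z s) (evl_ker₃ofFst r u)))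

@[simp]
theorem actL₂_co {a b b' c d x : A} (r : Elem l (ker p a b' x)) (s : Elem l (ker p x c d))
    (u : Elem l (b ⟶[V] b')) : actL₂ p a b b' c d ⋆ coL p r s ⊠ u = coL p (pact₂ p r u) s :=
  (smul_comp (ker₃ofSnd p a) (tenL A (ker₁ p c d)) (a := op b') (b := op b) _ u).trans ((smul_tenL
      (M := ker₃ p a b') (M' := ker₃ p a b) (N := ker₁ p c d) r s _).trans
    (congrArg (fun z => co (M := ker₃ p a b) (N := ker₁ p c d) z s) (evl_ker₃ofSnd r u)))

@[simp]
theorem actL₃_co {a b c c' d x : A} (r : Elem l (ker p a b x)) (s : Elem l (ker p x c' d))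
    (u : Elem l (c ⟶[V] c')) : actL₃ p a b c c' d ⋆ coL p r s ⊠ u = coL p r (pact₂ p s u) :=
  (smul_comp (ker₁ofSnd p d) (tenR A (ker₃ p a b)) (a := op c') (b := op c) _ u).trans ((smul_tenR
      (M := ker₃ p a b) (N := ker₁ p c' d) (N' := ker₁ p c d) r s _).trans
    (congrArg (fun z => co (M := ker₃ p a b) (N := ker₁ p c d) r z) (evl_ker₁ofSnd s u)))

@[simp]
theorem actL₄_co {a b c d d' x : A} (r : Elem l (ker p a b x)) (s : Elem l (ker p x c d))
    (u : Elem l (d ⟶[V] d')) : actL₄ p a b c d d' ⋆ coL p r s ⊠ u = coL p r (pact₃ p s u) :=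
  (smul_comp (ker₁ofThd p c) (tenR A (ker₃ p a b))  _ u).trans ((smul_tenR (M := ker₃ p a b) (N :=
      ker₁ p c d) (N' := ker₁ p c d') r s _).trans
    (congrArg (fun z => co (M := ker₃ p a b) (N := ker₁ p c d') r z) (evl_ker₁ofThd s u)))

@[simp]
theorem actR₁_co {a a' b c d x : A} (r : Elem l (ker p b c x)) (s : Elem l (ker p a' x d))
    (u : Elem l (a ⟶[V] a')) : actR₁ p a a' b c d ⋆ coR p r s ⊠ u = coR p r (pact₁ p s u) :=
  (smul_comp (ker₂ofFst p d) (tenR A (ker₃ p b c)) (a := op a') (b := op a) _ u).trans ((smul_tenR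
      (M := ker₃ p b c) (N := ker₂ p a' d) (N' := ker₂ p a d) r s _).trans
    (congrArg (fun z => co (M := ker₃ p b c) (N := ker₂ p a d) r z) (evl_ker₂ofFst s u)))

@[simp]
theorem actR₂_co {a b b' c d x : A} (r : Elem l (ker p b' c x)) (s : Elem l (ker p a x d))
    (u : Elem l (b ⟶[V] b')) : actR₂ p a b b' c d ⋆ coR p r s ⊠ u = coR p (pact₁ p r u) s :=
  (smul_comp (ker₃ofFst p c) (tenL A (ker₂ p a d)) (a := op b') (b := op b) _ u).trans ((smul_tenL
      (M := ker₃ p b' c) (M' := ker₃ p b c) (N := ker₂ p a d) r s _).trans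
    (congrArg (fun z => co (M := ker₃ p b c) (N := ker₂ p a d) z s) (evl_ker₃ofFst r u)))

@[simp]
theorem actR₃_co {a b c c' d x : A} (r : Elem l (ker p b c' x)) (s : Elem l (ker p a x d))
    (u : Elem l (c ⟶[V] c')) : actR₃ p a b c c' d ⋆ coR p r s ⊠ u = coR p (pact₂ p r u) s :=
  (smul_comp (ker₃ofSnd p b) (tenL A (ker₂ p a d)) (a := op c') (b := op c) _ u).trans ((smul_tenL
      (M := ker₃ p b c') (M' := ker₃ p b c) (N := ker₂ p a d) r s _).trans
    (congrArg (fun z => co (M := ker₃ p b c) (N := ker₂ p a d) z s) (evl_ker₃ofSnd r u)))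

@[simp]
theorem actR₄_co {a b c d d' x : A} (r : Elem l (ker p b c x)) (s : Elem l (ker p a x d))
    (u : Elem l (d ⟶[V] d')) : actR₄ p a b c d d' ⋆ coR p r s ⊠ u = coR p r (pact₃ p s u) :=
  (smul_comp (ker₂ofThd p a) (tenR A (ker₃ p b c))  _ u).trans ((smul_tenR (M := ker₃ p b c) (N :=
      ker₂ p a d) (N' := ker₂ p a d') r s _).trans
    (congrArg (fun z => co (M := ker₃ p b c) (N := ker₂ p a d') r z) (evl_ker₂ofThd s u)))

theorem coL_smul {a b c d x x' : A} (r : Elem l (ker p a b x)) (u : Elem l (x ⟶[V] x'))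
    (s : Elem l (ker p x' c d)) : coL p (pact₃ p r u) s = coL p r (pact₁ p s u) :=
  co_smul (M := ker₃ p a b) (N := ker₁ p c d) r u s

theorem coR_smul {a b c d y y' : A} (r : Elem l (ker p b c y)) (u : Elem l (y ⟶[V] y'))
    (s : Elem l (ker p a y' d)) : coR p (pact₃ p r u) s = coR p r (pact₂ p s u) :=
  co_smul (M := ker₃ p b c) (N := ker₂ p a d) r u s

theorem coL_ext₃ {a b c d : A} {X Y Z Q : V}
    {f g : X ⊗ Y ⊗ Z ⊗ assocL p a b c d ⟶ Q}
    (h : ∀ (l : List V) (i : A) (x : Elem l X) (y : Elem l Y) (z : Elem l Z)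
      (r : Elem l (ker p a b i)) (s : Elem l (ker p i c d)),
      f ⋆ x ⊠ y ⊠ z ⊠ coL p r s = g ⋆ x ⊠ y ⊠ z ⊠ coL p r s) : f = g :=
  co_ext_elem₃ (M := ker₃ p a b) (N := ker₁ p c d) fun l i x y z r s => h l i x y z r s

theorem coL_ext₄ {a b c d : A} {X Y Z W Q : V}
    {f g : X ⊗ Y ⊗ Z ⊗ W ⊗ assocL p a b c d ⟶ Q}
    (h : ∀ (l : List V) (i : A) (x : Elem l X) (y : Elem l Y) (z : Elem l Z) (w : Elem l W)
      (r : Elem l (ker p a b i)) (s : Elem l (ker p i c d)),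
      f ⋆ x ⊠ y ⊠ z ⊠ w ⊠ coL p r s = g ⋆ x ⊠ y ⊠ z ⊠ w ⊠ coL p r s) : f = g :=
  co_ext_elem₄ (M := ker₃ p a b) (N := ker₁ p c d) fun l i x y z w r s => h l i x y z w r s

theorem coL_exists_desc₃ {a b c d : A} {X Y Z Q : V}
    (k : ∀ i, X ⊗ Y ⊗ Z ⊗ ker p a b i ⊗ ker p i c d ⟶ Q)
    (hk : ∀ (l : List V) (i i' : A) (x : Elem l X) (y : Elem l Y) (z : Elem l Z)
      (r : Elem l (ker p a b i)) (u : Elem l (i ⟶[V] i')) (s : Elem l (ker p i' c d)),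
      k i ⋆ x ⊠ y ⊠ z ⊠ r ⊠ pact₁ p s u = k i' ⋆ x ⊠ y ⊠ z ⊠ pact₃ p r u ⊠ s) :
    ∃ f : X ⊗ Y ⊗ Z ⊗ assocL p a b c d ⟶ Q, ∀ (l : List V) (i : A) (x : Elem l X)
      (y : Elem l Y) (z : Elem l Z) (r : Elem l (ker p a b i)) (s : Elem l (ker p i c d)),
      f ⋆ x ⊠ y ⊠ z ⊠ coL p r s = k i ⋆ x ⊠ y ⊠ z ⊠ r ⊠ s :=
  co_exists_desc₃ (M := ker₃ p a b) (N := ker₁ p c d) k fun l i i' x y z r u s => hk l i i' x y z r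
      u s

theorem coR_ext₃ {a b c d : A} {X Y Z Q : V}
    {f g : X ⊗ Y ⊗ Z ⊗ assocR p a b c d ⟶ Q}
    (h : ∀ (l : List V) (i : A) (x : Elem l X) (y : Elem l Y) (z : Elem l Z)
      (r : Elem l (ker p b c i)) (s : Elem l (ker p a i d)),
      f ⋆ x ⊠ y ⊠ z ⊠ coR p r s = g ⋆ x ⊠ y ⊠ z ⊠ coR p r s) : f = g :=
  co_ext_elem₃ (M := ker₃ p b c) (N := ker₂ p a d) fun l i x y z r s => h l i x y z r s

theorem coR_ext₄ {a b c d : A} {X Y Z W Q : V}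
    {f g : X ⊗ Y ⊗ Z ⊗ W ⊗ assocR p a b c d ⟶ Q}
    (h : ∀ (l : List V) (i : A) (x : Elem l X) (y : Elem l Y) (z : Elem l Z) (w : Elem l W)
      (r : Elem l (ker p b c i)) (s : Elem l (ker p a i d)),
      f ⋆ x ⊠ y ⊠ z ⊠ w ⊠ coR p r s = g ⋆ x ⊠ y ⊠ z ⊠ w ⊠ coR p r s) : f = g :=
  co_ext_elem₄ (M := ker₃ p b c) (N := ker₂ p a d) fun l i x y z w r s => h l i x y z w r s

theorem coR_ext₅ {a b c d : A} {X Y Z W U Q : V}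
    {f g : X ⊗ Y ⊗ Z ⊗ W ⊗ U ⊗ assocR p a b c d ⟶ Q}
    (h : ∀ (l : List V) (i : A) (x : Elem l X) (y : Elem l Y) (z : Elem l Z) (w : Elem l W) (u :
        Elem l U)
      (r : Elem l (ker p b c i)) (s : Elem l (ker p a i d)),
      f ⋆ x ⊠ y ⊠ z ⊠ w ⊠ u ⊠ coR p r s = g ⋆ x ⊠ y ⊠ z ⊠ w ⊠ u ⊠ coR p r s) : f = g :=
  co_ext_elem₅ (M := ker₃ p b c) (N := ker₂ p a d) fun l i x y z w u r s => h l i x y z w u r s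

theorem coR_exists_desc₃ {a b c d : A} {X Y Z Q : V}
    (k : ∀ i, X ⊗ Y ⊗ Z ⊗ ker p b c i ⊗ ker p a i d ⟶ Q)
    (hk : ∀ (l : List V) (i i' : A) (x : Elem l X) (y : Elem l Y) (z : Elem l Z)
      (r : Elem l (ker p b c i)) (u : Elem l (i ⟶[V] i')) (s : Elem l (ker p a i' d)),
      k i ⋆ x ⊠ y ⊠ z ⊠ r ⊠ pact₂ p s u = k i' ⋆ x ⊠ y ⊠ z ⊠ pact₃ p r u ⊠ s) :
    ∃ f : X ⊗ Y ⊗ Z ⊗ assocR p a b c d ⟶ Q, ∀ (l : List V) (i : A) (x : Elem l X)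
      (y : Elem l Y) (z : Elem l Z) (r : Elem l (ker p b c i)) (s : Elem l (ker p a i d)),
      f ⋆ x ⊠ y ⊠ z ⊠ coR p r s = k i ⋆ x ⊠ y ⊠ z ⊠ r ⊠ s :=
  co_exists_desc₃ (M := ker₃ p b c) (N := ker₂ p a d) k fun l i i' x y z r u s => hk l i i' x y z r
      u s

end KernelCoends
end StarAut

namespace StarAut
open Elem

/-! ### Elements of the coends in a promonoidal structure -/
section PromonoidalElements
variable {V : Type u} [Category.{v} V] [MonoidalCategory V] [SymmetricCategory V]
  [MonoidalClosed V] [HasLimits V] [HasColimits V] {A : Type v} [EnrichedCategory V A]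
  {l : List V}

section
variable (p : EnrichedFunctor V (TensorCat Aᵒᵖ (TensorCat Aᵒᵖ A)) V) (j : EnrichedFunctor V A V)

/-- The coend `∫^x j x ⊗ p(x, b, c)`. -/
noncomputable abbrev unitL (b c : A) : V := tensorOver j (ker₁ p b c)

/-- The coend `∫^x j x ⊗ p(a, x, c)`. -/
noncomputable abbrev unitR (a c : A) : V := tensorOver j (ker₂ p a c)

/-- The element of `∫^x j x ⊗ p(x, b, c)` given by elements of the factors. -/
noncomputable def coUL {a b c : A} (t : Elem l (j.obj a)) (r : Elem l (ker p a b c)) :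
    Elem l (unitL p j b c) := co (M := j) (N := ker₁ p b c) t r

/-- The element of `∫^x j x ⊗ p(a, x, c)` given by elements of the factors. -/
noncomputable def coUR {a b c : A} (t : Elem l (j.obj b)) (r : Elem l (ker p a b c)) :
    Elem l (unitR p j a c) := co (M := j) (N := ker₂ p a c) t r

/-- The action on the variable `b` of `∫^x j x ⊗ p(x, b, c)`. -/
noncomputable def actUL (b b' c : A) : unitL p j b' c ⊗ (b ⟶[V] b') ⟶ unitL p j b c :=
  act ((ker₁ofSnd p c).comp V (tenR A j)) (op b') (op b)

/-- The action on the variable `a` of `∫^x j x ⊗ p(a, x, c)`. -/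
noncomputable def actUR (a a' c : A) : unitR p j a' c ⊗ (a ⟶[V] a') ⟶ unitR p j a c :=
  act ((ker₂ofFst p c).comp V (tenR A j)) (op a') (op a)

variable {p j}

@[simp]
theorem actUL_co {a b b' c : A} (t : Elem l (j.obj a)) (r : Elem l (ker p a b' c))
    (u : Elem l (b ⟶[V] b')) : actUL p j b b' c ⋆ coUL p j t r ⊠ u = coUL p j t (pact₂ p r u) :=
  (smul_comp (ker₁ofSnd p c) (tenR A j) (a := op b') (b := op b) _ u).trans
    ((smul_tenR (M := j) (N := ker₁ p b' c) (N' := ker₁ p b c) t r _).trans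
    (congrArg (fun z => co (M := j) (N := ker₁ p b c) t z) (evl_ker₁ofSnd r u)))

@[simp]
theorem actUR_co {a a' b c : A} (t : Elem l (j.obj b)) (r : Elem l (ker p a' b c))
    (u : Elem l (a ⟶[V] a')) : actUR p j a a' c ⋆ coUR p j t r ⊠ u = coUR p j t (pact₁ p r u) :=
  (smul_comp (ker₂ofFst p c) (tenR A j) (a := op a') (b := op a) _ u).trans
    ((smul_tenR (M := j) (N := ker₂ p a' c) (N' := ker₂ p a c) t r _).trans
    (congrArg (fun z => co (M := j) (N := ker₂ p a c) t z) (evl_ker₂ofFst r u)))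

theorem smul_unitL {a b c c' : A} (t : Elem l (j.obj a)) (r : Elem l (ker p a b c))
    (u : Elem l (c ⟶[V] c')) : smul ((ker₁ofThd p b).comp V (tenR A j)) (a := c) (b := c')
      (coUL p j t r) u = coUL p j t (pact₃ p r u) :=
  (smul_comp (ker₁ofThd p b) (tenR A j) _ u).trans
    ((smul_tenR (M := j) (N := ker₁ p b c) (N' := ker₁ p b c') t r _).trans
    (congrArg (fun z => co (M := j) (N := ker₁ p b c') t z) (evl_ker₁ofThd r u)))

theorem smul_unitR {a b c c' : A} (t : Elem l (j.obj b)) (r : Elem l (ker p a b c))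
    (u : Elem l (c ⟶[V] c')) : smul ((ker₂ofThd p a).comp V (tenR A j)) (a := c) (b := c')
      (coUR p j t r) u = coUR p j t (pact₃ p r u) :=
  (smul_comp (ker₂ofThd p a) (tenR A j) _ u).trans
    ((smul_tenR (M := j) (N := ker₂ p a c) (N' := ker₂ p a c') t r _).trans
    (congrArg (fun z => co (M := j) (N := ker₂ p a c') t z) (evl_ker₂ofThd r u)))

theorem coUL_smul {a a' b c : A} (t : Elem l (j.obj a)) (u : Elem l (a ⟶[V] a'))
    (r : Elem l (ker p a' b c)) : coUL p j (smul j t u) r = coUL p j t (pact₁ p r u) :=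
  co_smul (M := j) (N := ker₁ p b c) t u r

theorem coUR_smul {a b b' c : A} (t : Elem l (j.obj b)) (u : Elem l (b ⟶[V] b'))
    (r : Elem l (ker p a b' c)) : coUR p j (smul j t u) r = coUR p j t (pact₂ p r u) :=
  co_smul (M := j) (N := ker₂ p a c) t u r

variable (p j) in
/-- The coprojections of `∫^x j x ⊗ p(x, b, c)`. -/
noncomputable def ιUL (a b c : A) : j.obj a ⊗ ker p a b c ⟶ unitL p j b c := coι j (ker₁ p b c) a

variable (p j) in
/-- The coprojections of `∫^x j x ⊗ p(a, x, c)`. -/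
noncomputable def ιUR (a b c : A) : j.obj b ⊗ ker p a b c ⟶ unitR p j a c := coι j (ker₂ p a c) b

@[simp]
theorem ιUL_app {a b c : A} (t : Elem l (j.obj a)) (r : Elem l (ker p a b c)) :
    ιUL p j a b c ⋆ t ⊠ r = coUL p j t r := rfl

@[simp]
theorem ιUR_app {a b c : A} (t : Elem l (j.obj b)) (r : Elem l (ker p a b c)) :
    ιUR p j a b c ⋆ t ⊠ r = coUR p j t r := rfl

theorem coUL_ext₁ {b c : A} {X Z : V} {m n : X ⊗ unitL p j b c ⟶ Z}
    (h : ∀ (l : List V) (a : A) (x : Elem l X) (t : Elem l (j.obj a)) (r : Elem l (ker p a b c)),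
      m ⋆ x ⊠ coUL p j t r = n ⋆ x ⊠ coUL p j t r) : m = n :=
  co_ext_elem₁ (M := j) (N := ker₁ p b c) fun l a x t r => h l a x t r

theorem coUL_ext₂ {b c : A} {X Y Z : V} {m n : X ⊗ Y ⊗ unitL p j b c ⟶ Z}
    (h : ∀ (l : List V) (a : A) (x : Elem l X) (y : Elem l Y) (t : Elem l (j.obj a))
      (r : Elem l (ker p a b c)), m ⋆ x ⊠ y ⊠ coUL p j t r = n ⋆ x ⊠ y ⊠ coUL p j t r) : m = n :=
  co_ext_elem₂ (M := j) (N := ker₁ p b c) fun l a x y t r => h l a x y t r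

theorem coUL_exists_desc {b c : A} {X Z : V}
    (k : ∀ a, X ⊗ j.obj a ⊗ ker p a b c ⟶ Z)
    (hk : ∀ (l : List V) (a a' : A) (x : Elem l X) (t : Elem l (j.obj a))
      (u : Elem l (a ⟶[V] a')) (r : Elem l (ker p a' b c)),
      k a ⋆ x ⊠ t ⊠ pact₁ p r u = k a' ⋆ x ⊠ smul j t u ⊠ r) :
    ∃ m : X ⊗ unitL p j b c ⟶ Z, ∀ (l : List V) (a : A) (x : Elem l X) (t : Elem l (j.obj a))
      (r : Elem l (ker p a b c)), m ⋆ x ⊠ coUL p j t r = k a ⋆ x ⊠ t ⊠ r :=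
  ⟨coDescLeft (M := j) (N := ker₁ p b c) k fun l a a' x t u r => hk l a a' x t u r,
    fun _ _ x t r => coDescLeft_app (M := j) (N := ker₁ p b c) k _ x t r⟩

theorem coUR_ext₁ {a c : A} {X Z : V} {m n : X ⊗ unitR p j a c ⟶ Z}
    (h : ∀ (l : List V) (b : A) (x : Elem l X) (t : Elem l (j.obj b)) (r : Elem l (ker p a b c)),
      m ⋆ x ⊠ coUR p j t r = n ⋆ x ⊠ coUR p j t r) : m = n :=
  co_ext_elem₁ (M := j) (N := ker₂ p a c) fun l b x t r => h l b x t r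

theorem coUR_ext₂ {a c : A} {X Y Z : V} {m n : X ⊗ Y ⊗ unitR p j a c ⟶ Z}
    (h : ∀ (l : List V) (b : A) (x : Elem l X) (y : Elem l Y) (t : Elem l (j.obj b))
      (r : Elem l (ker p a b c)), m ⋆ x ⊠ y ⊠ coUR p j t r = n ⋆ x ⊠ y ⊠ coUR p j t r) : m = n :=
  co_ext_elem₂ (M := j) (N := ker₂ p a c) fun l b x y t r => h l b x y t r

theorem coUR_exists_desc {a c : A} {X Z : V}
    (k : ∀ b, X ⊗ j.obj b ⊗ ker p a b c ⟶ Z)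
    (hk : ∀ (l : List V) (b b' : A) (x : Elem l X) (t : Elem l (j.obj b))
      (u : Elem l (b ⟶[V] b')) (r : Elem l (ker p a b' c)),
      k b ⋆ x ⊠ t ⊠ pact₂ p r u = k b' ⋆ x ⊠ smul j t u ⊠ r) :
    ∃ m : X ⊗ unitR p j a c ⟶ Z, ∀ (l : List V) (b : A) (x : Elem l X) (t : Elem l (j.obj b))
      (r : Elem l (ker p a b c)), m ⋆ x ⊠ coUR p j t r = k b ⋆ x ⊠ t ⊠ r :=
  ⟨coDescLeft (M := j) (N := ker₂ p a c) k fun l b b' x t u r => hk l b b' x t u r,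
    fun _ _ x t r => coDescLeft_app (M := j) (N := ker₂ p a c) k _ x t r⟩
end

namespace Promonoidal
variable (P : Promonoidal V A)

theorem assoc_hom_act₁ {a a' b c d : A} (w : Elem l (assocL P.p a' b c d))
    (u : Elem l (a ⟶[V] a')) :
    (P.assoc a b c d).hom ⋆ actL₁ P.p a a' b c d ⋆ w ⊠ u =
      actR₁ P.p a a' b c d ⋆ ((P.assoc a' b c d).hom ⋆ w) ⊠ u :=
  isNatural_iff.1 (P.assoc_natural₁ b c d) l (op a') (op a) w u

/-- The inverse of a natural isomorphism is natural. It is needed in the first three variables only,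
those over which the triple convolution is a coend. -/
theorem assoc_inv_act₁ {a a' b c d : A} (w : Elem l (assocR P.p a' b c d))
    (u : Elem l (a ⟶[V] a')) :
    (P.assoc a b c d).inv ⋆ actR₁ P.p a a' b c d ⋆ w ⊠ u =
      actL₁ P.p a a' b c d ⋆ ((P.assoc a' b c d).inv ⋆ w) ⊠ u := by
  have h := P.assoc_hom_act₁ ((P.assoc a' b c d).inv ⋆ w) u
  rw [inv_hom_app] at h
  rw [← h, hom_inv_app]

theorem assoc_hom_act₂ {a b b' c d : A} (w : Elem l (assocL P.p a b' c d))
    (u : Elem l (b ⟶[V] b')) :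
    (P.assoc a b c d).hom ⋆ actL₂ P.p a b b' c d ⋆ w ⊠ u =
      actR₂ P.p a b b' c d ⋆ ((P.assoc a b' c d).hom ⋆ w) ⊠ u :=
  isNatural_iff.1 (P.assoc_natural₂ a c d) l (op b') (op b) w u

theorem assoc_inv_act₂ {a b b' c d : A} (w : Elem l (assocR P.p a b' c d))
    (u : Elem l (b ⟶[V] b')) :
    (P.assoc a b c d).inv ⋆ actR₂ P.p a b b' c d ⋆ w ⊠ u =
      actL₂ P.p a b b' c d ⋆ ((P.assoc a b' c d).inv ⋆ w) ⊠ u := by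
  have h := P.assoc_hom_act₂ ((P.assoc a b' c d).inv ⋆ w) u
  rw [inv_hom_app] at h
  rw [← h, hom_inv_app]

theorem assoc_hom_act₃ {a b c c' d : A} (w : Elem l (assocL P.p a b c' d))
    (u : Elem l (c ⟶[V] c')) :
    (P.assoc a b c d).hom ⋆ actL₃ P.p a b c c' d ⋆ w ⊠ u =
      actR₃ P.p a b c c' d ⋆ ((P.assoc a b c' d).hom ⋆ w) ⊠ u :=
  isNatural_iff.1 (P.assoc_natural₃ a b d) l (op c') (op c) w u

theorem assoc_inv_act₃ {a b c c' d : A} (w : Elem l (assocR P.p a b c' d))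
    (u : Elem l (c ⟶[V] c')) :
    (P.assoc a b c d).inv ⋆ actR₃ P.p a b c c' d ⋆ w ⊠ u =
      actL₃ P.p a b c c' d ⋆ ((P.assoc a b c' d).inv ⋆ w) ⊠ u := by
  have h := P.assoc_hom_act₃ ((P.assoc a b c' d).inv ⋆ w) u
  rw [inv_hom_app] at h
  rw [← h, hom_inv_app]

theorem assoc_hom_act₄ {a b c d d' : A} (w : Elem l (assocL P.p a b c d))
    (u : Elem l (d ⟶[V] d')) :
    (P.assoc a b c d').hom ⋆ actL₄ P.p a b c d d' ⋆ w ⊠ u =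
      actR₄ P.p a b c d d' ⋆ ((P.assoc a b c d).hom ⋆ w) ⊠ u :=
  isNatural_iff.1 (P.assoc_natural₄ a b c) l d d' w u

theorem leftUnit_act {b b' c : A} (w : Elem l (unitL P.p P.j b' c)) (u : Elem l (b ⟶[V] b')) :
    (P.leftUnit b c).hom ⋆ actUL P.p P.j b b' c ⋆ w ⊠ u = cmp u ((P.leftUnit b' c).hom ⋆ w) :=
  (isNatural_iff.1 (P.leftUnit_natural₁ c) l (op b') (op b) w u).trans (opsmul_yo _ _)

theorem rightUnit_act {a a' c : A} (w : Elem l (unitR P.p P.j a' c)) (u : Elem l (a ⟶[V] a')) :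
    (P.rightUnit a c).hom ⋆ actUR P.p P.j a a' c ⋆ w ⊠ u = cmp u ((P.rightUnit a' c).hom ⋆ w) :=
  (isNatural_iff.1 (P.rightUnit_natural₁ c) l (op a') (op a) w u).trans (opsmul_yo _ _)

theorem leftUnit_pact₂ {a b b' c : A} (t : Elem l (P.j.obj a)) (r : Elem l (ker P.p a b' c))
    (u : Elem l (b ⟶[V] b')) : (P.leftUnit b c).hom ⋆ coUL P.p P.j t (pact₂ P.p r u) =
      cmp u ((P.leftUnit b' c).hom ⋆ coUL P.p P.j t r) := by
  rw [← actUL_co, leftUnit_act]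

theorem leftUnit_pact₃ {a b c c' : A} (t : Elem l (P.j.obj a)) (r : Elem l (ker P.p a b c))
    (u : Elem l (c ⟶[V] c')) : (P.leftUnit b c').hom ⋆ coUL P.p P.j t (pact₃ P.p r u) =
      cmp ((P.leftUnit b c).hom ⋆ coUL P.p P.j t r) u := by
  rw [← smul_unitL]
  exact (isNatural_iff.1 (P.leftUnit_natural₂ b) l c c' _ u).trans (smul_coyo _ _)

theorem rightUnit_pact₁ {a a' b c : A} (t : Elem l (P.j.obj b)) (r : Elem l (ker P.p a' b c))
    (u : Elem l (a ⟶[V] a')) : (P.rightUnit a c).hom ⋆ coUR P.p P.j t (pact₁ P.p r u) =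
      cmp u ((P.rightUnit a' c).hom ⋆ coUR P.p P.j t r) := by
  rw [← actUR_co, rightUnit_act]

theorem rightUnit_pact₃ {a b c c' : A} (t : Elem l (P.j.obj b)) (r : Elem l (ker P.p a b c))
    (u : Elem l (c ⟶[V] c')) : (P.rightUnit a c').hom ⋆ coUR P.p P.j t (pact₃ P.p r u) =
      cmp ((P.rightUnit a c).hom ⋆ coUR P.p P.j t r) u := by
  rw [← smul_unitR]
  exact (isNatural_iff.1 (P.rightUnit_natural₂ a) l c c' _ u).trans (smul_coyo _ _)

/-- Used with `s` an identity: the inverse of the unit isomorphism is then determined by its value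
at identities, as in the Yoneda lemma. -/
theorem leftUnit_inv_cmp {b b' c : A} (s : Elem l (b' ⟶[V] c)) (u : Elem l (b ⟶[V] b')) :
    (P.leftUnit b c).inv ⋆ cmp u s = actUL P.p P.j b b' c ⋆ ((P.leftUnit b' c).inv ⋆ s) ⊠ u := by
  have h := P.leftUnit_act ((P.leftUnit b' c).inv ⋆ s) u
  rw [inv_hom_app] at h
  rw [← h, hom_inv_app]

theorem rightUnit_inv_cmp {a a' c : A} (s : Elem l (a' ⟶[V] c)) (u : Elem l (a ⟶[V] a')) :
    (P.rightUnit a c).inv ⋆ cmp u s = actUR P.p P.j a a' c ⋆ ((P.rightUnit a' c).inv ⋆ s) ⊠ u := by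
  have h := P.rightUnit_act ((P.rightUnit a' c).inv ⋆ s) u
  rw [inv_hom_app] at h
  rw [← h, hom_inv_app]

end Promonoidal
end PromonoidalElements
end StarAut

namespace StarAut
open Elem

/-! ### Triple Day convolutions -/
section TripleConvolution
variable {V : Type u} [Category.{v} V] [MonoidalCategory V] [SymmetricCategory V]
  [MonoidalClosed V] [HasLimits V] [HasColimits V] {A : Type v} [EnrichedCategory V A]
  {l : List V} {p : EnrichedFunctor V (TensorCat Aᵒᵖ (TensorCat Aᵒᵖ A)) V}

variable (p) in
/-- The coprojections of `∫^x p(a, b, x) ⊗ p(x, c, d)`. -/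
noncomputable def ιL (a b c d x : A) : ker p a b x ⊗ ker p x c d ⟶ assocL p a b c d :=
  coι (ker₃ p a b) (ker₁ p c d) x

variable (p) in
/-- The coprojections of `∫^y p(b, c, y) ⊗ p(a, y, d)`. -/
noncomputable def ιR (a b c d y : A) : ker p b c y ⊗ ker p a y d ⟶ assocR p a b c d :=
  coι (ker₃ p b c) (ker₂ p a d) y

@[simp]
theorem ιL_app {a b c d x : A} (r : Elem l (ker p a b x)) (s : Elem l (ker p x c d)) :
    ιL p a b c d x ⋆ r ⊠ s = coL p r s := rfl

@[simp]
theorem ιR_app {a b c d y : A} (r : Elem l (ker p b c y)) (s : Elem l (ker p a y d)) :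
    ιR p a b c d y ⋆ r ⊠ s = coR p r s := rfl

namespace DayData
variable (D : DayData p) {f g h : EnrichedFunctor V A V}

/-- The element of `∫^{a,b} f a ⊗ g b ⊗ p(a, b, c)` given by elements of the factors. -/
def el {a b c : A} (x : Elem l (f.obj a)) (y : Elem l (g.obj b)) (r : Elem l (ker p a b c)) :
    Elem l ((D.T.obj ⟨f, g⟩).obj c) := D.ι f g a b c ⋆ x ⊠ y ⊠ r

@[simp]
theorem ι_app {a b c : A} (x : Elem l (f.obj a)) (y : Elem l (g.obj b))
    (r : Elem l (ker p a b c)) : D.ι f g a b c ⋆ x ⊠ y ⊠ r = D.el x y r := rfl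

theorem smul_el {a b c c' : A} (x : Elem l (f.obj a)) (y : Elem l (g.obj b))
    (r : Elem l (ker p a b c)) (s : Elem l (c ⟶[V] c')) :
    smul (D.T.obj ⟨f, g⟩) (D.el x y r) s = D.el x y (pact₃ p r s) := D.smul_ι x y r s

theorem evl_el_fst {f' : EnrichedFunctor V A V} {a b c : A} (x : Elem l (f.obj a))
    (y : Elem l (g.obj b)) (r : Elem l (ker p a b c)) (t : Elem l (f ⟶[V] f')) :
    evl (F := D.T.obj ⟨f, g⟩) (G := D.T.obj ⟨f', g⟩) (D.el x y r) (fmap (partL D.T g) t) =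
      D.el (evl x t) y r := D.evl_ι_fst x y r t

theorem evl_el_snd {g' : EnrichedFunctor V A V} {a b c : A} (x : Elem l (f.obj a))
    (y : Elem l (g.obj b)) (r : Elem l (ker p a b c)) (t : Elem l (g ⟶[V] g')) :
    evl (F := D.T.obj ⟨f, g⟩) (G := D.T.obj ⟨f, g'⟩) (D.el x y r) (fmap (partR D.T f) t) =
      D.el x (evl y t) r := D.evl_ι_snd x y r t

theorem el_pact₁ {a a' b c : A} (x : Elem l (f.obj a)) (y : Elem l (g.obj b))
    (r : Elem l (ker p a' b c)) (s : Elem l (a ⟶[V] a')) :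
    D.el x y (pact₁ p r s) = D.el (smul f x s) y r := (D.isDayCoend f g c).ι_pact₁ x y r s

theorem el_pact₂ {a b b' c : A} (x : Elem l (f.obj a)) (y : Elem l (g.obj b))
    (r : Elem l (ker p a b' c)) (s : Elem l (b ⟶[V] b')) :
    D.el x y (pact₂ p r s) = D.el x (smul g y s) r := (D.isDayCoend f g c).ι_pact₂ x y r s

/-- The outer coend is removed first. The factor `(f * g) i` it leaves behind is itself a coend
tensored with objects, so the inner extensionality applies. -/
theorem tripleLeft_ext {d : A} {H Z : V}
    {m n : (D.T.obj ⟨D.T.obj ⟨f, g⟩, h⟩).obj d ⊗ H ⟶ Z}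
    (hmn : ∀ (l : List V) (a b c i : A) (x : Elem l (f.obj a)) (y : Elem l (g.obj b))
      (z : Elem l (h.obj c)) (r : Elem l (ker p a b i)) (s : Elem l (ker p i c d)) (t : Elem l H),
      m ⋆ D.el (D.el x y r) z s ⊠ t = n ⋆ D.el (D.el x y r) z s ⊠ t) : m = n := by
  apply (D.isDayCoend _ h d).hom_ext_right
  intro i c
  rw [← cancel_epi (α_ _ _ _).inv, ← cancel_epi (_ ◁ (α_ _ _ _).inv)]
  apply (D.isDayCoend f g i).elem_ext_right₃
  intro l a b x y r z s t
  simpa using hmn l a b c i x y z r s t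

theorem tripleLeft_ext₂ {d : A} {H H' Z : V}
    {m n : (D.T.obj ⟨D.T.obj ⟨f, g⟩, h⟩).obj d ⊗ H ⊗ H' ⟶ Z}
    (hmn : ∀ (l : List V) (a b c i : A) (x : Elem l (f.obj a)) (y : Elem l (g.obj b))
      (z : Elem l (h.obj c)) (r : Elem l (ker p a b i)) (s : Elem l (ker p i c d)) (t : Elem l H)
      (t' : Elem l H'),
      m ⋆ D.el (D.el x y r) z s ⊠ t ⊠ t' = n ⋆ D.el (D.el x y r) z s ⊠ t ⊠ t') : m = n := by
  apply (D.isDayCoend _ h d).hom_ext_right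
  intro i c
  rw [← cancel_epi (α_ _ _ _).inv, ← cancel_epi (_ ◁ (α_ _ _ _).inv)]
  apply (D.isDayCoend f g i).elem_ext_right₄
  intro l a b x y r z s t t'
  simpa using hmn l a b c i x y z r s t t'

theorem tripleRight_ext {d : A} {H Z : V}
    {m n : (D.T.obj ⟨f, D.T.obj ⟨g, h⟩⟩).obj d ⊗ H ⟶ Z}
    (hmn : ∀ (l : List V) (a b c i : A) (x : Elem l (f.obj a)) (y : Elem l (g.obj b))
      (z : Elem l (h.obj c)) (r : Elem l (ker p b c i)) (s : Elem l (ker p a i d)) (t : Elem l H),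
      m ⋆ D.el x (D.el y z r) s ⊠ t = n ⋆ D.el x (D.el y z r) s ⊠ t) : m = n := by
  apply (D.isDayCoend f _ d).hom_ext_right
  intro a i
  rw [← cancel_epi (α_ _ _ _).inv, ← cancel_epi (_ ◁ (α_ _ _ _).inv),
    ← cancel_epi (swapLeft _ _ _)]
  apply (D.isDayCoend g h i).elem_ext_right₃
  intro l b c y z r x s t
  simpa using hmn l a b c i x y z r s t

theorem tripleLeft_hom_ext {d : A} {Z : V} {m n : (D.T.obj ⟨D.T.obj ⟨f, g⟩, h⟩).obj d ⟶ Z}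
    (hmn : ∀ (l : List V) (a b c i : A) (x : Elem l (f.obj a)) (y : Elem l (g.obj b))
      (z : Elem l (h.obj c)) (r : Elem l (ker p a b i)) (s : Elem l (ker p i c d)),
      m ⋆ D.el (D.el x y r) z s = n ⋆ D.el (D.el x y r) z s) : m = n := by
  rw [← cancel_epi (ρ_ _).hom, ← rightUnitor_naturality, ← rightUnitor_naturality]
  congr 1
  apply D.tripleLeft_ext
  intro l a b c i x y z r s t
  rw [whiskerRight_app, whiskerRight_app, hmn]

theorem tripleRight_hom_ext {d : A} {Z : V} {m n : (D.T.obj ⟨f, D.T.obj ⟨g, h⟩⟩).obj d ⟶ Z}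
    (hmn : ∀ (l : List V) (a b c i : A) (x : Elem l (f.obj a)) (y : Elem l (g.obj b))
      (z : Elem l (h.obj c)) (r : Elem l (ker p b c i)) (s : Elem l (ker p a i d)),
      m ⋆ D.el x (D.el y z r) s = n ⋆ D.el x (D.el y z r) s) : m = n := by
  rw [← cancel_epi (ρ_ _).hom, ← rightUnitor_naturality, ← rightUnitor_naturality]
  congr 1
  apply D.tripleRight_ext
  intro l a b c i x y z r s t
  rw [whiskerRight_app, whiskerRight_app, hmn]

/-- Presents `(f * g) * h` at `d` as a coend over `a`, `b`, `c` of `f a ⊗ g b ⊗ h c ⊗ assocL p a b c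
d`. The intermediate object `i` needs no hypothesis: `k` sees the two kernels only through their
class in `assocL`, which is already balanced over `i`. -/
theorem tripleLeft_exists_desc {d : A} {Z : V}
    (k : ∀ a b c, f.obj a ⊗ g.obj b ⊗ h.obj c ⊗ assocL p a b c d ⟶ Z)
    (h₁ : ∀ (l : List V) (a a' b c : A) (x : Elem l (f.obj a)) (y : Elem l (g.obj b))
      (z : Elem l (h.obj c)) (w : Elem l (assocL p a' b c d)) (u : Elem l (a ⟶[V] a')),
      k a b c ⋆ x ⊠ y ⊠ z ⊠ (actL₁ p a a' b c d ⋆ w ⊠ u) = k a' b c ⋆ smul f x u ⊠ y ⊠ z ⊠ w)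
    (h₂ : ∀ (l : List V) (a b b' c : A) (x : Elem l (f.obj a)) (y : Elem l (g.obj b))
      (z : Elem l (h.obj c)) (w : Elem l (assocL p a b' c d)) (u : Elem l (b ⟶[V] b')),
      k a b c ⋆ x ⊠ y ⊠ z ⊠ (actL₂ p a b b' c d ⋆ w ⊠ u) = k a b' c ⋆ x ⊠ smul g y u ⊠ z ⊠ w)
    (h₃ : ∀ (l : List V) (a b c c' : A) (x : Elem l (f.obj a)) (y : Elem l (g.obj b))
      (z : Elem l (h.obj c)) (w : Elem l (assocL p a b c' d)) (u : Elem l (c ⟶[V] c')),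
      k a b c ⋆ x ⊠ y ⊠ z ⊠ (actL₃ p a b c c' d ⋆ w ⊠ u) = k a b c' ⋆ x ⊠ y ⊠ smul h z u ⊠ w) :
    ∃ m : (D.T.obj ⟨D.T.obj ⟨f, g⟩, h⟩).obj d ⟶ Z, ∀ (l : List V) (a b c i : A)
      (x : Elem l (f.obj a)) (y : Elem l (g.obj b)) (z : Elem l (h.obj c))
      (r : Elem l (ker p a b i)) (s : Elem l (ker p i c d)),
      m ⋆ D.el (D.el x y r) z s = k a b c ⋆ x ⊠ y ⊠ z ⊠ coL p r s := by
  -- Descent through the inner convolution for fixed `i` and `c`, using balancing in `a` and `b`;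
  -- balancing in `c` and in `i` is left for the outer one.
  have h₀ : ∀ i c, ∃ m : (D.T.obj ⟨f, g⟩).obj i ⊗ (h.obj c ⊗ ker p i c d) ⟶ Z,
      ∀ (l : List V) (a b : A) (x : Elem l (f.obj a)) (y : Elem l (g.obj b))
      (r : Elem l (ker p a b i)) (z : Elem l (h.obj c)) (s : Elem l (ker p i c d)),
      m ⋆ D.el x y r ⊠ z ⊠ s = k a b c ⋆ x ⊠ y ⊠ z ⊠ coL p r s := by
    intro i c
    obtain ⟨m, hm⟩ := (D.isDayCoend f g i).exists_elem_desc₂ (fun a b => (α_ _ _ _).hom ≫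
      f.obj a ◁ ((α_ _ _ _).hom ≫ g.obj b ◁ (swapLeft _ _ _ ≫ h.obj c ◁ ιL p a b c d i)) ≫
        k a b c) (by
        intro l a a' b x y r u z s
        simpa using h₁ l a a' b c x y z (coL p r s) u) (by
        intro l a b b' x y r u z s
        simpa using h₂ l a b b' c x y z (coL p r s) u)
    refine ⟨m, fun l a b x y r z s => ?_⟩
    simpa using hm l a b x y r z s
  choose m hm using h₀
  obtain ⟨n, hn, -⟩ := (D.isDayCoend (D.T.obj ⟨f, g⟩) h d).universal m (by
    refine isDayCowedge_iff.2 ⟨fun l i i' c e z s u => ?_, fun l i c c' e z s u => ?_⟩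
    · have he : _ ◁ _ ◁ kact₁ p i i' c d ≫ m i c =
          _ ◁ (_ ◁ (β_ _ _).hom ≫ swapLeft _ _ _) ≫ (α_ _ _ _).inv ≫
            act (D.T.obj ⟨f, g⟩) i i' ▷ _ ≫ m i' c := by
        apply (D.isDayCoend f g i).elem_ext_right₃
        intro l a b x y r z s u
        simp [smul_el, hm, coL_smul]
      simpa using app_congr he (e ⊠ z ⊠ s ⊠ u)
    · have he : _ ◁ _ ◁ kact₂ p i c c' d ≫ m i c =
          _ ◁ (_ ◁ (β_ _ _).hom ≫ (α_ _ _ _).inv ≫ act h c c' ▷ _) ≫ m i c' := by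
        apply (D.isDayCoend f g i).elem_ext_right₃
        intro l a b x y r z s u
        simpa [hm] using h₃ l a b c c' x y z (coL p r s) u
      simpa using app_congr he (e ⊠ z ⊠ s ⊠ u))
  refine ⟨n, fun l a b c i x y z r s => ?_⟩
  rw [← hm, ← hn, comp_app, ι_app]

theorem tripleRight_exists_desc {d : A} {Z : V}
    (k : ∀ a b c, f.obj a ⊗ g.obj b ⊗ h.obj c ⊗ assocR p a b c d ⟶ Z)
    (h₁ : ∀ (l : List V) (a a' b c : A) (x : Elem l (f.obj a)) (y : Elem l (g.obj b))
      (z : Elem l (h.obj c)) (w : Elem l (assocR p a' b c d)) (u : Elem l (a ⟶[V] a')),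
      k a b c ⋆ x ⊠ y ⊠ z ⊠ (actR₁ p a a' b c d ⋆ w ⊠ u) = k a' b c ⋆ smul f x u ⊠ y ⊠ z ⊠ w)
    (h₂ : ∀ (l : List V) (a b b' c : A) (x : Elem l (f.obj a)) (y : Elem l (g.obj b))
      (z : Elem l (h.obj c)) (w : Elem l (assocR p a b' c d)) (u : Elem l (b ⟶[V] b')),
      k a b c ⋆ x ⊠ y ⊠ z ⊠ (actR₂ p a b b' c d ⋆ w ⊠ u) = k a b' c ⋆ x ⊠ smul g y u ⊠ z ⊠ w)
    (h₃ : ∀ (l : List V) (a b c c' : A) (x : Elem l (f.obj a)) (y : Elem l (g.obj b))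
      (z : Elem l (h.obj c)) (w : Elem l (assocR p a b c' d)) (u : Elem l (c ⟶[V] c')),
      k a b c ⋆ x ⊠ y ⊠ z ⊠ (actR₃ p a b c c' d ⋆ w ⊠ u) = k a b c' ⋆ x ⊠ y ⊠ smul h z u ⊠ w) :
    ∃ m : (D.T.obj ⟨f, D.T.obj ⟨g, h⟩⟩).obj d ⟶ Z, ∀ (l : List V) (a b c i : A)
      (x : Elem l (f.obj a)) (y : Elem l (g.obj b)) (z : Elem l (h.obj c))
      (r : Elem l (ker p b c i)) (s : Elem l (ker p a i d)),
      m ⋆ D.el x (D.el y z r) s = k a b c ⋆ x ⊠ y ⊠ z ⊠ coR p r s := by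
  have h₀ : ∀ a i, ∃ m : (D.T.obj ⟨g, h⟩).obj i ⊗ (f.obj a ⊗ ker p a i d) ⟶ Z,
      ∀ (l : List V) (b c : A) (y : Elem l (g.obj b)) (z : Elem l (h.obj c))
      (r : Elem l (ker p b c i)) (x : Elem l (f.obj a)) (s : Elem l (ker p a i d)),
      m ⋆ D.el y z r ⊠ x ⊠ s = k a b c ⋆ x ⊠ y ⊠ z ⊠ coR p r s := by
    intro a i
    obtain ⟨m, hm⟩ := (D.isDayCoend g h i).exists_elem_desc₂ (fun b c => swapLeft _ _ _ ≫
      f.obj a ◁ ((α_ _ _ _).hom ≫ g.obj b ◁ ((α_ _ _ _).hom ≫ h.obj c ◁ ιR p a b c d i)) ≫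
        k a b c) (by
        intro l b b' c y z r u x s
        simpa using h₂ l a b b' c x y z (coR p r s) u) (by
        intro l b c c' y z r u x s
        simpa using h₃ l a b c c' x y z (coR p r s) u)
    refine ⟨m, fun l b c y z r x s => ?_⟩
    simpa using hm l b c y z r x s
  choose m hm using h₀
  obtain ⟨n, hn, -⟩ := (D.isDayCoend f (D.T.obj ⟨g, h⟩) d).universal
    (fun a i => swapLeft _ _ _ ≫ m a i) (by
    refine isDayCowedge_iff.2 ⟨fun l a a' i x e s u => ?_, fun l a i i' x e s u => ?_⟩
    · have he : _ ◁ _ ◁ kact₁ p a a' i d ≫ m a i =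
          _ ◁ (_ ◁ (β_ _ _).hom ≫ (α_ _ _ _).inv ≫ act f a a' ▷ _) ≫ m a' i := by
        apply (D.isDayCoend g h i).elem_ext_right₃
        intro l b c y z r x s u
        simpa [hm] using h₁ l a a' b c x y z (coR p r s) u
      simpa using app_congr he (e ⊠ x ⊠ s ⊠ u)
    · have he : _ ◁ _ ◁ kact₂ p a i i' d ≫ m a i =
          _ ◁ (_ ◁ (β_ _ _).hom ≫ swapLeft _ _ _) ≫ (α_ _ _ _).inv ≫
            act (D.T.obj ⟨g, h⟩) i i' ▷ _ ≫ m a i' := by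
        apply (D.isDayCoend g h i).elem_ext_right₃
        intro l b c y z r x s u
        simp [smul_el, hm, coR_smul]
      simpa using app_congr he (e ⊠ x ⊠ s ⊠ u))
  refine ⟨n, fun l a b c i x y z r s => ?_⟩
  rw [← hm]
  simpa using app_congr (hn a i) (x ⊠ D.el y z r ⊠ s)

end DayData
end TripleConvolution
end StarAut

namespace StarAut
open Elem

/-! ### Dinatural families into triple convolutions -/
section TripleFamilies
variable {V : Type u} [Category.{v} V] [MonoidalCategory V] [SymmetricCategory V]
  [MonoidalClosed V] [HasLimits V] [HasColimits V] {A : Type v} [EnrichedCategory V A]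
  {l : List V} {p : EnrichedFunctor V (TensorCat Aᵒᵖ (TensorCat Aᵒᵖ A)) V}

namespace DayData
variable (D : DayData p)

/-- The effect of the convolution on hom-objects in the first variable. -/
noncomputable def mapL (f f' g : EnrichedFunctor V A V) :
    (f ⟶[V] f') ⟶ (D.T.obj ⟨f, g⟩ ⟶[V] D.T.obj ⟨f', g⟩) := (partL D.T g).map f f'

/-- The effect of the convolution on hom-objects in the second variable. -/
noncomputable def mapR (f g g' : EnrichedFunctor V A V) :
    (g ⟶[V] g') ⟶ (D.T.obj ⟨f, g⟩ ⟶[V] D.T.obj ⟨f, g'⟩) := (partR D.T f).map g g'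

variable {f g h : EnrichedFunctor V A V}

theorem evl_mapL {f' : EnrichedFunctor V A V} {a b c : A} (x : Elem l (f.obj a))
    (y : Elem l (g.obj b)) (r : Elem l (ker p a b c)) (t : Elem l (f ⟶[V] f')) :
    evl (D.el x y r) (D.mapL f f' g ⋆ t) = D.el (evl x t) y r := D.evl_el_fst x y r t

theorem evl_mapR {g' : EnrichedFunctor V A V} {a b c : A} (x : Elem l (f.obj a))
    (y : Elem l (g.obj b)) (r : Elem l (ker p a b c)) (t : Elem l (g ⟶[V] g')) :
    evl (D.el x y r) (D.mapR f g g' ⋆ t) = D.el x (evl y t) r := D.evl_el_snd x y r t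

/-- The nested generators are balanced over the intermediate object `i`, since the action of `A` on
`g * h` is the one on the third variable of its kernel. They therefore depend only on the class of
the two kernels in `assocR`. -/
theorem exists_midR (f g h : EnrichedFunctor V A V) (a b c d : A) :
    ∃ m : f.obj a ⊗ g.obj b ⊗ h.obj c ⊗ assocR p a b c d ⟶ (D.T.obj ⟨f, D.T.obj ⟨g, h⟩⟩).obj d,
      ∀ (l : List V) (i : A) (x : Elem l (f.obj a)) (y : Elem l (g.obj b)) (z : Elem l (h.obj c))
        (r : Elem l (ker p b c i)) (s : Elem l (ker p a i d)),
        m ⋆ x ⊠ y ⊠ z ⊠ coR p r s = D.el x (D.el y z r) s := by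
  obtain ⟨m, hm⟩ := coR_exists_desc₃ (p := p) (a := a) (b := b) (c := c) (d := d)
    (X := f.obj a) (Y := g.obj b) (Z := h.obj c)
    (fun i => f.obj a ◁ (g.obj b ◁ (α_ _ _ _).inv ≫ (α_ _ _ _).inv ≫ D.ι g h b c i ▷ _) ≫
        D.ι f (D.T.obj ⟨g, h⟩) a i d) (by
      intro l i i' x y z r u s
      simp [D.el_pact₂, D.smul_el])
  refine ⟨m, fun l i x y z r s => ?_⟩
  simpa using hm l i x y z r s

/-- The family induced by the elements `el x (el y z r) s`. -/
noncomputable def midR (f g h : EnrichedFunctor V A V) (a b c d : A) :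
    f.obj a ⊗ g.obj b ⊗ h.obj c ⊗ assocR p a b c d ⟶ (D.T.obj ⟨f, D.T.obj ⟨g, h⟩⟩).obj d :=
  (D.exists_midR f g h a b c d).choose

@[simp]
theorem midR_co {a b c d i : A} (x : Elem l (f.obj a)) (y : Elem l (g.obj b))
    (z : Elem l (h.obj c)) (r : Elem l (ker p b c i)) (s : Elem l (ker p a i d)) :
    D.midR f g h a b c d ⋆ x ⊠ y ⊠ z ⊠ coR p r s = D.el x (D.el y z r) s :=
  (D.exists_midR f g h a b c d).choose_spec l i x y z r s

/-- With the next two lemmas: the family is dinatural in `a`, `b` and `c`. Here `w` is an arbitrary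
element of the coend, because the images of generators under the associativity of `p` are not
generators. -/
theorem midR_act₁ {a a' b c d : A} (x : Elem l (f.obj a)) (y : Elem l (g.obj b))
    (z : Elem l (h.obj c)) (w : Elem l (assocR p a' b c d)) (u : Elem l (a ⟶[V] a')) :
    D.midR f g h a b c d ⋆ x ⊠ y ⊠ z ⊠ (actR₁ p a a' b c d ⋆ w ⊠ u) =
      D.midR f g h a' b c d ⋆ smul f x u ⊠ y ⊠ z ⊠ w := by
  have e : f.obj a ◁ (swapLeft _ _ _ ≫ g.obj b ◁ (swapLeft _ _ _ ≫ h.obj c ◁ ((β_ _ _).hom ≫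
      actR₁ p a a' b c d))) ≫
      D.midR f g h a b c d = (α_ _ _ _).inv ≫ act f a a' ▷ _ ≫
        D.midR f g h a' b c d := by
    apply coR_ext₄
    intro l i x u y z r s
    simp [D.el_pact₁]
  simpa using app_congr e (x ⊠ u ⊠ y ⊠ z ⊠ w)

theorem midR_act₂ {a b b' c d : A} (x : Elem l (f.obj a)) (y : Elem l (g.obj b))
    (z : Elem l (h.obj c)) (w : Elem l (assocR p a b' c d)) (u : Elem l (b ⟶[V] b')) :
    D.midR f g h a b c d ⋆ x ⊠ y ⊠ z ⊠ (actR₂ p a b b' c d ⋆ w ⊠ u) =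
      D.midR f g h a b' c d ⋆ x ⊠ smul g y u ⊠ z ⊠ w := by
  have e : f.obj a ◁ g.obj b ◁ (swapLeft _ _ _ ≫ h.obj c ◁ ((β_ _ _).hom ≫ actR₂ p a b b' c d)) ≫
      D.midR f g h a b c d = f.obj a ◁ ((α_ _ _ _).inv ≫ act g b b' ▷ _) ≫
        D.midR f g h a b' c d := by
    apply coR_ext₄
    intro l i x y u z r s
    simp [D.el_pact₁]
  simpa using app_congr e (x ⊠ y ⊠ u ⊠ z ⊠ w)

theorem midR_act₃ {a b c c' d : A} (x : Elem l (f.obj a)) (y : Elem l (g.obj b))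
    (z : Elem l (h.obj c)) (w : Elem l (assocR p a b c' d)) (u : Elem l (c ⟶[V] c')) :
    D.midR f g h a b c d ⋆ x ⊠ y ⊠ z ⊠ (actR₃ p a b c c' d ⋆ w ⊠ u) =
      D.midR f g h a b c' d ⋆ x ⊠ y ⊠ smul h z u ⊠ w := by
  have e : f.obj a ◁ g.obj b ◁ h.obj c ◁ ((β_ _ _).hom ≫ actR₃ p a b c c' d) ≫
      D.midR f g h a b c d = f.obj a ◁ g.obj b ◁ ((α_ _ _ _).inv ≫ act h c c' ▷ _) ≫
        D.midR f g h a b c' d := by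
    apply coR_ext₄
    intro l i x y z u r s
    simp [D.el_pact₂]
  simpa using app_congr e (x ⊠ y ⊠ z ⊠ u ⊠ w)

theorem exists_midL (f g h : EnrichedFunctor V A V) (a b c d : A) :
    ∃ m : f.obj a ⊗ g.obj b ⊗ h.obj c ⊗ assocL p a b c d ⟶ (D.T.obj ⟨D.T.obj ⟨f, g⟩, h⟩).obj d,
      ∀ (l : List V) (i : A) (x : Elem l (f.obj a)) (y : Elem l (g.obj b)) (z : Elem l (h.obj c))
        (r : Elem l (ker p a b i)) (s : Elem l (ker p i c d)),
        m ⋆ x ⊠ y ⊠ z ⊠ coL p r s = D.el (D.el x y r) z s := by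
  obtain ⟨m, hm⟩ := coL_exists_desc₃ (p := p) (a := a) (b := b) (c := c) (d := d)
    (X := f.obj a) (Y := g.obj b) (Z := h.obj c)
    (fun i => f.obj a ◁ (g.obj b ◁ swapLeft _ _ _ ≫ (α_ _ _ _).inv) ≫ (α_ _ _ _).inv ≫
        D.ι f g a b i ▷ _ ≫ D.ι (D.T.obj ⟨f, g⟩) h i c d) (by
      intro l i i' x y z r u s
      simp [D.el_pact₁, D.smul_el])
  refine ⟨m, fun l i x y z r s => ?_⟩
  simpa using hm l i x y z r s

/-- The family induced by the elements `el (el x y r) z s`. -/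
noncomputable def midL (f g h : EnrichedFunctor V A V) (a b c d : A) :
    f.obj a ⊗ g.obj b ⊗ h.obj c ⊗ assocL p a b c d ⟶ (D.T.obj ⟨D.T.obj ⟨f, g⟩, h⟩).obj d :=
  (D.exists_midL f g h a b c d).choose

@[simp]
theorem midL_co {a b c d i : A} (x : Elem l (f.obj a)) (y : Elem l (g.obj b))
    (z : Elem l (h.obj c)) (r : Elem l (ker p a b i)) (s : Elem l (ker p i c d)) :
    D.midL f g h a b c d ⋆ x ⊠ y ⊠ z ⊠ coL p r s = D.el (D.el x y r) z s :=
  (D.exists_midL f g h a b c d).choose_spec l i x y z r s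

theorem midL_act₁ {a a' b c d : A} (x : Elem l (f.obj a)) (y : Elem l (g.obj b))
    (z : Elem l (h.obj c)) (w : Elem l (assocL p a' b c d)) (u : Elem l (a ⟶[V] a')) :
    D.midL f g h a b c d ⋆ x ⊠ y ⊠ z ⊠ (actL₁ p a a' b c d ⋆ w ⊠ u) =
      D.midL f g h a' b c d ⋆ smul f x u ⊠ y ⊠ z ⊠ w := by
  have e : f.obj a ◁ (swapLeft _ _ _ ≫ g.obj b ◁ (swapLeft _ _ _ ≫ h.obj c ◁ ((β_ _ _).hom ≫
      actL₁ p a a' b c d))) ≫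
      D.midL f g h a b c d = (α_ _ _ _).inv ≫ act f a a' ▷ _ ≫
        D.midL f g h a' b c d := by
    apply coL_ext₄
    intro l i x u y z r s
    simp [D.el_pact₁]
  simpa using app_congr e (x ⊠ u ⊠ y ⊠ z ⊠ w)

theorem midL_act₂ {a b b' c d : A} (x : Elem l (f.obj a)) (y : Elem l (g.obj b))
    (z : Elem l (h.obj c)) (w : Elem l (assocL p a b' c d)) (u : Elem l (b ⟶[V] b')) :
    D.midL f g h a b c d ⋆ x ⊠ y ⊠ z ⊠ (actL₂ p a b b' c d ⋆ w ⊠ u) =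
      D.midL f g h a b' c d ⋆ x ⊠ smul g y u ⊠ z ⊠ w := by
  have e : f.obj a ◁ g.obj b ◁ (swapLeft _ _ _ ≫ h.obj c ◁ ((β_ _ _).hom ≫ actL₂ p a b b' c d)) ≫
      D.midL f g h a b c d = f.obj a ◁ ((α_ _ _ _).inv ≫ act g b b' ▷ _) ≫
        D.midL f g h a b' c d := by
    apply coL_ext₄
    intro l i x y u z r s
    simp [D.el_pact₂]
  simpa using app_congr e (x ⊠ y ⊠ u ⊠ z ⊠ w)

theorem midL_act₃ {a b c c' d : A} (x : Elem l (f.obj a)) (y : Elem l (g.obj b))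
    (z : Elem l (h.obj c)) (w : Elem l (assocL p a b c' d)) (u : Elem l (c ⟶[V] c')) :
    D.midL f g h a b c d ⋆ x ⊠ y ⊠ z ⊠ (actL₃ p a b c c' d ⋆ w ⊠ u) =
      D.midL f g h a b c' d ⋆ x ⊠ y ⊠ smul h z u ⊠ w := by
  have e : f.obj a ◁ g.obj b ◁ h.obj c ◁ ((β_ _ _).hom ≫ actL₃ p a b c c' d) ≫
      D.midL f g h a b c d = f.obj a ◁ g.obj b ◁ ((α_ _ _ _).inv ≫ act h c c' ▷ _) ≫
        D.midL f g h a b c' d := by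
    apply coL_ext₄
    intro l i x y z u r s
    simp [D.el_pact₂]
  simpa using app_congr e (x ⊠ y ⊠ z ⊠ u ⊠ w)

/-- Naturality of the family in `d`; it makes the associativity constraint a natural family in `d`,
and makes the fourfold family of `exists_quad` balanced. -/
theorem smul_midR {a b c d d' : A} (x : Elem l (f.obj a)) (y : Elem l (g.obj b))
    (z : Elem l (h.obj c)) (w : Elem l (assocR p a b c d)) (u : Elem l (d ⟶[V] d')) :
    smul (D.T.obj ⟨f, D.T.obj ⟨g, h⟩⟩) (D.midR f g h a b c d ⋆ x ⊠ y ⊠ z ⊠ w) u =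
      D.midR f g h a b c d' ⋆ x ⊠ y ⊠ z ⊠ (actR₄ p a b c d d' ⋆ w ⊠ u) := by
  have e : f.obj a ◁ (g.obj b ◁ (h.obj c ◁ (β_ _ _).hom ≫ (α_ _ _ _).inv) ≫ (α_ _ _ _).inv) ≫
      (α_ _ _ _).inv ≫ D.midR f g h a b c d ▷ _ ≫ act (D.T.obj ⟨f, D.T.obj ⟨g, h⟩⟩) d d' =
      f.obj a ◁ g.obj b ◁ h.obj c ◁ ((β_ _ _).hom ≫ actR₄ p a b c d d') ≫
        D.midR f g h a b c d' := by
    apply coR_ext₄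
    intro l i x y z u r s
    simp [D.smul_el]
  simpa using app_congr e (x ⊠ y ⊠ z ⊠ u ⊠ w)

/-- Naturality in `f`, followed by naturality in `g` and in `h`; the `V`-naturality of the
associativity constraint rests on these three. -/
theorem evl_midR₁ {f' : EnrichedFunctor V A V} {a b c d : A} (x : Elem l (f.obj a))
    (y : Elem l (g.obj b)) (z : Elem l (h.obj c)) (w : Elem l (assocR p a b c d))
    (t : Elem l (f ⟶[V] f')) :
    evl (D.midR f g h a b c d ⋆ x ⊠ y ⊠ z ⊠ w) (D.mapL f f' (D.T.obj ⟨g, h⟩) ⋆ t) =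
      D.midR f' g h a b c d ⋆ evl x t ⊠ y ⊠ z ⊠ w := by
  have e : f.obj a ◁ (g.obj b ◁ (h.obj c ◁ (β_ _ _).hom ≫ (α_ _ _ _).inv) ≫ (α_ _ _ _).inv) ≫
      (α_ _ _ _).inv ≫ (D.midR f g h a b c d ⊗ₘ D.mapL f f' (D.T.obj ⟨g, h⟩)) ≫
        evalAt _ _ d = f.obj a ◁ (g.obj b ◁ swapLeft _ _ _ ≫ swapLeft _ _ _) ≫ (α_ _ _ _).inv ≫
            evalAt f f' a ▷ _ ≫
        D.midR f' g h a b c d := by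
    apply coR_ext₄
    intro l i x y z t r s
    simp [D.evl_mapL]
  simpa using app_congr e (x ⊠ y ⊠ z ⊠ t ⊠ w)

theorem evl_midR₂ {g' : EnrichedFunctor V A V} {a b c d : A} (x : Elem l (f.obj a))
    (y : Elem l (g.obj b)) (z : Elem l (h.obj c)) (w : Elem l (assocR p a b c d))
    (t : Elem l (g ⟶[V] g')) :
    evl (D.midR f g h a b c d ⋆ x ⊠ y ⊠ z ⊠ w) (D.mapR f (D.T.obj ⟨g, h⟩) (D.T.obj ⟨g',
        h⟩) ⋆ D.mapL g g' h ⋆ t) =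
      D.midR f g' h a b c d ⋆ x ⊠ evl y t ⊠ z ⊠ w := by
  have e : f.obj a ◁ (g.obj b ◁ (h.obj c ◁ (β_ _ _).hom ≫ (α_ _ _ _).inv) ≫ (α_ _ _ _).inv) ≫
      (α_ _ _ _).inv ≫ (D.midR f g h a b c d ⊗ₘ (D.mapL g g' h ≫ D.mapR f (D.T.obj ⟨g,
          h⟩) (D.T.obj ⟨g', h⟩))) ≫
        evalAt _ _ d = f.obj a ◁ (g.obj b ◁ swapLeft _ _ _ ≫ (α_ _ _ _).inv ≫ evalAt g g' b ▷ _) ≫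
        D.midR f g' h a b c d := by
    apply coR_ext₄
    intro l i x y z t r s
    simp [D.evl_mapL, D.evl_mapR]
  simpa using app_congr e (x ⊠ y ⊠ z ⊠ t ⊠ w)

theorem evl_midR₃ {h' : EnrichedFunctor V A V} {a b c d : A} (x : Elem l (f.obj a))
    (y : Elem l (g.obj b)) (z : Elem l (h.obj c)) (w : Elem l (assocR p a b c d))
    (t : Elem l (h ⟶[V] h')) :
    evl (D.midR f g h a b c d ⋆ x ⊠ y ⊠ z ⊠ w) (D.mapR f (D.T.obj ⟨g, h⟩) (D.T.obj ⟨g,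
        h'⟩) ⋆ D.mapR g h h' ⋆ t) =
      D.midR f g h' a b c d ⋆ x ⊠ y ⊠ evl z t ⊠ w := by
  have e : f.obj a ◁ (g.obj b ◁ (h.obj c ◁ (β_ _ _).hom ≫ (α_ _ _ _).inv) ≫ (α_ _ _ _).inv) ≫
      (α_ _ _ _).inv ≫ (D.midR f g h a b c d ⊗ₘ (D.mapR g h h' ≫ D.mapR f (D.T.obj ⟨g,
          h⟩) (D.T.obj ⟨g, h'⟩))) ≫
        evalAt _ _ d = f.obj a ◁ g.obj b ◁ ((α_ _ _ _).inv ≫ evalAt h h' c ▷ _) ≫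
        D.midR f g h' a b c d := by
    apply coR_ext₄
    intro l i x y z t r s
    simp [D.evl_mapR]
  simpa using app_congr e (x ⊠ y ⊠ z ⊠ t ⊠ w)

end DayData
end TripleFamilies
end StarAut

namespace StarAut
open Elem

/-! ### Morphisms of `V`-functors on elements -/
section Arrows
variable {V : Type u} [Category.{v} V] [MonoidalCategory V] [SymmetricCategory V]
  [MonoidalClosed V]
universe u₁ u₂
variable {l : List V}

namespace Elem
section
variable {C : Type u₁} {D : Type u₂} [EnrichedCategory V C] [EnrichedCategory V D]

/-- The element of a hom-object given by a morphism of the underlying category. -/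
def arr {X Y : C} (φ : ForgetEnrichment.of V X ⟶ ForgetEnrichment.of V Y) : Elem l (X ⟶[V] Y) :=
  (show 𝟙_ V ⟶ (X ⟶[V] Y) from ForgetEnrichment.homTo V φ) ⋆ unit

theorem arr_id (X : C) : arr (𝟙 (ForgetEnrichment.of V X)) = (idn X : Elem l _) :=
  app_congr (ForgetEnrichment.homTo_id V (ForgetEnrichment.of V X)) unit

theorem arr_comp {X Y Z : C} (φ : ForgetEnrichment.of V X ⟶ ForgetEnrichment.of V Y)
    (ψ : ForgetEnrichment.of V Y ⟶ ForgetEnrichment.of V Z) :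
    (arr (φ ≫ ψ) : Elem l _) = cmp (arr φ) (arr ψ) := by
  refine (app_congr (ForgetEnrichment.homTo_comp V φ ψ) unit).trans ?_
  refine (comp_app _ _ _).trans ?_
  refine (congrArg _ ((comp_app _ _ _).trans ((congrArg _ (leftUnitor_inv_app _)).trans
    (tensorHom_app _ _ _ _)))).trans ?_
  rfl

theorem arr_homOf {X Y : C} (φ : 𝟙_ V ⟶ (X ⟶[V] Y)) :
    (arr (ForgetEnrichment.homOf V φ) : Elem l _) = φ ⋆ unit := rfl

theorem arr_forget (F : EnrichedFunctor V C D) {X Y : C}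
    (φ : ForgetEnrichment.of V X ⟶ ForgetEnrichment.of V Y) :
    arr (X := F.obj X) (Y := F.obj Y) (F.forget.map φ) = fmap F (arr φ : Elem l _) :=
  comp_app _ _ _

end

variable [HasLimits V] [HasColimits V] {A : Type v} [EnrichedCategory V A]
  {F G : EnrichedFunctor V A V}

theorem arr_ext {φ ψ : ForgetEnrichment.of V F ⟶ ForgetEnrichment.of V G}
    (h : ∀ (l : List V) (c : A) (x : Elem l (F.obj c)), evl x (arr φ) = evl x (arr ψ)) : φ = ψ := by
  have h₂ : (show 𝟙_ V ⟶ (F ⟶[V] G) from ForgetEnrichment.homTo V φ) =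
      (show 𝟙_ V ⟶ (F ⟶[V] G) from ForgetEnrichment.homTo V ψ) := by
    apply natObj_hom_ext
    intro c
    rw [← cancel_epi (ρ_ _).inv]
    apply elem_ext₁
    intro l x
    simpa [arr] using h l c x
  exact h₂

end Elem

variable [HasLimits V] [HasColimits V] {A : Type v} [EnrichedCategory V A]
  {F G : EnrichedFunctor V A V}

/-- The component at `c` of a morphism of `V`-functors. -/
noncomputable def arrAt (φ : ForgetEnrichment.of V F ⟶ ForgetEnrichment.of V G) (c : A) :
    F.obj c ⟶ G.obj c :=
  (ρ_ _).inv ≫ F.obj c ◁ (show 𝟙_ V ⟶ (F ⟶[V] G) from ForgetEnrichment.homTo V φ) ≫ evalAt F G c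

theorem arrAt_app (φ : ForgetEnrichment.of V F ⟶ ForgetEnrichment.of V G) {c : A}
    (x : Elem l (F.obj c)) : arrAt φ c ⋆ x = evl x (arr φ) := by
  rw [arrAt, comp_app, comp_app, rightUnitor_inv_app, whiskerLeft_app, evalAt_app]
  rfl

theorem arrAt_ext {φ ψ : ForgetEnrichment.of V F ⟶ ForgetEnrichment.of V G}
    (h : ∀ c, arrAt φ c = arrAt ψ c) : φ = ψ :=
  arr_ext fun l c x => by rw [← arrAt_app, ← arrAt_app, h]

theorem arrAt_comp {H : EnrichedFunctor V A V}
    (φ : ForgetEnrichment.of V F ⟶ ForgetEnrichment.of V G)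
    (ψ : ForgetEnrichment.of V G ⟶ ForgetEnrichment.of V H) (c : A) :
    arrAt (φ ≫ ψ) c = arrAt φ c ≫ arrAt ψ c := by
  apply elem_ext₁
  intro l x
  rw [comp_app, arrAt_app, arrAt_app, arrAt_app, arr_comp, evl_cmp]

/-- A morphism into an object of transformations is determined by its components on elements, so
`V`-naturality becomes the usual naturality square applied to an element. -/
theorem isGradedNat_of_elem {C : Type u₁} [EnrichedCategory V C]
    {S T : EnrichedFunctor V C (EnrichedFunctor V A V)} (e : ∀ X, VIso V (S.obj X) (T.obj X))
    (h : ∀ (l : List V) (X Y : C) (c : A) (x : Elem l ((S.obj X).obj c)) (s : Elem l (X ⟶[V] Y)),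
      evl (evl x (fmap S s)) (arr (e Y).hom) = evl (evl x (arr (e X).hom)) (fmap T s)) :
    IsGradedNat S T (fun X => (e X).elem) := by
  intro X Y
  rw [← cancel_epi (ρ_ _).inv]
  apply natObj_elem_ext₁
  intro l c x s
  have h₂ := h l X Y c x s
  rw [← evl_cmp, ← evl_cmp] at h₂
  simp only [comp_app, rightUnitor_inv_app, tensorHom_app, braiding_app, eComp_app]
  exact h₂

/-- An isomorphism of `V`-functors from a `V`-natural family of isomorphisms. -/
theorem exists_vIso {F G : EnrichedFunctor V A V} (t : ∀ c, F.obj c ⟶ G.obj c)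
    (t' : ∀ c, G.obj c ⟶ F.obj c) (h₁ : ∀ c, t c ≫ t' c = 𝟙 _) (h₂ : ∀ c, t' c ≫ t c = 𝟙 _)
    (ht : IsNatural F G t) :
    ∃ e : VIso V F G, ∀ (l : List V) (c : A) (x : Elem l (F.obj c)),
      arrAt e.hom c ⋆ x = t c ⋆ x := by
  have ht' : IsNatural G F t' := isNatural_inv (t := fun c => ⟨t c, t' c, h₁ c, h₂ c⟩) ht
  let n (F G : EnrichedFunctor V A V) (t : ∀ c, F.obj c ⟶ G.obj c) (ht : IsNatural F G t) :
      𝟙_ V ⟶ (F ⟶[V] G) := natOf (fun c => (ρ_ _).hom ≫ t c) (by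
    intro l c c' x s k
    -- The element `k` of the monoidal unit is arbitrary. As an equality of morphisms the claim
    -- reduces, along a unitor, to the generic element `unit`.
    have h : _ ◁ (β_ _ _).hom ≫ (α_ _ _ _).inv ≫ act F c c' ▷ 𝟙_ V ≫ (ρ_ _).hom ≫ t c' =
        (α_ _ _ _).inv ≫ (ρ_ _).hom ▷ _ ≫ t c ▷ _ ≫ act G c c' := by
      rw [← cancel_epi (F.obj c ◁ (λ_ _).inv)]
      apply elem_ext₂
      intro l x s
      simpa using isNatural_iff.1 ht l c c' x s
    simpa only [comp_app, whiskerLeft_app, whiskerRight_app, braiding_app, associator_inv_app,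
      act_app] using app_congr h (x ⊠ k ⊠ s))
  have hn : ∀ (F G) (t) (ht) (l : List V) (c : A) (x : Elem l (F.obj c)),
      evl x (arr (ForgetEnrichment.homOf V (n F G t ht))) = t c ⋆ x := by
    intro F G t ht l c x
    rw [arr_homOf, evl_natOf, comp_app, rightUnitor_hom_app]
  refine ⟨⟨ForgetEnrichment.homOf V (n F G t ht), ForgetEnrichment.homOf V (n G F t' ht'),
    arr_ext fun l c x => ?_, arr_ext fun l c x => ?_⟩,
        fun l c x => (arrAt_app _ x).trans (hn F G t ht l c x)⟩
  · rw [arr_comp, evl_cmp, hn F G t ht, hn G F t' ht', ← comp_app, h₁, id_app, arr_id, evl_idn]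
  · rw [arr_comp, evl_cmp, hn G F t' ht', hn F G t ht, ← comp_app, h₂, id_app, arr_id, evl_idn]

end Arrows
end StarAut

namespace StarAut
open Elem

/-! ### The constraints of the upper convolution -/
section Constraints
variable {V : Type u} [Category.{v} V] [MonoidalCategory V] [SymmetricCategory V]
  [MonoidalClosed V] [HasLimits V] [HasColimits V] {A : Type v} [EnrichedCategory V A]
  {l : List V} {P : Promonoidal V A}

namespace DayData
variable (D : DayData P.p)

/-- The two bracketings are coends over `a`, `b`, `c` that differ only in `assocL` and `assocR`. The
associativity of `p` and its inverse are natural in these variables and hence induce maps in both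
directions. -/
theorem exists_assoc (f g h : EnrichedFunctor V A V) :
    ∃ e : VIso V (D.T.obj ⟨D.T.obj ⟨f, g⟩, h⟩) (D.T.obj ⟨f, D.T.obj ⟨g, h⟩⟩),
      ∀ (l : List V) (a b c d i : A) (x : Elem l (f.obj a)) (y : Elem l (g.obj b))
        (z : Elem l (h.obj c)) (r : Elem l (ker P.p a b i)) (s : Elem l (ker P.p i c d)),
        arrAt e.hom d ⋆ D.el (D.el x y r) z s =
          D.midR f g h a b c d ⋆ x ⊠ y ⊠ z ⊠ ((P.assoc a b c d).hom ⋆ coL P.p r s) := by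
  have h₁ : ∀ d, ∃ m : (D.T.obj ⟨D.T.obj ⟨f, g⟩, h⟩).obj d ⟶ (D.T.obj ⟨f, D.T.obj ⟨g, h⟩⟩).obj d,
      ∀ (l : List V) (a b c i : A) (x : Elem l (f.obj a)) (y : Elem l (g.obj b))
        (z : Elem l (h.obj c)) (r : Elem l (ker P.p a b i)) (s : Elem l (ker P.p i c d)),
        m ⋆ D.el (D.el x y r) z s =
          D.midR f g h a b c d ⋆ x ⊠ y ⊠ z ⊠ ((P.assoc a b c d).hom ⋆ coL P.p r s) := by
    intro d
    obtain ⟨m, hm⟩ := D.tripleLeft_exists_desc (f := f) (g := g) (h := h) (d := d)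
      (fun a b c => f.obj a ◁ g.obj b ◁ h.obj c ◁ (P.assoc a b c d).hom ≫ D.midR f g h a b c d)
      (by
        intro l a a' b c x y z w u
        simp [P.assoc_hom_act₁, D.midR_act₁]) (by
        intro l a b b' c x y z w u
        simp [P.assoc_hom_act₂, D.midR_act₂]) (by
        intro l a b c c' x y z w u
        simp [P.assoc_hom_act₃, D.midR_act₃])
    refine ⟨m, fun l a b c i x y z r s => ?_⟩
    simpa using hm l a b c i x y z r s
  have h₂ : ∀ d, ∃ m : (D.T.obj ⟨f, D.T.obj ⟨g, h⟩⟩).obj d ⟶ (D.T.obj ⟨D.T.obj ⟨f, g⟩, h⟩).obj d,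
      ∀ (l : List V) (a b c i : A) (x : Elem l (f.obj a)) (y : Elem l (g.obj b))
        (z : Elem l (h.obj c)) (r : Elem l (ker P.p b c i)) (s : Elem l (ker P.p a i d)),
        m ⋆ D.el x (D.el y z r) s =
          D.midL f g h a b c d ⋆ x ⊠ y ⊠ z ⊠ ((P.assoc a b c d).inv ⋆ coR P.p r s) := by
    intro d
    obtain ⟨m, hm⟩ := D.tripleRight_exists_desc (f := f) (g := g) (h := h) (d := d)
      (fun a b c => f.obj a ◁ g.obj b ◁ h.obj c ◁ (P.assoc a b c d).inv ≫ D.midL f g h a b c d)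
      (by
        intro l a a' b c x y z w u
        simp [P.assoc_inv_act₁, D.midL_act₁]) (by
        intro l a b b' c x y z w u
        simp [P.assoc_inv_act₂, D.midL_act₂]) (by
        intro l a b c c' x y z w u
        simp [P.assoc_inv_act₃, D.midL_act₃])
    refine ⟨m, fun l a b c i x y z r s => ?_⟩
    simpa using hm l a b c i x y z r s
  choose m hm using h₁
  choose m' hm' using h₂
  -- The formula for `m'` is extended from generators to every element of `assocR`; the images under
  -- `P.assoc` to which it must be applied are not generators.
  have hmid : ∀ (a b c d : A), D.midR f g h a b c d ≫ m' d =
      f.obj a ◁ g.obj b ◁ h.obj c ◁ (P.assoc a b c d).inv ≫ D.midL f g h a b c d := by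
    intro a b c d
    apply coR_ext₃
    intro l i x y z r s
    simp [hm']
  have hmid' : ∀ (a b c d : A), D.midL f g h a b c d ≫ m d =
      f.obj a ◁ g.obj b ◁ h.obj c ◁ (P.assoc a b c d).hom ≫ D.midR f g h a b c d := by
    intro a b c d
    apply coL_ext₃
    intro l i x y z r s
    simp [hm]
  obtain ⟨e, he⟩ := exists_vIso m m' (by
    intro d
    apply D.tripleLeft_hom_ext
    intro l a b c i x y z r s
    have h₃ := app_congr (hmid a b c d) (x ⊠ y ⊠ z ⊠ ((P.assoc a b c d).hom ⋆ coL P.p r s))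
    simp only [comp_app, whiskerLeft_app, hom_inv_app, midL_co] at h₃
    rw [comp_app, hm, h₃, id_app]) (by
    intro d
    apply D.tripleRight_hom_ext
    intro l a b c i x y z r s
    have h₃ := app_congr (hmid' a b c d) (x ⊠ y ⊠ z ⊠ ((P.assoc a b c d).inv ⋆ coR P.p r s))
    simp only [comp_app, whiskerLeft_app, inv_hom_app, midR_co] at h₃
    rw [comp_app, hm', h₃, id_app]) (by
    intro d d'
    apply D.tripleLeft_ext
    intro l a b c i x y z r s u
    simp [D.smul_el, hm, D.smul_midR, ← P.assoc_hom_act₄])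
  exact ⟨e, fun l a b c d i x y z r s => (he l d _).trans (hm d l a b c i x y z r s)⟩

/-- Integrating out `a` first turns the coend of `j a ⊗ f b ⊗ p(a, b, c)` into that of `f b ⊗ A(b,
c)`, which is `f c` by the co-Yoneda lemma. -/
theorem exists_leftUnit (f : EnrichedFunctor V A V) :
    ∃ e : VIso V (D.T.obj ⟨P.j, f⟩) f,
      ∀ (l : List V) (a b c : A) (t : Elem l (P.j.obj a)) (x : Elem l (f.obj b))
        (r : Elem l (ker P.p a b c)),
        arrAt e.hom c ⋆ D.el t x r =
          smul f x ((P.leftUnit b c).hom ⋆ coUL P.p P.j t r) := by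
  have h₁ : ∀ c, ∃ m : (D.T.obj ⟨P.j, f⟩).obj c ⟶ f.obj c,
      ∀ (l : List V) (a b : A) (t : Elem l (P.j.obj a)) (x : Elem l (f.obj b))
        (r : Elem l (ker P.p a b c)),
        m ⋆ D.el t x r = smul f x ((P.leftUnit b c).hom ⋆ coUL P.p P.j t r) := by
    intro c
    let k : ∀ a b, P.j.obj a ⊗ (f.obj b ⊗ ker P.p a b c) ⟶ f.obj c := fun a b =>
      swapLeft _ _ _ ≫ f.obj b ◁ (ιUL P.p P.j a b c ≫ (P.leftUnit b c).hom) ≫ act f b c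
    have hk : ∀ (l : List V) (a b : A) (t : Elem l (P.j.obj a)) (x : Elem l (f.obj b))
        (r : Elem l (ker P.p a b c)),
        k a b ⋆ t ⊠ x ⊠ r = smul f x ((P.leftUnit b c).hom ⋆ coUL P.p P.j t r) := by
      intro l a b t x r
      simp [k]
    clear_value k
    obtain ⟨m, hm, -⟩ := (D.isDayCoend P.j f c).universal k (by
      refine isDayCowedge_iff.2 ⟨fun l a a' b t x r u => ?_, fun l a b b' t x r u => ?_⟩
      · rw [hk, hk, coUL_smul]
      · rw [hk, hk, P.leftUnit_pact₂, Elem.smul_smul])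
    refine ⟨m, fun l a b t x r => ?_⟩
    rw [← hk, ← hm, comp_app, ι_app]
  choose m hm using h₁
  have h₂ : ∀ b c, ∃ n : f.obj b ⊗ unitL P.p P.j b c ⟶ (D.T.obj ⟨P.j, f⟩).obj c,
      ∀ (l : List V) (a : A) (x : Elem l (f.obj b)) (t : Elem l (P.j.obj a))
        (r : Elem l (ker P.p a b c)), n ⋆ x ⊠ coUL P.p P.j t r = D.el t x r := by
    intro b c
    obtain ⟨n, hn⟩ := coUL_exists_desc (p := P.p) (j := P.j) (b := b) (c := c) (X := f.obj b)
      (fun a => swapLeft _ _ _ ≫ D.ι P.j f a b c) (by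
        intro l a a' x t u r
        simpa using D.el_pact₁ t x r u)
    exact ⟨n, fun l a x t r => by simpa using hn l a x t r⟩
  choose n hn using h₂
  have hn₂ : ∀ (l : List V) (b b' c : A) (x : Elem l (f.obj b)) (w : Elem l (unitL P.p P.j b' c))
      (u : Elem l (b ⟶[V] b')),
      n b c ⋆ x ⊠ (actUL P.p P.j b b' c ⋆ w ⊠ u) = n b' c ⋆ smul f x u ⊠ w := by
    intro l b b' c x w u
    have e : f.obj b ◁ ((β_ _ _).hom ≫ actUL P.p P.j b b' c) ≫ n b c =
        (α_ _ _ _).inv ≫ act f b b' ▷ _ ≫ n b' c := by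
      apply coUL_ext₂
      intro l a x u t r
      simpa [hn] using D.el_pact₂ t x r u
    simpa using app_congr e (x ⊠ u ⊠ w)
  have hmn : ∀ b c, n b c ≫ m c = f.obj b ◁ (P.leftUnit b c).hom ≫ act f b c := by
    intro b c
    apply coUL_ext₁
    intro l a x t r
    simp [hn, hm]
  -- The inverse, as in the co-Yoneda lemma: `x` is paired with the class in `∫^a j a ⊗ p(a, c, c)`
  -- that corresponds to the identity of `c`.
  let i c := (ρ_ (f.obj c)).inv ≫ f.obj c ◁ (eId V c ≫ (P.leftUnit c c).inv) ≫ n c c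
  have hi : ∀ (l : List V) (c : A) (x : Elem l (f.obj c)),
      i c ⋆ x = n c c ⋆ x ⊠ ((P.leftUnit c c).inv ⋆ idn c) := by
    intro l c x
    simp [i]
  obtain ⟨e, he⟩ := exists_vIso m i (by
    intro c
    apply (D.isDayCoend P.j f c).elem_ext
    intro l a b t x r
    -- The arrow by which `x` was moved is shifted to the unit coend; composed with the identity
    -- there it is returned by the inverse unit isomorphism to the class it came from.
    rw [ι_app, comp_app, hm, hi, id_app, ← hn₂, ← P.leftUnit_inv_cmp, cmp_idn, hom_inv_app, hn]) (by
    intro c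
    apply elem_ext₁
    intro l x
    rw [comp_app, hi, ← comp_app, hmn, comp_app, whiskerLeft_app, inv_hom_app, act_app, smul_idn,
      id_app]) (by
    intro c c'
    apply (D.isDayCoend P.j f c).elem_ext_right
    intro l a b t x r u
    simp [D.smul_el, hm, P.leftUnit_pact₃, Elem.smul_smul])
  exact ⟨e, fun l a b c t x r => (he l c _).trans (hm c l a b t x r)⟩

/-- Mirror image of the left unit: here `b` is integrated out first, and co-Yoneda is applied in the
variable `a`. -/
theorem exists_rightUnit (f : EnrichedFunctor V A V) :
    ∃ e : VIso V (D.T.obj ⟨f, P.j⟩) f,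
      ∀ (l : List V) (a b c : A) (x : Elem l (f.obj a)) (t : Elem l (P.j.obj b))
        (r : Elem l (ker P.p a b c)),
        arrAt e.hom c ⋆ D.el x t r =
          smul f x ((P.rightUnit a c).hom ⋆ coUR P.p P.j t r) := by
  have h₁ : ∀ c, ∃ m : (D.T.obj ⟨f, P.j⟩).obj c ⟶ f.obj c,
      ∀ (l : List V) (a b : A) (x : Elem l (f.obj a)) (t : Elem l (P.j.obj b))
        (r : Elem l (ker P.p a b c)),
        m ⋆ D.el x t r = smul f x ((P.rightUnit a c).hom ⋆ coUR P.p P.j t r) := by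
    intro c
    let k : ∀ a b, f.obj a ⊗ (P.j.obj b ⊗ ker P.p a b c) ⟶ f.obj c := fun a b =>
      f.obj a ◁ (ιUR P.p P.j a b c ≫ (P.rightUnit a c).hom) ≫ act f a c
    have hk : ∀ (l : List V) (a b : A) (x : Elem l (f.obj a)) (t : Elem l (P.j.obj b))
        (r : Elem l (ker P.p a b c)),
        k a b ⋆ x ⊠ t ⊠ r = smul f x ((P.rightUnit a c).hom ⋆ coUR P.p P.j t r) := by
      intro l a b x t r
      simp [k]
    clear_value k
    obtain ⟨m, hm, -⟩ := (D.isDayCoend f P.j c).universal k (by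
      refine isDayCowedge_iff.2 ⟨fun l a a' b x t r u => ?_, fun l a b b' x t r u => ?_⟩
      · rw [hk, hk, P.rightUnit_pact₁, Elem.smul_smul]
      · rw [hk, hk, coUR_smul])
    refine ⟨m, fun l a b x t r => ?_⟩
    rw [← hk, ← hm, comp_app, ι_app]
  choose m hm using h₁
  have h₂ : ∀ a c, ∃ n : f.obj a ⊗ unitR P.p P.j a c ⟶ (D.T.obj ⟨f, P.j⟩).obj c,
      ∀ (l : List V) (b : A) (x : Elem l (f.obj a)) (t : Elem l (P.j.obj b))
        (r : Elem l (ker P.p a b c)), n ⋆ x ⊠ coUR P.p P.j t r = D.el x t r := by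
    intro a c
    exact coUR_exists_desc (p := P.p) (j := P.j) (a := a) (c := c) (X := f.obj a)
      (fun b => D.ι f P.j a b c) fun l b b' x t u r => D.el_pact₂ x t r u
  choose n hn using h₂
  have hn₂ : ∀ (l : List V) (a a' c : A) (x : Elem l (f.obj a)) (w : Elem l (unitR P.p P.j a' c))
      (u : Elem l (a ⟶[V] a')),
      n a c ⋆ x ⊠ (actUR P.p P.j a a' c ⋆ w ⊠ u) = n a' c ⋆ smul f x u ⊠ w := by
    intro l a a' c x w u
    have e : f.obj a ◁ ((β_ _ _).hom ≫ actUR P.p P.j a a' c) ≫ n a c =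
        (α_ _ _ _).inv ≫ act f a a' ▷ _ ≫ n a' c := by
      apply coUR_ext₂
      intro l b x u t r
      simpa [hn] using D.el_pact₁ x t r u
    simpa using app_congr e (x ⊠ u ⊠ w)
  have hmn : ∀ a c, n a c ≫ m c = f.obj a ◁ (P.rightUnit a c).hom ≫ act f a c := by
    intro a c
    apply coUR_ext₁
    intro l b x t r
    simp [hn, hm]
  let i c := (ρ_ (f.obj c)).inv ≫ f.obj c ◁ (eId V c ≫ (P.rightUnit c c).inv) ≫ n c c
  have hi : ∀ (l : List V) (c : A) (x : Elem l (f.obj c)),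
      i c ⋆ x = n c c ⋆ x ⊠ ((P.rightUnit c c).inv ⋆ idn c) := by
    intro l c x
    simp [i]
  obtain ⟨e, he⟩ := exists_vIso m i (by
    intro c
    apply (D.isDayCoend f P.j c).elem_ext
    intro l a b x t r
    rw [ι_app, comp_app, hm, hi, id_app, ← hn₂, ← P.rightUnit_inv_cmp, cmp_idn, hom_inv_app, hn])
    (by
    intro c
    apply elem_ext₁
    intro l x
    rw [comp_app, hi, ← comp_app, hmn, comp_app, whiskerLeft_app, inv_hom_app, act_app, smul_idn,
      id_app]) (by
    intro c c'
    apply (D.isDayCoend f P.j c).elem_ext_right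
    intro l a b x t r u
    simp [D.smul_el, hm, P.rightUnit_pact₃, Elem.smul_smul])
  exact ⟨e, fun l a b c x t r => (he l c _).trans (hm c l a b x t r)⟩

end DayData
end Constraints
end StarAut

namespace StarAut
open Elem

/-! ### The pentagon and the triangle on elements -/
section PromonoidalElements
variable {V : Type u} [Category.{v} V] [MonoidalCategory V] [SymmetricCategory V]
  [MonoidalClosed V] [HasLimits V] [HasColimits V] {A : Type v} [EnrichedCategory V A]
  {l : List V}

section
variable (p : EnrichedFunctor V (TensorCat Aᵒᵖ (TensorCat Aᵒᵖ A)) V)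

/-- The coend `∫^{z,w} p(c, d, z) ⊗ p(b, z, w) ⊗ p(a, w, e)`. -/
noncomputable def quad (a b c d e : A) : V :=
  tensorOver ((ker₂ofThd p b).comp V (tenR A (ker₃ p c d))) (ker₂ p a e)

/-- The coprojections of the coend `quad`. -/
noncomputable def ιQ (a b c d e w : A) : assocR p b c d w ⊗ ker p a w e ⟶ quad p a b c d e :=
  coι ((ker₂ofThd p b).comp V (tenR A (ker₃ p c d))) (ker₂ p a e) w

/-- The element of the coend `quad` given by elements of the factors. -/
noncomputable def coQ {a b c d e w : A} (q : Elem l (assocR p b c d w)) (s : Elem l (ker p a w e)) :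
    Elem l (quad p a b c d e) := ιQ p a b c d e w ⋆ q ⊠ s

@[simp]
theorem ιQ_app {a b c d e w : A} (q : Elem l (assocR p b c d w)) (s : Elem l (ker p a w e)) :
    ιQ p a b c d e w ⋆ q ⊠ s = coQ p q s := rfl

variable {p}

theorem coQ_exists_desc {a b c d e : A} {X Y Z W Q : V}
    (k : ∀ i, X ⊗ Y ⊗ Z ⊗ W ⊗ assocR p b c d i ⊗ ker p a i e ⟶ Q)
    (hk : ∀ (l : List V) (i i' : A) (x : Elem l X) (y : Elem l Y) (z : Elem l Z) (w : Elem l W)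
      (q : Elem l (assocR p b c d i)) (u : Elem l (i ⟶[V] i')) (s : Elem l (ker p a i' e)),
      k i ⋆ x ⊠ y ⊠ z ⊠ w ⊠ q ⊠ pact₂ p s u =
        k i' ⋆ x ⊠ y ⊠ z ⊠ w ⊠ (actR₄ p b c d i i' ⋆ q ⊠ u) ⊠ s) :
    ∃ f : X ⊗ Y ⊗ Z ⊗ W ⊗ quad p a b c d e ⟶ Q, ∀ (l : List V) (i : A) (x : Elem l X)
      (y : Elem l Y) (z : Elem l Z) (w : Elem l W) (q : Elem l (assocR p b c d i))
      (s : Elem l (ker p a i e)),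
      f ⋆ x ⊠ y ⊠ z ⊠ w ⊠ coQ p q s = k i ⋆ x ⊠ y ⊠ z ⊠ w ⊠ q ⊠ s :=
  co_exists_desc₄ (M := (ker₂ofThd p b).comp V (tenR A (ker₃ p c d))) (N := ker₂ p a e) k
    fun l i i' x y z w q u s => hk l i i' x y z w q u s

end

namespace Promonoidal
variable (P : Promonoidal V A)

/-- The pentagon axiom read on generators. One route leads through `m₁` and `m₂`, the other through
`n₁` and `n₂`, and the last clause is their agreement. -/
theorem exists_pentagon (a b c d e : A) :
    ∃ (m₂ : ∀ z, ker P.p c d z ⊗ assocR P.p a b z e ⟶ quad P.p a b c d e)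
      (m₁ : ∀ x, ker P.p a b x ⊗ assocR P.p x c d e ⟶ quad P.p a b c d e)
      (n₂ : ∀ z, ker P.p b c z ⊗ assocR P.p a z d e ⟶ quad P.p a b c d e)
      (n₁ : ∀ y, assocR P.p a b c y ⊗ ker P.p y d e ⟶ quad P.p a b c d e),
      (∀ (l : List V) (z w : A) (q : Elem l (ker P.p c d z)) (r : Elem l (ker P.p b z w))
        (s : Elem l (ker P.p a w e)), m₂ z ⋆ q ⊠ coR P.p r s = coQ P.p (coR P.p q r) s) ∧
      (∀ (l : List V) (x z : A) (r : Elem l (ker P.p a b x)) (q : Elem l (ker P.p c d z))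
        (s : Elem l (ker P.p x z e)),
        m₁ x ⋆ r ⊠ coR P.p q s = m₂ z ⋆ q ⊠ ((P.assoc a b z e).hom ⋆ coL P.p r s)) ∧
      (∀ (l : List V) (z w : A) (q : Elem l (ker P.p b c z)) (r : Elem l (ker P.p z d w))
        (s : Elem l (ker P.p a w e)),
        n₂ z ⋆ q ⊠ coR P.p r s = coQ P.p ((P.assoc b c d w).hom ⋆ coL P.p q r) s) ∧
      (∀ (l : List V) (y z : A) (q : Elem l (ker P.p b c z)) (s : Elem l (ker P.p a z y))
        (t : Elem l (ker P.p y d e)),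
        n₁ y ⋆ coR P.p q s ⊠ t = n₂ z ⋆ q ⊠ ((P.assoc a z d e).hom ⋆ coL P.p s t)) ∧
      ∀ (l : List V) (x y : A) (r : Elem l (ker P.p a b x)) (s : Elem l (ker P.p x c y))
        (t : Elem l (ker P.p y d e)),
        n₁ y ⋆ ((P.assoc a b c y).hom ⋆ coL P.p r s) ⊠ t =
          m₁ x ⋆ r ⊠ ((P.assoc x c d e).hom ⋆ coL P.p s t) := by
  obtain ⟨m₂, m₁, n₂, n₁, h₁, h₂, h₃, h₄, h₅⟩ :
      ∃ (m₂ : ∀ z, ker P.p c d z ⊗ assocR P.p a b z e ⟶ quad P.p a b c d e)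
        (m₁ : ∀ x, ker P.p a b x ⊗ assocR P.p x c d e ⟶ quad P.p a b c d e)
        (n₂ : ∀ z, ker P.p b c z ⊗ assocR P.p a z d e ⟶ quad P.p a b c d e)
        (n₁ : ∀ y, assocR P.p a b c y ⊗ ker P.p y d e ⟶ quad P.p a b c d e),
        (∀ z w, ker P.p c d z ◁ ιR P.p a b z e w ≫ m₂ z =
          (α_ (ker P.p c d z) (ker P.p b z w) (ker P.p a w e)).inv ≫
            ιR P.p b c d w z ▷ ker P.p a w e ≫ ιQ P.p a b c d e w) ∧
        (∀ x z, ker P.p a b x ◁ ιR P.p x c d e z ≫ m₁ x =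
          swapLeft (ker P.p a b x) (ker P.p c d z) (ker P.p x z e) ≫
            ker P.p c d z ◁ (ιL P.p a b z e x ≫ (P.assoc a b z e).hom) ≫ m₂ z) ∧
        (∀ z w, ker P.p b c z ◁ ιR P.p a z d e w ≫ n₂ z =
          (α_ (ker P.p b c z) (ker P.p z d w) (ker P.p a w e)).inv ≫
            (ιL P.p b c d w z ≫ (P.assoc b c d w).hom) ▷ ker P.p a w e ≫ ιQ P.p a b c d e w) ∧
        (∀ y z, ιR P.p a b c y z ▷ ker P.p y d e ≫ n₁ y =
          (α_ (ker P.p b c z) (ker P.p a z y) (ker P.p y d e)).hom ≫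
            ker P.p b c z ◁ (ιL P.p a z d e y ≫ (P.assoc a z d e).hom) ≫ n₂ z) ∧
        ∀ x y, (α_ (ker P.p a b x) (ker P.p x c y) (ker P.p y d e)).inv ≫
          (ιL P.p a b c y x ≫ (P.assoc a b c y).hom) ▷ ker P.p y d e ≫ n₁ y =
            ker P.p a b x ◁ (ιL P.p x c d e y ≫ (P.assoc x c d e).hom) ≫ m₁ x :=
    P.pentagon a b c d e
  refine ⟨m₂, m₁, n₂, n₁, fun l z w q r s => ?_, fun l x z r q s => ?_, fun l z w q r s => ?_,
    fun l y z q s t => ?_, fun l x y r s t => ?_⟩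
  · simpa using app_congr (h₁ z w) (q ⊠ r ⊠ s)
  · simpa using app_congr (h₂ x z) (r ⊠ q ⊠ s)
  · simpa using app_congr (h₃ z w) (q ⊠ r ⊠ s)
  · simpa using app_congr (h₄ y z) ((q ⊠ s) ⊠ t)
  · simpa using app_congr (h₅ x y) (r ⊠ s ⊠ t)

theorem exists_triangle (a b c y : A) :
    ∃ m : P.j.obj y ⊗ assocR P.p a y b c ⟶ ker P.p a b c,
      (∀ (l : List V) (z : A) (t : Elem l (P.j.obj y)) (q : Elem l (ker P.p y b z))
        (s : Elem l (ker P.p a z c)),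
        m ⋆ t ⊠ coR P.p q s = pact₂ P.p s ((P.leftUnit b z).hom ⋆ coUL P.p P.j t q)) ∧
      ∀ (l : List V) (x : A) (t : Elem l (P.j.obj y)) (r : Elem l (ker P.p a y x))
        (s : Elem l (ker P.p x b c)),
        m ⋆ t ⊠ ((P.assoc a y b c).hom ⋆ coL P.p r s) =
          pact₁ P.p s ((P.rightUnit a x).hom ⋆ coUR P.p P.j t r) := by
  obtain ⟨m, h₁, h₂⟩ : ∃ m : P.j.obj y ⊗ assocR P.p a y b c ⟶ ker P.p a b c,
      (∀ z, P.j.obj y ◁ ιR P.p a y b c z ≫ m =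
        (α_ (P.j.obj y) (ker P.p y b z) (ker P.p a z c)).inv ≫
          (ιUL P.p P.j y b z ≫ (P.leftUnit b z).hom) ▷ ker P.p a z c ≫
            (β_ (b ⟶[V] z) (ker P.p a z c)).hom ≫ kact₂ P.p a b z c) ∧
      ∀ x, P.j.obj y ◁ (ιL P.p a y b c x ≫ (P.assoc a y b c).hom) ≫ m =
        (α_ (P.j.obj y) (ker P.p a y x) (ker P.p x b c)).inv ≫
          (ιUR P.p P.j a y x ≫ (P.rightUnit a x).hom) ▷ ker P.p x b c ≫
            (β_ (a ⟶[V] x) (ker P.p x b c)).hom ≫ kact₁ P.p a x b c :=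
    P.triangle a b c y
  refine ⟨m, fun l z t q s => ?_, fun l x t r s => ?_⟩
  · simpa using app_congr (h₁ z) (t ⊠ q ⊠ s)
  · simpa using app_congr (h₂ x) (t ⊠ r ⊠ s)

end Promonoidal
end PromonoidalElements
end StarAut

namespace StarAut
open Elem

/-! ### Coherence of the constraints of the upper convolution -/
section Coherence
variable {V : Type u} [Category.{v} V] [MonoidalCategory V] [SymmetricCategory V]
  [MonoidalClosed V] [HasLimits V] [HasColimits V] {A : Type v} [EnrichedCategory V A]
  {l : List V} {P : Promonoidal V A}

namespace DayData

section
variable {p : EnrichedFunctor V (TensorCat Aᵒᵖ (TensorCat Aᵒᵖ A)) V} (D : DayData p)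

/-- The morphism `f * g ⟶ f' * g` induced by a morphism `f ⟶ f'`. -/
noncomputable def homL {f f' : EnrichedFunctor V A V}
    (φ : ForgetEnrichment.of V f ⟶ ForgetEnrichment.of V f') (g : EnrichedFunctor V A V) :
    ForgetEnrichment.of V (D.T.obj ⟨f, g⟩) ⟶ ForgetEnrichment.of V (D.T.obj ⟨f', g⟩) :=
  (partL D.T g).forget.map φ

/-- The morphism `f * g ⟶ f * g'` induced by a morphism `g ⟶ g'`. -/
noncomputable def homR (f : EnrichedFunctor V A V) {g g' : EnrichedFunctor V A V}
    (φ : ForgetEnrichment.of V g ⟶ ForgetEnrichment.of V g') :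
    ForgetEnrichment.of V (D.T.obj ⟨f, g⟩) ⟶ ForgetEnrichment.of V (D.T.obj ⟨f, g'⟩) :=
  (partR D.T f).forget.map φ

theorem homL_el {f f' g : EnrichedFunctor V A V}
    (φ : ForgetEnrichment.of V f ⟶ ForgetEnrichment.of V f') {a b c : A} (x : Elem l (f.obj a))
    (y : Elem l (g.obj b)) (r : Elem l (ker p a b c)) :
    arrAt (D.homL φ g) c ⋆ D.el x y r = D.el (arrAt φ a ⋆ x) y r := by
  rw [arrAt_app, arrAt_app]
  exact (congrArg _ (arr_forget (partL D.T g) φ)).trans (D.evl_el_fst x y r _)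

theorem homR_el {f g g' : EnrichedFunctor V A V}
    (φ : ForgetEnrichment.of V g ⟶ ForgetEnrichment.of V g') {a b c : A} (x : Elem l (f.obj a))
    (y : Elem l (g.obj b)) (r : Elem l (ker p a b c)) :
    arrAt (D.homR f φ) c ⋆ D.el x y r = D.el x (arrAt φ b ⋆ y) r := by
  rw [arrAt_app, arrAt_app]
  exact (congrArg _ (arr_forget (partR D.T f) φ)).trans (D.evl_el_snd x y r _)

/-- The fourfold analogue of `midR`. It carries an equality in the target of the pentagon for `p` to
one in `f * (g * (h * k))`. -/
theorem exists_quad (f g h k : EnrichedFunctor V A V) (a b c d e : A) :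
    ∃ M : f.obj a ⊗ g.obj b ⊗ h.obj c ⊗ k.obj d ⊗ quad p a b c d e ⟶
        (D.T.obj ⟨f, D.T.obj ⟨g, D.T.obj ⟨h, k⟩⟩⟩).obj e,
      ∀ (l : List V) (i : A) (x : Elem l (f.obj a)) (y : Elem l (g.obj b)) (z : Elem l (h.obj c))
        (w : Elem l (k.obj d)) (q : Elem l (assocR p b c d i)) (s : Elem l (ker p a i e)),
        M ⋆ x ⊠ y ⊠ z ⊠ w ⊠ coQ p q s = D.el x (D.midR g h k b c d i ⋆ y ⊠ z ⊠ w ⊠ q) s := by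
  let K (i : A) : f.obj a ⊗ g.obj b ⊗ h.obj c ⊗ k.obj d ⊗ assocR p b c d i ⊗ ker p a i e ⟶
      (D.T.obj ⟨f, D.T.obj ⟨g, D.T.obj ⟨h, k⟩⟩⟩).obj e :=
    f.obj a ◁ (g.obj b ◁ (h.obj c ◁ (α_ _ _ _).inv ≫ (α_ _ _ _).inv) ≫ (α_ _ _ _).inv ≫
      D.midR g h k b c d i ▷ _) ≫ D.ι f (D.T.obj ⟨g, D.T.obj ⟨h, k⟩⟩) a i e
  have hK : ∀ (l : List V) (i : A) (x : Elem l (f.obj a)) (y : Elem l (g.obj b))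
      (z : Elem l (h.obj c)) (w : Elem l (k.obj d)) (q : Elem l (assocR p b c d i))
      (s : Elem l (ker p a i e)), K i ⋆ x ⊠ y ⊠ z ⊠ w ⊠ q ⊠ s =
        D.el x (D.midR g h k b c d i ⋆ y ⊠ z ⊠ w ⊠ q) s := by
    intro l i x y z w q s
    simp only [K, comp_app, whiskerLeft_app, whiskerRight_app, associator_inv_app, ι_app]
  clear_value K
  obtain ⟨M, hM⟩ := coQ_exists_desc (p := p) (a := a) (b := b) (c := c) (d := d) (e := e) K (by
    intro l i i' x y z w q u s
    rw [hK, hK, el_pact₂, smul_midR])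
  exact ⟨M, fun l i x y z w q s => by rw [hM, hK]⟩

end

variable (D : DayData P.p)

/-- The associativity constraint of the upper convolution. -/
noncomputable def assocIso (f g h : EnrichedFunctor V A V) :
    VIso V (D.T.obj ⟨D.T.obj ⟨f, g⟩, h⟩) (D.T.obj ⟨f, D.T.obj ⟨g, h⟩⟩) :=
  (D.exists_assoc f g h).choose

/-- The left unit constraint of the upper convolution. -/
noncomputable def leftUnitIso (f : EnrichedFunctor V A V) : VIso V (D.T.obj ⟨P.j, f⟩) f :=
  (D.exists_leftUnit f).choose

/-- The right unit constraint of the upper convolution. -/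
noncomputable def rightUnitIso (f : EnrichedFunctor V A V) : VIso V (D.T.obj ⟨f, P.j⟩) f :=
  (D.exists_rightUnit f).choose

variable {f g h k : EnrichedFunctor V A V}

theorem assocIso_el {a b c d i : A} (x : Elem l (f.obj a)) (y : Elem l (g.obj b))
    (z : Elem l (h.obj c)) (r : Elem l (ker P.p a b i)) (s : Elem l (ker P.p i c d)) :
    arrAt (D.assocIso f g h).hom d ⋆ D.el (D.el x y r) z s =
      D.midR f g h a b c d ⋆ x ⊠ y ⊠ z ⊠ ((P.assoc a b c d).hom ⋆ coL P.p r s) :=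
  (D.exists_assoc f g h).choose_spec l a b c d i x y z r s

theorem leftUnitIso_el {a b c : A} (t : Elem l (P.j.obj a)) (x : Elem l (f.obj b))
    (r : Elem l (ker P.p a b c)) : arrAt (D.leftUnitIso f).hom c ⋆ D.el t x r =
      smul f x ((P.leftUnit b c).hom ⋆ coUL P.p P.j t r) :=
  (D.exists_leftUnit f).choose_spec l a b c t x r

theorem rightUnitIso_el {a b c : A} (x : Elem l (f.obj a)) (t : Elem l (P.j.obj b))
    (r : Elem l (ker P.p a b c)) : arrAt (D.rightUnitIso f).hom c ⋆ D.el x t r =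
      smul f x ((P.rightUnit a c).hom ⋆ coUR P.p P.j t r) :=
  (D.exists_rightUnit f).choose_spec l a b c x t r

/-- Both sides are `M` applied to `x ⊠ y ⊠ z ⊠ w` and a side of the pentagon for `p`. The left side
is unwound from the end of its path, through `n₂` (`e₁`) and then `n₁` (`e₂`); the right side
through `m₂` (`e₃`) and then `m₁` (`e₄`). Each of these is proved on generators and reused at
arbitrary elements. -/
theorem pentagon_el {a b c d e i j : A} (x : Elem l (f.obj a)) (y : Elem l (g.obj b))
    (z : Elem l (h.obj c)) (w : Elem l (k.obj d)) (r : Elem l (ker P.p a b i))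
    (s : Elem l (ker P.p i c j)) (t : Elem l (ker P.p j d e)) :
    arrAt (D.homR f (D.assocIso g h k).hom) e ⋆ arrAt (D.assocIso f (D.T.obj ⟨g, h⟩) k).hom e ⋆
        D.el (D.midR f g h a b c j ⋆ x ⊠ y ⊠ z ⊠ ((P.assoc a b c j).hom ⋆ coL P.p r s)) w t =
      arrAt (D.assocIso f g (D.T.obj ⟨h, k⟩)).hom e ⋆ D.midR (D.T.obj ⟨f, g⟩) h k i c d e ⋆
        D.el x y r ⊠ z ⊠ w ⊠ ((P.assoc i c d e).hom ⋆ coL P.p s t) := by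
  obtain ⟨M, hM⟩ := D.exists_quad f g h k a b c d e
  obtain ⟨m₂, m₁, n₂, n₁, h₁, h₂, h₃, h₄, h₅⟩ := P.exists_pentagon a b c d e
  have e₁ (i : A) : f.obj a ◁ (g.obj b ◁ (α_ _ _ _).inv ≫ (α_ _ _ _).inv ≫ D.ι g h b c i ▷ _) ≫
      D.midR f (D.T.obj ⟨g, h⟩) k a i d e ≫ arrAt (D.homR f (D.assocIso g h k).hom) e =
      f.obj a ◁ g.obj b ◁ h.obj c ◁ (swapLeft _ _ _ ≫ k.obj d ◁ n₂ i) ≫ M := by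
    apply coR_ext₅
    intro l i' x y z q w r s
    simp [hM, h₃, D.assocIso_el, D.homR_el]
  have h₁' {l : List V} {i : A} (x : Elem l (f.obj a)) (y : Elem l (g.obj b)) (z : Elem l (h.obj c))
      (w : Elem l (k.obj d)) (q : Elem l (ker P.p b c i)) (W : Elem l (assocR P.p a i d e)) :
      arrAt (D.homR f (D.assocIso g h k).hom) e ⋆ D.midR f (D.T.obj ⟨g, h⟩) k a i d e ⋆
        x ⊠ D.el y z q ⊠ w ⊠ W = M ⋆ x ⊠ y ⊠ z ⊠ w ⊠ (n₂ i ⋆ q ⊠ W) := by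
    simpa using app_congr (e₁ i) (x ⊠ y ⊠ z ⊠ q ⊠ w ⊠ W)
  have e₂ (j : A) : f.obj a ◁ (g.obj b ◁ (h.obj c ◁ ((α_ _ _ _).inv ≫ (β_ _ _).hom) ≫
        (α_ _ _ _).inv) ≫ (α_ _ _ _).inv) ≫ (α_ _ _ _).inv ≫ D.midR f g h a b c j ▷ _ ≫
      D.ι (D.T.obj ⟨f, D.T.obj ⟨g, h⟩⟩) k j d e ≫
      arrAt (D.assocIso f (D.T.obj ⟨g, h⟩) k).hom e ≫ arrAt (D.homR f (D.assocIso g h k).hom) e =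
      f.obj a ◁ g.obj b ◁ h.obj c ◁ k.obj d ◁ ((β_ _ _).hom ≫ n₁ j) ≫ M := by
    apply coR_ext₅
    intro l i x y z w t q s
    simp [h₁', h₄, D.assocIso_el]
  have h₂' {l : List V} {j : A} (x : Elem l (f.obj a)) (y : Elem l (g.obj b)) (z : Elem l (h.obj c))
      (w : Elem l (k.obj d)) (W : Elem l (assocR P.p a b c j)) (t : Elem l (ker P.p j d e)) :
      arrAt (D.homR f (D.assocIso g h k).hom) e ⋆ arrAt (D.assocIso f (D.T.obj ⟨g, h⟩) k).hom e ⋆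
        D.el (D.midR f g h a b c j ⋆ x ⊠ y ⊠ z ⊠ W) w t = M ⋆ x ⊠ y ⊠ z ⊠ w ⊠ (n₁ j ⋆ W ⊠ t) := by
    simpa only [comp_app, whiskerLeft_app, whiskerRight_app, associator_inv_app, braiding_app,
      ι_app] using app_congr (e₂ j) (x ⊠ y ⊠ z ⊠ w ⊠ t ⊠ W)
  have e₃ (i : A) : f.obj a ◁ g.obj b ◁ (h.obj c ◁ (α_ _ _ _).inv ≫ (α_ _ _ _).inv ≫
      D.ι h k c d i ▷ _) ≫ D.midR f g (D.T.obj ⟨h, k⟩) a b i e =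
      f.obj a ◁ g.obj b ◁ h.obj c ◁ k.obj d ◁ m₂ i ≫ M := by
    apply coR_ext₅
    intro l i x y z w q r s
    simp [hM, h₁]
  have h₃' {l : List V} {i : A} (x : Elem l (f.obj a)) (y : Elem l (g.obj b)) (z : Elem l (h.obj c))
      (w : Elem l (k.obj d)) (q : Elem l (ker P.p c d i)) (W : Elem l (assocR P.p a b i e)) :
      D.midR f g (D.T.obj ⟨h, k⟩) a b i e ⋆ x ⊠ y ⊠ D.el z w q ⊠ W =
        M ⋆ x ⊠ y ⊠ z ⊠ w ⊠ (m₂ i ⋆ q ⊠ W) := by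
    simpa only [comp_app, whiskerLeft_app, whiskerRight_app, associator_inv_app, ι_app] using
      app_congr (e₃ i) (x ⊠ y ⊠ z ⊠ w ⊠ q ⊠ W)
  have e₄ (i : A) : f.obj a ◁ (α_ _ _ _).inv ≫ (α_ _ _ _).inv ≫
      D.ι f g a b i ▷ _ ≫ D.midR (D.T.obj ⟨f, g⟩) h k i c d e ≫
      arrAt (D.assocIso f g (D.T.obj ⟨h, k⟩)).hom e =
      f.obj a ◁ g.obj b ◁ (swapLeft _ _ _ ≫ h.obj c ◁ (swapLeft _ _ _ ≫ k.obj d ◁ m₁ i)) ≫ M := by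
    apply coR_ext₅
    intro l i' x y r z w q s
    simp [D.assocIso_el, h₃', h₂]
  have h₄' {l : List V} {i : A} (x : Elem l (f.obj a)) (y : Elem l (g.obj b)) (z : Elem l (h.obj c))
      (w : Elem l (k.obj d)) (r : Elem l (ker P.p a b i)) (W : Elem l (assocR P.p i c d e)) :
      arrAt (D.assocIso f g (D.T.obj ⟨h, k⟩)).hom e ⋆ D.midR (D.T.obj ⟨f, g⟩) h k i c d e ⋆
        D.el x y r ⊠ z ⊠ w ⊠ W = M ⋆ x ⊠ y ⊠ z ⊠ w ⊠ (m₁ i ⋆ r ⊠ W) := by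
    simpa only [comp_app, whiskerLeft_app, whiskerRight_app, associator_inv_app,
      associator_hom_app, braiding_app, ι_app] using app_congr (e₄ i) (x ⊠ y ⊠ r ⊠ z ⊠ w ⊠ W)
  rw [h₂', h₄', h₅]

/-- The triangle for `p` sends the kernels and `t` to a single kernel with an arrow acting on one of
its variables. Balancing of the convolution over `A` moves that arrow to `z` or to `x`, where the
unit constraints put it. -/
theorem triangle_el {a b c i j : A} (x : Elem l (f.obj a)) (t : Elem l (P.j.obj b))
    (z : Elem l (g.obj c)) (r : Elem l (ker P.p a b i)) (s : Elem l (ker P.p i c j)) :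
    arrAt (D.homR f (D.leftUnitIso g).hom) j ⋆
        arrAt (D.assocIso f P.j g).hom j ⋆ D.el (D.el x t r) z s =
      arrAt (D.homL (D.rightUnitIso f).hom g) j ⋆ D.el (D.el x t r) z s := by
  obtain ⟨m, h₁, h₂⟩ := P.exists_triangle a c j b
  have e : D.midR f P.j g a b c j ≫ arrAt (D.homR f (D.leftUnitIso g).hom) j =
      f.obj a ◁ (swapLeft _ _ _ ≫ g.obj c ◁ m) ≫ D.ι f g a c j := by
    apply coR_ext₃
    intro l i x t z r s
    simp [h₁, D.homR_el, D.leftUnitIso_el, D.el_pact₂]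
  have e' := app_congr e (x ⊠ t ⊠ z ⊠ ((P.assoc a b c j).hom ⋆ coL P.p r s))
  simp only [comp_app, whiskerLeft_app, whiskerRight_app, associator_inv_app, associator_hom_app,
    braiding_app, h₂, ι_app] at e'
  rw [assocIso_el, e', homL_el, rightUnitIso_el, el_pact₁]

theorem pentagon (f g h k : EnrichedFunctor V A V) :
    D.homL (D.assocIso f g h).hom k ≫ (D.assocIso f (D.T.obj ⟨g, h⟩) k).hom ≫
        D.homR f (D.assocIso g h k).hom =
      (D.assocIso (D.T.obj ⟨f, g⟩) h k).hom ≫ (D.assocIso f g (D.T.obj ⟨h, k⟩)).hom := by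
  apply arrAt_ext
  intro e
  rw [arrAt_comp, arrAt_comp, arrAt_comp]
  -- A quadruple convolution is generated by `el (el (el x y r) z s) w t`: the outermost coend is
  -- removed here, the inner triple one by the next extensionality.
  apply (D.isDayCoend _ k e).hom_ext
  intro j d
  apply D.tripleLeft_ext₂
  intro l a b c i x y z r s w t
  simp only [comp_app, ι_app, homL_el, assocIso_el, pentagon_el]

theorem triangle (f g : EnrichedFunctor V A V) :
    (D.assocIso f P.j g).hom ≫ D.homR f (D.leftUnitIso g).hom =
      D.homL (D.rightUnitIso f).hom g := by
  apply arrAt_ext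
  intro c
  rw [arrAt_comp]
  apply D.tripleLeft_hom_ext
  intro l a b c i x y z r s
  rw [comp_app, triangle_el]

/-- On generators both sides apply the transformation to the factor `f a` and the associativity of
`p` to the kernels, and these do not interfere. The other variables are treated alike. -/
theorem assocIso_natural₁ {f' : EnrichedFunctor V A V} {d : A}
    (x : Elem l ((D.T.obj ⟨D.T.obj ⟨f, g⟩, h⟩).obj d)) (s : Elem l (f ⟶[V] f')) :
    evl (evl x ((D.mapL f f' g ≫ D.mapL _ _ h) ⋆ s)) (arr (D.assocIso f' g h).hom) =
      evl (evl x (arr (D.assocIso f g h).hom)) (D.mapL f f' (D.T.obj ⟨g, h⟩) ⋆ s) := by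
  rw [← arrAt_app, ← arrAt_app]
  have e : _ ◁ (D.mapL f f' g ≫ D.mapL _ _ h) ≫ evalAt _ _ d ≫ arrAt (D.assocIso f' g h).hom d =
      arrAt (D.assocIso f g h).hom d ▷ _ ≫ _ ◁ D.mapL f f' (D.T.obj ⟨g, h⟩) ≫ evalAt _ _ d := by
    apply D.tripleLeft_ext
    intro l a b c i x y z r s t
    simp [D.evl_mapL, D.assocIso_el, D.evl_midR₁]
  simpa using app_congr e (x ⊠ s)

theorem assocIso_natural₂ {g' : EnrichedFunctor V A V} {d : A}
    (x : Elem l ((D.T.obj ⟨D.T.obj ⟨f, g⟩, h⟩).obj d)) (s : Elem l (g ⟶[V] g')) :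
    evl (evl x ((D.mapR f g g' ≫ D.mapL _ _ h) ⋆ s)) (arr (D.assocIso f g' h).hom) =
      evl (evl x (arr (D.assocIso f g h).hom)) ((D.mapL g g' h ≫ D.mapR f _ _) ⋆ s) := by
  rw [← arrAt_app, ← arrAt_app]
  have e : _ ◁ (D.mapR f g g' ≫ D.mapL _ _ h) ≫ evalAt _ _ d ≫ arrAt (D.assocIso f g' h).hom d =
      arrAt (D.assocIso f g h).hom d ▷ _ ≫ _ ◁ (D.mapL g g' h ≫ D.mapR f _ _) ≫
        evalAt _ _ d := by
    apply D.tripleLeft_ext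
    intro l a b c i x y z r s t
    simp [D.evl_mapL, D.evl_mapR, D.assocIso_el, D.evl_midR₂]
  simpa using app_congr e (x ⊠ s)

theorem assocIso_natural₃ {h' : EnrichedFunctor V A V} {d : A}
    (x : Elem l ((D.T.obj ⟨D.T.obj ⟨f, g⟩, h⟩).obj d)) (s : Elem l (h ⟶[V] h')) :
    evl (evl x (D.mapR (D.T.obj ⟨f, g⟩) h h' ⋆ s)) (arr (D.assocIso f g h').hom) =
      evl (evl x (arr (D.assocIso f g h).hom)) ((D.mapR g h h' ≫ D.mapR f _ _) ⋆ s) := by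
  rw [← arrAt_app, ← arrAt_app]
  have e : _ ◁ D.mapR (D.T.obj ⟨f, g⟩) h h' ≫ evalAt _ _ d ≫ arrAt (D.assocIso f g h').hom d =
      arrAt (D.assocIso f g h).hom d ▷ _ ≫ _ ◁ (D.mapR g h h' ≫ D.mapR f _ _) ≫
        evalAt _ _ d := by
    apply D.tripleLeft_ext
    intro l a b c i x y z r s t
    simp [D.evl_mapR, D.assocIso_el, D.evl_midR₃]
  simpa using app_congr e (x ⊠ s)

theorem leftUnitIso_natural {f' : EnrichedFunctor V A V} {c : A}
    (x : Elem l ((D.T.obj ⟨P.j, f⟩).obj c)) (s : Elem l (f ⟶[V] f')) :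
    evl (evl x (D.mapR P.j f f' ⋆ s)) (arr (D.leftUnitIso f').hom) =
      evl (evl x (arr (D.leftUnitIso f).hom)) s := by
  rw [← arrAt_app, ← arrAt_app]
  have e : _ ◁ D.mapR P.j f f' ≫ evalAt _ _ c ≫ arrAt (D.leftUnitIso f').hom c =
      arrAt (D.leftUnitIso f).hom c ▷ _ ≫ evalAt _ _ c := by
    apply (D.isDayCoend P.j f c).elem_ext_right
    intro l a b t x r s
    simp [D.evl_mapR, D.leftUnitIso_el, evl_smul]
  simpa using app_congr e (x ⊠ s)

theorem rightUnitIso_natural {f' : EnrichedFunctor V A V} {c : A}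
    (x : Elem l ((D.T.obj ⟨f, P.j⟩).obj c)) (s : Elem l (f ⟶[V] f')) :
    evl (evl x (D.mapL f f' P.j ⋆ s)) (arr (D.rightUnitIso f').hom) =
      evl (evl x (arr (D.rightUnitIso f).hom)) s := by
  rw [← arrAt_app, ← arrAt_app]
  have e : _ ◁ D.mapL f f' P.j ≫ evalAt _ _ c ≫ arrAt (D.rightUnitIso f').hom c =
      arrAt (D.rightUnitIso f).hom c ▷ _ ≫ evalAt _ _ c := by
    apply (D.isDayCoend f P.j c).elem_ext_right
    intro l a b x t r s
    simp [D.evl_mapL, D.rightUnitIso_el, evl_smul]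
  simpa using app_congr e (x ⊠ s)

theorem assocIso_isGradedNat₁ (g h : EnrichedFunctor V A V) :
    IsGradedNat ((partL D.T g).comp V (partL D.T h)) (partL D.T (D.T.obj ⟨g, h⟩))
      (fun f => (D.assocIso f g h).elem) :=
  isGradedNat_of_elem (S := (partL D.T g).comp V (partL D.T h))
    (T := partL D.T (D.T.obj ⟨g, h⟩)) (fun f => D.assocIso f g h)
    fun _ f f' c x s => D.assocIso_natural₁ (f := f) (f' := f') (d := c) x s

theorem assocIso_isGradedNat₂ (f h : EnrichedFunctor V A V) :
    IsGradedNat ((partR D.T f).comp V (partL D.T h)) ((partL D.T h).comp V (partR D.T f))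
      (fun g => (D.assocIso f g h).elem) :=
  isGradedNat_of_elem (S := (partR D.T f).comp V (partL D.T h))
    (T := (partL D.T h).comp V (partR D.T f)) (fun g => D.assocIso f g h)
    fun _ g g' c x s => D.assocIso_natural₂ (g := g) (g' := g') (d := c) x s

theorem assocIso_isGradedNat₃ (f g : EnrichedFunctor V A V) :
    IsGradedNat (partR D.T (D.T.obj ⟨f, g⟩)) ((partR D.T g).comp V (partR D.T f))
      (fun h => (D.assocIso f g h).elem) :=
  isGradedNat_of_elem (S := partR D.T (D.T.obj ⟨f, g⟩))
    (T := (partR D.T g).comp V (partR D.T f)) (fun h => D.assocIso f g h)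
    fun _ h h' c x s => D.assocIso_natural₃ (h := h) (h' := h') (d := c) x s

theorem leftUnitIso_isGradedNat :
    IsGradedNat (partR D.T P.j) (EnrichedFunctor.id V _) (fun f => (D.leftUnitIso f).elem) :=
  isGradedNat_of_elem (S := partR D.T P.j) (T := EnrichedFunctor.id V _) D.leftUnitIso
    fun _ f f' c x s => (D.leftUnitIso_natural (f := f) (f' := f') (c := c) x s).trans
      (congrArg (evl _) (id_app s).symm)

theorem rightUnitIso_isGradedNat :
    IsGradedNat (partL D.T P.j) (EnrichedFunctor.id V _) (fun f => (D.rightUnitIso f).elem) :=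
  isGradedNat_of_elem (S := partL D.T P.j) (T := EnrichedFunctor.id V _) D.rightUnitIso
    fun _ f f' c x s => (D.rightUnitIso_natural (f := f) (f' := f') (c := c) x s).trans
      (congrArg (evl _) (id_app s).symm)

/-- The monoidal structure given by the upper convolution. -/
noncomputable def monoidal : MonoidalVCat D.T P.j where
  assoc := D.assocIso
  leftUnit := D.leftUnitIso
  rightUnit := D.rightUnitIso
  assoc_natural₁ := D.assocIso_isGradedNat₁
  assoc_natural₂ := D.assocIso_isGradedNat₂
  assoc_natural₃ := D.assocIso_isGradedNat₃
  leftUnit_natural := D.leftUnitIso_isGradedNat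
  rightUnit_natural := D.rightUnitIso_isGradedNat
  pentagon := D.pentagon
  triangle := D.triangle

end DayData
end Coherence
end StarAut

namespace StarAut
open Elem

/-! ### The upper convolution -/
section Convolution
variable {V : Type u} [Category.{v} V] [MonoidalCategory V] [SymmetricCategory V]
  [MonoidalClosed V] [HasLimits V] [HasColimits V] {A : Type v} [EnrichedCategory V A]
  {l : List V} {P : Promonoidal V A}

namespace DayData
variable (D : DayData P.p)

theorem ι_natural (f g : EnrichedFunctor V A V) (a b c c' : A) :
    D.ι f g a b c ▷ _ ≫ act (D.T.obj ⟨f, g⟩) c c' =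
      (α_ _ _ _).hom ≫ f.obj a ◁ ((α_ _ _ _).hom ≫ g.obj b ◁ kact₃ P.p a b c c') ≫
        D.ι f g a b c' := by
  rw [← cancel_epi (α_ _ _ _).inv, ← cancel_epi (_ ◁ (α_ _ _ _).inv)]
  apply elem_ext₄
  intro l x y r s
  simp [D.smul_el]

theorem ι_natural_fst (f f' g : EnrichedFunctor V A V) (a b c : A) :
    D.ι f g a b c ▷ _ ≫ _ ◁ D.mapL f f' g ≫ evalAt (D.T.obj ⟨f, g⟩) (D.T.obj ⟨f', g⟩) c =
      swapRight _ _ _ ≫ evalAt f f' a ▷ _ ≫ D.ι f' g a b c := by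
  rw [← cancel_epi (α_ _ _ _).inv, ← cancel_epi (_ ◁ (α_ _ _ _).inv)]
  apply elem_ext₄
  intro l x y r s
  simp [D.evl_mapL]

theorem ι_natural_snd (f g g' : EnrichedFunctor V A V) (a b c : A) :
    D.ι f g a b c ▷ _ ≫ _ ◁ D.mapR f g g' ≫ evalAt (D.T.obj ⟨f, g⟩) (D.T.obj ⟨f, g'⟩) c =
      (α_ _ _ _).hom ≫ f.obj a ◁ (swapRight _ _ _ ≫ evalAt g g' b ▷ _) ≫ D.ι f g' a b c := by
  rw [← cancel_epi (α_ _ _ _).inv, ← cancel_epi (_ ◁ (α_ _ _ _).inv)]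
  apply elem_ext₄
  intro l x y r s
  simp [D.evl_mapR]

theorem ι_assoc (f g h : EnrichedFunctor V A V) (a b c d : A) :
    ∃ m : ((f.obj a ⊗ g.obj b) ⊗ h.obj c) ⊗ assocR P.p a b c d ⟶
        (D.T.obj ⟨f, D.T.obj ⟨g, h⟩⟩).obj d,
      (∀ y : A, _ ◁ ιR P.p a b c d y ≫ m =
        (α_ _ _ _).hom ≫ (α_ _ _ _).hom ≫ f.obj a ◁ (g.obj b ◁ (α_ _ _ _).inv ≫
          (α_ _ _ _).inv ≫ D.ι g h b c y ▷ _) ≫ D.ι f (D.T.obj ⟨g, h⟩) a y d) ∧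
      ∀ x : A, _ ◁ (ιL P.p a b c d x ≫ (P.assoc a b c d).hom) ≫ m =
        tensorμ _ _ _ _ ≫ ((α_ _ _ _).hom ≫ D.ι f g a b x) ▷ _ ≫
          D.ι (D.T.obj ⟨f, g⟩) h x c d ≫ arrAt (D.assocIso f g h).hom d := by
  -- The required map is `midR` up to bracketing: the first condition defines it, the second is the
  -- formula for the associativity constraint.
  refine ⟨(α_ _ _ _).hom ≫ (α_ _ _ _).hom ≫ D.midR f g h a b c d, fun y => ?_, fun x => ?_⟩
  · rw [← cancel_epi (α_ _ _ _).inv, ← cancel_epi (α_ _ _ _).inv]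
    apply elem_ext₅
    intro l x y z r s
    simp
  · rw [← cancel_epi (α_ _ _ _).inv, ← cancel_epi (α_ _ _ _).inv]
    apply elem_ext₅
    intro l x y z r s
    simp [assocIso_el]

theorem ι_leftUnit (f : EnrichedFunctor V A V) (a b c : A) :
    D.ι P.j f a b c ≫ arrAt (D.leftUnitIso f).hom c =
      swapLeft _ _ _ ≫ f.obj b ◁ (ιUL P.p P.j a b c ≫ (P.leftUnit b c).hom) ≫ act f b c := by
  apply elem_ext₃
  intro l t x r
  simp [leftUnitIso_el]

theorem ι_rightUnit (f : EnrichedFunctor V A V) (a b c : A) :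
    D.ι f P.j a b c ≫ arrAt (D.rightUnitIso f).hom c =
      f.obj a ◁ (ιUR P.p P.j a b c ≫ (P.rightUnit a c).hom) ≫ act f a c := by
  apply elem_ext₃
  intro l x t r
  simp [rightUnitIso_el]

/-- The upper convolution on the `V`-functor category. -/
noncomputable def upperConvolution : UpperConvolution P where
  T := D.T
  monoidal := D.monoidal
  ι := D.ι
  ι_cowedge f g c := (D.isDayCoend f g c).cowedge
  ι_universal f g c := (D.isDayCoend f g c).universal
  ι_natural := D.ι_natural
  ι_natural_fst := D.ι_natural_fst
  ι_natural_snd := D.ι_natural_snd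
  ι_assoc := D.ι_assoc
  ι_leftUnit := D.ι_leftUnit
  ι_rightUnit := D.ι_rightUnit

end DayData

/-! ### Every upper convolution is a choice of Day convolution data. -/

namespace UpperConvolution
variable (U : UpperConvolution P)

/-- The coprojections of an upper convolution. -/
noncomputable def coproj (f g : EnrichedFunctor V A V) (a b c : A) :
    f.obj a ⊗ (g.obj b ⊗ ker P.p a b c) ⟶ (U.T.obj ⟨f, g⟩).obj c := U.ι f g a b c

theorem smul_coproj {f g : EnrichedFunctor V A V} {a b c c' : A} (x : Elem l (f.obj a))
    (y : Elem l (g.obj b)) (r : Elem l (ker P.p a b c)) (s : Elem l (c ⟶[V] c')) :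
    smul (U.T.obj ⟨f, g⟩) (U.coproj f g a b c ⋆ x ⊠ y ⊠ r) s =
      U.coproj f g a b c' ⋆ x ⊠ y ⊠ pact₃ P.p r s := by
  have h : U.coproj f g a b c ▷ _ ≫ act (U.T.obj ⟨f, g⟩) c c' =
    (α_ (f.obj a) (g.obj b ⊗ ker P.p a b c) _).hom ≫
      f.obj a ◁ ((α_ (g.obj b) (ker P.p a b c) (c ⟶[V] c')).hom ≫
      g.obj b ◁ kact₃ P.p a b c c') ≫ U.coproj f g a b c' := U.ι_natural f g a b c c'
  simpa using app_congr h ((x ⊠ y ⊠ r) ⊠ s)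

theorem evl_coproj_fst {f f' g : EnrichedFunctor V A V} {a b c : A} (x : Elem l (f.obj a))
    (y : Elem l (g.obj b)) (r : Elem l (ker P.p a b c)) (t : Elem l (f ⟶[V] f')) :
    evl (F := U.T.obj ⟨f, g⟩) (G := U.T.obj ⟨f', g⟩) (U.coproj f g a b c ⋆ x ⊠ y ⊠ r)
      (fmap (partL U.T g) t) = U.coproj f' g a b c ⋆ evl x t ⊠ y ⊠ r := by
  let m : (f ⟶[V] f') ⟶ (U.T.obj ⟨f, g⟩ ⟶[V] U.T.obj ⟨f', g⟩) := (partL U.T g).map f f'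
  have h : U.coproj f g a b c ▷ _ ≫ _ ◁ m ≫ evalAt (U.T.obj ⟨f, g⟩) (U.T.obj ⟨f', g⟩) c =
    swapRight (f.obj a) (g.obj b ⊗ ker P.p a b c) (f ⟶[V] f') ≫
      evalAt f f' a ▷ (g.obj b ⊗ ker P.p a b c) ≫ U.coproj f' g a b c :=
    U.ι_natural_fst f f' g a b c
  change evl _ (m ⋆ t) = _
  clear_value m
  simpa using app_congr h ((x ⊠ y ⊠ r) ⊠ t)

theorem evl_coproj_snd {f g g' : EnrichedFunctor V A V} {a b c : A} (x : Elem l (f.obj a))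
    (y : Elem l (g.obj b)) (r : Elem l (ker P.p a b c)) (t : Elem l (g ⟶[V] g')) :
    evl (F := U.T.obj ⟨f, g⟩) (G := U.T.obj ⟨f, g'⟩) (U.coproj f g a b c ⋆ x ⊠ y ⊠ r)
      (fmap (partR U.T f) t) = U.coproj f g' a b c ⋆ x ⊠ evl y t ⊠ r := by
  let m : (g ⟶[V] g') ⟶ (U.T.obj ⟨f, g⟩ ⟶[V] U.T.obj ⟨f, g'⟩) := (partR U.T f).map g g'
  have h : U.coproj f g a b c ▷ _ ≫ _ ◁ m ≫ evalAt (U.T.obj ⟨f, g⟩) (U.T.obj ⟨f, g'⟩) c =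
    (α_ (f.obj a) (g.obj b ⊗ ker P.p a b c) _).hom ≫
      f.obj a ◁ (swapRight (g.obj b) (ker P.p a b c) (g ⟶[V] g') ≫
        evalAt g g' b ▷ ker P.p a b c) ≫ U.coproj f g' a b c := U.ι_natural_snd f g g' a b c
  change evl _ (m ⋆ t) = _
  clear_value m
  simpa using app_congr h ((x ⊠ y ⊠ r) ⊠ t)

/-- The convolution tensor product underlying an upper convolution. -/
noncomputable def dayData : DayData P.p where
  T := U.T
  ι := U.coproj
  isDayCoend f g c := ⟨U.ι_cowedge f g c, U.ι_universal f g c⟩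
  smul_ι := U.smul_coproj
  evl_ι_fst := U.evl_coproj_fst
  evl_ι_snd := U.evl_coproj_snd

end UpperConvolution

end Convolution
end StarAut

namespace StarAut
open Elem

/-! ### Elements of the dual of a `V`-functor -/
section DualElements
variable {V : Type u} [Category.{v} V] [MonoidalCategory V] [SymmetricCategory V]
  [MonoidalClosed V]
universe u₁ u₂
variable {l : List V}

namespace Elem

/-- Evaluation at a fresh generic variable is the transpose of the evaluation morphism, which is the
identity. It is the eta rule for internal homs. -/
theorem ihom_elem_ext {X Y : V} {s t : Elem l ((ihom X).obj Y)}
    (h : ap (var : Elem (X :: l) X) (con s) = ap var (con t)) : s = t := by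
  have h₃ : MonoidalClosed.curry ((ihom.ev X).app Y) = 𝟙 _ := by
    apply MonoidalClosed.uncurry_injective
    rw [MonoidalClosed.uncurry_curry, MonoidalClosed.uncurry_eq, MonoidalCategory.whiskerLeft_id]
    exact (Category.id_comp _).symm
  apply lin_injective
  rw [← ev_app, ← ev_app, app_var_pair_con, app_var_pair_con, h₃, id_app, id_app] at h
  exact h

section
variable {C : Type u₁} {D : Type u₂} [EnrichedCategory V C] [EnrichedCategory V D]

/-- The effect of a contravariant `V`-functor on elements of hom-objects. -/
def opmap (S : EnrichedFunctor V Cᵒᵖ D) {a b : C} (s : Elem l (a ⟶[V] b)) :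
    Elem l (S.obj (op b) ⟶[V] S.obj (op a)) := fmap S (a := op b) (b := op a) s

theorem opmap_Sop (S : EnrichedFunctor V Cᵒᵖ C) {a b : C} (s : Elem l (a ⟶[V] b)) :
    (fmap (Sop S) s : Elem l (S.obj (op b) ⟶[V] S.obj (op a))) = opmap S s :=
  (fmap_comp (opOp V C) (opF S) s).trans
    (congrArg (fun t => fmap S (a := op b) (b := op a) t) (id_app s))

theorem opsmul_opF_yo (F : EnrichedFunctor V C D) {d : D} {a b : C}
    (x : Elem l (F.obj b ⟶[V] d)) (s : Elem l (a ⟶[V] b)) :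
    opsmul ((opF F).comp V (yo d)) x s = cmp (fmap F s) x :=
  (smul_comp (opF F) (yo d) (a := op b) (b := op a) x s).trans
    (opsmul_yo (a := F.obj a) (b := F.obj b) x (fmap F s))

theorem opsmul_comp_coyo (S : EnrichedFunctor V Cᵒᵖ D) {d : D} {a b : C}
    (x : Elem l (d ⟶[V] S.obj (op b))) (s : Elem l (a ⟶[V] b)) :
    opsmul (S.comp V (coyo d)) x s = cmp x (opmap S s) :=
  (smul_comp S (coyo d) (a := op b) (b := op a) x s).trans (smul_coyo x (opmap S s))
end

end Elem

variable [HasLimits V] [StarAutonomousBase V] {A : Type v} [EnrichedCategory V A]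
  (S : EnrichedFunctor V Aᵒᵖ A) {f g : EnrichedFunctor V A V}

/-- The dual of a `V`-functor. -/
noncomputable abbrev star (f : EnrichedFunctor V A V) : EnrichedFunctor V A V :=
  (starFunctor S).obj (op f)

/-- The evaluation pairing of a `V`-functor and its dual. -/
noncomputable def starEv (f : EnrichedFunctor V A V) (a : A) :
    f.obj (S.obj (op a)) ⊗ (star S f).obj a ⟶ StarAutonomousBase.dualizing (V := V) :=
  (ihom.ev (f.obj (S.obj (op a)))).app _

/-- The effect of the dual on hom-objects. -/
noncomputable def starMap (f g : EnrichedFunctor V A V) :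
    (f ⟶[V] g) ⟶ (star S g ⟶[V] star S f) := (starFunctor S).map (op g) (op f)

theorem toFunctorCat_comp_π {B : Type u₁} {D : Type u₂} [EnrichedCategory V B]
    [EnrichedCategory V D] (obj : B → EnrichedFunctor V A D) (q) (hq) (hid) (hcomp) (b b' : B)
    (c : A) : (toFunctorCat obj q hq hid hcomp).map b b' ≫ natπ (obj b) (obj b') c = q b b' c :=
  natLift_π (q b b') (hq b b') c

/-- The dual is a composite of three `V`-functors, each given on hom-objects by its components;
composing the three component formulas gives the component of the dual at `a`. -/
theorem starMap_π (f g : EnrichedFunctor V A V) (a : A) :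
    starMap S f g ≫ natπ (star S g) (star S f) a =
      natπ f g (S.obj (op a)) ≫ (dualFunctor V).map (op (g.obj (S.obj (op a))))
        (op (f.obj (S.obj (op a)))) := by
  let G (f : EnrichedFunctor V A V) : EnrichedFunctor V A Vᵒᵖ := (Sop S).comp V (opF f)
  have h₁ : (opFunctor A V).map (op g) (op f) ≫ natπ (opF g) (opF f) (op (S.obj (op a))) =
    natπ f g (S.obj (op a)) := toFunctorCat_comp_π _ _ _ _ _ _ _ _
  have h₂ : (whiskerL (Sop S) Vᵒᵖ).map (opF g) (opF f) ≫ natπ (G g) (G f) a =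
    natπ (opF g) (opF f) (op (S.obj (op a))) := toFunctorCat_comp_π _ _ _ _ _ _ _ _
  have h₃ : (whiskerR A (dualFunctor V)).map (G g) (G f) ≫ natπ (star S g) (star S f) a =
      natπ (G g) (G f) a ≫ (dualFunctor V).map (op (g.obj (S.obj (op a))))
        (op (f.obj (S.obj (op a)))) := toFunctorCat_comp_π _ _ _ _ _ _ _ _
  have h₄ : starMap S f g = (opFunctor A V).map (op g) (op f) ≫
      (whiskerL (Sop S) Vᵒᵖ).map (opF g) (opF f) ≫ (whiskerR A (dualFunctor V)).map (G g) (G f) :=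
    rfl
  exact (congrArg (· ≫ natπ (star S g) (star S f) a) h₄).trans
    ((Category.assoc _ _ _).trans ((_ ≫= ((Category.assoc _ _ _).trans (_ ≫= h₃))).trans
      ((_ ≫= ((Category.assoc _ _ _).symm.trans (h₂ =≫ _))).trans
        ((Category.assoc _ _ _).symm.trans (h₁ =≫ _)))))

variable {S}
namespace Elem

/-- The evaluation pairing on elements. -/
noncomputable def pr {a : A} (x : Elem l (f.obj (S.obj (op a)))) (φ : Elem l ((star S f).obj a)) :
    Elem l (StarAutonomousBase.dualizing (V := V)) := starEv S f a ⋆ x ⊠ φ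

@[simp]
theorem starEv_app {a : A} (x : Elem l (f.obj (S.obj (op a)))) (φ : Elem l ((star S f).obj a)) :
    starEv S f a ⋆ x ⊠ φ = pr x φ := rfl

theorem pr_ext {a : A} {φ ψ : Elem l ((star S f).obj a)}
    (h : pr (var : Elem (f.obj (S.obj (op a)) :: l) _) (con φ) = pr var (con ψ)) : φ = ψ :=
  ihom_elem_ext h

theorem ap_cmp_op {X Y Z : V} (x : Elem l X) (t : Elem l (EnrichedCategory.Hom (V := V) X Y))
    (φ : Elem l (EnrichedCategory.Hom (V := V) Y Z)) :
    ap x (cmp (C := Vᵒᵖ) (a := op Z) (b := op Y) (c := op X) φ t) = ap (ap x t) φ :=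
  (congrArg (ap x) (cmp_op (C := V) t φ)).trans (ap_cmp x t φ)

theorem ap_dualFunctor {X Y : V} (x : Elem l X) (t : Elem l (EnrichedCategory.Hom (V := V) X Y))
    (φ : Elem l ((dualFunctor V).obj (op Y))) :
    ap x (smul (dualFunctor V) (a := op Y) (b := op X) φ t : Elem l ((ihom X).obj _)) =
      ap (ap x t) (show Elem l ((ihom Y).obj _) from φ) :=
  (congrArg (ap x) (smul_coyo (C := Vᵒᵖ) (a := op (StarAutonomousBase.dualizing (V := V)))
    (b := op Y) (c := op X) φ t)).trans (ap_cmp_op x t φ)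

/-- The action on `f*` is the contravariant functor `[-, D]` applied to the action on `f` through
`S`, and `[-, D]` acts by precomposition. With `pr_evl`, this is all that is used about the dual
besides nondegeneracy of the pairing in `φ` and, for `f ≅ f**`, the dualizing property. -/
theorem pr_smul {a b : A} (x : Elem l (f.obj (S.obj (op b)))) (φ : Elem l ((star S f).obj a))
    (u : Elem l (a ⟶[V] b)) :
    pr x (smul (star S f) φ u) = pr (smul f x (opmap S u)) φ := by
  have h₁ : smul (star S f) φ u = smul (dualFunctor V) (a := op (f.obj (S.obj (op a))))
      (b := op (f.obj (S.obj (op b)))) φ (fmap f (opmap S u)) :=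
    (smul_comp ((Sop S).comp V (opF f)) (dualFunctor V) φ u).trans
      (congrArg (fun t => smul (dualFunctor V) (a := op (f.obj (S.obj (op a))))
        (b := op (f.obj (S.obj (op b)))) φ t) ((fmap_comp (Sop S) (opF f) u).trans
          (congrArg (fun t => fmap (V := V) f (a := S.obj (op b)) (b := S.obj (op a)) t)
            (opmap_Sop S u))))
  have h₂ := ap_dualFunctor x (fmap f (opmap S u)) φ
  rw [← smul_eq_ap] at h₂
  exact (congrArg (pr x) h₁).trans h₂

/-- The dual acts on transformations by precomposition, hence as an adjoint with respect to the
pairing. -/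
theorem pr_evl {a : A} (x : Elem l (f.obj (S.obj (op a)))) (φ : Elem l ((star S g).obj a))
    (τ : Elem l (f ⟶[V] g)) : pr x (evl φ (starMap S f g ⋆ τ)) = pr (evl x τ) φ := by
  have h₁ : evl φ (starMap S f g ⋆ τ) = ap φ (((dualFunctor V).map (op (g.obj (S.obj (op a))))
      (op (f.obj (S.obj (op a))))) ⋆ natπ f g (S.obj (op a)) ⋆ τ) :=
    (evl_of_comp_π (starMap S f g) _ (starMap_π S f g a) φ τ).trans
      (congrArg (ap φ) (comp_app _ _ _))
  have h₂ := ap_dualFunctor x (natπ f g (S.obj (op a)) ⋆ τ) φ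
  rw [← evl_eq_ap] at h₂
  exact (congrArg (pr x) (h₁.trans (smul_eq_ap (dualFunctor V) (a := op (g.obj (S.obj (op a))))
    (b := op (f.obj (S.obj (op a)))) φ _).symm)).trans h₂

end Elem
end DualElements
end StarAut

namespace StarAut
open Elem

/-! ### The dual on `V`-functor categories is an antipode -/
section DualAntipode
variable {V : Type u} [Category.{v} V] [MonoidalCategory V] [SymmetricCategory V]
  [MonoidalClosed V]
universe u₁ u₂
variable {l : List V}

/-! ### Units and triangle identities of an antipode on a `V`-category. -/

section Antipodes
variable {C : Type u₁} [EnrichedCategory V C] {S : EnrichedFunctor V Cᵒᵖ C}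

/-- The transposition isomorphisms `C(b, S a) ≅ C(a, S b)` of an antipode. -/
def Antipode.swap (hS : Antipode S) (a b : C) :
    (b ⟶[V] S.obj (op a)) ≅ (a ⟶[V] S.obj (op b)) := hS.adj.iso a (op b)

namespace Elem

theorem con_smul {X : V} (F : EnrichedFunctor V C V) {a b : C} (x : Elem l (F.obj a))
    (s : Elem l (a ⟶[V] b)) : smul F (con x : Elem (X :: l) _) (con s) = con (smul F x s) := by
  rw [smul, con_pair_con, app_con]; rfl

end Elem

theorem opsmul_opF_Sop_yo {a a' b : C} (θ : Elem l (b ⟶[V] S.obj (op a)))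
    (u : Elem l (a' ⟶[V] a)) :
    opsmul ((opF (Sop S)).comp V (yo (op b))) (a := a') (b := a) θ u = cmp θ (opmap S u) :=
  (opsmul_opF_yo (Sop S) (d := op b) θ u).trans ((congrArg (fun t => cmp (C := Cᵒᵖ)
    (a := op (S.obj (op a'))) (b := op (S.obj (op a))) (c := op b) t θ) (opmap_Sop S u)).trans
      (cmp_op θ (opmap S u)))

theorem isNatural_opF_Sop_yo {b : C} {G : EnrichedFunctor V Cᵒᵖ V}
    (t : ∀ a : C, (b ⟶[V] S.obj (op a)) ⟶ G.obj (op a))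
    (h : ∀ (l : List V) (a a' : C) (θ : Elem l (b ⟶[V] S.obj (op a))) (u : Elem l (a' ⟶[V] a)),
      t a' ⋆ cmp θ (opmap S u) = opsmul G (t a ⋆ θ) u) :
    IsNatural ((opF (Sop S)).comp V (yo (op b))) G (fun a => t a.unop) :=
  isNatural_op_iff.2 fun l a' a θ u =>
    (congrArg (t a' ⋆ ·) (opsmul_opF_Sop_yo θ u)).trans (h l a a' θ u)

namespace Antipode
variable (hS : Antipode S)

/-- Naturality of the adjunction in the variable of `S`; the next lemma is naturality in the
variable of `Sᵒᵖ`. Transposing exchanges composition in front with composition behind through `S`.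
-/
theorem swap_cmp {a b b' : C} (θ : Elem l (b ⟶[V] S.obj (op a))) (u : Elem l (b' ⟶[V] b)) :
    (hS.swap a b').hom ⋆ cmp u θ = cmp ((hS.swap a b).hom ⋆ θ) (opmap S u) := by
  have h := isNatural_op_iff.1 (hS.adj.natural_right a) l b' b θ u
  exact ((congrArg _ (opsmul_yo θ u)).symm.trans h).trans (opsmul_comp_coyo S _ u)

theorem swap_cmp_opmap {a a' b : C} (θ : Elem l (b ⟶[V] S.obj (op a)))
    (u : Elem l (a' ⟶[V] a)) :
    (hS.swap a' b).hom ⋆ cmp θ (opmap S u) = cmp u ((hS.swap a b).hom ⋆ θ) := by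
  have h := isNatural_op_iff.1 (hS.adj.natural_left (op b)) l a' a θ u
  exact ((congrArg _ (opsmul_opF_Sop_yo θ u)).symm.trans h).trans (opsmul_yo _ u)

theorem swap_inv_cmp {a b a' : C} (φ : Elem l (a ⟶[V] S.obj (op b))) (u : Elem l (a' ⟶[V] a)) :
    (hS.swap a' b).inv ⋆ cmp u φ = cmp ((hS.swap a b).inv ⋆ φ) (opmap S u) := by
  have h := hS.swap_cmp_opmap ((hS.swap a b).inv ⋆ φ) u
  rw [inv_hom_app] at h
  rw [← h, hom_inv_app]

theorem swap_inv_cmp_opmap {a b b' : C} (φ : Elem l (a ⟶[V] S.obj (op b)))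
    (u : Elem l (b' ⟶[V] b)) :
    (hS.swap a b').inv ⋆ cmp φ (opmap S u) = cmp u ((hS.swap a b).inv ⋆ φ) := by
  have h := hS.swap_cmp ((hS.swap a b).inv ⋆ φ) u
  rw [inv_hom_app] at h
  rw [← h, hom_inv_app]

/-- The unit `a → S (S a)`. -/
def unitHom (a : C) : 𝟙_ V ⟶ (a ⟶[V] S.obj (op (S.obj (op a)))) :=
  eId V (S.obj (op a)) ≫ (hS.swap a (S.obj (op a))).hom

/-- The unit `a → S (S a)` obtained by the inverse transposition. -/
def unitHom' (a : C) : 𝟙_ V ⟶ (a ⟶[V] S.obj (op (S.obj (op a)))) :=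
  eId V (S.obj (op a)) ≫ (hS.swap (S.obj (op a)) a).inv

/-- The element of `C(a, S (S a))` given by the unit. -/
def η (a : C) : Elem l (a ⟶[V] S.obj (op (S.obj (op a)))) := hS.unitHom a ⋆ unit

/-- The element of `C(a, S (S a))` given by the inverse transposition. -/
def η' (a : C) : Elem l (a ⟶[V] S.obj (op (S.obj (op a)))) := hS.unitHom' a ⋆ unit

theorem η_eq (a : C) : (hS.η a : Elem l _) = (hS.swap a (S.obj (op a))).hom ⋆ idn _ :=
  comp_app _ _ _

theorem η'_eq (a : C) : (hS.η' a : Elem l _) = (hS.swap (S.obj (op a)) a).inv ⋆ idn _ :=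
  comp_app _ _ _

/-- Both composites are the transpose of `S u`, once by naturality in each variable. -/
theorem cmp_η {a b : C} (u : Elem l (a ⟶[V] b)) :
    cmp u (hS.η b) = cmp (hS.η a) (opmap S (opmap S u)) := by
  rw [η_eq, η_eq, ← swap_cmp_opmap, ← swap_cmp, cmp_idn, idn_cmp]

theorem cmp_η' {a b : C} (u : Elem l (a ⟶[V] b)) :
    cmp u (hS.η' b) = cmp (hS.η' a) (opmap S (opmap S u)) := by
  rw [η'_eq, η'_eq, ← swap_inv_cmp_opmap, ← swap_inv_cmp, cmp_idn, idn_cmp]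

/-- A triangle identity. Transposing twice is not assumed to be the identity, so the adjunction
gives two families `η` and `η'`, its unit and its counit read in `C`; each inverts the other in this
sense. -/
theorem η_opmap_η' (a : C) :
    cmp (hS.η (S.obj (op a))) (opmap S (hS.η' a)) = (idn (S.obj (op a)) : Elem l _) := by
  rw [η_eq, ← swap_cmp, cmp_idn, η'_eq, inv_hom_app]

theorem η'_opmap_η (a : C) :
    cmp (hS.η' (S.obj (op a))) (opmap S (hS.η a)) = (idn (S.obj (op a)) : Elem l _) := by
  rw [η'_eq, ← swap_inv_cmp, cmp_idn, η_eq, hom_inv_app]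

end Antipode
end Antipodes

variable [HasLimits V] [StarAutonomousBase V] {A : Type v} [EnrichedCategory V A]
  {S : EnrichedFunctor V Aᵒᵖ A} {f g F : EnrichedFunctor V A V} {K K' : V}

theorem starEv_hom_ext {Z : V} {a : A} {m n : Z ⟶ (star S f).obj a}
    (h : f.obj (S.obj (op a)) ◁ m ≫ starEv S f a = f.obj (S.obj (op a)) ◁ n ≫ starEv S f a) :
    m = n := by
  apply MonoidalClosed.uncurry_injective
  exact (MonoidalClosed.uncurry_eq _).trans (h.trans (MonoidalClosed.uncurry_eq _).symm)

theorem starNat_ext {s t : K ⟶ (F ⟶[V] star S f)}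
    (h : ∀ (l : List V) (a : A) (x : Elem l (F.obj a)) (y : Elem l (f.obj (S.obj (op a))))
      (k : Elem l K), pr y (evl x (s ⋆ k)) = pr y (evl x (t ⋆ k))) : s = t := by
  apply natObj_hom_ext
  intro a
  apply starEv_hom_ext
  apply elem_ext₃
  intro l y x k
  simpa using h l a x y k

theorem starNat_ext₂ {s t : K ⊗ K' ⟶ (F ⟶[V] star S f)}
    (h : ∀ (l : List V) (a : A) (x : Elem l (F.obj a)) (y : Elem l (f.obj (S.obj (op a))))
      (k : Elem l K) (k' : Elem l K'),
      pr y (evl x (s ⋆ k ⊠ k')) = pr y (evl x (t ⋆ k ⊠ k'))) : s = t := by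
  apply natObj_hom_ext
  intro a
  apply starEv_hom_ext
  apply elem_ext₄
  intro l y x k k'
  simpa using h l a x y k k'

/-- Morphisms into an object of `V`-natural transformations `F ⟶ f*` from pairings. -/
theorem exists_starNat (k : ∀ a, f.obj (S.obj (op a)) ⊗ (F.obj a ⊗ K) ⟶
      StarAutonomousBase.dualizing (V := V))
    (hk : ∀ (l : List V) (a a' : A) (x : Elem l (F.obj a)) (y : Elem l (f.obj (S.obj (op a'))))
      (u : Elem l (a ⟶[V] a')) (t : Elem l K),
      k a' ⋆ y ⊠ smul F x u ⊠ t = k a ⋆ smul f y (opmap S u) ⊠ x ⊠ t) :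
    ∃ m : K ⟶ (F ⟶[V] star S f), ∀ (l : List V) (a : A) (x : Elem l (F.obj a))
      (y : Elem l (f.obj (S.obj (op a)))) (t : Elem l K),
      pr y (evl x (m ⋆ t)) = k a ⋆ y ⊠ x ⊠ t := by
  let k' (a : A) : F.obj a ⊗ K ⟶ (star S f).obj a := MonoidalClosed.curry (k a)
  have hk' : ∀ (l : List V) (a : A) (x : Elem l (F.obj a)) (y : Elem l (f.obj (S.obj (op a))))
      (t : Elem l K), pr y (k' a ⋆ x ⊠ t) = k a ⋆ y ⊠ x ⊠ t :=
    fun l a x y t => ap_curry (k a) y (x ⊠ t)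
  clear_value k'
  refine ⟨natOf k' fun l a a' x u t => pr_ext ?_, fun l a x y t => ?_⟩
  · rw [← app_con, ← con_pair_con, ← con_smul, ← con_smul, hk', hk, pr_smul, ← app_con,
      ← con_pair_con, hk', opmap]
  · rw [evl_natOf, hk']

/-- A transformation `θ : g → f*` pairs `y` in `g (S a)` with elements of `f (S (S a))`, and `x` in
`f a` is brought there by `η`. Naturality of `η` is what makes the result natural in `a`. -/
theorem exists_transpose (η : ∀ a, 𝟙_ V ⟶ (a ⟶[V] S.obj (op (S.obj (op a)))))
    (hη : ∀ (l : List V) (a b : A) (u : Elem l (a ⟶[V] b)),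
      cmp u (η b ⋆ unit) = cmp (η a ⋆ unit) (opmap S (opmap S u)))
    (f g : EnrichedFunctor V A V) :
    ∃ m : (g ⟶[V] star S f) ⟶ (f ⟶[V] star S g), ∀ (l : List V) (a : A) (x : Elem l (f.obj a))
      (y : Elem l (g.obj (S.obj (op a)))) (θ : Elem l (g ⟶[V] star S f)),
      pr y (evl x (m ⋆ θ)) = pr (smul f x (η a ⋆ unit)) (evl y θ) := by
  let k (a : A) : g.obj (S.obj (op a)) ⊗ (f.obj a ⊗ (g ⟶[V] star S f)) ⟶
      StarAutonomousBase.dualizing (V := V) :=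
    swapLeft _ _ _ ≫ (((ρ_ _).inv ≫ f.obj a ◁ η a ≫ act f _ _) ⊗ₘ
      evalAt g (star S f) (S.obj (op a))) ≫ starEv S f (S.obj (op a))
  have hk : ∀ (l : List V) (a : A) (x : Elem l (f.obj a)) (y : Elem l (g.obj (S.obj (op a))))
      (θ : Elem l (g ⟶[V] star S f)),
      k a ⋆ y ⊠ x ⊠ θ = pr (smul f x (η a ⋆ unit)) (evl y θ) := by
    intro l a x y θ
    simp [k]
  clear_value k
  obtain ⟨m, hm⟩ := exists_starNat k (by
    intro l a a' x y u θ
    rw [hk, hk, Elem.smul_smul, hη, evl_smul, pr_smul, Elem.smul_smul])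
  exact ⟨m, fun l a x y θ => by rw [hm, hk]⟩

namespace Antipode
variable (hS : Antipode S)

/-- `η` gives the map and `η'` the map back. In either composite one of the two acts on each side of
the pairing; moved to the same side by `pr_smul`, they cancel by a triangle identity. -/
theorem exists_transposeIso (f g : EnrichedFunctor V A V) :
    ∃ m : (g ⟶[V] star S f) ≅ (f ⟶[V] star S g),
      ∀ (l : List V) (a : A) (x : Elem l (f.obj a)) (y : Elem l (g.obj (S.obj (op a))))
        (θ : Elem l (g ⟶[V] star S f)),
        pr y (evl x (m.hom ⋆ θ)) = pr (smul f x (hS.η a)) (evl y θ) := by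
  obtain ⟨m, hm⟩ := exists_transpose hS.unitHom (fun l a b u => hS.cmp_η u) f g
  obtain ⟨n, hn⟩ := exists_transpose hS.unitHom' (fun l a b u => hS.cmp_η' u) g f
  refine ⟨⟨m, n, starNat_ext fun l a y x θ => ?_, starNat_ext fun l a x y θ => ?_⟩, hm⟩
  · have h := hS.η_opmap_η' (l := l) a
    rw [η, η'] at h
    rw [comp_app, hn, hm, evl_smul, pr_smul, Elem.smul_smul, h, smul_idn, id_app]
  · have h := hS.η'_opmap_η (l := l) a
    rw [η, η'] at h
    rw [comp_app, hm, hn, evl_smul, pr_smul, Elem.smul_smul, h, smul_idn, id_app]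

/-- The isomorphism `[A, V](g, f*) ≅ [A, V](f, g*)`. -/
noncomputable def transpose (f g : EnrichedFunctor V A V) :
    (g ⟶[V] star S f) ≅ (f ⟶[V] star S g) := (hS.exists_transposeIso f g).choose

theorem transpose_app {a : A} (x : Elem l (f.obj a)) (y : Elem l (g.obj (S.obj (op a))))
    (θ : Elem l (g ⟶[V] star S f)) :
    pr y (evl x ((hS.transpose f g).hom ⋆ θ)) = pr (smul f x (hS.η a)) (evl y θ) :=
  (hS.exists_transposeIso f g).choose_spec l a x y θ

theorem transpose_cmp {g' : EnrichedFunctor V A V} (s : Elem l (g' ⟶[V] g))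
    (θ : Elem l (g ⟶[V] star S f)) :
    (hS.transpose f g').hom ⋆ cmp s θ =
      cmp ((hS.transpose f g).hom ⋆ θ) (starMap S g' g ⋆ s) := by
  have e : eComp V g' g (star S f) ≫ (hS.transpose f g').hom =
      (β_ _ _).hom ≫ ((hS.transpose f g).hom ⊗ₘ starMap S g' g) ≫ eComp V _ _ _ := by
    apply starNat_ext₂
    intro l a x y s θ
    simp [transpose_app, pr_evl, evl_cmp]
  simpa using app_congr e (s ⊠ θ)

theorem transpose_cmp_starMap {f' : EnrichedFunctor V A V} (s : Elem l (f' ⟶[V] f))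
    (θ : Elem l (g ⟶[V] star S f)) :
    (hS.transpose f' g).hom ⋆ cmp θ (starMap S f' f ⋆ s) =
      cmp s ((hS.transpose f g).hom ⋆ θ) := by
  have e : _ ◁ starMap S f' f ≫ eComp V g (star S f) (star S f') ≫ (hS.transpose f' g).hom =
      (β_ _ _).hom ≫ _ ◁ (hS.transpose f g).hom ≫ eComp V _ _ _ := by
    apply starNat_ext₂
    intro l a x y θ s
    simp [transpose_app, pr_evl, evl_cmp, evl_smul]
  simpa using app_congr e (θ ⊠ s)

theorem transpose_natural_right (f : EnrichedFunctor V A V) :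
    IsNatural (coyo ((Sop (starFunctor S)).obj f)) ((starFunctor S).comp V (coyo f))
      (fun g => (hS.transpose f g.unop).hom) :=
  isNatural_op_iff.2 fun _ g' g θ s =>
    (congrArg ((hS.transpose f g').hom ⋆ ·) (opsmul_yo (a := g') (b := g) θ s)).trans
      ((hS.transpose_cmp s θ).trans (opsmul_comp_coyo (starFunctor S) _ s).symm)

theorem transpose_natural_left (g : EnrichedFunctor V A V) :
    IsNatural ((opF (Sop (starFunctor S))).comp V (yo (op g))) (yo (star S g))
      (fun f => (hS.transpose f.unop g).hom) :=
  isNatural_opF_Sop_yo (C := EnrichedFunctor V A V) (S := starFunctor S) (b := g)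
    (G := yo (C := EnrichedFunctor V A V) (star S g))
    (fun f : EnrichedFunctor V A V => (hS.transpose f g).hom)
    fun _ f f' θ s => (hS.transpose_cmp_starMap (f := f) (f' := f') s θ).trans
      (opsmul_yo (a := f') (b := f) (c := star S g) _ s).symm

/-- The dual is self-adjoint on the right. -/
noncomputable def starAdjunction : VAdjunction (Sop (starFunctor S)) (starFunctor S) where
  iso f g := hS.transpose f g.unop
  natural_right f := hS.transpose_natural_right f
  natural_left g := hS.transpose_natural_left g.unop

end Antipode

end DualAntipode
end StarAut

namespace StarAut
open Elem

/-! ### The dual on `V`-functor categories is involutive -/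
section DoubleDual
variable {V : Type u} [Category.{v} V] [MonoidalCategory V] [SymmetricCategory V]
  [MonoidalClosed V]
universe u₁ u₂
variable {l : List V}

section
variable {C : Type u₁} {D : Type u₂} [EnrichedCategory V C] [EnrichedCategory V D]

theorem VNatIso.cmp_arr {F G : EnrichedFunctor V C D} (e : VNatIso F G) {a b : C}
    (s : Elem l (a ⟶[V] b)) :
    cmp (fmap F s) (arr (e.iso b).hom) = cmp (arr (e.iso a).hom) (fmap G s) := by
  have h₁ := congrArg (fun t => (ρ_ _).inv ≫ t) (e.natural a b)
  have h₂ := app_congr h₁ s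
  simp only [comp_app, rightUnitor_inv_app, tensorHom_app, braiding_app, eComp_app] at h₂
  exact h₂

namespace Elem

/-- The effect of a `V`-functor to `V` on a morphism. -/
def actBy (F : EnrichedFunctor V C V) {a b : C} (u : 𝟙_ V ⟶ (a ⟶[V] b)) : F.obj a ⟶ F.obj b :=
  (ρ_ _).inv ≫ F.obj a ◁ u ≫ act F a b

theorem actBy_app (F : EnrichedFunctor V C V) {a b : C} (u : 𝟙_ V ⟶ (a ⟶[V] b))
    (x : Elem l (F.obj a)) : actBy F u ⋆ x = smul F x (u ⋆ unit) := by
  simp [actBy]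

end Elem

namespace Antipode
variable {S : EnrichedFunctor V Cᵒᵖ C} (hS : Antipode S)

/-- The element of `C(a, S (S a))` given by the isomorphism `S² ≅ 1`. -/
def σ (a : C) : Elem l (a ⟶[V] S.obj (op (S.obj (op a)))) := arr (hS.sq.iso a).inv

/-- The element of `C(S (S a), a)` given by the isomorphism `S² ≅ 1`. -/
def τ (a : C) : Elem l (S.obj (op (S.obj (op a))) ⟶[V] a) := arr (hS.sq.iso a).hom

theorem σ_τ (a : C) : cmp (hS.σ a) (hS.τ a) = (idn a : Elem l _) :=
  (arr_comp _ _).symm.trans ((congrArg arr (hS.sq.iso a).inv_hom_id).trans (arr_id a))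

theorem τ_σ (a : C) : cmp (hS.τ a) (hS.σ a) = (idn (S.obj (op (S.obj (op a)))) : Elem l _) :=
  (arr_comp _ _).symm.trans ((congrArg arr (hS.sq.iso a).hom_inv_id).trans (arr_id _))

theorem opmap_τ {a b : C} (u : Elem l (a ⟶[V] b)) :
    cmp (opmap S (opmap S u)) (hS.τ b) = cmp (hS.τ a) u := by
  have h := hS.sq.cmp_arr u
  have h₁ : fmap ((Sop S).comp V S) u = opmap S (opmap S u) :=
    (fmap_comp (Sop S) S u).trans (congrArg (fun t => fmap S (a := op (S.obj (op a)))
      (b := op (S.obj (op b))) t) (opmap_Sop S u))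
  have h₂ : fmap (EnrichedFunctor.id V C) u = u := id_app u
  exact ((congrArg (fun t => cmp t (hS.τ b)) h₁).symm.trans h).trans
    (congrArg (fun t => cmp (hS.τ a) t) h₂)

/-- Naturality of `τ`, composed with `σ` at both ends. -/
theorem cmp_σ {a b : C} (u : Elem l (a ⟶[V] b)) :
    cmp u (hS.σ b) = cmp (hS.σ a) (opmap S (opmap S u)) := by
  have h := congrArg (fun t => cmp (hS.σ a) (cmp t (hS.σ b))) (hS.opmap_τ u)
  simp only [cmp_cmp, τ_σ, cmp_idn] at h
  rw [h, ← cmp_cmp, σ_τ, idn_cmp]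

end Antipode
end

variable [HasLimits V] [StarAutonomousBase V] {A : Type v} [EnrichedCategory V A]
  {S : EnrichedFunctor V Aᵒᵖ A} {f g : EnrichedFunctor V A V}

theorem exists_doubleDualIso (X : V) :
    ∃ d : X ≅ (ihom ((ihom X).obj (StarAutonomousBase.dualizing (V := V)))).obj
      (StarAutonomousBase.dualizing (V := V)),
      ∀ (l : List V) (x : Elem l X) (φ : Elem l ((ihom X).obj _)), ap φ (d.hom ⋆ x) = ap x φ := by
  have := StarAutonomousBase.isIso_doubleDual X
  refine ⟨asIso (doubleDual (StarAutonomousBase.dualizing (V := V)) X), fun l x φ => ?_⟩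
  have h := ap_curry ((β_ ((ihom X).obj _) X).hom ≫ (ihom.ev X).app
    (StarAutonomousBase.dualizing (V := V))) φ x
  rw [comp_app, braiding_app, ev_app] at h
  exact h

/-- At `a` the value of `f**` is the double dual of `f (S (S a))`, so the isomorphism is `f` applied
to `σ`, followed by the canonical map to the double dual. -/
theorem exists_doubleStar (hS : Antipode S) (f : EnrichedFunctor V A V) :
    ∃ e : VIso V f (star S (star S f)), ∀ (l : List V) (a : A) (x : Elem l (f.obj a))
      (φ : Elem l ((star S f).obj (S.obj (op a)))),
      pr φ (evl x (arr e.hom)) = pr (smul f x (hS.σ a)) φ := by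
  let m (a : A) : f.obj a ≅ f.obj (S.obj (op (S.obj (op a)))) :=
    { hom := actBy f (ForgetEnrichment.homTo V (hS.sq.iso a).inv)
      inv := actBy f (ForgetEnrichment.homTo V (hS.sq.iso a).hom)
      hom_inv_id := by
        apply elem_ext₁
        intro l x
        rw [comp_app, id_app, actBy_app, actBy_app]
        exact (Elem.smul_smul f x (hS.σ a) (hS.τ a)).trans
          ((congrArg (smul f x) (hS.σ_τ a)).trans (smul_idn f x))
      inv_hom_id := by
        apply elem_ext₁
        intro l x
        rw [comp_app, id_app, actBy_app, actBy_app]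
        exact (Elem.smul_smul f x (hS.τ a) (hS.σ a)).trans
          ((congrArg (smul f x) (hS.τ_σ a)).trans (smul_idn f x)) }
  have hm : ∀ (l : List V) (a : A) (x : Elem l (f.obj a)), (m a).hom ⋆ x = smul f x (hS.σ a) :=
    fun l a x => actBy_app f _ x
  clear_value m
  choose d hd using fun X : V => exists_doubleDualIso X
  let t (a : A) : f.obj a ≅ (star S (star S f)).obj a := m a ≪≫ d _
  have ht : ∀ (l : List V) (a : A) (x : Elem l (f.obj a))
      (φ : Elem l ((star S f).obj (S.obj (op a)))),
      pr φ ((t a).hom ⋆ x) = pr (smul f x (hS.σ a)) φ := fun l a x φ =>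
    (congrArg (pr φ) (comp_app (m a).hom (d _).hom x)).trans
      ((hd _ l ((m a).hom ⋆ x) φ).trans (congrArg (fun y => pr y φ) (hm l a x)))
  clear_value t
  obtain ⟨e, he⟩ := exists_vIso (fun a => (t a).hom) (fun a => (t a).inv)
    (fun a => (t a).hom_inv_id) (fun a => (t a).inv_hom_id) (by
      intro a b
      apply starEv_hom_ext
      apply elem_ext₃
      intro l φ x u
      -- After pairing with `φ`, both routes act on `x`: one by `u` and then `σ`, the other by `σ`
      -- and then `S (S u)`. They agree by naturality of `σ`.
      have h₁ := ht l b (smul f x u) φ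
      have h₂ := pr_smul φ ((t a).hom ⋆ x) u
      rw [ht, pr_smul (f := f), Elem.smul_smul, ← hS.cmp_σ, ← Elem.smul_smul, ← h₁] at h₂
      simpa using h₂.symm)
  refine ⟨e, fun l a x φ => ?_⟩
  rw [← arrAt_app, he, ht]

/-- The isomorphism `f ≅ f**`. -/
noncomputable def doubleStar (hS : Antipode S) (f : EnrichedFunctor V A V) :
    VIso V f (star S (star S f)) := (exists_doubleStar hS f).choose

theorem pr_doubleStar (hS : Antipode S) {a : A} (x : Elem l (f.obj a))
    (φ : Elem l ((star S f).obj (S.obj (op a)))) :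
    pr φ (evl x (arr (doubleStar hS f).hom)) = pr (smul f x (hS.σ a)) φ :=
  (exists_doubleStar hS f).choose_spec l a x φ

theorem doubleStar_natural (hS : Antipode S) {a : A} (x : Elem l (f.obj a))
    (s : Elem l (f ⟶[V] g)) :
    evl (evl x (arr (doubleStar hS f).hom)) (starMap S (star S g) (star S f) ⋆ starMap S f g ⋆ s) =
      evl (evl x s) (arr (doubleStar hS g).hom) := by
  have e : arrAt (doubleStar hS f).hom a ▷ _ ≫
        _ ◁ (starMap S f g ≫ starMap S (star S g) (star S f)) ≫ evalAt _ _ a =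
      evalAt f g a ≫ arrAt (doubleStar hS g).hom a := by
    apply starEv_hom_ext
    apply elem_ext₃
    intro l φ x s
    have h₁ := pr_doubleStar hS (evl x s) φ
    have h₂ := pr_doubleStar hS x (evl φ (starMap S f g ⋆ s))
    rw [pr_evl, evl_smul, ← h₁] at h₂
    simpa [arrAt_app, pr_evl] using h₂
  simpa [arrAt_app] using app_congr e (x ⊠ s)

/-- An antipode requires the isomorphism in the direction from `f**` to `f`, so naturality is
conjugated to the inverse. -/
theorem doubleStar_inv_natural (hS : Antipode S) {a : A}
    (x : Elem l ((star S (star S f)).obj a)) (s : Elem l (f ⟶[V] g)) :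
    evl (evl x (starMap S (star S g) (star S f) ⋆ starMap S f g ⋆ s))
        (arr (doubleStar hS g).inv) =
      evl (evl x (arr (doubleStar hS f).inv)) s := by
  have h₁ : cmp (arr (doubleStar hS f).inv) (arr (doubleStar hS f).hom) =
      (idn _ : Elem l (star S (star S f) ⟶[V] star S (star S f))) :=
    (arr_comp _ _).symm.trans ((congrArg arr (doubleStar hS f).inv_hom_id).trans (arr_id _))
  have h₂ : cmp (arr (doubleStar hS g).hom) (arr (doubleStar hS g).inv) =
      (idn _ : Elem l (g ⟶[V] g)) :=
    (arr_comp _ _).symm.trans ((congrArg arr (doubleStar hS g).hom_inv_id).trans (arr_id _))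
  have h₃ := doubleStar_natural hS (evl x (arr (doubleStar hS f).inv)) s
  rw [← evl_cmp x, h₁, evl_idn] at h₃
  rw [h₃, ← evl_cmp, h₂, evl_idn]

/-- The dual on `V`-functor categories is an antipode. -/
noncomputable def starAntipode (hS : Antipode S) : Antipode (starFunctor S) where
  adj := hS.starAdjunction
  sq :=
    { iso f := (doubleStar hS f).symm
      natural := isGradedNat_of_elem (S := (Sop (starFunctor S)).comp V (starFunctor S))
        (T := EnrichedFunctor.id V (EnrichedFunctor V A V)) (fun f => (doubleStar hS f).symm) 
        fun _ f g _ x s => (congrArg (fun t => evl (evl x t) _)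
          ((fmap_comp (Sop (starFunctor S)) (starFunctor S) s).trans
            (congrArg (fun t => fmap (starFunctor S) (a := op (star S f)) (b := op (star S g)) t)
              (opmap_Sop (starFunctor S) s)))).trans
          ((doubleStar_inv_natural hS x s).trans (congrArg (evl _) (id_app s).symm)) }

end DoubleDual
end StarAut

namespace StarAut
open Elem

/-! ### Cyclic symmetry of the convolution -/
section Cyclic
variable {V : Type u} [Category.{v} V] [MonoidalCategory V] [SymmetricCategory V]
  [MonoidalClosed V] {A : Type v} [EnrichedCategory V A] {l : List V}
  {p : EnrichedFunctor V (TensorCat Aᵒᵖ (TensorCat Aᵒᵖ A)) V} {S : EnrichedFunctor V Aᵒᵖ A}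

namespace SAutonomous
variable (hS : SAutonomous p S)

/-- The isomorphism `p(a, b, S c) ≅ p(b, c, S a)`. -/
def rot (a b c : A) : ker p a b (S.obj (op c)) ≅ ker p b c (S.obj (op a)) := hS.cyc a b c

/-- The rotation carries the actions along: under it and its inverse, an action on a plain variable
either stays on that variable in its new place or becomes an action through `S` on the third place,
and conversely. -/
theorem rot_pact₁ {a a' b c : A} (r : Elem l (ker p a' b (S.obj (op c))))
    (s : Elem l (a ⟶[V] a')) :
    (hS.rot a b c).hom ⋆ pact₁ p r s = pact₃ p ((hS.rot a' b c).hom ⋆ r) (opmap S s) :=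
  (isNatural_op_iff.1 (hS.cyc_natural₁ b c) l a a' r s).trans
    (smul_comp S (ker₃ p b c) (a := op a') (b := op a) _ s)

theorem rot_pact₂ {a b b' c : A} (r : Elem l (ker p a b' (S.obj (op c))))
    (s : Elem l (b ⟶[V] b')) :
    (hS.rot a b c).hom ⋆ pact₂ p r s = pact₁ p ((hS.rot a b' c).hom ⋆ r) s :=
  isNatural_op_iff.1 (hS.cyc_natural₂ a c) l b b' r s

theorem rot_pact₃ {a b c c' : A} (r : Elem l (ker p a b (S.obj (op c'))))
    (s : Elem l (c ⟶[V] c')) :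
    (hS.rot a b c).hom ⋆ pact₃ p r (opmap S s) = pact₂ p ((hS.rot a b c').hom ⋆ r) s :=
  (congrArg ((hS.rot a b c).hom ⋆ ·)
    (smul_comp S (ker₃ p a b) (a := op c') (b := op c) r s).symm).trans
      (isNatural_op_iff.1 (hS.cyc_natural₃ a b) l c c' r s)

theorem rot_inv_pact₁ {a b b' c : A} (r : Elem l (ker p b' c (S.obj (op a))))
    (s : Elem l (b ⟶[V] b')) :
    (hS.rot a b c).inv ⋆ pact₁ p r s = pact₂ p ((hS.rot a b' c).inv ⋆ r) s := by
  rw [← hom_inv_app (hS.rot a b c) (pact₂ p _ s), rot_pact₂, inv_hom_app]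

theorem rot_inv_pact₂ {a b c c' : A} (r : Elem l (ker p b c' (S.obj (op a))))
    (s : Elem l (c ⟶[V] c')) :
    (hS.rot a b c).inv ⋆ pact₂ p r s = pact₃ p ((hS.rot a b c').inv ⋆ r) (opmap S s) := by
  rw [← hom_inv_app (hS.rot a b c) (pact₃ p _ _), rot_pact₃, inv_hom_app]

theorem rot_inv_pact₃ {a a' b c : A} (r : Elem l (ker p b c (S.obj (op a'))))
    (s : Elem l (a ⟶[V] a')) :
    (hS.rot a b c).inv ⋆ pact₃ p r (opmap S s) = pact₁ p ((hS.rot a' b c).inv ⋆ r) s := by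
  rw [← hom_inv_app (hS.rot a b c) (pact₁ p _ s), rot_pact₁, inv_hom_app]

end SAutonomous

variable [HasLimits V] [StarAutonomousBase V] (D : DayData p) {f g h : EnrichedFunctor V A V}

namespace DayData

variable (S) in
/-- The contravariant action of `A` on the composite of `S` and a `V`-functor. -/
def opact (F : EnrichedFunctor V A V) (a a' : A) :
    F.obj (S.obj (op a')) ⊗ (a ⟶[V] a') ⟶ F.obj (S.obj (op a)) :=
  _ ◁ S.map (op a') (op a) ≫ act F _ _

@[simp]
theorem opact_app {F : EnrichedFunctor V A V} {a a' : A} (x : Elem l (F.obj (S.obj (op a'))))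
    (u : Elem l (a ⟶[V] a')) : opact S F a a' ⋆ x ⊠ u = smul F x (opmap S u) :=
  (comp_app _ _ _).trans ((congrArg _ (whiskerLeft_app _ _ _)).trans (act_app _ _ _))

/-- Both sides consist of families of pairings on `f a ⊗ g b ⊗ h c` and a kernel, which is `p(a, b,
S c)` on one side and `p(b, c, S a)` on the other; the map substitutes the inverse rotation. -/
theorem exists_flip (hS : SAutonomous p S) (f g h : EnrichedFunctor V A V) :
    ∃ m : (h ⟶[V] star S (D.T.obj ⟨f, g⟩)) ⟶ (f ⟶[V] star S (D.T.obj ⟨g, h⟩)),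
      ∀ (l : List V) (a b c : A) (x : Elem l (f.obj a)) (y : Elem l (g.obj b))
        (z : Elem l (h.obj c)) (r : Elem l (ker p b c (S.obj (op a))))
        (θ : Elem l (h ⟶[V] star S (D.T.obj ⟨f, g⟩))),
        pr (D.el y z r) (evl x (m ⋆ θ)) = pr (D.el x y ((hS.rot a b c).inv ⋆ r)) (evl z θ) := by
  have hk₀ (a b c : A) : ∃ k : (g.obj b ⊗ (h.obj c ⊗ ker p b c (S.obj (op a)))) ⊗
      (f.obj a ⊗ (h ⟶[V] star S (D.T.obj ⟨f, g⟩))) ⟶ StarAutonomousBase.dualizing (V := V),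
      ∀ (l : List V) (x : Elem l (f.obj a)) (y : Elem l (g.obj b)) (z : Elem l (h.obj c))
        (r : Elem l (ker p b c (S.obj (op a)))) (θ : Elem l (h ⟶[V] star S (D.T.obj ⟨f, g⟩))),
        k ⋆ (y ⊠ z ⊠ r) ⊠ x ⊠ θ = pr (D.el x y ((hS.rot a b c).inv ⋆ r)) (evl z θ) := by
    refine ⟨swapLeft _ _ _ ≫ f.obj a ◁ ((α_ _ _ _).hom ≫ g.obj b ◁ ((α_ _ _ _).hom ≫
      swapLeft _ _ _ ≫ (hS.rot a b c).inv ▷ _) ≫ (α_ _ _ _).inv) ≫ (α_ _ _ _).inv ≫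
        (D.ι f g a b (S.obj (op c)) ⊗ₘ evalAt h _ c) ≫ starEv S _ c, fun l x y z r θ => ?_⟩
    simp
  choose k₀ hk₀ using hk₀
  -- Descent to `g * h` at `S a`. Balancing in `b` comes from that of `f * g`; in `c`, the rotated
  -- action on the third variable is moved across the pairing and absorbed by naturality of `θ`.
  have hk (a : A) := (D.isDayCoend g h (S.obj (op a))).exists_elem_desc₂ (k₀ a)
    (by
      intro l b b' c y z r s x θ
      rw [hk₀, hk₀, hS.rot_inv_pact₁, el_pact₂])
    (by
      intro l b c c' y z r s x θ
      rw [hk₀, hk₀, hS.rot_inv_pact₂, ← smul_el, ← pr_smul, ← evl_smul])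
  choose k hk using hk
  simp only [hk₀] at hk
  obtain ⟨m, hm⟩ := exists_starNat k (by
    intro l a a' x w u θ
    -- Naturality in `a` is tested on generators of `g * h`, where it becomes the balancing of `f *
    -- g` in its first variable.
    have e : _ ◁ ((α_ _ _ _).inv ≫ act f a a' ▷ _) ≫ k a' =
        _ ◁ swapLeft _ _ _ ≫ (α_ _ _ _).inv ≫ opact S (D.T.obj ⟨g, h⟩) a a' ▷ _ ≫ k a := by
      apply (D.isDayCoend g h (S.obj (op a'))).elem_ext_right₃
      intro l b c y z r x u θ
      have h₁ := hk a l b c y z (pact₃ p r (opmap S u)) x θ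
      have h₂ := hk a' l b c y z r (smul f x u) θ
      rw [ι_app, hS.rot_inv_pact₃, el_pact₁, ← h₂, ι_app, ← smul_el] at h₁
      simpa using h₁.symm
    simpa using app_congr e (w ⊠ x ⊠ u ⊠ θ))
  exact ⟨m, fun l a b c x y z r θ => by rw [hm, ← ι_app, hk]⟩

theorem exists_unflip (hS : SAutonomous p S) (f g h : EnrichedFunctor V A V) :
    ∃ m : (f ⟶[V] star S (D.T.obj ⟨g, h⟩)) ⟶ (h ⟶[V] star S (D.T.obj ⟨f, g⟩)),
      ∀ (l : List V) (a b c : A) (x : Elem l (f.obj a)) (y : Elem l (g.obj b))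
        (z : Elem l (h.obj c)) (r : Elem l (ker p a b (S.obj (op c))))
        (θ : Elem l (f ⟶[V] star S (D.T.obj ⟨g, h⟩))),
        pr (D.el x y r) (evl z (m ⋆ θ)) = pr (D.el y z ((hS.rot a b c).hom ⋆ r)) (evl x θ) := by
  have hk₀ (c a b : A) : ∃ k : (f.obj a ⊗ (g.obj b ⊗ ker p a b (S.obj (op c)))) ⊗
      (h.obj c ⊗ (f ⟶[V] star S (D.T.obj ⟨g, h⟩))) ⟶ StarAutonomousBase.dualizing (V := V),
      ∀ (l : List V) (x : Elem l (f.obj a)) (y : Elem l (g.obj b)) (z : Elem l (h.obj c))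
        (r : Elem l (ker p a b (S.obj (op c)))) (θ : Elem l (f ⟶[V] star S (D.T.obj ⟨g, h⟩))),
        k ⋆ (x ⊠ y ⊠ r) ⊠ z ⊠ θ = pr (D.el y z ((hS.rot a b c).hom ⋆ r)) (evl x θ) := by
    refine ⟨(α_ _ _ _).hom ≫ f.obj a ◁ ((α_ _ _ _).hom ≫ g.obj b ◁ (swapLeft _ _ _ ≫
      h.obj c ◁ (hS.rot a b c).hom ▷ _ ≫ (α_ _ _ _).inv) ≫ (α_ _ _ _).inv ≫
        D.ι g h b c (S.obj (op a)) ▷ _) ≫ swapLeft _ _ _ ≫ _ ◁ evalAt f _ a ≫ starEv S _ a,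
      fun l x y z r θ => ?_⟩
    simp
  choose k₀ hk₀ using hk₀
  have hk (c : A) := (D.isDayCoend f g (S.obj (op c))).exists_elem_desc₂ (k₀ c)
    (by
      intro l a a' b x y r s z θ
      rw [hk₀, hk₀, hS.rot_pact₁, ← smul_el, ← pr_smul, ← evl_smul])
    (by
      intro l a b b' x y r s z θ
      rw [hk₀, hk₀, hS.rot_pact₂, el_pact₁])
  choose k hk using hk
  simp only [hk₀] at hk
  obtain ⟨m, hm⟩ := exists_starNat k (by
    intro l c c' z w u θ
    have e : _ ◁ ((α_ _ _ _).inv ≫ act h c c' ▷ _) ≫ k c' =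
        _ ◁ swapLeft _ _ _ ≫ (α_ _ _ _).inv ≫ opact S (D.T.obj ⟨f, g⟩) c c' ▷ _ ≫ k c := by
      apply (D.isDayCoend f g (S.obj (op c'))).elem_ext_right₃
      intro l a b x y r z u θ
      have h₁ := hk c l a b x y (pact₃ p r (opmap S u)) z θ
      have h₂ := hk c' l a b x y r (smul h z u) θ
      rw [ι_app, hS.rot_pact₃, el_pact₂, ← h₂, ι_app, ← smul_el] at h₁
      simpa using h₁.symm
    simpa using app_congr e (w ⊠ z ⊠ u ⊠ θ))
  exact ⟨m, fun l a b c x y z r θ => by rw [hm, ← ι_app, hk]⟩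

/-- A transformation into `(g * h)*` is a family of pairings with `g * h`, and pairings with a coend
are determined on its generators. -/
theorem starNat_el_ext {K : V} {s t : K ⟶ (f ⟶[V] star S (D.T.obj ⟨g, h⟩))}
    (hst : ∀ (l : List V) (a b c : A) (x : Elem l (f.obj a)) (y : Elem l (g.obj b))
      (z : Elem l (h.obj c)) (r : Elem l (ker p b c (S.obj (op a)))) (k : Elem l K),
      pr (D.el y z r) (evl x (s ⋆ k)) = pr (D.el y z r) (evl x (t ⋆ k))) : s = t := by
  apply natObj_hom_ext
  intro a
  apply starEv_hom_ext
  apply (D.isDayCoend g h (S.obj (op a))).elem_ext_right₂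
  intro l b c y z r x k
  simpa using hst l a b c x y z r k

theorem starNat_el_ext₂ {K K' : V} {s t : K ⊗ K' ⟶ (f ⟶[V] star S (D.T.obj ⟨g, h⟩))}
    (hst : ∀ (l : List V) (a b c : A) (x : Elem l (f.obj a)) (y : Elem l (g.obj b))
      (z : Elem l (h.obj c)) (r : Elem l (ker p b c (S.obj (op a)))) (k : Elem l K)
      (k' : Elem l K'),
      pr (D.el y z r) (evl x (s ⋆ k ⊠ k')) = pr (D.el y z r) (evl x (t ⋆ k ⊠ k'))) : s = t := by
  apply natObj_hom_ext
  intro a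
  apply starEv_hom_ext
  apply (D.isDayCoend g h (S.obj (op a))).elem_ext_right₃
  intro l b c y z r x k k'
  simpa using hst l a b c x y z r k k'

theorem exists_flipIso (hS : SAutonomous p S) (f g h : EnrichedFunctor V A V) :
    ∃ m : (h ⟶[V] star S (D.T.obj ⟨f, g⟩)) ≅ (f ⟶[V] star S (D.T.obj ⟨g, h⟩)),
      ∀ (l : List V) (a b c : A) (x : Elem l (f.obj a)) (y : Elem l (g.obj b))
        (z : Elem l (h.obj c)) (r : Elem l (ker p b c (S.obj (op a))))
        (θ : Elem l (h ⟶[V] star S (D.T.obj ⟨f, g⟩))),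
        pr (D.el y z r) (evl x (m.hom ⋆ θ)) =
          pr (D.el x y ((hS.rot a b c).inv ⋆ r)) (evl z θ) := by
  obtain ⟨m, hm⟩ := D.exists_flip hS f g h
  obtain ⟨n, hn⟩ := D.exists_unflip hS f g h
  refine ⟨⟨m, n, D.starNat_el_ext fun l c a b z x y r θ => ?_,
    D.starNat_el_ext fun l a b c x y z r θ => ?_⟩, hm⟩
  · rw [comp_app, hn, hm, hom_inv_app, id_app]
  · rw [comp_app, hm, hn, inv_hom_app, id_app]

/-- The isomorphism `[A, V](h, (f ⊗ g)*) ≅ [A, V](f, (g ⊗ h)*)`. -/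
noncomputable def flip (hS : SAutonomous p S) (f g h : EnrichedFunctor V A V) :
    (h ⟶[V] star S (D.T.obj ⟨f, g⟩)) ≅ (f ⟶[V] star S (D.T.obj ⟨g, h⟩)) :=
  (D.exists_flipIso hS f g h).choose

variable (hS : SAutonomous p S)

theorem flip_app {a b c : A} (x : Elem l (f.obj a)) (y : Elem l (g.obj b)) (z : Elem l (h.obj c))
    (r : Elem l (ker p b c (S.obj (op a)))) (θ : Elem l (h ⟶[V] star S (D.T.obj ⟨f, g⟩))) :
    pr (D.el y z r) (evl x ((D.flip hS f g h).hom ⋆ θ)) =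
      pr (D.el x y ((hS.rot a b c).inv ⋆ r)) (evl z θ) :=
  (D.exists_flipIso hS f g h).choose_spec l a b c x y z r θ

/-- Transformations act on the functor factors and the rotation only on the kernel. This gives
naturality in `f` here, and in `g` and `h` below. -/
theorem flip_cmp_mapL {f' : EnrichedFunctor V A V} (s : Elem l (f' ⟶[V] f))
    (θ : Elem l (h ⟶[V] star S (D.T.obj ⟨f, g⟩))) :
    (D.flip hS f' g h).hom ⋆ cmp θ (starMap S (D.T.obj ⟨f', g⟩) (D.T.obj ⟨f,
        g⟩) ⋆ D.mapL f' f g ⋆ s) =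
      cmp s ((D.flip hS f g h).hom ⋆ θ) := by
  have e : (h ⟶[V] star S (D.T.obj ⟨f, g⟩)) ◁ (D.mapL f' f g ≫ starMap S (D.T.obj ⟨f', g⟩)
        (D.T.obj ⟨f, g⟩)) ≫ eComp V h (star S (D.T.obj ⟨f, g⟩)) (star S (D.T.obj ⟨f', g⟩)) ≫
          (D.flip hS f' g h).hom =
      (β_ _ _).hom ≫ (f' ⟶[V] f) ◁ (D.flip hS f g h).hom ≫
        eComp V f' f (star S (D.T.obj ⟨g, h⟩)) := by
    apply D.starNat_el_ext₂
    intro l a b c x y z r θ s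
    simp [flip_app, evl_cmp, pr_evl, evl_mapL]
  simpa using app_congr e (θ ⊠ s)

theorem flip_cmp_mapR {g' : EnrichedFunctor V A V} (s : Elem l (g' ⟶[V] g))
    (θ : Elem l (h ⟶[V] star S (D.T.obj ⟨f, g⟩))) :
    (D.flip hS f g' h).hom ⋆ cmp θ (starMap S (D.T.obj ⟨f, g'⟩) (D.T.obj ⟨f,
        g⟩) ⋆ D.mapR f g' g ⋆ s) =
      cmp ((D.flip hS f g h).hom ⋆ θ) (starMap S (D.T.obj ⟨g', h⟩) (D.T.obj ⟨g,
          h⟩) ⋆ D.mapL g' g h ⋆ s) := by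
  have e : (h ⟶[V] star S (D.T.obj ⟨f, g⟩)) ◁ (D.mapR f g' g ≫ starMap S (D.T.obj ⟨f, g'⟩)
        (D.T.obj ⟨f, g⟩)) ≫ eComp V h (star S (D.T.obj ⟨f, g⟩)) (star S (D.T.obj ⟨f, g'⟩)) ≫
          (D.flip hS f g' h).hom =
      ((D.flip hS f g h).hom ⊗ₘ (D.mapL g' g h ≫ starMap S (D.T.obj ⟨g', h⟩)
        (D.T.obj ⟨g, h⟩))) ≫ eComp V f (star S (D.T.obj ⟨g, h⟩)) (star S (D.T.obj ⟨g', h⟩)) := by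
    apply D.starNat_el_ext₂
    intro l a b c x y z r θ s
    simp [flip_app, evl_cmp, pr_evl, evl_mapL, evl_mapR]
  simpa using app_congr e (θ ⊠ s)

theorem flip_cmp {h' : EnrichedFunctor V A V} (s : Elem l (h' ⟶[V] h))
    (θ : Elem l (h ⟶[V] star S (D.T.obj ⟨f, g⟩))) :
    (D.flip hS f g h').hom ⋆ cmp s θ =
      cmp ((D.flip hS f g h).hom ⋆ θ) (starMap S (D.T.obj ⟨g, h'⟩) (D.T.obj ⟨g,
          h⟩) ⋆ D.mapR g h' h ⋆ s) := by
  have e : eComp V h' h (star S (D.T.obj ⟨f, g⟩)) ≫ (D.flip hS f g h').hom = (β_ _ _).hom ≫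
      ((D.flip hS f g h).hom ⊗ₘ (D.mapR g h' h ≫ starMap S (D.T.obj ⟨g, h'⟩)
        (D.T.obj ⟨g, h⟩))) ≫ eComp V f (star S (D.T.obj ⟨g, h⟩)) (star S (D.T.obj ⟨g, h'⟩)) := by
    apply D.starNat_el_ext₂
    intro l a b c x y z r s θ
    simp [flip_app, evl_cmp, pr_evl, evl_mapR]
  simpa using app_congr e (s ⊠ θ)

/-- The isomorphism `[A, V](f ⊗ g, h*) ≅ [A, V](g ⊗ h, f*)`. -/
noncomputable def cyc (f g h : EnrichedFunctor V A V) :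
    (D.T.obj ⟨f, g⟩ ⟶[V] star S h) ≅ (D.T.obj ⟨g, h⟩ ⟶[V] star S f) :=
  -- Transposing first puts the kernel into the form `p(a, b, S c)`, to which the rotation applies.
  hS.transpose h (D.T.obj ⟨f, g⟩) ≪≫ D.flip hS f g h ≪≫ (hS.transpose f (D.T.obj ⟨g, h⟩)).symm

theorem cyc_app (θ : Elem l (D.T.obj ⟨f, g⟩ ⟶[V] star S h)) :
    (D.cyc hS f g h).hom ⋆ θ = (hS.transpose f (D.T.obj ⟨g, h⟩)).inv ⋆ (D.flip hS f g h).hom ⋆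
      (hS.transpose h (D.T.obj ⟨f, g⟩)).hom ⋆ θ := by
  simp [cyc]

/-- Naturality passes through the three constituents in turn; for the inverse transposition at the
end it is obtained by cancelling the forward one. -/
theorem cyc_cmp_mapL {f' : EnrichedFunctor V A V} (s : Elem l (f' ⟶[V] f))
    (θ : Elem l (D.T.obj ⟨f, g⟩ ⟶[V] star S h)) :
    (D.cyc hS f' g h).hom ⋆ cmp (D.mapL f' f g ⋆ s) θ =
      cmp ((D.cyc hS f g h).hom ⋆ θ) (starMap S f' f ⋆ s) := by
  rw [cyc_app, cyc_app, Antipode.transpose_cmp, flip_cmp_mapL,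
    ← hom_inv_app (hS.transpose f' _) (cmp _ (starMap S f' f ⋆ s)),
    Antipode.transpose_cmp_starMap, inv_hom_app]

theorem cyc_cmp_mapR {g' : EnrichedFunctor V A V} (s : Elem l (g' ⟶[V] g))
    (θ : Elem l (D.T.obj ⟨f, g⟩ ⟶[V] star S h)) :
    (D.cyc hS f g' h).hom ⋆ cmp (D.mapR f g' g ⋆ s) θ =
      cmp (D.mapL g' g h ⋆ s) ((D.cyc hS f g h).hom ⋆ θ) := by
  rw [cyc_app, cyc_app, Antipode.transpose_cmp, flip_cmp_mapR,
    ← hom_inv_app (hS.transpose f _) (cmp (D.mapL g' g h ⋆ s) _),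
    Antipode.transpose_cmp, inv_hom_app]

theorem cyc_cmp_starMap {h' : EnrichedFunctor V A V} (s : Elem l (h' ⟶[V] h))
    (θ : Elem l (D.T.obj ⟨f, g⟩ ⟶[V] star S h)) :
    (D.cyc hS f g h').hom ⋆ cmp θ (starMap S h' h ⋆ s) =
      cmp (D.mapR g h' h ⋆ s) ((D.cyc hS f g h).hom ⋆ θ) := by
  rw [cyc_app, cyc_app, Antipode.transpose_cmp_starMap, flip_cmp,
    ← hom_inv_app (hS.transpose f _) (cmp (D.mapR g h' h ⋆ s) _),
    Antipode.transpose_cmp, inv_hom_app]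

end DayData
end Cyclic
end StarAut

namespace StarAut
open Elem

/-! ### `V`-functor categories are `*`-autonomous -/
section FunctorStarAutonomous
variable {V : Type u} [Category.{v} V] [MonoidalCategory V] [SymmetricCategory V]
  [MonoidalClosed V] [HasLimits V] [StarAutonomousBase V] {A : Type v} [EnrichedCategory V A]
  {p : EnrichedFunctor V (TensorCat Aᵒᵖ (TensorCat Aᵒᵖ A)) V} {S : EnrichedFunctor V Aᵒᵖ A}

namespace DayData
variable (D : DayData p) (hS : SAutonomous p S)

/-- The preceding identities on elements, with the actions of the representable `V`-functors
rewritten as composition. -/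
theorem cyc_natural₁ (g h : EnrichedFunctor V A V) :
    IsNatural ((opF (partL D.T g)).comp V (yo (star S h)))
      ((starFunctor S).comp V (coyo (D.T.obj ⟨g, h⟩))) (fun f => (D.cyc hS f.unop g h).hom) :=
  isNatural_op_iff.2 fun _ f' f θ s =>
    (congrArg ((D.cyc hS f' g h).hom ⋆ ·) (opsmul_opF_yo (partL D.T g) (d := star S h)
      (a := f') (b := f) θ s)).trans ((D.cyc_cmp_mapL hS s θ).trans
        (opsmul_comp_coyo (starFunctor S) (d := D.T.obj ⟨g, h⟩) (a := f') (b := f) _ s).symm)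

theorem cyc_natural₂ (f h : EnrichedFunctor V A V) :
    IsNatural ((opF (partR D.T f)).comp V (yo (star S h)))
      ((opF (partL D.T h)).comp V (yo (star S f))) (fun g => (D.cyc hS f g.unop h).hom) :=
  isNatural_op_iff.2 fun _ g' g θ s =>
    (congrArg ((D.cyc hS f g' h).hom ⋆ ·) (opsmul_opF_yo (partR D.T f) (d := star S h)
      (a := g') (b := g) θ s)).trans ((D.cyc_cmp_mapR hS s θ).trans
        (opsmul_opF_yo (partL D.T h) (d := star S f) (a := g') (b := g) _ s).symm)

theorem cyc_natural₃ (f g : EnrichedFunctor V A V) :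
    IsNatural ((starFunctor S).comp V (coyo (D.T.obj ⟨f, g⟩)))
      ((opF (partR D.T g)).comp V (yo (star S f))) (fun h => (D.cyc hS f g h.unop).hom) :=
  isNatural_op_iff.2 fun _ h' h θ s =>
    (congrArg ((D.cyc hS f g h').hom ⋆ ·) (opsmul_comp_coyo (starFunctor S)
      (d := D.T.obj ⟨f, g⟩) (a := h') (b := h) θ s)).trans ((D.cyc_cmp_starMap hS s θ).trans
        (opsmul_opF_yo (partR D.T g) (d := star S f) (a := h') (b := h) _ s).symm)

/-- The convolution monoidal structure of an `S`-autonomous `V`-category is `*`-autonomous. -/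
noncomputable def starAutonomous {U : EnrichedFunctor V A V} (M : MonoidalVCat D.T U) :
    StarAutonomous M (starFunctor S) where
  toAntipode := starAntipode hS.toAntipode
  cyc f g h := D.cyc hS f g h
  cyc_natural₁ g h := D.cyc_natural₁ hS g h
  cyc_natural₂ f h := D.cyc_natural₂ hS f h
  cyc_natural₃ f g := D.cyc_natural₃ hS f g

end DayData
end FunctorStarAutonomous
end StarAut

/-! ### Existence of the upper convolution and its `*`-autonomy. -/

theorem mainTheorem1 {V : Type u} [Category.{v} V] [MonoidalCategory V] [SymmetricCategory V]
    [MonoidalClosed V] [HasLimits V] [StarAutonomousBase V] {A : Type v} [EnrichedCategory V A]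
    (P : Promonoidal V A) (S : EnrichedFunctor V Aᵒᵖ A) (hS : SAutonomous P.p S) :
    Nonempty (UpperConvolution P) ∧
      ∀ U : UpperConvolution P, Nonempty (StarAutonomous U.monoidal (starFunctor S)) := by
  -- Existence uses one chosen system of coends; the second half uses the coends of the given `U`.
  exact ⟨⟨(dayData P.p).upperConvolution⟩, fun U => ⟨U.dayData.starAutonomous hS U.monoidal⟩⟩
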